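/- **Setting.** Let $0<q<1$, and let $\mathcal M$ be the field of meromorphic functions on $\mathbb C$, with automorphisms $(T_af)(\lambda)=f(\lambda+a)$. Put $F(\lambda)=\frac{q^{2(\lambda+1)}-q^{-2}}{q^{2(\lambda+1)}-1}$, $G(\lambda)=\frac{(q^{2(\lambda+1)}-q^{2})(q^{2(\lambda+1)}-q^{-2})}{(q^{2(\lambda+1)}-1)^2}$, $H(\lambda,\mu)=\frac{(q-q^{-1})(q^{2(\lambda+\mu+2)}-1)}{(q^{2(\lambda+1)}-1)(q^{2(\mu+1)}-1)}$, $I(\lambda,\mu)=\frac{(q-q^{-1})(q^{2(\mu+1)}-q^{2(\lambda+1)})}{(q^{2(\lambda+1)}-1)(q^{2(\mu+1)}-1)}$. Let $A=\mathcal F_R(\mathrm{SL}(2))$ be the complex algebra generated by $\alpha,\beta,\gamma,\delta$ and two commuting copies $f\mapsto f(\lambda)$, $f\mapsto f(\mu)$ of the algebra $\mathcal M$, with the relations $f(\lambda)\alpha=\alpha f(\lambda+1)$, $f(\mu)\alpha=\alpha f(\mu+1)$, $f(\lambda)\beta=\beta f(\lambda+1)$, $f(\mu)\beta=\beta f(\mu-1)$,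 $f(\lambda)\gamma=\gamma f(\lambda-1)$, $f(\mu)\gamma=\gamma f(\mu+1)$, $f(\lambda)\delta=\delta f(\lambda-1)$, $f(\mu)\delta=\delta f(\mu-1)$, and $\alpha\beta=qF(\mu-1)\beta\alpha$, $\alpha\gamma=qF(\lambda)\gamma\alpha$, $\beta\delta=qF(\lambda)\delta\beta$, $\gamma\delta=qF(\mu-1)\delta\gamma$, $\alpha\delta-\delta\alpha=H(\lambda,\mu)\gamma\beta$, $\beta\gamma-G(\mu)\gamma\beta=I(\lambda,\mu)\delta\alpha$, $\alpha\delta-qF(\lambda)\gamma\beta=1$. It is bigraded, $A=\bigoplus A_{mn}$, with $f(\lambda),f(\mu)\in A_{00}$, $\alpha\in A_{1,1}$, $\beta\in A_{1,-1}$, $\gamma\in A_{-1,1}$, $\delta\in A_{-1,-1}$. An $\mathfrak h$-space is an $\mathcal M$-vector space with a grading $V=\bigoplus_{a\in\mathbb C}V_a$; morphisms are the grade-preserving $\mathcal M$-linear maps. $A\widetilde\otimes V=\bigoplus_{a,b}A_{ab}\otimes V_b$, with the relations $f(\mu)x\otimes v=x\otimes fv$, is an $\mathfrak h$-space by $f(x\otimes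 v)=f(\lambda)x\otimes v$ and the degree $a$. The coproduct is the algebra homomorphism with $\Delta\alpha=\alpha\otimes\alpha+\beta\otimes\gamma$, $\Delta\beta=\alpha\otimes\beta+\beta\otimes\delta$, $\Delta\gamma=\gamma\otimes\alpha+\delta\otimes\gamma$, $\Delta\delta=\gamma\otimes\beta+\delta\otimes\delta$, $\Delta f(\lambda)=f(\lambda)\otimes1$, $\Delta f(\mu)=1\otimes f(\mu)$; the counit is the homomorphism to difference operators on $\mathcal M$ with $\varepsilon(\alpha)=T_{-1}$, $\varepsilon(\beta)=\varepsilon(\gamma)=0$, $\varepsilon(\delta)=T_1$, $\varepsilon(f(\lambda))=\varepsilon(f(\mu))=f$. A corepresentation on $V$ is a morphism $\pi:V\to A\widetilde\otimes V$ with $(\Delta\otimes\mathrm{id})\pi=(\mathrm{id}\otimes\pi)\pi$ and $(\varepsilon\otimes\mathrm{id})\pi=\mathrm{id}$ (where $\varepsilon\otimes\mathrm{id}:x\otimes v\mapsto(\varepsilon(x)1)v$); an intertwiner is a morphism $\phi$ with $\pi'\phi=(\mathrm{id}\otimes\phi)\pi$. $V\widehat\otimes W$ is the tensor product modulo $fv\otimes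 w=v\otimes(T_af)w$ for $v\in V_a$, graded by $V_a\widehat\otimes W_b\subseteq(V\widehat\otimes W)_{a+b}$, with $\mathcal M$ acting on the left factor, and with coaction $v\otimes w\mapsto\sum_{i,j}a_ib_j\otimes(v_i\otimes w_j)$ if $v\mapsto\sum_i a_i\otimes v_i$ and $w\mapsto\sum_j b_j\otimes w_j$. For $N\in\mathbb Z_{\ge0}$, $V_N\subset A$ is the span of $\gamma^{N-k}\alpha^k$, $0\le k\le N$, over the functions $f(\lambda)$, where $\gamma^{N-k}\alpha^k$ has degree $2k-N$ and the coaction is the restriction of $\Delta$. Its matrix elements $t^N_{kj}\in A$ are defined by $\Delta(\gamma^{N-k}\alpha^k)=\sum_{j=0}^Nt^N_{kj}\otimes\gamma^{N-j}\alpha^j$. Write $(a;Q)_n=\prod_{i=0}^{n-1}(1-aQ^i)$, $(a,b;Q)_n=(a;Q)_n(b;Q)_n$, $\binom nk_{Q}=\frac{(Q;Q)_n}{(Q;Q)_k(Q;Q)_{n-k}}$ and $$R_n(\mu(x);a,b,c,d;Q)={}_4\phi_3\left[\begin{matrix}Q^{-n},abQ^{n+1},Q^{-x},cdQ^{x+1}\\aQ,bdQ,cQ\end{matrix};Q,Q\right],\qquad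 \mu(x)=Q^{-x}+cdQ^{x+1}$$ ($q$-Racah polynomials); in the series, terms with a vanishing numerator are $0$. **Theorem.** Let $M,N\in\mathbb Z_{\ge0}$. For $0\le s\le\min(M,N)$, $0\le j\le M$, $0\le k\le N$ put, as meromorphic functions of $\lambda$, $$\kappa^{s}_{jk}(\lambda)=q^{(j-s)(N-k)+sj}\frac{(q^{-2(j+k)};q^2)_s\,(q^{2(j+k-M-N-\lambda-1)};q^2)_j}{(q^{-2N};q^2)_s\,(q^{2(j-M-\lambda-1)};q^2)_j},$$ $$C^{s}_{jk}(\lambda)=C^{MN,M+N-2s}_{jk,j+k-s}(\lambda)=\kappa^{s}_{jk}(\lambda)\;{}_4\phi_3\left[\begin{matrix}q^{-2s},\,q^{2(s-M-N-1)},\,q^{-2j},\,q^{2(j-M-\lambda-1)}\\ q^{-2M},\,q^{-2(j+k)},\,q^{2(j+k-M-N-\lambda-1)}\end{matrix};q^2,q^2\right].$$ (i) The $V_n$ ($n\ge0$), $V_M\widehat\otimes V_N$ and $\bigoplus_{s=0}^{\min(M,N)}V_{M+N-2s}$ are corepresentations. For each $0\le s\le\min(M,N)$, $$C_s(\gamma^{M-j}\alpha^j\otimes\gamma^{N-k}\alpha^k)=C^{s}_{jk}(\lambda)\,\gamma^{M+N-s-j-k}\alpha^{j+k-s}\qquad(0\le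 j\le M,\ 0\le k\le N),$$ where the right-hand side is read as $0$ unless $0\le j+k-s\le M+N-2s$, defines an intertwiner $C_s:V_M\widehat\otimes V_N\to V_{M+N-2s}$, and $\bigoplus_sC_s$ is an equivalence of corepresentations $$V_M\widehat\otimes V_N\simeq\bigoplus_{s=0}^{\min(M,N)}V_{M+N-2s}.$$ (ii) (Clebsch–Gordan formula) For $0\le s\le\min(M,N)$, $0\le m\le M$, $0\le n\le N$, $0\le p\le M+N-2s$, $$\sum_{\substack{k+l=p+s\\0\le k\le M,\ 0\le l\le N}}C^{s}_{kl}(\mu)\,t^M_{mk}t^N_{nl}=C^{s}_{mn}(\lambda)\,t^{M+N-2s}_{m+n-s,p},$$ where the right-hand side is read as $0$ unless $0\le m+n-s\le M+N-2s$. (iii) The coefficients are $q$-Racah polynomials: with $L=j+k$, $$C^{s}_{jk}(\lambda)=\kappa^{s}_{jk}(\lambda)\,R_s\big(\mu(j);q^{-2(M+1)},q^{-2(N+1)},q^{-2(L+1)},q^{2(L-M-\lambda-1)};q^2\big).$$ (iv) (Orthogonality) Put $$\Gamma^N_k(\lambda)=\binom Nk_{q^2}\frac{(q^{2(k-N-\lambda-1)};q^2)_k}{(q^{-2\lambda};q^2)_k},\qquad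 Z_s=(-1)^sq^{-s(s+1)}\frac{(q^2,q^{2(s-M-N-1)};q^2)_s}{(q^{-2M},q^{-2N};q^2)_s}.$$ For $0\le L\le M+N$ and $0\le s,t\le\min(L,M,N,M+N-L)$, $$\sum_{\substack{j+k=L\\0\le j\le M,\ 0\le k\le N}}\frac{\Gamma^M_j(\lambda)\Gamma^N_k(\lambda+M-2j)}{\Gamma^{M+N-2t}_{L-t}(\lambda)}\,C^{s}_{jk}(\lambda)C^{t}_{jk}(\lambda)=\delta_{st}Z_s,$$ and, for $\max(0,L-N)\le j,k\le\min(L,M)$, $$\sum_{s=0}^{\min(L,M,N,M+N-L)}\frac1{Z_s}\,\frac{\Gamma^M_j(\lambda)\Gamma^N_{L-j}(\lambda+M-2j)}{\Gamma^{M+N-2s}_{L-s}(\lambda)}\,C^{s}_{j,L-j}(\lambda)C^{s}_{k,L-k}(\lambda)=\delta_{jk}.$$ -/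

import Mathlib

noncomputable section

open scoped TensorProduct DirectSum

set_option linter.unusedSimpArgs false
set_option linter.unusedSectionVars false

namespace DynSU2

/-! ### The field of meromorphic functions on `ℂ` -/

/-- The algebra of functions `ℂ → ℂ` which are meromorphic at every point. -/
def merFun : Subalgebra ℂ (ℂ → ℂ) where
  carrier := {f | Meromorphic f}
  mul_mem' hf hg := Meromorphic.mul hf hg
  add_mem' hf hg := Meromorphic.add hf hg
  algebraMap_mem' c := Meromorphic.const c

/-- Functions that vanish off a closed discrete set: the values of a meromorphic function at
isolated points are disregarded. -/
def merNull : Ideal merFun where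
  carrier := {f | ∀ z : ℂ, ∀ᶠ x in nhdsWithin z {z}ᶜ, (f : ℂ → ℂ) x = 0}
  add_mem' := by
    intro a b ha hb z
    filter_upwards [ha z, hb z] with x h1 h2
    simp [h1, h2]
  zero_mem' := by
    intro z
    exact Filter.Eventually.of_forall fun x => rfl
  smul_mem' := by
    intro c a ha z
    filter_upwards [ha z] with x h1
    simp [h1]

theorem mem_merNull {f : merFun} :
    f ∈ merNull ↔ ∀ z : ℂ, ∀ᶠ x in nhdsWithin z {z}ᶜ, (f : ℂ → ℂ) x = 0 := Iff.rfl

instance merNull_isMaximal : merNull.IsMaximal := by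
  rw [Ideal.isMaximal_iff]
  constructor
  · intro h
    have h1 := (mem_merNull.1 h 0).exists
    obtain ⟨x, hx⟩ := h1
    simp at hx
  · intro J f hJ hf hfJ
    have hmer : Meromorphic (f : ℂ → ℂ) := f.2
    have hne : ∀ z : ℂ, ∀ᶠ x in nhdsWithin z {z}ᶜ, (f : ℂ → ℂ) x ≠ 0 := by
      rw [mem_merNull] at hf
      push Not at hf
      obtain ⟨z, hz⟩ := hf
      have hz' : meromorphicOrderAt (f : ℂ → ℂ) z ≠ ⊤ := by
        intro h
        rw [meromorphicOrderAt_eq_top_iff] at h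
        exact hz (h.mono fun x hx => by simpa using hx)
      intro y
      have := (meromorphicOn_univ.2 hmer).meromorphicOrderAt_ne_top_of_isPreconnected
        isPreconnected_univ (Set.mem_univ z) (Set.mem_univ y) hz'
      exact (meromorphicOrderAt_ne_top_iff_eventually_ne_zero (hmer y)).1 this
    let g : merFun := ⟨(f : ℂ → ℂ)⁻¹, hmer.inv⟩
    have h1 : (1 - g * f) ∈ merNull := by
      intro z
      filter_upwards [hne z] with x hx
      simp [g, hx]
    have := J.add_mem (hJ h1) (J.mul_mem_left g hfJ)
    simpa using this

/-- The field `M` of meromorphic functions on `ℂ`. -/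
def Mer : Type := merFun ⧸ merNull

section
attribute [local instance] Ideal.Quotient.field
instance : Field Mer := inferInstanceAs (Field (merFun ⧸ merNull))
end
instance : Algebra ℂ Mer := inferInstanceAs (Algebra ℂ (merFun ⧸ merNull))

/-- The class of a meromorphic function. -/
def Mer.mk (f : ℂ → ℂ) (hf : Meromorphic f) : Mer := Ideal.Quotient.mk merNull ⟨f, hf⟩

theorem Mer.mk_eq_mk {f g : ℂ → ℂ} (hf : Meromorphic f) (hg : Meromorphic g) :
    Mer.mk f hf = Mer.mk g hg ↔ ∀ z : ℂ, ∀ᶠ x in nhdsWithin z {z}ᶜ, f x = g x := by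
  have h := @Ideal.Quotient.eq merFun _ merNull ⟨f, hf⟩ ⟨g, hg⟩ _
  refine h.trans (mem_merNull.trans ?_)
  exact forall_congr' fun z => ⟨fun h => h.mono fun x hx => sub_eq_zero.1 hx,
    fun h => h.mono fun x hx => sub_eq_zero.2 hx⟩

theorem Mer.algebraMap_eq (c : ℂ) : algebraMap ℂ Mer c = Mer.mk (fun _ => c) (.const c) := rfl

theorem meromorphic_shift {f : ℂ → ℂ} (hf : Meromorphic f) (a : ℂ) :
    Meromorphic (fun z => f (z + a)) := fun z =>
  MeromorphicAt.comp_analyticAt (g := fun z => z + a) (hf (z + a)) (by fun_prop)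

/-- The shift on functions. -/
def shiftFun (a : ℂ) : merFun →ₐ[ℂ] merFun where
  toFun f := ⟨fun z => (f : ℂ → ℂ) (z + a), meromorphic_shift f.2 a⟩
  map_one' := rfl
  map_mul' _ _ := rfl
  map_zero' := rfl
  map_add' _ _ := rfl
  commutes' _ := rfl

/-- The automorphism `T_a f (λ) = f (λ + a)` of the field of meromorphic functions. -/
def T (a : ℂ) : Mer →ₐ[ℂ] Mer :=
  show (merFun ⧸ merNull) →ₐ[ℂ] (merFun ⧸ merNull) from
  Ideal.Quotient.liftₐ merNull ((Ideal.Quotient.mkₐ ℂ merNull).comp (shiftFun a)) (by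
    intro f hf
    rw [AlgHom.comp_apply, Ideal.Quotient.mkₐ_eq_mk, Ideal.Quotient.eq_zero_iff_mem]
    intro z
    have h := hf (z + a)
    have ht : Filter.Tendsto (fun x : ℂ => x + a) (nhdsWithin z {z}ᶜ)
        (nhdsWithin (z + a) {z + a}ᶜ) := by
      refine tendsto_nhdsWithin_iff.2 ⟨?_, ?_⟩
      · exact ((continuous_id.add continuous_const).tendsto z).mono_left nhdsWithin_le_nhds
      · filter_upwards [self_mem_nhdsWithin] with x hx
        simpa using hx
    exact ht.eventually h)

theorem T_mk (a : ℂ) (f : ℂ → ℂ) (hf : Meromorphic f) :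
    T a (Mer.mk f hf) = Mer.mk (fun z => f (z + a)) (meromorphic_shift hf a) := rfl

theorem Mer.ind {p : Mer → Prop} (h : ∀ f hf, p (Mer.mk f hf)) (x : Mer) : p x := by
  obtain ⟨f, rfl⟩ := Ideal.Quotient.mk_surjective x
  exact h f.1 f.2

theorem T_T (a b : ℂ) (f : Mer) : T a (T b f) = T (a + b) f := by
  induction f using Mer.ind with
  | h f hf =>
    rw [T_mk, T_mk, T_mk, Mer.mk_eq_mk]
    exact fun z => Filter.Eventually.of_forall fun x => by simp only [add_assoc]

theorem T_zero (f : Mer) : T 0 f = f := by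
  induction f using Mer.ind with
  | h f hf =>
    rw [T_mk, Mer.mk_eq_mk]
    exact fun z => Filter.Eventually.of_forall fun x => by simp only [add_zero]

variable (q : Set.Ioo (0 : ℝ) 1)

theorem q_ne_zero : ((q : ℝ) : ℂ) ≠ 0 := by exact_mod_cast q.2.1.ne'

theorem meromorphic_qpow (b a : ℤ) :
    Meromorphic (fun z : ℂ => ((q : ℝ) : ℂ) ^ ((b : ℂ) * z + a)) := fun z => by
  refine AnalyticAt.meromorphicAt ?_
  refine DifferentiableOn.analyticAt (s := Set.univ) ?_ Filter.univ_mem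
  intro x _
  refine DifferentiableAt.differentiableWithinAt ?_
  exact DifferentiableAt.const_cpow (by fun_prop) (Or.inl (q_ne_zero q))

/-- The function `λ ↦ q ^ (b λ + a)`. -/
def qpow (b a : ℤ) : Mer :=
  Mer.mk (fun z => ((q : ℝ) : ℂ) ^ ((b : ℂ) * z + a)) (meromorphic_qpow q b a)

theorem qpow_add (b a b' a' : ℤ) : qpow q (b + b') (a + a') = qpow q b a * qpow q b' a' := by
  have h : qpow q b a * qpow q b' a' = Mer.mk (fun z => ((q : ℝ) : ℂ) ^ ((b : ℂ) * z + a) *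
    ((q : ℝ) : ℂ) ^ ((b' : ℂ) * z + a'))
    (Meromorphic.mul (meromorphic_qpow q b a) (meromorphic_qpow q b' a')) := rfl
  rw [h, qpow, Mer.mk_eq_mk]
  refine fun z => Filter.Eventually.of_forall fun x => ?_
  rw [← Complex.cpow_add _ _ (q_ne_zero q)]
  push_cast
  ring_nf

theorem qpow_zero_left (a : ℤ) : qpow q 0 a = algebraMap ℂ Mer (((q : ℝ) : ℂ) ^ a) := by
  rw [Mer.algebraMap_eq, qpow, Mer.mk_eq_mk]
  refine fun z => Filter.Eventually.of_forall fun x => ?_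
  simp [Complex.cpow_intCast]

theorem qpow_zero_zero : qpow q 0 0 = 1 := by
  rw [qpow_zero_left]; simp

theorem qpow_ne_zero (b a : ℤ) : qpow q b a ≠ 0 := by
  intro h
  have := qpow_add q b a (-b) (-a)
  rw [h] at this
  simp [qpow_zero_zero] at this

theorem T_qpow (n b a : ℤ) : T n (qpow q b a) = qpow q b (a + b * n) := by
  rw [qpow, T_mk, qpow, Mer.mk_eq_mk]
  refine fun z => Filter.Eventually.of_forall fun x => ?_
  push_cast
  ring_nf

theorem qpow_ne_algebraMap {b : ℤ} (hb : b ≠ 0) (a : ℤ) (c : ℂ) :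
    qpow q b a ≠ algebraMap ℂ Mer c := by
  intro h
  have h1 := T_qpow q 1 b a
  rw [h, AlgHom.commutes] at h1
  have h2 := qpow_add q 0 (b * 1) b a
  rw [zero_add, add_comm (b * 1) a, ← h1, h, qpow_zero_left, ← map_mul] at h2
  have h3 := (algebraMap ℂ Mer).injective h2
  have hc : c ≠ 0 := by
    rintro rfl
    exact qpow_ne_zero q b a (by rw [h, map_zero])
  rw [mul_one] at h3
  have h4 : ((q : ℝ) : ℂ) ^ b = 1 := by
    have : c * 1 = c * ((q : ℝ) : ℂ) ^ b := by rw [mul_one]; linear_combination h3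
    exact (mul_left_cancel₀ hc this).symm
  have h5 : (q : ℝ) ^ b = 1 := by exact_mod_cast h4
  have := (zpow_eq_one_iff_right₀ q.2.1.le q.2.2.ne).1 h5
  exact hb this

theorem qpow_sub_qpow_ne_zero {b : ℤ} (hb : b ≠ 0) (a c : ℤ) :
    qpow q b a - qpow q 0 c ≠ 0 := by
  rw [qpow_zero_left]
  exact sub_ne_zero.2 (qpow_ne_algebraMap q hb a _)

/-- The coordinate function `λ`. -/
def coord : Mer := Mer.mk (fun z => z) (fun z => MeromorphicAt.id z)

theorem T_coord (a : ℂ) : T a coord = coord + algebraMap ℂ Mer a := rfl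

end DynSU2

namespace DynSU2
variable (q : Set.Ioo (0 : ℝ) 1)

/-! ### The algebra -/

/-- `F(λ) = (q^{2(λ+1)} - q^{-2}) / (q^{2(λ+1)} - 1)`. -/
def F : Mer := (qpow q 2 2 - qpow q 0 (-2)) / (qpow q 2 2 - 1)

/-- `G(λ) = (q^{2(λ+1)} - q^2) (q^{2(λ+1)} - q^{-2}) / (q^{2(λ+1)} - 1)^2`. -/
def G : Mer := (qpow q 2 2 - qpow q 0 2) * (qpow q 2 2 - qpow q 0 (-2)) / (qpow q 2 2 - 1) ^ 2

/-- The generators: `α`, `β`, `γ`, `δ`, and two copies `f(λ)`, `f(μ)` of the meromorphic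
functions. -/
inductive Gen : Type
  | α | β | γ | δ
  | l (f : Mer)
  | r (f : Mer)

/-- The defining relations, for elements `α`, `β`, `γ`, `δ`, `l f = f(λ)`, `r f = f(μ)`
of a complex algebra. -/
inductive Relation {B : Type} [Ring B] [Algebra ℂ B] (α β γ δ : B) (l r : Mer → B) : B → B → Prop
  -- `l` and `r` are homomorphisms of complex algebras
  | l_add (f g : Mer) : Relation α β γ δ l r (l (f + g)) (l f + l g)
  | l_mul (f g : Mer) : Relation α β γ δ l r (l (f * g)) (l f * l g)
  | l_const (c : ℂ) : Relation α β γ δ l r (l (algebraMap ℂ Mer c)) (algebraMap ℂ B c)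
  | r_add (f g : Mer) : Relation α β γ δ l r (r (f + g)) (r f + r g)
  | r_mul (f g : Mer) : Relation α β γ δ l r (r (f * g)) (r f * r g)
  | r_const (c : ℂ) : Relation α β γ δ l r (r (algebraMap ℂ Mer c)) (algebraMap ℂ B c)
  -- commutation with the functions of `λ` and `μ`
  | l_r (f g : Mer) : Relation α β γ δ l r (l f * r g) (r g * l f)
  | l_α (f : Mer) : Relation α β γ δ l r (l f * α) (α * l (T 1 f))
  | r_α (f : Mer) : Relation α β γ δ l r (r f * α) (α * r (T 1 f))
  | l_β (f : Mer) : Relation α β γ δ l r (l f * β) (β * l (T 1 f))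
  | r_β (f : Mer) : Relation α β γ δ l r (r f * β) (β * r (T (-1) f))
  | l_γ (f : Mer) : Relation α β γ δ l r (l f * γ) (γ * l (T (-1) f))
  | r_γ (f : Mer) : Relation α β γ δ l r (r f * γ) (γ * r (T 1 f))
  | l_δ (f : Mer) : Relation α β γ δ l r (l f * δ) (δ * l (T (-1) f))
  | r_δ (f : Mer) : Relation α β γ δ l r (r f * δ) (δ * r (T (-1) f))
  -- `αβ = q F(μ-1) βα`, `αγ = q F(λ) γα`, `βδ = q F(λ) δβ`, `γδ = q F(μ-1) δγ`
  | αβ : Relation α β γ δ l r (α * β) (r (qpow q 0 1 * T (-1) (F q)) * (β * α))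
  | αγ : Relation α β γ δ l r (α * γ) (l (qpow q 0 1 * F q) * (γ * α))
  | βδ : Relation α β γ δ l r (β * δ) (l (qpow q 0 1 * F q) * (δ * β))
  | γδ : Relation α β γ δ l r (γ * δ) (r (qpow q 0 1 * T (-1) (F q)) * (δ * γ))
  -- `αδ - δα = H(λ,μ) γβ`, where
  -- `H(λ,μ) = (q - q⁻¹)(q^{2(λ+μ+2)} - 1) / ((q^{2(λ+1)} - 1)(q^{2(μ+1)} - 1))`
  | αδ : Relation α β γ δ l r (α * δ - δ * α)
      (l (qpow q 0 1 - qpow q 0 (-1)) * (l (qpow q 2 2) * r (qpow q 2 2) - 1) *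
        (l (qpow q 2 2 - 1)⁻¹ * r (qpow q 2 2 - 1)⁻¹) * (γ * β))
  -- `βγ - G(μ) γβ = I(λ,μ) δα`, where
  -- `I(λ,μ) = (q - q⁻¹)(q^{2(μ+1)} - q^{2(λ+1)}) / ((q^{2(λ+1)} - 1)(q^{2(μ+1)} - 1))`
  | βγ : Relation α β γ δ l r (β * γ - r (G q) * (γ * β))
      (l (qpow q 0 1 - qpow q 0 (-1)) * (r (qpow q 2 2) - l (qpow q 2 2)) *
        (l (qpow q 2 2 - 1)⁻¹ * r (qpow q 2 2 - 1)⁻¹) * (δ * α))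
  -- the dynamical determinant is one: `αδ - q F(λ) γβ = 1`
  | det : Relation α β γ δ l r (α * δ - l (qpow q 0 1 * F q) * (γ * β)) 1

/-- The relations in the free algebra. -/
def FreeRel : FreeAlgebra ℂ Gen → FreeAlgebra ℂ Gen → Prop :=
  Relation q (FreeAlgebra.ι ℂ Gen.α) (FreeAlgebra.ι ℂ Gen.β) (FreeAlgebra.ι ℂ Gen.γ)
    (FreeAlgebra.ι ℂ Gen.δ) (fun f => FreeAlgebra.ι ℂ (Gen.l f)) (fun f => FreeAlgebra.ι ℂ (Gen.r f))

/-- The algebra `F_R(SL(2))`. -/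
def FSL : Type := RingQuot (FreeRel q)

instance : Ring (FSL q) := inferInstanceAs (Ring (RingQuot (FreeRel q)))
instance : Algebra ℂ (FSL q) := inferInstanceAs (Algebra ℂ (RingQuot (FreeRel q)))

namespace FSL

/-- The images of the generators. -/
def gen (g : Gen) : FSL q := RingQuot.mkAlgHom ℂ (FreeRel q) (FreeAlgebra.ι ℂ g)
def α : FSL q := gen q Gen.α
def β : FSL q := gen q Gen.β
def γ : FSL q := gen q Gen.γ
def δ : FSL q := gen q Gen.δ

/-- The quotient map. -/
def proj : FreeAlgebra ℂ Gen →ₐ[ℂ] FSL q := RingQuot.mkAlgHom ℂ (FreeRel q)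

theorem proj_ι (g : Gen) : proj q (FreeAlgebra.ι ℂ g) = gen q g := rfl

theorem proj_surjective : Function.Surjective (proj q) := RingQuot.mkAlgHom_surjective ℂ (FreeRel q)

theorem proj_rel {x y : FreeAlgebra ℂ Gen} (h : FreeRel q x y) : proj q x = proj q y :=
  RingQuot.mkAlgHom_rel ℂ h

/-- The left moment map `f ↦ f(λ)`. -/
def l : Mer →ₐ[ℂ] FSL q where
  toFun f := gen q (Gen.l f)
  map_one' := by
    have := proj_rel q (Relation.l_const 1)
    simpa [proj_ι] using this
  map_mul' f g := by
    have := proj_rel q (Relation.l_mul f g)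
    simpa [proj_ι] using this
  map_zero' := by
    have := proj_rel q (Relation.l_const 0)
    simpa [proj_ι] using this
  map_add' f g := by
    have := proj_rel q (Relation.l_add f g)
    simpa [proj_ι] using this
  commutes' c := by
    have := proj_rel q (Relation.l_const c)
    simpa [proj_ι] using this

/-- The right moment map `f ↦ f(μ)`. -/
def r : Mer →ₐ[ℂ] FSL q where
  toFun f := gen q (Gen.r f)
  map_one' := by
    have := proj_rel q (Relation.r_const 1)
    simpa [proj_ι] using this
  map_mul' f g := by
    have := proj_rel q (Relation.r_mul f g)
    simpa [proj_ι] using this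
  map_zero' := by
    have := proj_rel q (Relation.r_const 0)
    simpa [proj_ι] using this
  map_add' f g := by
    have := proj_rel q (Relation.r_add f g)
    simpa [proj_ι] using this
  commutes' c := by
    have := proj_rel q (Relation.r_const c)
    simpa [proj_ι] using this

theorem l_apply (f : Mer) : l q f = gen q (Gen.l f) := rfl
theorem r_apply (f : Mer) : r q f = gen q (Gen.r f) := rfl

/-- The defining relations hold. -/
theorem rel {x y : FSL q} (h : Relation q (α q) (β q) (γ q) (δ q) (l q) (r q) x y) : x = y := by
  cases h
  case l_add f g => exact map_add (l q) f g
  case l_mul f g => exact map_mul (l q) f g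
  case l_const c => exact (l q).commutes c
  case r_add f g => exact map_add (r q) f g
  case r_mul f g => exact map_mul (r q) f g
  case r_const c => exact (r q).commutes c
  case l_r f g =>
    have := proj_rel q (Relation.l_r f g)
    simp only [map_sub, map_mul, map_one, proj_ι] at this
    exact this
  case l_α f =>
    have := proj_rel q (Relation.l_α f)
    simp only [map_sub, map_mul, map_one, proj_ι] at this
    exact this
  case r_α f =>
    have := proj_rel q (Relation.r_α f)
    simp only [map_sub, map_mul, map_one, proj_ι] at this
    exact this
  case l_β f =>
    have := proj_rel q (Relation.l_β f)
    simp only [map_sub, map_mul, map_one, proj_ι] at this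
    exact this
  case r_β f =>
    have := proj_rel q (Relation.r_β f)
    simp only [map_sub, map_mul, map_one, proj_ι] at this
    exact this
  case l_γ f =>
    have := proj_rel q (Relation.l_γ f)
    simp only [map_sub, map_mul, map_one, proj_ι] at this
    exact this
  case r_γ f =>
    have := proj_rel q (Relation.r_γ f)
    simp only [map_sub, map_mul, map_one, proj_ι] at this
    exact this
  case l_δ f =>
    have := proj_rel q (Relation.l_δ f)
    simp only [map_sub, map_mul, map_one, proj_ι] at this
    exact this
  case r_δ f =>
    have := proj_rel q (Relation.r_δ f)
    simp only [map_sub, map_mul, map_one, proj_ι] at this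
    exact this
  case αβ =>
    have := proj_rel q (Relation.αβ)
    simp only [map_sub, map_mul, map_one, proj_ι] at this
    exact this
  case αγ =>
    have := proj_rel q (Relation.αγ)
    simp only [map_sub, map_mul, map_one, proj_ι] at this
    exact this
  case βδ =>
    have := proj_rel q (Relation.βδ)
    simp only [map_sub, map_mul, map_one, proj_ι] at this
    exact this
  case γδ =>
    have := proj_rel q (Relation.γδ)
    simp only [map_sub, map_mul, map_one, proj_ι] at this
    exact this
  case αδ =>
    have := proj_rel q (Relation.αδ)
    simp only [map_sub, map_mul, map_one, proj_ι] at this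
    exact this
  case βγ =>
    have := proj_rel q (Relation.βγ)
    simp only [map_sub, map_mul, map_one, proj_ι] at this
    exact this
  case det =>
    have := proj_rel q (Relation.det)
    simp only [map_sub, map_mul, map_one, proj_ι] at this
    exact this

/-- Universal property. -/
def lift {B : Type} [Ring B] [Algebra ℂ B] (a b c d : B) (L R : Mer → B)
    (h : ∀ x y, Relation q a b c d L R x y → x = y) : FSL q →ₐ[ℂ] B :=
  RingQuot.liftAlgHom ℂ ⟨FreeAlgebra.lift ℂ (fun g => match g with
    | Gen.α => a | Gen.β => b | Gen.γ => c | Gen.δ => d | Gen.l f => L f | Gen.r f => R f), by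
    intro x y hxy
    apply h
    cases hxy <;> simp only [map_sub, map_mul, map_add, map_one, FreeAlgebra.lift_ι_apply,
      AlgHom.commutes] <;> constructor⟩

section
variable {B : Type} [Ring B] [Algebra ℂ B] (a b c d : B) (L R : Mer → B)
    (h : ∀ x y, Relation q a b c d L R x y → x = y)

theorem lift_gen (g : Gen) : lift q a b c d L R h (gen q g) = (match g with
    | Gen.α => a | Gen.β => b | Gen.γ => c | Gen.δ => d | Gen.l f => L f | Gen.r f => R f) := by
  unfold lift gen
  erw [RingQuot.liftAlgHom_mkAlgHom_apply]
  simp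

theorem lift_α : lift q a b c d L R h (α q) = a := lift_gen q a b c d L R h _
theorem lift_β : lift q a b c d L R h (β q) = b := lift_gen q a b c d L R h _
theorem lift_γ : lift q a b c d L R h (γ q) = c := lift_gen q a b c d L R h _
theorem lift_δ : lift q a b c d L R h (δ q) = d := lift_gen q a b c d L R h _
theorem lift_l (f : Mer) : lift q a b c d L R h (l q f) = L f := lift_gen q a b c d L R h _
theorem lift_r (f : Mer) : lift q a b c d L R h (r q f) = R f := lift_gen q a b c d L R h _
end

end FSL
end DynSU2

namespace DynSU2
variable (q : Set.Ioo (0 : ℝ) 1)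

/-- Auxiliary function `1 / (q^{2(λ+1)} - 1)`. -/
def wInv : Mer := (qpow q 2 2 - 1)⁻¹

theorem x_sub_one_ne_zero : qpow q 2 2 - 1 ≠ 0 := by
  have := qpow_sub_qpow_ne_zero q (b := 2) (by norm_num) 2 0
  rwa [qpow_zero_zero] at this

theorem x_mul_wInv : qpow q 2 2 * wInv q = 1 + wInv q := by
  have := x_sub_one_ne_zero q
  unfold wInv
  field_simp
  ring

theorem qpow_const_mul (a b : ℤ) : qpow q 0 a * qpow q 0 b = qpow q 0 (a + b) := by
  rw [← qpow_add, add_zero]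

theorem F_eq : F q = 1 + (1 - qpow q 0 (-2)) * wInv q := by
  have := x_mul_wInv q
  rw [F, div_eq_mul_inv]
  change _ * wInv q = _
  linear_combination this

theorem T_F : T (-1) (F q) = (1 + (1 - qpow q 0 2) * wInv q)⁻¹ := by
  have e1 : T (-1) (qpow q 2 2) = qpow q 2 0 := by
    have := T_qpow q (-1) 2 2
    push_cast at this
    rw [this]
  have e2 (c : ℤ) : T (-1) (qpow q 0 c) = qpow q 0 c := by
    have := T_qpow q (-1) 0 c
    push_cast at this
    rw [this]; norm_num
  have e3 : qpow q 2 2 = qpow q 2 0 * qpow q 0 2 := by rw [← qpow_add]; norm_num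
  have e4 : qpow q 0 (-2) * qpow q 0 2 = 1 := by
    rw [qpow_const_mul]; exact qpow_zero_zero q
  have h1 := x_sub_one_ne_zero q
  have h2 := qpow_sub_qpow_ne_zero q (b := 2) (by norm_num) 0 0
  rw [qpow_zero_zero] at h2
  have h3 : qpow q 2 2 - qpow q 0 2 ≠ 0 := by
    have : qpow q 2 2 - qpow q 0 2 = qpow q 0 2 * (qpow q 2 0 - 1) := by rw [e3]; ring
    rw [this]
    exact mul_ne_zero (qpow_ne_zero _ _ _) h2
  have h4 : 1 + (1 - qpow q 0 2) * wInv q = (qpow q 2 2 - qpow q 0 2) * wInv q := by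
    linear_combination - x_mul_wInv q
  rw [h4, F, map_div₀, map_sub, map_sub, map_one, e1, e2]
  unfold wInv
  field_simp
  rw [e3]
  linear_combination e4 * (1 - qpow q 2 0)

theorem w2_ne_zero : (1 + (1 - qpow q 0 2) * wInv q) ≠ 0 := by
  intro h
  have := T_F q
  rw [h, inv_zero] at this
  have h1 : F q = 0 := (map_eq_zero (T (-1))).1 this
  rw [F, div_eq_zero_iff] at h1
  rcases h1 with h1 | h1
  · exact qpow_sub_qpow_ne_zero q (by norm_num) _ _ h1
  · exact x_sub_one_ne_zero q h1

theorem G_eq : G q = (1 + (1 - qpow q 0 (-2)) * wInv q) * (1 + (1 - qpow q 0 2) * wInv q) := by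
  have := x_mul_wInv q
  have h : G q = ((qpow q 2 2 - qpow q 0 2) * wInv q) * ((qpow q 2 2 - qpow q 0 (-2)) * wInv q) := by
    rw [G, wInv]
    have := x_sub_one_ne_zero q
    field_simp
  have h1 : (qpow q 2 2 - qpow q 0 2) * wInv q = 1 + (1 - qpow q 0 2) * wInv q := by
    linear_combination this
  have h2 : (qpow q 2 2 - qpow q 0 (-2)) * wInv q = 1 + (1 - qpow q 0 (-2)) * wInv q := by
    linear_combination this
  rw [h, h1, h2, mul_comm]
end DynSU2

namespace DynSU2
variable (q : Set.Ioo (0 : ℝ) 1)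

namespace FSL

theorem l_comm_r (f g : Mer) : l q f * r q g = r q g * l q f := rel q (Relation.l_r f g)
theorem l_comm_l (f g : Mer) : l q f * l q g = l q g * l q f := by
  rw [← map_mul, ← map_mul, mul_comm]
theorem r_comm_r (f g : Mer) : r q f * r q g = r q g * r q f := by
  rw [← map_mul, ← map_mul, mul_comm]

theorem l_qpow_zero (a : ℤ) : l q (qpow q 0 a) = algebraMap ℂ _ (((q : ℝ) : ℂ) ^ a) := by
  rw [qpow_zero_left, AlgHom.commutes]
theorem r_qpow_zero (a : ℤ) : r q (qpow q 0 a) = algebraMap ℂ _ (((q : ℝ) : ℂ) ^ a) := by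
  rw [qpow_zero_left, AlgHom.commutes]

/-- The functions `f(λ) g(μ)`. -/
def Fun2 : Type := Mer ⊗[ℂ] Mer

instance : CommRing Fun2 := inferInstanceAs (CommRing (Mer ⊗[ℂ] Mer))
instance : Algebra ℂ Fun2 := inferInstanceAs (Algebra ℂ (Mer ⊗[ℂ] Mer))

/-- The action of the functions of `λ` and `μ`, used for computations. -/
def act : Fun2 →ₐ[ℂ] FSL q :=
  show Mer ⊗[ℂ] Mer →ₐ[ℂ] FSL q from
  Algebra.TensorProduct.lift (l q) (r q) (fun f g => l_comm_r q f g)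

section cross
local instance : Module Fun2 (FSL q) := Module.compHom (FSL q) (act q).toRingHom

theorem smul_act (s : Fun2) (a : FSL q) : s • a = act q s * a := rfl

/-- `1/(q^{2(λ+1)}-1)` -/
def wl : Fun2 := wInv q ⊗ₜ[ℂ] (1 : Mer)
/-- `1/(q^{2(μ+1)}-1)` -/
def wr : Fun2 := (1 : Mer) ⊗ₜ[ℂ] wInv q
def sQ : Fun2 := algebraMap ℂ _ ((q : ℝ) : ℂ)
def sP : Fun2 := algebraMap ℂ _ ((q : ℝ) : ℂ)⁻¹

theorem sQ_sP : sQ q * sP q = 1 := by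
  rw [sQ, sP, ← map_mul, mul_inv_cancel₀ (q_ne_zero q), map_one]

theorem act_l (f : Mer) : act q (f ⊗ₜ[ℂ] (1 : Mer)) = l q f := by
  have := Algebra.TensorProduct.lift_tmul (l q) (r q) (fun f g => l_comm_r q f g) f 1
  rw [map_one, mul_one] at this
  exact this
theorem act_r (f : Mer) : act q ((1 : Mer) ⊗ₜ[ℂ] f) = r q f := by
  have := Algebra.TensorProduct.lift_tmul (l q) (r q) (fun f g => l_comm_r q f g) 1 f
  rw [map_one, one_mul] at this
  exact this

theorem act_wl : act q (wl q) = l q (wInv q) := act_l q _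
theorem act_wr : act q (wr q) = r q (wInv q) := act_r q _
theorem act_sQ : act q (sQ q) = algebraMap ℂ _ ((q : ℝ) : ℂ) := (act q).commutes _
theorem act_sP : act q (sP q) = algebraMap ℂ _ ((q : ℝ) : ℂ)⁻¹ := (act q).commutes _

/-- `q F(λ)`, `q F(μ)`, `F(λ-1)⁻¹`, `F(μ-1)⁻¹`. -/
def uF : Mer := 1 + (1 - qpow q 0 (-2)) * wInv q
def vF : Mer := 1 + (1 - qpow q 0 2) * wInv q

theorem l_uF : l q (uF q) = act q (1 + (1 - sP q ^ 2) * wl q) := by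
  simp only [uF, map_add, map_one, map_mul, map_sub, map_pow, act_sP, act_wl, l_qpow_zero]
  simp [← map_pow]
theorem r_uF : r q (uF q) = act q (1 + (1 - sP q ^ 2) * wr q) := by
  simp only [uF, map_add, map_one, map_mul, map_sub, map_pow, act_sP, act_wr, r_qpow_zero]
  simp [← map_pow]
theorem l_vF : l q (vF q) = act q (1 + (1 - sQ q ^ 2) * wl q) := by
  simp only [vF, map_add, map_one, map_mul, map_sub, map_pow, act_sQ, act_wl, l_qpow_zero]
  simp [← map_pow]
theorem r_vF : r q (vF q) = act q (1 + (1 - sQ q ^ 2) * wr q) := by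
  simp only [vF, map_add, map_one, map_mul, map_sub, map_pow, act_sQ, act_wr, r_qpow_zero]
  simp [← map_pow]

theorem αδ' : α q * δ q - δ q * α q = ((sQ q - sP q) * (1 + wl q + wr q)) • (γ q * β q) := by
  rw [rel q Relation.αδ, smul_act]
  congr 1
  have h1 : l q (qpow q 2 2 - 1)⁻¹ = l q (wInv q) := rfl
  have h2 : r q (qpow q 2 2 - 1)⁻¹ = r q (wInv q) := rfl
  have h3 : l q (qpow q 2 2) * l q (wInv q) = 1 + l q (wInv q) := by
    rw [← map_mul, x_mul_wInv, map_add, map_one]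
  have h4 : r q (qpow q 2 2) * r q (wInv q) = 1 + r q (wInv q) := by
    rw [← map_mul, x_mul_wInv, map_add, map_one]
  rw [map_mul, h1, h2, mul_assoc]
  congr 1
  · simp only [map_sub, act_sQ, act_sP, l_qpow_zero]
    simp
  · simp only [map_add, map_one, act_wl, act_wr]
    calc (l q (qpow q 2 2) * r q (qpow q 2 2) - 1) * (l q (wInv q) * r q (wInv q))
        = l q (qpow q 2 2) * (r q (qpow q 2 2) * l q (wInv q)) * r q (wInv q)
          - l q (wInv q) * r q (wInv q) := by noncomm_ring
      _ = (l q (qpow q 2 2) * l q (wInv q)) * (r q (qpow q 2 2) * r q (wInv q))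
          - l q (wInv q) * r q (wInv q) := by rw [← l_comm_r]; noncomm_ring
      _ = _ := by rw [h3, h4]; noncomm_ring

theorem βγ' : β q * γ q - r q (G q) * (γ q * β q) =
    ((sQ q - sP q) * (wl q - wr q)) • (δ q * α q) := by
  rw [rel q Relation.βγ, smul_act]
  congr 1
  have h1 : l q (qpow q 2 2 - 1)⁻¹ = l q (wInv q) := rfl
  have h2 : r q (qpow q 2 2 - 1)⁻¹ = r q (wInv q) := rfl
  have h3 : l q (qpow q 2 2) * l q (wInv q) = 1 + l q (wInv q) := by
    rw [← map_mul, x_mul_wInv, map_add, map_one]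
  have h4 : r q (qpow q 2 2) * r q (wInv q) = 1 + r q (wInv q) := by
    rw [← map_mul, x_mul_wInv, map_add, map_one]
  rw [map_mul, h1, h2, mul_assoc]
  congr 1
  · simp only [map_sub, act_sQ, act_sP, l_qpow_zero]
    simp
  · simp only [map_sub, act_wl, act_wr]
    calc (r q (qpow q 2 2) - l q (qpow q 2 2)) * (l q (wInv q) * r q (wInv q))
        = (r q (qpow q 2 2) * l q (wInv q)) * r q (wInv q)
          - (l q (qpow q 2 2) * l q (wInv q)) * r q (wInv q) := by noncomm_ring
      _ = l q (wInv q) * (r q (qpow q 2 2) * r q (wInv q))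
          - (l q (qpow q 2 2) * l q (wInv q)) * r q (wInv q) := by rw [← l_comm_r]; noncomm_ring
      _ = _ := by rw [h3, h4]; noncomm_ring

theorem qF_eq : qpow q 0 1 * F q = qpow q 0 1 * uF q := by rw [F_eq, uF]
theorem G_eq' : G q = uF q * vF q := by rw [G_eq, uF, vF]
theorem TF_eq : T (-1) (F q) = (vF q)⁻¹ := by rw [T_F, vF]
theorem vF_ne_zero : vF q ≠ 0 := w2_ne_zero q

theorem det' : α q * δ q - (sQ q * (1 + (1 - sP q ^ 2) * wl q)) • (γ q * β q) = 1 := by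
  rw [← rel q Relation.det, smul_act, qF_eq, map_mul, map_mul, l_uF, l_qpow_zero, act_sQ, zpow_one]

theorem βγ'' : β q * γ q = ((sQ q - sP q) * (wl q - wr q)) • (δ q * α q) +
    ((1 + (1 - sP q ^ 2) * wr q) * (1 + (1 - sQ q ^ 2) * wr q)) • (γ q * β q) := by
  rw [← βγ', G_eq', map_mul, r_uF, r_vF, smul_act, ← map_mul]
  abel

theorem αδ_act : α q * δ q = 1 + (sQ q * (1 + (1 - sP q ^ 2) * wl q)) • (γ q * β q) := by
  rw [← det' q]; abel

theorem δα_act : δ q * α q = 1 + (sP q * (1 + (1 - sQ q ^ 2) * wr q)) • (γ q * β q) := by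
  have h2 := αδ' q
  have h3 := sQ_sP q
  have h4 : δ q * α q = α q * δ q - ((sQ q - sP q) * (1 + wl q + wr q)) • (γ q * β q) := by
    rw [← h2]; abel
  rw [h4, αδ_act]
  match_scalars
  · ring
  · linear_combination (- wl q * sP q + wr q * sQ q) * h3

theorem βγ_act : β q * γ q = (sQ q * (1 + (1 - sP q ^ 2) * wl q)) • (1 : FSL q)
    - (sQ q * (1 + (1 - sP q ^ 2) * wr q)) • (1 : FSL q)
    + ((1 + (1 - sP q ^ 2) * wl q) * (1 + (1 - sQ q ^ 2) * wr q)) • (γ q * β q) := by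
  have h3 := sQ_sP q
  rw [βγ'', δα_act]
  match_scalars
  · linear_combination sP q * (wl q - wr q) * h3
  · linear_combination (wl q - wr q) * (1 + wr q - wr q * (sQ q ^ 2)) * h3

/-- `αδ = 1 + q F(λ) γβ` -/
theorem αδ_eq : α q * δ q = 1 + l q (qpow q 0 1 * uF q) * (γ q * β q) := by
  rw [αδ_act, smul_act, map_mul (l q), map_mul, l_uF, l_qpow_zero, act_sQ, zpow_one]

/-- `δα = 1 + q⁻¹ F(μ-1)⁻¹ γβ` -/
theorem δα_eq : δ q * α q = 1 + r q (qpow q 0 (-1) * vF q) * (γ q * β q) := by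
  rw [δα_act, smul_act, map_mul (r q), map_mul, r_vF, r_qpow_zero, act_sP, zpow_neg_one]

/-- `βγ = q F(λ) - q F(μ) + F(λ) F(μ-1)⁻¹ γβ` -/
theorem βγ_eq : β q * γ q = l q (qpow q 0 1 * uF q) - r q (qpow q 0 1 * uF q)
    + l q (uF q) * r q (vF q) * (γ q * β q) := by
  rw [βγ_act, smul_act, smul_act, smul_act, map_mul (l q), map_mul, map_mul, map_mul, map_mul (r q),
    l_uF, r_vF, r_uF, l_qpow_zero, r_qpow_zero, act_sQ, zpow_one, mul_one, mul_one]

end cross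
end FSL
end DynSU2

namespace DynSU2
variable (q : Set.Ioo (0 : ℝ) 1)

/-- `A` is a vector space over the meromorphic functions by `f • a = f(λ) a`. -/
instance : Module Mer (FSL q) := Module.compHom (FSL q) (FSL.l q).toRingHom

theorem FSL.smul_def (f : Mer) (a : FSL q) : f • a = FSL.l q f * a := rfl

/-- `A` as a vector space over the meromorphic functions by `f • a = f(μ) a`. -/
def RFSL : Type := FSL q

instance : AddCommGroup (RFSL q) := inferInstanceAs (AddCommGroup (FSL q))
instance : Module Mer (RFSL q) := Module.compHom (FSL q) (FSL.r q).toRingHom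

/-- The identity map `A → A`. -/
def RFSL.of : FSL q ≃+ RFSL q := AddEquiv.refl _

theorem RFSL.of_r_mul (f : Mer) (a : FSL q) :
    RFSL.of q (FSL.r q f * a) = f • RFSL.of q a := rfl

/-- Left multiplication by `f(λ)`. -/
def lEnd : Mer →+* Module.End Mer (RFSL q) where
  toFun f :=
    { toFun := fun a => RFSL.of q (FSL.l q f * (RFSL.of q).symm a)
      map_add' := fun a b => by rw [map_add, mul_add, map_add]
      map_smul' := fun g a => by
        obtain ⟨a, rfl⟩ := (RFSL.of q).surjective a
        rw [← RFSL.of_r_mul, AddEquiv.symm_apply_apply, AddEquiv.symm_apply_apply,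
          RingHom.id_apply, ← RFSL.of_r_mul, ← mul_assoc, ← mul_assoc, FSL.l_comm_r] }
  map_one' := LinearMap.ext fun a => by
    change RFSL.of q (FSL.l q 1 * (RFSL.of q).symm a) = a
    rw [map_one, one_mul, AddEquiv.apply_symm_apply]
  map_mul' f g := LinearMap.ext fun a => by
    change RFSL.of q (FSL.l q (f * g) * (RFSL.of q).symm a) =
      RFSL.of q (FSL.l q f * (RFSL.of q).symm (RFSL.of q (FSL.l q g * (RFSL.of q).symm a)))
    rw [map_mul (FSL.l q), mul_assoc, AddEquiv.symm_apply_apply]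
  map_zero' := LinearMap.ext fun a => by
    change RFSL.of q (FSL.l q 0 * (RFSL.of q).symm a) = 0
    rw [map_zero, zero_mul, map_zero]
  map_add' f g := LinearMap.ext fun a => by
    change RFSL.of q (FSL.l q (f + g) * (RFSL.of q).symm a) =
      RFSL.of q (FSL.l q f * (RFSL.of q).symm a) + RFSL.of q (FSL.l q g * (RFSL.of q).symm a)
    rw [map_add, add_mul, map_add]

/-- The tensor product `A ⊗ V` modulo the relations `f(μ) a ⊗ v = a ⊗ f v`. -/
def ATens (V : Type) [AddCommGroup V] [Module Mer V] : Type := RFSL q ⊗[Mer] V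

namespace ATens

variable (V : Type) [AddCommGroup V] [Module Mer V]

instance : AddCommGroup (ATens q V) := inferInstanceAs (AddCommGroup (RFSL q ⊗[Mer] V))

/-- Extension of scalars: `f (a ⊗ v) = f(λ) a ⊗ v`. -/
instance : Module Mer (ATens q V) :=
  Module.compHom (RFSL q ⊗[Mer] V)
    ((Module.End.rTensorAlgHom Mer (RFSL q) V).toRingHom.comp (lEnd q))

variable {V}

/-- The element `a ⊗ v`. -/
def mk (a : FSL q) (v : V) : ATens q V := (RFSL.of q a) ⊗ₜ[Mer] v

variable {q}

theorem mk_add (a : FSL q) (v w : V) : mk q a (v + w) = mk q a v + mk q a w :=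
  TensorProduct.tmul_add (R := Mer) (RFSL.of q a) v w

theorem add_mk (a b : FSL q) (v : V) : mk q (a + b) v = mk q a v + mk q b v :=
  TensorProduct.add_tmul (R := Mer) (RFSL.of q a) (RFSL.of q b) v

theorem mk_zero (a : FSL q) : mk q a (0 : V) = 0 :=
  TensorProduct.tmul_zero (R := Mer) _ (RFSL.of q a)

theorem zero_mk (v : V) : mk q 0 v = 0 := TensorProduct.zero_tmul (R := Mer) (RFSL q) v

theorem r_mk (f : Mer) (a : FSL q) (v : V) : mk q (FSL.r q f * a) v = mk q a (f • v) :=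
  TensorProduct.smul_tmul (R := Mer) f (RFSL.of q a) v

theorem smul_mk (f : Mer) (a : FSL q) (v : V) : f • mk q a v = mk q (FSL.l q f * a) v := rfl

theorem ind {p : ATens q V → Prop} (h0 : p 0) (h1 : ∀ a v, p (mk q a v))
    (h2 : ∀ x y, p x → p y → p (x + y)) (x : ATens q V) : p x :=
  TensorProduct.induction_on (motive := p) x h0 h1 h2

/-- Additive maps out of `A ⊗ V`. -/
def lift {P : Type} [AddCommGroup P] (φ : FSL q → V → P)
    (hl : ∀ a b v, φ (a + b) v = φ a v + φ b v) (hr : ∀ a v w, φ a (v + w) = φ a v + φ a w)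
    (h : ∀ f a v, φ (FSL.r q f * a) v = φ a (f • v)) : ATens q V →+ P :=
  TensorProduct.liftAddHom (R := Mer) (M := RFSL q) (N := V) (P := P)
    (AddMonoidHom.mk' (fun a => AddMonoidHom.mk' (fun v => φ a v) (hr a))
      (fun a b => AddMonoidHom.ext fun v => hl a b v)) h

theorem lift_mk {P : Type} [AddCommGroup P] (φ : FSL q → V → P)
    (hl : ∀ a b v, φ (a + b) v = φ a v + φ b v) (hr : ∀ a v w, φ a (v + w) = φ a v + φ a w)
    (h : ∀ f a v, φ (FSL.r q f * a) v = φ a (f • v)) (a : FSL q) (v : V) :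
    lift φ hl hr h (mk q a v) = φ a v := rfl

theorem hom_ext {P : Type} [AddCommGroup P] {φ ψ : ATens q V →+ P}
    (h : ∀ a v, φ (mk q a v) = ψ (mk q a v)) : φ = ψ := by
  ext x
  induction x using ind with
  | h0 => rw [map_zero, map_zero]
  | h1 a v => exact h a v
  | h2 x y hx hy => rw [map_add, map_add, hx, hy]

theorem linearMap_ext {P : Type} [AddCommGroup P] [Module Mer P] {φ ψ : ATens q V →ₗ[Mer] P}
    (h : ∀ a v, φ (mk q a v) = ψ (mk q a v)) : φ = ψ := by
  have : φ.toAddMonoidHom = ψ.toAddMonoidHom := hom_ext h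
  ext x
  exact DFunLike.congr_fun this x

variable {W : Type} [AddCommGroup W] [Module Mer W]

/-- An additive map out of `A ⊗ V` is linear if it is so on elements `a ⊗ v`. -/
def toLinear {P : Type} [AddCommGroup P] [Module Mer P] (φ : ATens q V →+ P)
    (h : ∀ (f : Mer) a v, φ (mk q (FSL.l q f * a) v) = f • φ (mk q a v)) :
    ATens q V →ₗ[Mer] P where
  toFun := φ
  map_add' := map_add φ
  map_smul' f x := by
    induction x using ind with
    | h0 => rw [smul_zero, map_zero, smul_zero]
    | h1 a v => rw [smul_mk]; exact h f a v
    | h2 x y hx hy => rw [smul_add, map_add, hx, hy, map_add, smul_add]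

variable (q) in
/-- The map `id ⊗ φ`. -/
def map (φ : V →ₗ[Mer] W) : ATens q V →ₗ[Mer] ATens q W :=
  toLinear (lift (fun a v => mk q a (φ v)) (fun a b v => add_mk a b (φ v))
    (fun a v w => by rw [map_add, mk_add]) (fun f a v => by rw [r_mk, map_smul]))
    (fun _ _ _ => rfl)

theorem map_mk (φ : V →ₗ[Mer] W) (a : FSL q) (v : V) : map q φ (mk q a v) = mk q a (φ v) := rfl

theorem map_injective (φ : V →ₗ[Mer] W) (h : Function.Injective φ) :
    Function.Injective (map q φ) := by
  have h1 := Module.Flat.lTensor_preserves_injective_linearMap (M := RFSL q) φ h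
  have h2 : (map q φ).toAddMonoidHom = (LinearMap.lTensor (RFSL q) φ).toAddMonoidHom :=
    hom_ext fun a v => rfl
  intro x y hxy
  refine h1 ?_
  have hx := DFunLike.congr_fun h2 x
  have hy := DFunLike.congr_fun h2 y
  exact hx.symm.trans (hxy.trans hy)

end ATens
end DynSU2

namespace DynSU2
variable (q : Set.Ioo (0 : ℝ) 1)

namespace FSL

theorem α_r (f : Mer) : α q * r q f = r q (T (-1) f) * α q := by
  have := rel q (Relation.r_α (T (-1) f))
  rw [this, T_T, add_neg_cancel, T_zero]
theorem α_l (f : Mer) : α q * l q f = l q (T (-1) f) * α q := by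
  have := rel q (Relation.l_α (T (-1) f))
  rw [this, T_T, add_neg_cancel, T_zero]
theorem β_r (f : Mer) : β q * r q f = r q (T 1 f) * β q := by
  have := rel q (Relation.r_β (T 1 f))
  rw [this, T_T, neg_add_cancel, T_zero]
theorem β_l (f : Mer) : β q * l q f = l q (T (-1) f) * β q := by
  have := rel q (Relation.l_β (T (-1) f))
  rw [this, T_T, add_neg_cancel, T_zero]
theorem γ_r (f : Mer) : γ q * r q f = r q (T (-1) f) * γ q := by
  have := rel q (Relation.r_γ (T (-1) f))
  rw [this, T_T, add_neg_cancel, T_zero]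
theorem γ_l (f : Mer) : γ q * l q f = l q (T 1 f) * γ q := by
  have := rel q (Relation.l_γ (T 1 f))
  rw [this, T_T, neg_add_cancel, T_zero]
theorem δ_r (f : Mer) : δ q * r q f = r q (T 1 f) * δ q := by
  have := rel q (Relation.r_δ (T 1 f))
  rw [this, T_T, neg_add_cancel, T_zero]
theorem δ_l (f : Mer) : δ q * l q f = l q (T 1 f) * δ q := by
  have := rel q (Relation.l_δ (T 1 f))
  rw [this, T_T, neg_add_cancel, T_zero]

end FSL

open FSL

instance (V : Type) [AddCommGroup V] [Module Mer V] : Module ℂ (ATens q V) :=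
  Module.compHom (ATens q V) (algebraMap ℂ Mer)

theorem ATens.complex_smul_def {V : Type} [AddCommGroup V] [Module Mer V] (c : ℂ) (x : ATens q V) :
    c • x = algebraMap ℂ Mer c • x := rfl

/-- Left multiplication by `a ⊗ b`, that is `c ⊗ d ↦ a c ⊗ b d`, where the right degree of `a`
and the left degree of `b` are both equal to `s`. -/
def pairOp (a b : FSL q) (s : ℂ) (ha : ∀ f, a * r q f = r q (T (-s) f) * a)
    (hb : ∀ f, b * l q f = l q (T (-s) f) * b) : Module.End ℂ (ATens q (FSL q)) where
  toFun := ATens.lift (fun c d => ATens.mk q (a * c) (b * d))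
    (fun c c' d => by rw [mul_add, ATens.add_mk]) (fun c d d' => by rw [mul_add, ATens.mk_add])
    (fun f c d => by
      rw [← mul_assoc, ha, mul_assoc, ATens.r_mk, smul_def, smul_def, ← mul_assoc, ← hb, mul_assoc])
  map_add' := map_add _
  map_smul' c x := by
    induction x using ATens.ind with
    | h0 => rw [smul_zero, map_zero, smul_zero]
    | h1 a v =>
      rw [ATens.complex_smul_def, ATens.smul_mk, AlgHom.commutes, ATens.lift_mk, ATens.lift_mk,
        RingHom.id_apply, ATens.complex_smul_def, ATens.smul_mk, AlgHom.commutes,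
        Algebra.left_comm]
    | h2 x y hx hy => rw [smul_add, map_add, hx, hy, map_add, smul_add]

variable {q} in
theorem pairOp_mk (a b : FSL q) (s : ℂ) (ha : ∀ f, a * r q f = r q (T (-s) f) * a)
    (hb : ∀ f, b * l q f = l q (T (-s) f) * b) (c d : FSL q) :
    pairOp q a b s ha hb (ATens.mk q c d) = ATens.mk q (a * c) (b * d) := rfl

variable {q} in
theorem end_ext {φ ψ : Module.End ℂ (ATens q (FSL q))}
    (h : ∀ a v, φ (ATens.mk q a v) = ψ (ATens.mk q a v)) : φ = ψ := by
  have : φ.toAddMonoidHom = ψ.toAddMonoidHom := ATens.hom_ext h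
  ext x
  exact DFunLike.congr_fun this x

/-- Multiplication by `f(λ) ⊗ 1`. -/
def opL (f : Mer) : Module.End ℂ (ATens q (FSL q)) :=
  pairOp q (l q f) 1 0 (fun g => by rw [neg_zero, T_zero, l_comm_r])
    (fun g => by rw [neg_zero, T_zero, one_mul, mul_one])

/-- Multiplication by `f(μ) ⊗ 1 = 1 ⊗ f(λ)`. -/
def opR (f : Mer) : Module.End ℂ (ATens q (FSL q)) :=
  pairOp q (r q f) 1 0 (fun g => by rw [neg_zero, T_zero, r_comm_r])
    (fun g => by rw [neg_zero, T_zero, one_mul, mul_one])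

/-- Multiplication by `1 ⊗ f(μ)`. -/
def opM (f : Mer) : Module.End ℂ (ATens q (FSL q)) :=
  pairOp q 1 (r q f) 0 (fun g => by rw [neg_zero, T_zero, one_mul, mul_one])
    (fun g => by rw [neg_zero, T_zero, l_comm_r])

/-- Multiplication by `α ⊗ α + β ⊗ γ`. -/
def opα : Module.End ℂ (ATens q (FSL q)) :=
  pairOp q (α q) (α q) 1 (α_r q) (α_l q) +
    pairOp q (β q) (γ q) (-1) (by simpa using β_r q) (by simpa using γ_l q)

/-- Multiplication by `α ⊗ β + β ⊗ δ`. -/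
def opβ : Module.End ℂ (ATens q (FSL q)) :=
  pairOp q (α q) (β q) 1 (α_r q) (β_l q) +
    pairOp q (β q) (δ q) (-1) (by simpa using β_r q) (by simpa using δ_l q)

/-- Multiplication by `γ ⊗ α + δ ⊗ γ`. -/
def opγ : Module.End ℂ (ATens q (FSL q)) :=
  pairOp q (γ q) (α q) 1 (γ_r q) (α_l q) +
    pairOp q (δ q) (γ q) (-1) (by simpa using δ_r q) (by simpa using γ_l q)

/-- Multiplication by `γ ⊗ β + δ ⊗ δ`. -/
def opδ : Module.End ℂ (ATens q (FSL q)) :=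
  pairOp q (γ q) (β q) 1 (γ_r q) (β_l q) +
    pairOp q (δ q) (δ q) (-1) (by simpa using δ_r q) (by simpa using δ_l q)

section
open ATens
variable (c d : FSL q) (f : Mer)
variable {q}

theorem opL_mk : opL q f (mk q c d) = mk q (l q f * c) d := by
  rw [opL, pairOp_mk, one_mul]
theorem opR_mk : opR q f (mk q c d) = mk q (r q f * c) d := by
  rw [opR, pairOp_mk, one_mul]
theorem opR_mk' : opR q f (mk q c d) = mk q c (l q f * d) := by
  rw [opR_mk, r_mk, smul_def]
theorem opM_mk : opM q f (mk q c d) = mk q c (r q f * d) := by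
  rw [opM, pairOp_mk, one_mul]
theorem opα_mk : opα q (mk q c d) = mk q (α q * c) (α q * d) + mk q (β q * c) (γ q * d) := rfl
theorem opβ_mk : opβ q (mk q c d) = mk q (α q * c) (β q * d) + mk q (β q * c) (δ q * d) := rfl
theorem opγ_mk : opγ q (mk q c d) = mk q (γ q * c) (α q * d) + mk q (δ q * c) (γ q * d) := rfl
theorem opδ_mk : opδ q (mk q c d) = mk q (γ q * c) (β q * d) + mk q (δ q * c) (δ q * d) := rfl

end

/-- The functions `f(λ) g(ρ) h(μ)`. -/
def Fun3 : Type := Mer ⊗[ℂ] (Mer ⊗[ℂ] Mer)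

instance : CommRing Fun3 := inferInstanceAs (CommRing (Mer ⊗[ℂ] (Mer ⊗[ℂ] Mer)))
instance : Algebra ℂ Fun3 := inferInstanceAs (Algebra ℂ (Mer ⊗[ℂ] (Mer ⊗[ℂ] Mer)))

/-- `opL` as a homomorphism -/
def hopL : Mer →ₐ[ℂ] Module.End ℂ (ATens q (FSL q)) where
  toFun := opL q
  map_one' := end_ext fun a v => by rw [opL_mk, map_one, one_mul]; rfl
  map_mul' f g := end_ext fun a v => by rw [Module.End.mul_apply, opL_mk, opL_mk, opL_mk, map_mul, mul_assoc]
  map_zero' := end_ext fun a v => by rw [opL_mk, map_zero, zero_mul, ATens.zero_mk]; rfl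
  map_add' f g := end_ext fun a v => by
    rw [LinearMap.add_apply, opL_mk, opL_mk, opL_mk, map_add, add_mul, ATens.add_mk]
  commutes' c := end_ext fun a v => by
    rw [opL_mk, Module.algebraMap_end_apply, ATens.complex_smul_def, ATens.smul_mk]

def hopR : Mer →ₐ[ℂ] Module.End ℂ (ATens q (FSL q)) where
  toFun := opR q
  map_one' := end_ext fun a v => by rw [opR_mk, map_one, one_mul]; rfl
  map_mul' f g := end_ext fun a v => by rw [Module.End.mul_apply, opR_mk, opR_mk, opR_mk, map_mul, mul_assoc]
  map_zero' := end_ext fun a v => by rw [opR_mk, map_zero, zero_mul, ATens.zero_mk]; rfl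
  map_add' f g := end_ext fun a v => by
    rw [LinearMap.add_apply, opR_mk, opR_mk, opR_mk, map_add, add_mul, ATens.add_mk]
  commutes' c := end_ext fun a v => by
    rw [opR_mk, Module.algebraMap_end_apply, ATens.complex_smul_def, ATens.smul_mk,
      AlgHom.commutes, AlgHom.commutes]

def hopM : Mer →ₐ[ℂ] Module.End ℂ (ATens q (FSL q)) where
  toFun := opM q
  map_one' := end_ext fun a v => by rw [opM_mk, map_one, one_mul]; rfl
  map_mul' f g := end_ext fun a v => by rw [Module.End.mul_apply, opM_mk, opM_mk, opM_mk, map_mul, mul_assoc]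
  map_zero' := end_ext fun a v => by rw [opM_mk, map_zero, zero_mul, ATens.mk_zero]; rfl
  map_add' f g := end_ext fun a v => by
    rw [LinearMap.add_apply, opM_mk, opM_mk, opM_mk, map_add, add_mul, ATens.mk_add]
  commutes' c := end_ext fun a v => by
    rw [opM_mk, Module.algebraMap_end_apply, ATens.complex_smul_def, ATens.smul_mk,
      AlgHom.commutes (r q) c, ← AlgHom.commutes (l q) c, ← smul_def, ← ATens.r_mk,
      AlgHom.commutes, AlgHom.commutes]

theorem hopR_hopM (f g : Mer) : Commute (hopR q f) (hopM q g) :=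
  show hopR q f * hopM q g = hopM q g * hopR q f from end_ext fun c d => by
    change opR q f (opM q g (ATens.mk q c d)) = opM q g (opR q f (ATens.mk q c d))
    rw [opM_mk, opR_mk, opR_mk, opM_mk]
theorem hopL_hopM (f g : Mer) : Commute (hopL q f) (hopM q g) :=
  show hopL q f * hopM q g = hopM q g * hopL q f from end_ext fun c d => by
    change opL q f (opM q g (ATens.mk q c d)) = opM q g (opL q f (ATens.mk q c d))
    rw [opM_mk, opL_mk, opL_mk, opM_mk]
theorem hopL_hopR (f g : Mer) : Commute (hopL q f) (hopR q g) :=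
  show hopL q f * hopR q g = hopR q g * hopL q f from end_ext fun c d => by
    change opL q f (opR q g (ATens.mk q c d)) = opR q g (opL q f (ATens.mk q c d))
    rw [opR_mk, opL_mk, opL_mk, opR_mk, ← mul_assoc, ← mul_assoc, l_comm_r]

/-- The action of functions of `ρ`, `μ`. -/
def hopRM : Mer ⊗[ℂ] Mer →ₐ[ℂ] Module.End ℂ (ATens q (FSL q)) :=
  Algebra.TensorProduct.lift (hopR q) (hopM q) (hopR_hopM q)

theorem hopRM_tmul (f g : Mer) : hopRM q (f ⊗ₜ g) = hopR q f * hopM q g :=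
  Algebra.TensorProduct.lift_tmul _ _ (hopR_hopM q) f g

theorem hopL_hopRM (f : Mer) (x : Mer ⊗[ℂ] Mer) : Commute (hopL q f) (hopRM q x) := by
  induction x using TensorProduct.induction_on with
  | zero => rw [map_zero]; exact Commute.zero_right _
  | add x y hx hy => rw [map_add]; exact hx.add_right hy
  | tmul g h =>
    rw [hopRM_tmul]
    exact (hopL_hopR q f g).mul_right (hopL_hopM q f h)

/-- The action of functions of `λ`, `ρ`, `μ`. -/
def act3 : Fun3 →ₐ[ℂ] Module.End ℂ (ATens q (FSL q)) :=
  show Mer ⊗[ℂ] (Mer ⊗[ℂ] Mer) →ₐ[ℂ] Module.End ℂ (ATens q (FSL q)) from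
  Algebra.TensorProduct.lift (hopL q) (hopRM q) (hopL_hopRM q)

theorem act3_tmul (f : Mer) (x : Mer ⊗[ℂ] Mer) :
    act3 q (f ⊗ₜ[ℂ] x : Mer ⊗[ℂ] (Mer ⊗[ℂ] Mer)) = hopL q f * hopRM q x :=
  Algebra.TensorProduct.lift_tmul _ _ (hopL_hopRM q) f x

def sL : Mer →ₐ[ℂ] Fun3 :=
  show Mer →ₐ[ℂ] Mer ⊗[ℂ] (Mer ⊗[ℂ] Mer) from Algebra.TensorProduct.includeLeft
def sR : Mer →ₐ[ℂ] Fun3 :=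
  show Mer →ₐ[ℂ] Mer ⊗[ℂ] (Mer ⊗[ℂ] Mer) from
    Algebra.TensorProduct.includeRight.comp Algebra.TensorProduct.includeLeft
def sM : Mer →ₐ[ℂ] Fun3 :=
  show Mer →ₐ[ℂ] Mer ⊗[ℂ] (Mer ⊗[ℂ] Mer) from
    Algebra.TensorProduct.includeRight.comp Algebra.TensorProduct.includeRight

theorem act3_sL (f : Mer) : act3 q (sL f) = opL q f := by
  refine (act3_tmul q f 1).trans ?_
  rw [map_one, mul_one]; rfl
theorem act3_sR (f : Mer) : act3 q (sR f) = opR q f := by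
  refine (act3_tmul q 1 (f ⊗ₜ 1)).trans ?_
  rw [map_one, one_mul, hopRM_tmul, map_one, mul_one]; rfl
theorem act3_sM (f : Mer) : act3 q (sM f) = opM q f := by
  refine (act3_tmul q 1 (1 ⊗ₜ f)).trans ?_
  rw [map_one, one_mul, hopRM_tmul, map_one, one_mul]; rfl

end DynSU2

namespace DynSU2
variable (q : Set.Ioo (0 : ℝ) 1)
open FSL

/-- `F(λ-1)` -/
def vI : Mer := T (-1) (F q)

theorem vF_mul_vI : vF q * vI q = 1 := by
  rw [vI, TF_eq, mul_inv_cancel₀ (vF_ne_zero q)]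

section words
variable {q} (c : FSL q)
theorem αβ_mul : α q * (β q * c) = r q (qpow q 0 1) * (r q (vI q) * (β q * (α q * c))) := by
  rw [← mul_assoc, rel q Relation.αβ, map_mul]; simp only [mul_assoc, vI]
theorem γδ_mul : γ q * (δ q * c) = r q (qpow q 0 1) * (r q (vI q) * (δ q * (γ q * c))) := by
  rw [← mul_assoc, rel q Relation.γδ, map_mul]; simp only [mul_assoc, vI]
theorem αγ_mul : α q * (γ q * c) = l q (qpow q 0 1) * (l q (uF q) * (γ q * (α q * c))) := by
  rw [← mul_assoc, rel q Relation.αγ, qF_eq, map_mul]; simp only [mul_assoc]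
theorem βδ_mul : β q * (δ q * c) = l q (qpow q 0 1) * (l q (uF q) * (δ q * (β q * c))) := by
  rw [← mul_assoc, rel q Relation.βδ, qF_eq, map_mul]; simp only [mul_assoc]
theorem αδ_mul : α q * (δ q * c) = c + l q (qpow q 0 1) * (l q (uF q) * (γ q * (β q * c))) := by
  rw [← mul_assoc, αδ_eq, map_mul, add_mul, one_mul]; simp only [mul_assoc]
theorem δα_mul : δ q * (α q * c) = c + r q (qpow q 0 (-1)) * (r q (vF q) * (γ q * (β q * c))) := by
  rw [← mul_assoc, δα_eq, map_mul, add_mul, one_mul]; simp only [mul_assoc]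
theorem βγ_mul : β q * (γ q * c) = l q (qpow q 0 1) * (l q (uF q) * c) +
    - (r q (qpow q 0 1) * (r q (uF q) * c)) + l q (uF q) * (r q (vF q) * (γ q * (β q * c))) := by
  rw [← mul_assoc, βγ_eq, map_mul, map_mul, sub_eq_add_neg, add_mul, add_mul, neg_mul]
  simp only [mul_assoc]
end words

section cross
local instance : Module Fun3 (ATens q (FSL q)) := Module.compHom _ (act3 q).toRingHom

variable {q} (f : Mer) (c d : FSL q)
open ATens
theorem mk_l_left : mk q (l q f * c) d = sL f • mk q c d := by
  rw [← opL_mk, ← act3_sL]; rfl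
theorem mk_r_left : mk q (r q f * c) d = sR f • mk q c d := by
  rw [← opR_mk, ← act3_sR]; rfl
theorem mk_l_right : mk q c (l q f * d) = sR f • mk q c d := by
  rw [← opR_mk', ← act3_sR]; rfl
theorem mk_r_right : mk q c (r q f * d) = sM f • mk q c d := by
  rw [← opM_mk, ← act3_sM]; rfl
theorem neg_mk : mk q (-c) d = - mk q c d := by
  rw [eq_neg_iff_add_eq_zero, ← add_mk, neg_add_cancel, zero_mk]
theorem mk_neg : mk q c (-d) = - mk q c d := by
  rw [eq_neg_iff_add_eq_zero, ← ATens.mk_add, neg_add_cancel, ATens.mk_zero]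

variable (q)
def tQ : Fun3 := algebraMap ℂ _ ((q : ℝ) : ℂ)
def tP : Fun3 := algebraMap ℂ _ ((q : ℝ) : ℂ)⁻¹
theorem tQ_tP : tQ q * tP q = 1 := by
  rw [tQ, tP, ← map_mul, mul_inv_cancel₀ (q_ne_zero q), map_one]

theorem s_const (s : Mer →ₐ[ℂ] Fun3) (a : ℤ) :
    s (qpow q 0 a) = algebraMap ℂ _ (((q : ℝ) : ℂ) ^ a) := by
  rw [qpow_zero_left, AlgHom.commutes]
theorem s_one (s : Mer →ₐ[ℂ] Fun3) : s (qpow q 0 1) = tQ q := by rw [s_const, zpow_one]; rfl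
theorem s_neg_one (s : Mer →ₐ[ℂ] Fun3) : s (qpow q 0 (-1)) = tP q := by
  rw [s_const, zpow_neg_one]; rfl
theorem s_two (s : Mer →ₐ[ℂ] Fun3) : s (qpow q 0 2) = tQ q ^ 2 := by
  rw [s_const, tQ, ← map_pow]; norm_cast
theorem s_neg_two (s : Mer →ₐ[ℂ] Fun3) : s (qpow q 0 (-2)) = tP q ^ 2 := by
  rw [s_const, tP, ← map_pow]; congr 1; simp
theorem s_uF (s : Mer →ₐ[ℂ] Fun3) : s (uF q) = 1 + (1 - tP q ^ 2) * s (wInv q) := by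
  rw [uF, map_add, map_mul, map_sub, map_one, s_neg_two]
theorem s_vF (s : Mer →ₐ[ℂ] Fun3) : s (vF q) = 1 + (1 - tQ q ^ 2) * s (wInv q) := by
  rw [vF, map_add, map_mul, map_sub, map_one, s_two]
theorem s_vI (s : Mer →ₐ[ℂ] Fun3) : (1 + (1 - tQ q ^ 2) * s (wInv q)) * s (vI q) = 1 := by
  rw [← s_vF, ← map_mul, vF_mul_vI, map_one]
theorem s_x (s : Mer →ₐ[ℂ] Fun3) : s (qpow q 2 2) * s (wInv q) = 1 + s (wInv q) := by
  rw [← map_mul, x_mul_wInv, map_add, map_one]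

theorem op_αβ : opα q * opβ q =
    opM q (qpow q 0 1 * vI q) * (opβ q * opα q) := by
  refine end_ext fun c d => ?_
  have hQ := tQ_tP q
  have hR := s_vI q sR
  have hM := s_vI q sM
  change opα q (opβ q (mk q c d)) =
    opM q (qpow q 0 1 * vI q) (opβ q (opα q (mk q c d)))
  simp only [opα_mk, opβ_mk, opγ_mk, opδ_mk, map_add, map_sub, opL_mk, opM_mk]
  simp only [αβ_mul, γδ_mul, αγ_mul, βδ_mul, αδ_mul, δα_mul, βγ_mul,
    mul_assoc, mul_add, mul_neg, map_mul, map_sub, map_one, ATens.mk_add, add_mk, mk_neg, neg_mk,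
    mk_l_left, mk_r_left, mk_l_right, mk_r_right, s_one, s_neg_one, s_uF, s_vF]
  match_scalars
  all_goals clear * - hQ hR hM
  all_goals grind

theorem op_γδ : opγ q * opδ q =
    opM q (qpow q 0 1 * vI q) * (opδ q * opγ q) := by
  refine end_ext fun c d => ?_
  have hQ := tQ_tP q
  have hR := s_vI q sR
  have hM := s_vI q sM
  change opγ q (opδ q (mk q c d)) =
    opM q (qpow q 0 1 * vI q) (opδ q (opγ q (mk q c d)))
  simp only [opα_mk, opβ_mk, opγ_mk, opδ_mk, map_add, map_sub, opL_mk, opM_mk]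
  simp only [αβ_mul, γδ_mul, αγ_mul, βδ_mul, αδ_mul, δα_mul, βγ_mul,
    mul_assoc, mul_add, mul_neg, map_mul, map_sub, map_one, ATens.mk_add, add_mk, mk_neg, neg_mk,
    mk_l_left, mk_r_left, mk_l_right, mk_r_right, s_one, s_neg_one, s_uF, s_vF]
  match_scalars
  all_goals clear * - hQ hR hM
  all_goals grind

theorem op_αγ : opα q * opγ q =
    opL q (qpow q 0 1 * uF q) * (opγ q * opα q) := by
  refine end_ext fun c d => ?_
  have hQ := tQ_tP q
  have hR := s_vI q sR
  have hM := s_vI q sM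
  change opα q (opγ q (mk q c d)) =
    opL q (qpow q 0 1 * uF q) (opγ q (opα q (mk q c d)))
  simp only [opα_mk, opβ_mk, opγ_mk, opδ_mk, map_add, map_sub, opL_mk, opM_mk]
  simp only [αβ_mul, γδ_mul, αγ_mul, βδ_mul, αδ_mul, δα_mul, βγ_mul,
    mul_assoc, mul_add, mul_neg, map_mul, map_sub, map_one, ATens.mk_add, add_mk, mk_neg, neg_mk,
    mk_l_left, mk_r_left, mk_l_right, mk_r_right, s_one, s_neg_one, s_uF, s_vF]
  match_scalars
  all_goals clear * - hQ hR hM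
  all_goals grind

theorem op_βδ : opβ q * opδ q =
    opL q (qpow q 0 1 * uF q) * (opδ q * opβ q) := by
  refine end_ext fun c d => ?_
  have hQ := tQ_tP q
  have hR := s_vI q sR
  have hM := s_vI q sM
  change opβ q (opδ q (mk q c d)) =
    opL q (qpow q 0 1 * uF q) (opδ q (opβ q (mk q c d)))
  simp only [opα_mk, opβ_mk, opγ_mk, opδ_mk, map_add, map_sub, opL_mk, opM_mk]
  simp only [αβ_mul, γδ_mul, αγ_mul, βδ_mul, αδ_mul, δα_mul, βγ_mul,
    mul_assoc, mul_add, mul_neg, map_mul, map_sub, map_one, ATens.mk_add, add_mk, mk_neg, neg_mk,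
    mk_l_left, mk_r_left, mk_l_right, mk_r_right, s_one, s_neg_one, s_uF, s_vF]
  match_scalars
  all_goals clear * - hQ hR hM
  all_goals grind

theorem op_det : opα q * opδ q - opL q (qpow q 0 1 * uF q) * (opγ q * opβ q) =
    1 := by
  refine end_ext fun c d => ?_
  have hQ := tQ_tP q
  have hR := s_vI q sR
  have hM := s_vI q sM
  change opα q (opδ q (mk q c d)) - opL q (qpow q 0 1 * uF q) (opγ q (opβ q (mk q c d))) =
    mk q c d
  simp only [opα_mk, opβ_mk, opγ_mk, opδ_mk, map_add, map_sub, opL_mk, opM_mk]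
  simp only [αβ_mul, γδ_mul, αγ_mul, βδ_mul, αδ_mul, δα_mul, βγ_mul,
    mul_assoc, mul_add, mul_neg, map_mul, map_sub, map_one, ATens.mk_add, add_mk, mk_neg, neg_mk,
    mk_l_left, mk_r_left, mk_l_right, mk_r_right, s_one, s_neg_one, s_uF, s_vF]
  match_scalars
  all_goals clear * - hQ hR hM
  all_goals grind

theorem op_αδ : opα q * opδ q - opδ q * opα q =
    opL q (qpow q 0 1 - qpow q 0 (-1)) * (opL q (qpow q 2 2) * opM q (qpow q 2 2) - 1) *
      (opL q (wInv q) * opM q (wInv q)) * (opγ q * opβ q) := by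
  refine end_ext fun c d => ?_
  have hQ := tQ_tP q
  have hR := s_vI q sR
  have hM1 := s_vI q sM
  have hL := s_x q sL
  have hM := s_x q sM
  change opα q (opδ q (mk q c d)) - opδ q (opα q (mk q c d)) =
    opL q (qpow q 0 1 - qpow q 0 (-1)) (opL q (qpow q 2 2) (opM q (qpow q 2 2)
      (opL q (wInv q) (opM q (wInv q) (opγ q (opβ q (mk q c d)))))) -
      opL q (wInv q) (opM q (wInv q) (opγ q (opβ q (mk q c d)))))
  simp only [opα_mk, opβ_mk, opγ_mk, opδ_mk, map_add, map_sub, opL_mk, opM_mk]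
  simp only [αβ_mul, γδ_mul, αγ_mul, βδ_mul, αδ_mul, δα_mul, βγ_mul,
    sub_eq_add_neg, add_mul, neg_mul,
    map_neg, mul_assoc, mul_add, mul_neg, map_mul, map_sub, map_one, ATens.mk_add, add_mk, mk_neg, neg_mk,
    mk_l_left, mk_r_left, mk_l_right, mk_r_right, s_one, s_neg_one, s_uF, s_vF]
  match_scalars
  all_goals clear * - hQ hR hM1 hL hM
  all_goals grind

theorem op_βγ : opβ q * opγ q - opM q (uF q * vF q) * (opγ q * opβ q) =
    opL q (qpow q 0 1 - qpow q 0 (-1)) * (opM q (qpow q 2 2) - opL q (qpow q 2 2)) *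
      (opL q (wInv q) * opM q (wInv q)) * (opδ q * opα q) := by
  refine end_ext fun c d => ?_
  have hQ := tQ_tP q
  have hR := s_vI q sR
  have hM1 := s_vI q sM
  have hL := s_x q sL
  have hM := s_x q sM
  change opβ q (opγ q (mk q c d)) - opM q (uF q * vF q) (opγ q (opβ q (mk q c d))) =
    opL q (qpow q 0 1 - qpow q 0 (-1)) (opM q (qpow q 2 2)
      (opL q (wInv q) (opM q (wInv q) (opδ q (opα q (mk q c d))))) -
      opL q (qpow q 2 2) (opL q (wInv q) (opM q (wInv q) (opδ q (opα q (mk q c d))))))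
  simp only [opα_mk, opβ_mk, opγ_mk, opδ_mk, map_add, map_sub, opL_mk, opM_mk]
  simp only [αβ_mul, γδ_mul, αγ_mul, βδ_mul, αδ_mul, δα_mul, βγ_mul,
    sub_eq_add_neg, add_mul, neg_mul,
    map_neg, mul_assoc, mul_add, mul_neg, map_mul, map_sub, map_one, ATens.mk_add, add_mk, mk_neg, neg_mk,
    mk_l_left, mk_r_left, mk_l_right, mk_r_right, s_one, s_neg_one, s_uF, s_vF]
  match_scalars
  all_goals clear * - hQ hR hM1 hL hM
  all_goals grind

end cross
end DynSU2

namespace DynSU2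
variable (q : Set.Ioo (0 : ℝ) 1)
open FSL

section words
variable {q} (f : Mer) (c : FSL q)
theorem α_r_mul : α q * (r q f * c) = r q (T (-1) f) * (α q * c) := by
  rw [← mul_assoc, α_r, mul_assoc]
theorem α_l_mul : α q * (l q f * c) = l q (T (-1) f) * (α q * c) := by
  rw [← mul_assoc, α_l, mul_assoc]
theorem β_r_mul : β q * (r q f * c) = r q (T 1 f) * (β q * c) := by
  rw [← mul_assoc, β_r, mul_assoc]
theorem β_l_mul : β q * (l q f * c) = l q (T (-1) f) * (β q * c) := by
  rw [← mul_assoc, β_l, mul_assoc]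
theorem γ_r_mul : γ q * (r q f * c) = r q (T (-1) f) * (γ q * c) := by
  rw [← mul_assoc, γ_r, mul_assoc]
theorem γ_l_mul : γ q * (l q f * c) = l q (T 1 f) * (γ q * c) := by
  rw [← mul_assoc, γ_l, mul_assoc]
theorem δ_r_mul : δ q * (r q f * c) = r q (T 1 f) * (δ q * c) := by
  rw [← mul_assoc, δ_r, mul_assoc]
theorem δ_l_mul : δ q * (l q f * c) = l q (T 1 f) * (δ q * c) := by
  rw [← mul_assoc, δ_l, mul_assoc]
end words

theorem op_rel (x y : Module.End ℂ (ATens q (FSL q)))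
    (h : Relation q (opα q) (opβ q) (opγ q) (opδ q) (opL q) (opM q) x y) : x = y := by
  cases h
  case l_add f g => exact map_add (hopL q) f g
  case l_mul f g => exact map_mul (hopL q) f g
  case l_const c => exact (hopL q).commutes c
  case r_add f g => exact map_add (hopM q) f g
  case r_mul f g => exact map_mul (hopM q) f g
  case r_const c => exact (hopM q).commutes c
  case l_r f g => exact hopL_hopM q f g
  case l_α f =>
    refine end_ext fun c d => ?_
    change opL q f (opα q (ATens.mk q c d)) = opα q (opL q (T 1 f) (ATens.mk q c d))
    simp only [opL_mk, opM_mk, opα_mk, map_add, α_l_mul, β_l_mul, α_r_mul, γ_r_mul, T_T,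
      neg_add_cancel, add_neg_cancel, T_zero]
  case r_α f =>
    refine end_ext fun c d => ?_
    change opM q f (opα q (ATens.mk q c d)) = opα q (opM q (T 1 f) (ATens.mk q c d))
    simp only [opL_mk, opM_mk, opα_mk, map_add, α_l_mul, β_l_mul, α_r_mul, γ_r_mul, T_T,
      neg_add_cancel, add_neg_cancel, T_zero]
  case l_β f =>
    refine end_ext fun c d => ?_
    change opL q f (opβ q (ATens.mk q c d)) = opβ q (opL q (T 1 f) (ATens.mk q c d))
    simp only [opL_mk, opM_mk, opβ_mk, map_add, α_l_mul, β_l_mul, β_r_mul, δ_r_mul, T_T,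
      neg_add_cancel, add_neg_cancel, T_zero]
  case r_β f =>
    refine end_ext fun c d => ?_
    change opM q f (opβ q (ATens.mk q c d)) = opβ q (opM q (T (-1) f) (ATens.mk q c d))
    simp only [opL_mk, opM_mk, opβ_mk, map_add, α_l_mul, β_l_mul, β_r_mul, δ_r_mul, T_T,
      neg_add_cancel, add_neg_cancel, T_zero]
  case l_γ f =>
    refine end_ext fun c d => ?_
    change opL q f (opγ q (ATens.mk q c d)) = opγ q (opL q (T (-1) f) (ATens.mk q c d))
    simp only [opL_mk, opM_mk, opγ_mk, map_add, γ_l_mul, δ_l_mul, α_r_mul, γ_r_mul, T_T,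
      neg_add_cancel, add_neg_cancel, T_zero]
  case r_γ f =>
    refine end_ext fun c d => ?_
    change opM q f (opγ q (ATens.mk q c d)) = opγ q (opM q (T 1 f) (ATens.mk q c d))
    simp only [opL_mk, opM_mk, opγ_mk, map_add, γ_l_mul, δ_l_mul, α_r_mul, γ_r_mul, T_T,
      neg_add_cancel, add_neg_cancel, T_zero]
  case l_δ f =>
    refine end_ext fun c d => ?_
    change opL q f (opδ q (ATens.mk q c d)) = opδ q (opL q (T (-1) f) (ATens.mk q c d))
    simp only [opL_mk, opM_mk, opδ_mk, map_add, γ_l_mul, δ_l_mul, β_r_mul, δ_r_mul, T_T,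
      neg_add_cancel, add_neg_cancel, T_zero]
  case r_δ f =>
    refine end_ext fun c d => ?_
    change opM q f (opδ q (ATens.mk q c d)) = opδ q (opM q (T (-1) f) (ATens.mk q c d))
    simp only [opL_mk, opM_mk, opδ_mk, map_add, γ_l_mul, δ_l_mul, β_r_mul, δ_r_mul, T_T,
      neg_add_cancel, add_neg_cancel, T_zero]
  case αβ => exact op_αβ q
  case αγ => rw [qF_eq]; exact op_αγ q
  case βδ => rw [qF_eq]; exact op_βδ q
  case γδ => exact op_γδ q
  case αδ => exact op_αδ q
  case βγ => rw [G_eq']; exact op_βγ q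
  case det => rw [qF_eq]; exact op_det q

/-- The operator on `A ⊗ A` of left multiplication by the coproduct of an element of `A`. -/
def comulEnd : FSL q →ₐ[ℂ] Module.End ℂ (ATens q (FSL q)) :=
  FSL.lift q (opα q) (opβ q) (opγ q) (opδ q) (opL q) (opM q) (op_rel q)

theorem comulEnd_α : comulEnd q (α q) = opα q := FSL.lift_α _ _ _ _ _ _ _ _
theorem comulEnd_β : comulEnd q (β q) = opβ q := FSL.lift_β _ _ _ _ _ _ _ _
theorem comulEnd_γ : comulEnd q (γ q) = opγ q := FSL.lift_γ _ _ _ _ _ _ _ _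
theorem comulEnd_δ : comulEnd q (δ q) = opδ q := FSL.lift_δ _ _ _ _ _ _ _ _
theorem comulEnd_l (f : Mer) : comulEnd q (l q f) = opL q f := FSL.lift_l _ _ _ _ _ _ _ _ f
theorem comulEnd_r (f : Mer) : comulEnd q (r q f) = opM q f := FSL.lift_r _ _ _ _ _ _ _ _ f

theorem opL_eq_smul (f : Mer) (x : ATens q (FSL q)) : opL q f x = f • x := by
  induction x using ATens.ind with
  | h0 => rw [map_zero, smul_zero]
  | h1 c d => rw [opL_mk, ATens.smul_mk]
  | h2 x y hx hy => rw [map_add, smul_add, hx, hy]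

/-- The coproduct `Δ : A → A ⊗ A`, `Δ x = Δ x (1 ⊗ 1)`. It is the homomorphism given by
`Δ α = α ⊗ α + β ⊗ γ`, `Δ β = α ⊗ β + β ⊗ δ`, `Δ γ = γ ⊗ α + δ ⊗ γ`, `Δ δ = γ ⊗ β + δ ⊗ δ`,
`Δ f(λ) = f(λ) ⊗ 1`, `Δ f(μ) = 1 ⊗ f(μ)`. -/
def comul : FSL q →ₗ[Mer] ATens q (FSL q) where
  toFun a := comulEnd q a (ATens.mk q 1 1)
  map_add' a b := by rw [map_add, LinearMap.add_apply]
  map_smul' f a := by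
    rw [smul_def, map_mul, Module.End.mul_apply, comulEnd_l, RingHom.id_apply, opL_eq_smul]

theorem comul_mul (a b : FSL q) : comul q (a * b) = comulEnd q a (comul q b) := by
  change comulEnd q (a * b) _ = _
  rw [map_mul]; rfl

theorem comul_one : comul q 1 = ATens.mk q 1 1 := by
  change comulEnd q 1 _ = _
  rw [map_one]; rfl

theorem comul_α : comul q (α q) = ATens.mk q (α q) (α q) + ATens.mk q (β q) (γ q) := by
  change comulEnd q _ _ = _
  rw [comulEnd_α, opα_mk]; simp only [mul_one]
theorem comul_γ : comul q (γ q) = ATens.mk q (γ q) (α q) + ATens.mk q (δ q) (γ q) := by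
  change comulEnd q _ _ = _
  rw [comulEnd_γ, opγ_mk]; simp only [mul_one]

end DynSU2

namespace DynSU2
variable (q : Set.Ioo (0 : ℝ) 1)
open FSL

/-! ### The bigrading -/

/-- The monomials of bidegree `(m, n)`: words in `f(λ)`, `f(μ)` (bidegree `(0, 0)`), `α`
(bidegree `(1, 1)`), `β` (bidegree `(1, -1)`), `γ` (bidegree `(-1, 1)`) and `δ`
(bidegree `(-1, -1)`). -/
inductive IsMonomial : ℂ → ℂ → FSL q → Prop
  | one : IsMonomial 0 0 1
  | l (m n : ℂ) (x : FSL q) (f : Mer) : IsMonomial m n x → IsMonomial m n (FSL.l q f * x)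
  | r (m n : ℂ) (x : FSL q) (f : Mer) : IsMonomial m n x → IsMonomial m n (FSL.r q f * x)
  | α (m n : ℂ) (x : FSL q) : IsMonomial m n x → IsMonomial (m + 1) (n + 1) (FSL.α q * x)
  | β (m n : ℂ) (x : FSL q) : IsMonomial m n x → IsMonomial (m + 1) (n - 1) (FSL.β q * x)
  | γ (m n : ℂ) (x : FSL q) : IsMonomial m n x → IsMonomial (m - 1) (n + 1) (FSL.γ q * x)
  | δ (m n : ℂ) (x : FSL q) : IsMonomial m n x → IsMonomial (m - 1) (n - 1) (FSL.δ q * x)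

/-- The component `A_{mn}` of the bigrading of `A`. -/
def gr (m n : ℂ) : Submodule ℂ (FSL q) := Submodule.span ℂ {x | IsMonomial q m n x}

section
variable {q} {m n : ℂ} {a : FSL q}

theorem monomial_r_comm (h : IsMonomial q m n a) (f : Mer) :
    a * r q f = r q (T (-n) f) * a := by
  induction h generalizing f with
  | one => rw [one_mul, mul_one, neg_zero, T_zero]
  | l m n x g hx ih => rw [mul_assoc, ih, ← mul_assoc, l_comm_r, mul_assoc]
  | r m n x g hx ih => rw [mul_assoc, ih, ← mul_assoc, r_comm_r, mul_assoc]
  | α m n x hx ih => rw [mul_assoc, ih, α_r_mul, T_T]; congr 3; ring_nf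
  | β m n x hx ih => rw [mul_assoc, ih, β_r_mul, T_T]; congr 3; ring_nf
  | γ m n x hx ih => rw [mul_assoc, ih, γ_r_mul, T_T]; congr 3; ring_nf
  | δ m n x hx ih => rw [mul_assoc, ih, δ_r_mul, T_T]; congr 3; ring_nf

theorem monomial_l_comm (h : IsMonomial q m n a) (f : Mer) :
    a * l q f = l q (T (-m) f) * a := by
  induction h generalizing f with
  | one => rw [one_mul, mul_one, neg_zero, T_zero]
  | l m n x g hx ih => rw [mul_assoc, ih, ← mul_assoc, l_comm_l, mul_assoc]
  | r m n x g hx ih => rw [mul_assoc, ih, ← mul_assoc, ← l_comm_r, mul_assoc]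
  | α m n x hx ih => rw [mul_assoc, ih, α_l_mul, T_T]; congr 3; ring_nf
  | β m n x hx ih => rw [mul_assoc, ih, β_l_mul, T_T]; congr 3; ring_nf
  | γ m n x hx ih => rw [mul_assoc, ih, γ_l_mul, T_T]; congr 3; ring_nf
  | δ m n x hx ih => rw [mul_assoc, ih, δ_l_mul, T_T]; congr 3; ring_nf

theorem monomial_mul (h : IsMonomial q m n a) {m' n' : ℂ} {b : FSL q}
    (h' : IsMonomial q m' n' b) : IsMonomial q (m + m') (n + n') (a * b) := by
  induction h with
  | one => simpa using h'
  | l m n x g hx ih => rw [mul_assoc]; exact ih.l _ _ _ _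
  | r m n x g hx ih => rw [mul_assoc]; exact ih.r _ _ _ _
  | α m n x hx ih =>
    rw [mul_assoc, add_right_comm, add_right_comm n]; exact ih.α _ _ _
  | β m n x hx ih =>
    rw [mul_assoc, add_right_comm, sub_add_eq_add_sub]; exact ih.β _ _ _
  | γ m n x hx ih =>
    rw [mul_assoc, sub_add_eq_add_sub, add_right_comm n]; exact ih.γ _ _ _
  | δ m n x hx ih =>
    rw [mul_assoc, sub_add_eq_add_sub, sub_add_eq_add_sub]; exact ih.δ _ _ _

theorem gr_r_comm (h : a ∈ gr q m n) (f : Mer) : a * r q f = r q (T (-n) f) * a := by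
  induction h using Submodule.span_induction with
  | mem x hx => exact monomial_r_comm hx f
  | zero => rw [zero_mul, mul_zero]
  | add x y _ _ hx hy => rw [add_mul, hx, hy, mul_add]
  | smul c x _ hx => rw [smul_mul_assoc, hx, mul_smul_comm]

theorem gr_l_comm (h : a ∈ gr q m n) (f : Mer) : a * l q f = l q (T (-m) f) * a := by
  induction h using Submodule.span_induction with
  | mem x hx => exact monomial_l_comm hx f
  | zero => rw [zero_mul, mul_zero]
  | add x y _ _ hx hy => rw [add_mul, hx, hy, mul_add]
  | smul c x _ hx => rw [smul_mul_assoc, hx, mul_smul_comm]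

theorem gr_mul (h : a ∈ gr q m n) {m' n' : ℂ} {b : FSL q} (h' : b ∈ gr q m' n') :
    a * b ∈ gr q (m + m') (n + n') := by
  induction h using Submodule.span_induction with
  | mem x hx =>
    induction h' using Submodule.span_induction with
    | mem y hy => exact Submodule.subset_span (monomial_mul hx hy)
    | zero => rw [mul_zero]; exact zero_mem _
    | add y z _ _ hy hz => rw [mul_add]; exact add_mem hy hz
    | smul c y _ hy => rw [mul_smul_comm]; exact Submodule.smul_mem _ _ hy
  | zero => rw [zero_mul]; exact zero_mem _
  | add x y _ _ hx hy => rw [add_mul]; exact add_mem hx hy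
  | smul c x _ hx => rw [smul_mul_assoc]; exact Submodule.smul_mem _ _ hx

variable (q)
theorem one_mem_gr : (1 : FSL q) ∈ gr q 0 0 := Submodule.subset_span IsMonomial.one
theorem l_mem_gr (f : Mer) : l q f ∈ gr q 0 0 := by
  rw [← mul_one (l q f)]; exact Submodule.subset_span (IsMonomial.one.l _ _ _ f)
theorem r_mem_gr (f : Mer) : r q f ∈ gr q 0 0 := by
  rw [← mul_one (r q f)]; exact Submodule.subset_span (IsMonomial.one.r _ _ _ f)
theorem α_mem_gr : α q ∈ gr q 1 1 := by
  rw [← mul_one (α q)]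
  have h := Submodule.subset_span (R := ℂ) (s := {x | IsMonomial q _ _ x})
    (IsMonomial.one.α _ _ _)
  simpa [gr] using h
theorem β_mem_gr : β q ∈ gr q 1 (-1) := by
  rw [← mul_one (β q)]
  have h := Submodule.subset_span (R := ℂ) (s := {x | IsMonomial q _ _ x})
    (IsMonomial.one.β _ _ _)
  simpa [gr] using h
theorem γ_mem_gr : γ q ∈ gr q (-1) 1 := by
  rw [← mul_one (γ q)]
  have h := Submodule.subset_span (R := ℂ) (s := {x | IsMonomial q _ _ x})
    (IsMonomial.one.γ _ _ _)
  simpa [gr] using h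
theorem δ_mem_gr : δ q ∈ gr q (-1) (-1) := by
  rw [← mul_one (δ q)]
  have h := Submodule.subset_span (R := ℂ) (s := {x | IsMonomial q _ _ x})
    (IsMonomial.one.δ _ _ _)
  simpa [gr] using h
theorem l_mul_mem_gr {m n : ℂ} {a : FSL q} (h : a ∈ gr q m n) (f : Mer) :
    l q f * a ∈ gr q m n := by simpa using gr_mul (l_mem_gr q f) h
theorem r_mul_mem_gr {m n : ℂ} {a : FSL q} (h : a ∈ gr q m n) (f : Mer) :
    r q f * a ∈ gr q m n := by simpa using gr_mul (r_mem_gr q f) h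
end

/-! ### `h`-spaces and corepresentations -/

/-- An `h`-space, for `h = ℂ`: a vector space over the field of meromorphic functions with
a linear endomorphism `h` (the action of `1`) which is diagonalizable with eigenvalues in `ℂ`. -/
class HSpace (V : Type) [AddCommGroup V] [Module Mer V] where
  /-- The action of `1`. -/
  h : V →ₗ[Mer] V
  diag : ⨆ a : ℂ, Module.End.eigenspace h (algebraMap ℂ Mer a) = ⊤

section
variable (V : Type) [AddCommGroup V] [Module Mer V] [HSpace V]

/-- The component `V_a` of an `h`-space. -/
def wt (a : ℂ) : Submodule Mer V := Module.End.eigenspace (HSpace.h (V := V)) (algebraMap ℂ Mer a)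

variable {V}
theorem mem_wt {a : ℂ} {v : V} : v ∈ wt V a ↔ HSpace.h v = algebraMap ℂ Mer a • v :=
  Module.End.mem_eigenspace_iff

variable (V)
theorem iSup_wt : ⨆ a : ℂ, wt V a = ⊤ := HSpace.diag

theorem wt_indep : iSupIndep (wt V) :=
  (Module.End.eigenspaces_iSupIndep (HSpace.h (V := V))).comp (algebraMap ℂ Mer).injective

theorem wt_le (U : ℂ → Submodule Mer V) (hU : ∀ a, U a ≤ wt V a) (htop : ⨆ a, U a = ⊤) (a : ℂ) :
    wt V a ≤ U a := by
  have h1 : (⊤ : Submodule Mer V) ≤ U a ⊔ ⨆ b ≠ a, U b := by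
    rw [← htop]
    refine iSup_le fun b => ?_
    by_cases hb : b = a
    · subst hb; exact le_sup_left
    · exact le_trans (le_iSup₂_of_le b hb le_rfl) le_sup_right
  have h2 : ⨆ b ≠ a, U b ≤ ⨆ b ≠ a, wt V b := iSup₂_mono fun b _ => hU b
  calc wt V a = (U a ⊔ ⨆ b ≠ a, U b) ⊓ wt V a := by rw [top_le_iff.1 h1, top_inf_eq]
    _ = U a ⊔ ((⨆ b ≠ a, U b) ⊓ wt V a) := by rw [sup_inf_assoc_of_le _ (hU a)]
    _ ≤ U a ⊔ ⊥ := by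
      refine sup_le_sup_left ?_ _
      rw [inf_comm]
      exact ((wt_indep V a).mono_right h2).le_bot
    _ = U a := sup_bot_eq _

/-- The component `⨁_b A_{ab} ⊗ V_b` of degree `a` of `A ⊗̃ V = ⨁_{a, b} A_{ab} ⊗ V_b`, as
a subspace of `A ⊗ V`. -/
def gradedPart (a : ℂ) : Submodule Mer (ATens q V) :=
  Submodule.span Mer {x | ∃ (b : ℂ) (c : FSL q) (v : V), c ∈ gr q a b ∧ v ∈ wt V b ∧
    x = ATens.mk q c v}

end

/-- An `h`-space morphism `V → A ⊗̃ V`. -/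
structure Coaction (V : Type) [AddCommGroup V] [Module Mer V] [HSpace V] where
  /-- The map. -/
  toMap : V →ₗ[Mer] ATens q V
  graded : ∀ (a : ℂ), ∀ v ∈ wt V a, toMap v ∈ gradedPart q V a

/-- The counit `ε : A → D_h`, an algebra homomorphism to difference operators,
`ε α = T_{-1}`, `ε β = ε γ = 0`, `ε δ = T_1`, `ε f(λ) = ε f(μ) = f`. -/
def counit : FSL q →ₐ[ℂ] Module.End ℂ Mer :=
  FSL.lift q (T (-1)).toLinearMap 0 0 (T 1).toLinearMap
    (fun f => Algebra.lmul ℂ Mer f) (fun f => Algebra.lmul ℂ Mer f) (by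
    intro x y h
    cases h
    case l_add f g => exact LinearMap.ext fun x => add_mul _ _ _
    case l_mul f g => exact LinearMap.ext fun x => mul_assoc _ _ _
    case l_const c => exact LinearMap.ext fun x => (Algebra.smul_def c x).symm
    case r_add f g => exact LinearMap.ext fun x => add_mul _ _ _
    case r_mul f g => exact LinearMap.ext fun x => mul_assoc _ _ _
    case r_const c => exact LinearMap.ext fun x => (Algebra.smul_def c x).symm
    case l_r f g => exact LinearMap.ext fun x => mul_left_comm _ _ _
    case l_α f =>
      refine LinearMap.ext fun x => ?_
      change f * T (-1) x = T (-1) (T 1 f * x)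
      rw [map_mul, T_T, neg_add_cancel, T_zero]
    case r_α f =>
      refine LinearMap.ext fun x => ?_
      change f * T (-1) x = T (-1) (T 1 f * x)
      rw [map_mul, T_T, neg_add_cancel, T_zero]
    case l_δ f =>
      refine LinearMap.ext fun x => ?_
      change f * T 1 x = T 1 (T (-1) f * x)
      rw [map_mul, T_T, add_neg_cancel, T_zero]
    case r_δ f =>
      refine LinearMap.ext fun x => ?_
      change f * T 1 x = T 1 (T (-1) f * x)
      rw [map_mul, T_T, add_neg_cancel, T_zero]
    case αδ =>
      refine LinearMap.ext fun x => ?_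
      change T (-1) (T 1 x) - T 1 (T (-1) x) = _
      rw [T_T, T_T, neg_add_cancel, add_neg_cancel, sub_self, zero_mul, mul_zero]; rfl
    case βγ =>
      simp only [sub_self, mul_zero, zero_mul]
    case det =>
      refine LinearMap.ext fun x => ?_
      rw [mul_zero, mul_zero, sub_zero]
      change T (-1) (T 1 x) = x
      rw [T_T, neg_add_cancel, T_zero]
    all_goals simp only [mul_zero, zero_mul])

end DynSU2

namespace DynSU2
variable (q : Set.Ioo (0 : ℝ) 1)
open FSL

theorem counit_r (f : Mer) (a : FSL q) : counit q (r q f * a) 1 = f * counit q a 1 := by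
  rw [map_mul, counit, FSL.lift_r]; rfl

section
variable (V : Type) [AddCommGroup V] [Module Mer V]

/-- The map `ε ⊗ id : A ⊗ V → V`, `a ⊗ v ↦ (ε(a) 1) v`. -/
def counitMap : ATens q V →+ V :=
  ATens.lift (fun a v => (counit q a 1) • v)
    (fun a b v => by rw [map_add, LinearMap.add_apply, add_smul])
    (fun a v w => smul_add _ _ _)
    (fun f a v => by rw [counit_r, mul_comm, mul_smul])

variable {V}
/-- The map `b ↦ b ⊗ v`. -/
def insertMap (v : V) : FSL q →ₗ[Mer] ATens q V where
  toFun b := ATens.mk q b v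
  map_add' a b := ATens.add_mk a b v
  map_smul' _ _ := rfl

variable (V)
/-- The map `Δ ⊗ id : A ⊗ V → A ⊗ (A ⊗ V)`. -/
def comulMap : ATens q V →+ ATens q (ATens q V) :=
  ATens.lift (fun a v => ATens.map q (insertMap q v) (comul q a))
    (fun a b v => by rw [map_add, map_add])
    (fun a v w => by
      generalize comul q a = x
      induction x using ATens.ind with
      | h0 => rw [map_zero, map_zero, map_zero, add_zero]
      | h1 b c =>
        rw [ATens.map_mk, ATens.map_mk, ATens.map_mk, ← ATens.mk_add]
        congr 1
        exact ATens.mk_add c v w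
      | h2 x y hx hy => rw [map_add, map_add, map_add, hx, hy]; abel)
    (fun f a v => by
      rw [comul_mul, comulEnd_r]
      generalize comul q a = x
      induction x using ATens.ind with
      | h0 => rw [map_zero, map_zero, map_zero]
      | h1 b c =>
        rw [opM_mk, ATens.map_mk, ATens.map_mk]
        congr 1
        exact ATens.r_mk f c v
      | h2 x y hx hy => rw [map_add, map_add, map_add, hx, hy])

variable {V} [HSpace V]
/-- `π` is a corepresentation: `(Δ ⊗ id) π = (id ⊗ π) π` and `(ε ⊗ id) π = id`. -/
def Coaction.IsCorepresentation (π : Coaction q V) : Prop :=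
  (∀ v, comulMap q V (π.toMap v) = ATens.map q π.toMap (π.toMap v)) ∧
    ∀ v, counitMap q V (π.toMap v) = v

/-- An intertwiner: a grade-preserving linear map that commutes with the coactions. -/
def IsIntertwiner {W : Type} [AddCommGroup W] [Module Mer W] [HSpace W]
    (πV : Coaction q V) (πW : Coaction q W) (φ : V →ₗ[Mer] W) : Prop :=
  (∀ v, φ (HSpace.h v) = HSpace.h (φ v)) ∧
    ∀ v, πW.toMap (φ v) = ATens.map q φ (πV.toMap v)
end

/-! ### The corepresentations `V_N` -/

/-- The element `γ^{N-k} α^k`. -/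
def vec (N k : ℕ) : FSL q := γ q ^ (N - k) * α q ^ k

/-- The span of `γ^{N-k} α^k`, `0 ≤ k ≤ N`, over the functions of `λ`. -/
def VN (N : ℕ) : Submodule Mer (FSL q) := Submodule.span Mer {x | ∃ k ≤ N, x = vec q N k}

theorem vec_mem (N k : ℕ) (h : k ≤ N) : vec q N k ∈ VN q N := Submodule.subset_span ⟨k, h, rfl⟩

/-- The commutator with `λ`, that is multiplication by `a` on `A_{ab}`. -/
def hEnd : FSL q →ₗ[Mer] FSL q where
  toFun a := l q coord * a - a * l q coord
  map_add' a b := by rw [mul_add, add_mul]; abel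
  map_smul' f a := by
    rw [smul_def, RingHom.id_apply, smul_def, mul_sub, ← mul_assoc, l_comm_l]
    simp only [mul_assoc]

theorem hEnd_gr {m n : ℂ} {a : FSL q} (h : a ∈ gr q m n) : hEnd q a = algebraMap ℂ Mer m • a := by
  change l q coord * a - a * l q coord = _
  rw [gr_l_comm h, T_coord, smul_def, map_add, add_mul, map_neg, map_neg, neg_mul]
  abel

variable {q} in
theorem gr_congr {m n m' n' : ℂ} {a : FSL q} (h : a ∈ gr q m n) (h1 : m = m') (h2 : n = n') :
    a ∈ gr q m' n' := by rwa [← h1, ← h2]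

theorem pow_mem_gr {m n : ℂ} {a : FSL q} (h : a ∈ gr q m n) (k : ℕ) : a ^ k ∈ gr q (k * m) (k * n) := by
  induction k with
  | zero => simpa using one_mem_gr q
  | succ k ih =>
    rw [pow_succ]
    have := gr_mul ih h
    push_cast
    rwa [add_one_mul, add_one_mul]

theorem vec_mem_gr {N k : ℕ} (h : k ≤ N) : vec q N k ∈ gr q (2 * k - N) N := by
  have := gr_mul (pow_mem_gr q (γ_mem_gr q) (N - k)) (pow_mem_gr q (α_mem_gr q) k)
  rw [Nat.cast_sub h] at this
  exact gr_congr this (by ring) (by ring)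

theorem hEnd_mem (N : ℕ) (x : FSL q) (hx : x ∈ VN q N) : hEnd q x ∈ VN q N := by
  induction hx using Submodule.span_induction with
  | mem x hx =>
    obtain ⟨k, hk, rfl⟩ := hx
    rw [hEnd_gr q (vec_mem_gr q hk)]
    exact Submodule.smul_mem _ _ (vec_mem q N k hk)
  | zero => rw [map_zero]; exact zero_mem _
  | add x y _ _ hx hy => rw [map_add]; exact add_mem hx hy
  | smul c x _ hx => rw [map_smul]; exact Submodule.smul_mem _ _ hx

/-- The vector `γ^{N-k} α^k` of `V_N`, and zero if `k > N`. -/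
def VN.v (N k : ℕ) : VN q N := if h : k ≤ N then ⟨vec q N k, vec_mem q N k h⟩ else 0

variable {q} in
theorem VN.v_coe {N k : ℕ} (h : k ≤ N) : (VN.v q N k : FSL q) = vec q N k := by
  rw [VN.v, dif_pos h]

theorem VN.span_v (N : ℕ) : Submodule.span Mer {x | ∃ k ≤ N, x = VN.v q N k} = ⊤ := by
  rw [eq_top_iff]
  rintro ⟨x, hx⟩ -
  induction hx using Submodule.span_induction with
  | mem x hx =>
    obtain ⟨k, hk, rfl⟩ := hx
    refine Submodule.subset_span ⟨k, hk, ?_⟩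
    exact Subtype.ext (VN.v_coe hk).symm
  | zero => exact zero_mem _
  | add x y hx hy hx' hy' => exact add_mem hx' hy'
  | smul c x hx hx' => exact Submodule.smul_mem _ c hx'

/-- `V_N` is an `h`-space, with the grading of `A` by the left degree. -/
instance (N : ℕ) : HSpace (VN q N) where
  h := (hEnd q).restrict (hEnd_mem q N)
  diag := by
    rw [eq_top_iff, ← VN.span_v, Submodule.span_le]
    rintro x ⟨k, hk, rfl⟩
    refine Submodule.mem_iSup_of_mem (2 * k - N : ℂ) ?_
    rw [Module.End.mem_eigenspace_iff]
    apply Subtype.ext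
    rw [LinearMap.coe_restrict_apply, Submodule.coe_smul, VN.v_coe hk]
    exact hEnd_gr q (vec_mem_gr q hk)

theorem VN.v_mem_wt {N k : ℕ} (hk : k ≤ N) : VN.v q N k ∈ wt (VN q N) (2 * k - N) := by
  rw [mem_wt]
  apply Subtype.ext
  change hEnd q (VN.v q N k : FSL q) = _
  rw [Submodule.coe_smul, VN.v_coe hk]
  exact hEnd_gr q (vec_mem_gr q hk)

/-- Auxiliary subspace of `A ⊗ A`. -/
def UN (N : ℕ) (m : ℂ) : Submodule ℂ (ATens q (FSL q)) :=
  Submodule.span ℂ {x | ∃ j ≤ N, ∃ a ∈ gr q m (2 * j - N), x = ATens.mk q a (vec q N j)}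

theorem exists_αγ (i : ℕ) : ∃ f : Mer, α q * γ q ^ i = l q f * (γ q ^ i * α q) := by
  induction i with
  | zero => exact ⟨1, by simp⟩
  | succ i ih =>
    obtain ⟨f, hf⟩ := ih
    refine ⟨f * T i (qpow q 0 1 * F q), ?_⟩
    have h := gr_l_comm (pow_mem_gr q (γ_mem_gr q) i) (qpow q 0 1 * F q)
    have h2 : (-((i : ℂ) * -1)) = i := by ring
    rw [h2] at h
    calc α q * γ q ^ (i + 1) = α q * γ q ^ i * γ q := by rw [pow_succ, mul_assoc]
      _ = l q f * γ q ^ i * (α q * γ q) := by rw [hf]; simp only [mul_assoc]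
      _ = l q f * (γ q ^ i * l q (qpow q 0 1 * F q)) * (γ q * α q) := by
        rw [rel q Relation.αγ]; simp only [mul_assoc]
      _ = _ := by rw [h, map_mul (l q) f, pow_succ]; simp only [mul_assoc]

theorem γ_vec {N j : ℕ} (h : j ≤ N) : γ q * vec q N j = vec q (N + 1) j := by
  rw [vec, vec, Nat.succ_sub h, pow_succ', mul_assoc]

theorem α_vec {N j : ℕ} : ∃ f, α q * vec q N j = l q f * vec q (N + 1) (j + 1) := by
  obtain ⟨f, hf⟩ := exists_αγ q (N - j)
  refine ⟨f, ?_⟩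
  rw [vec, vec, ← mul_assoc, hf, Nat.add_sub_add_right, pow_succ']
  simp only [mul_assoc]

theorem mk_mem_UN {N j : ℕ} (hj : j ≤ N) {m : ℂ} {a : FSL q} (ha : a ∈ gr q m (2 * j - N)) :
    ATens.mk q a (vec q N j) ∈ UN q N m := Submodule.subset_span ⟨j, hj, a, ha, rfl⟩

theorem mk_α_mem_UN {N j : ℕ} (hj : j ≤ N) {m : ℂ} {a : FSL q}
    (ha : a ∈ gr q m (2 * j - N + 1)) :
    ATens.mk q a (α q * vec q N j) ∈ UN q (N + 1) m := by
  obtain ⟨f, hf⟩ := α_vec q (N := N) (j := j)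
  rw [hf, ← smul_def, ← ATens.r_mk]
  refine mk_mem_UN q (by omega) (r_mul_mem_gr q ?_ f)
  exact gr_congr ha rfl (by push_cast; ring)

theorem mk_γ_mem_UN {N j : ℕ} (hj : j ≤ N) {m : ℂ} {a : FSL q}
    (ha : a ∈ gr q m (2 * j - N - 1)) :
    ATens.mk q a (γ q * vec q N j) ∈ UN q (N + 1) m := by
  rw [γ_vec q hj]
  refine mk_mem_UN q (by omega) ?_
  exact gr_congr ha rfl (by push_cast; ring)

theorem opα_UN (N : ℕ) (m : ℂ) (x : ATens q (FSL q)) (hx : x ∈ UN q N m) :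
    opα q x ∈ UN q (N + 1) (m + 1) := by
  induction hx using Submodule.span_induction with
  | mem x hx =>
    obtain ⟨j, hj, a, ha, rfl⟩ := hx
    rw [opα_mk]
    refine add_mem (mk_α_mem_UN q hj ?_) (mk_γ_mem_UN q hj ?_)
    · exact gr_congr (gr_mul (α_mem_gr q) ha) (by ring) (by ring)
    · exact gr_congr (gr_mul (β_mem_gr q) ha) (by ring) (by ring)
  | zero => rw [map_zero]; exact zero_mem _
  | add x y _ _ hx hy => rw [map_add]; exact add_mem hx hy
  | smul c x _ hx => rw [map_smul]; exact Submodule.smul_mem _ _ hx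

theorem opγ_UN (N : ℕ) (m : ℂ) (x : ATens q (FSL q)) (hx : x ∈ UN q N m) :
    opγ q x ∈ UN q (N + 1) (m - 1) := by
  induction hx using Submodule.span_induction with
  | mem x hx =>
    obtain ⟨j, hj, a, ha, rfl⟩ := hx
    rw [opγ_mk]
    refine add_mem (mk_α_mem_UN q hj ?_) (mk_γ_mem_UN q hj ?_)
    · exact gr_congr (gr_mul (γ_mem_gr q) ha) (by ring) (by ring)
    · exact gr_congr (gr_mul (δ_mem_gr q) ha) (by ring) (by ring)
  | zero => rw [map_zero]; exact zero_mem _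
  | add x y _ _ hx hy => rw [map_add]; exact add_mem hx hy
  | smul c x _ hx => rw [map_smul]; exact Submodule.smul_mem _ _ hx

theorem comul_α_pow (k : ℕ) : comul q (α q ^ k) ∈ UN q k k := by
  induction k with
  | zero =>
    rw [pow_zero, comul_one, Nat.cast_zero]
    have h : vec q 0 0 = 1 := by simp [vec]
    have := mk_mem_UN q (le_refl 0) (m := 0) (a := 1) (gr_congr (one_mem_gr q) rfl (by simp))
    rwa [h] at this
  | succ k ih =>
    rw [pow_succ', comul_mul, comulEnd_α]
    exact_mod_cast opα_UN q k k _ ih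

theorem comul_γ_α_pow (i k : ℕ) : comul q (γ q ^ i * α q ^ k) ∈ UN q (k + i) (k - i) := by
  induction i with
  | zero => simpa using comul_α_pow q k
  | succ i ih =>
    rw [pow_succ', mul_assoc, comul_mul, comulEnd_γ]
    have := opγ_UN q _ _ _ ih
    push_cast
    rwa [← sub_sub]

theorem comul_vec {N k : ℕ} (h : k ≤ N) : comul q (vec q N k) ∈ UN q N (2 * k - N) := by
  have := comul_γ_α_pow q (N - k) k
  rw [Nat.add_sub_cancel' h, Nat.cast_sub h] at this
  rw [show (2 * k - N : ℂ) = k - (N - k) by ring]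
  exact this

/-- `A ⊗ V_N → A ⊗ A` -/
def inclN (N : ℕ) : ATens q (VN q N) →ₗ[Mer] ATens q (FSL q) := ATens.map q (VN q N).subtype

theorem inclN_injective (N : ℕ) : Function.Injective (inclN q N) :=
  ATens.map_injective _ (VN q N).injective_subtype

theorem UN_le {N : ℕ} {m : ℂ} {x : ATens q (FSL q)} (hx : x ∈ UN q N m) :
    ∃ y ∈ gradedPart q (VN q N) m, inclN q N y = x := by
  induction hx using Submodule.span_induction with
  | mem x hx =>
    obtain ⟨j, hj, a, ha, rfl⟩ := hx
    refine ⟨ATens.mk q a (VN.v q N j), Submodule.subset_span ⟨_, a, _, ha, VN.v_mem_wt q hj, rfl⟩, ?_⟩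
    rw [inclN, ATens.map_mk, Submodule.subtype_apply, VN.v_coe hj]
  | zero => exact ⟨0, zero_mem _, map_zero _⟩
  | add x y _ _ hx hy =>
    obtain ⟨x', hx, rfl⟩ := hx
    obtain ⟨y', hy, rfl⟩ := hy
    exact ⟨x' + y', add_mem hx hy, map_add _ _ _⟩
  | smul c x _ hx =>
    obtain ⟨x', hx, rfl⟩ := hx
    exact ⟨algebraMap ℂ Mer c • x', Submodule.smul_mem _ _ hx, map_smul _ _ _⟩

theorem comul_mem (N : ℕ) (x : VN q N) : comul q (x : FSL q) ∈ LinearMap.range (inclN q N) := by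
  obtain ⟨x, hx⟩ := x
  induction hx using Submodule.span_induction with
  | mem x hx =>
    obtain ⟨k, hk, rfl⟩ := hx
    obtain ⟨y, -, hy⟩ := UN_le q (comul_vec q hk)
    exact ⟨y, hy⟩
  | zero => rw [map_zero]; exact zero_mem _
  | add x y _ _ hx hy => rw [map_add]; exact add_mem hx hy
  | smul c x _ hx => rw [map_smul]; exact Submodule.smul_mem _ _ hx

/-- The restriction of the coproduct, as a linear map `V_N → A ⊗ V_N`. -/
def coVNMap (N : ℕ) : VN q N →ₗ[Mer] ATens q (VN q N) :=
  (LinearEquiv.ofInjective (inclN q N) (inclN_injective q N)).symm.toLinearMap.comp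
    (((comul q).comp (VN q N).subtype).codRestrict (LinearMap.range (inclN q N)) (comul_mem q N))

theorem inclN_coVNMap (N : ℕ) (x : VN q N) : inclN q N (coVNMap q N x) = comul q (x : FSL q) := by
  have := LinearEquiv.apply_symm_apply (LinearEquiv.ofInjective (inclN q N) (inclN_injective q N))
    ⟨comul q (x : FSL q), comul_mem q N x⟩
  exact congrArg Subtype.val this

theorem coVNMap_v {N k : ℕ} (hk : k ≤ N) :
    coVNMap q N (VN.v q N k) ∈ gradedPart q (VN q N) (2 * k - N) := by
  obtain ⟨y, hy, hy'⟩ := UN_le q (comul_vec q hk)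
  have : coVNMap q N (VN.v q N k) = y := by
    apply inclN_injective
    rw [inclN_coVNMap, hy', VN.v_coe hk]
  rwa [this]

theorem graded_of_span {V : Type} [AddCommGroup V] [Module Mer V] [HSpace V]
    (φ : V →ₗ[Mer] ATens q V) (s : Set V) (hs : Submodule.span Mer s = ⊤)
    (h : ∀ v ∈ s, ∃ a, v ∈ wt V a ∧ φ v ∈ gradedPart q V a) (a : ℂ) (v : V) (hv : v ∈ wt V a) :
    φ v ∈ gradedPart q V a := by
  have := wt_le V (fun a => wt V a ⊓ (gradedPart q V a).comap φ) (fun a => inf_le_left) (by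
    rw [eq_top_iff, ← hs, Submodule.span_le]
    intro v hv
    obtain ⟨a, h1, h2⟩ := h v hv
    exact Submodule.mem_iSup_of_mem a ⟨h1, h2⟩) a hv
  exact this.2

/-- The coaction of `A` on `V_N`, the restriction of the coproduct. -/
def coVN (N : ℕ) : Coaction q (VN q N) where
  toMap := coVNMap q N
  graded := graded_of_span q _ _ (VN.span_v q N) (by
    rintro v ⟨k, hk, rfl⟩
    exact ⟨_, VN.v_mem_wt q hk, coVNMap_v q hk⟩)

end DynSU2

namespace DynSU2
variable (q : Set.Ioo (0 : ℝ) 1)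
open FSL

/-! ### Tensor products of corepresentations -/

section tens
variable (V W : Type) [AddCommGroup V] [Module Mer V] [HSpace V] [AddCommGroup W] [Module Mer W]

/-- The relations `f v ⊗ w = v ⊗ (T_a f) w` for `v ∈ V_a`. -/
def tensRel : Submodule Mer (V ⊗[ℤ] W) :=
  Submodule.span Mer {x | ∃ (a : ℂ) (v : V) (w : W) (f : Mer), v ∈ wt V a ∧
    x = (f • v) ⊗ₜ[ℤ] w - v ⊗ₜ[ℤ] (T a f • w)}

/-- The tensor product `V ⊗̂ W`, with the scalars acting on the left factor. (The relations
include that of a complex tensor product, since `T_a` fixes the constants.) -/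
def Tens : Type := (V ⊗[ℤ] W) ⧸ tensRel V W

instance : AddCommGroup (Tens V W) := inferInstanceAs (AddCommGroup ((V ⊗[ℤ] W) ⧸ tensRel V W))
instance : Module Mer (Tens V W) := inferInstanceAs (Module Mer ((V ⊗[ℤ] W) ⧸ tensRel V W))

namespace Tens
variable {V W}

/-- The element `v ⊗ w`. -/
def mk (v : V) (w : W) : Tens V W := Submodule.Quotient.mk (v ⊗ₜ[ℤ] w)

theorem add_mk (v v' : V) (w : W) : mk (v + v') w = mk v w + mk v' w :=
  congrArg (Submodule.Quotient.mk (p := tensRel V W)) (TensorProduct.add_tmul (R := ℤ) v v' w)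
theorem mk_add (v : V) (w w' : W) : mk v (w + w') = mk v w + mk v w' :=
  congrArg (Submodule.Quotient.mk (p := tensRel V W)) (TensorProduct.tmul_add (R := ℤ) v w w')
theorem smul_mk (f : Mer) (v : V) (w : W) : f • mk v w = mk (f • v) w := rfl
theorem zero_mk (w : W) : mk (0 : V) w = 0 :=
  congrArg (Submodule.Quotient.mk (p := tensRel V W)) (TensorProduct.zero_tmul (R := ℤ) V w)
theorem mk_zero (v : V) : mk v (0 : W) = 0 :=
  congrArg (Submodule.Quotient.mk (p := tensRel V W)) (TensorProduct.tmul_zero (R := ℤ) W v)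

theorem mk_rel {a : ℂ} {v : V} (hv : v ∈ wt V a) (w : W) (f : Mer) :
    mk (f • v) w = mk v (T a f • w) :=
  (Submodule.Quotient.eq (tensRel V W)).2 (Submodule.subset_span ⟨a, v, w, f, hv, rfl⟩)

theorem ind {p : Tens V W → Prop} (h0 : p 0) (h1 : ∀ v w, p (mk v w))
    (h2 : ∀ x y, p x → p y → p (x + y)) (x : Tens V W) : p x := by
  obtain ⟨x, rfl⟩ := Submodule.Quotient.mk_surjective (tensRel V W) x
  induction x using TensorProduct.induction_on with
  | zero => exact h0
  | tmul v w => exact h1 v w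
  | add x y hx hy => exact h2 _ _ hx hy

variable {P : Type} [AddCommGroup P] [Module Mer P]

/-- Linear maps out of the tensor product, before passing to the quotient. -/
def preLift (φ : V →+ W →+ P) (hs : ∀ (f : Mer) v w, φ (f • v) w = f • φ v w) :
    V ⊗[ℤ] W →ₗ[Mer] P where
  toFun := TensorProduct.liftAddHom (R := ℤ) φ
    (fun n v w => by rw [map_zsmul, map_zsmul, AddMonoidHom.smul_apply])
  map_add' := map_add _
  map_smul' f x := by
    induction x using TensorProduct.induction_on with
    | zero => rw [smul_zero, map_zero, smul_zero]
    | tmul v w => exact hs f v w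
    | add x y hx hy => rw [smul_add, map_add, hx, hy, map_add, smul_add]

/-- Linear maps out of the tensor product. -/
def lift (φ : V →+ W →+ P) (hs : ∀ (f : Mer) v w, φ (f • v) w = f • φ v w)
    (h : ∀ (a : ℂ) (v : V) (w : W) (f : Mer), v ∈ wt V a → φ (f • v) w = φ v (T a f • w)) :
    Tens V W →ₗ[Mer] P :=
  (tensRel V W).liftQ (preLift φ hs) (by
    rw [tensRel, Submodule.span_le]
    rintro x ⟨a, v, w, f, hv, rfl⟩
    change preLift φ hs _ = 0
    rw [map_sub, sub_eq_zero]
    exact h a v w f hv)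

theorem lift_mk (φ : V →+ W →+ P) (hs : ∀ (f : Mer) v w, φ (f • v) w = f • φ v w)
    (h : ∀ (a : ℂ) (v : V) (w : W) (f : Mer), v ∈ wt V a → φ (f • v) w = φ v (T a f • w))
    (v : V) (w : W) : lift φ hs h (mk v w) = φ v w := rfl

variable [HSpace W]

variable (V W) in
/-- The endomorphism `h ⊗ id + id ⊗ h`. -/
def hTens : Tens V W →ₗ[Mer] Tens V W :=
  lift (AddMonoidHom.mk' (fun v => AddMonoidHom.mk'
      (fun w => mk (HSpace.h v) w + mk v (HSpace.h w))
      (fun w w' => by rw [map_add, mk_add, mk_add]; abel))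
      (fun v v' => AddMonoidHom.ext fun w => by
        change mk (HSpace.h (v + v')) w + mk (v + v') (HSpace.h w) =
          (mk (HSpace.h v) w + mk v (HSpace.h w)) + (mk (HSpace.h v') w + mk v' (HSpace.h w))
        rw [map_add, add_mk, add_mk]; abel))
    (fun f v w => by
      change mk (HSpace.h (f • v)) w + mk (f • v) (HSpace.h w) =
        f • (mk (HSpace.h v) w + mk v (HSpace.h w))
      rw [map_smul, smul_add, smul_mk, smul_mk])
    (fun a v w f hv => by
      change mk (HSpace.h (f • v)) w + mk (f • v) (HSpace.h w) =
        mk (HSpace.h v) (T a f • w) + mk v (HSpace.h (T a f • w))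
      have hv' : HSpace.h v ∈ wt V a := by
        rw [mem_wt.1 hv]; exact Submodule.smul_mem _ _ hv
      rw [map_smul, map_smul, mk_rel hv, mk_rel hv'])

theorem hTens_mk (v : V) (w : W) :
    hTens V W (mk v w) = mk (HSpace.h v) w + mk v (HSpace.h w) := rfl

theorem hTens_wt {a b : ℂ} {v : V} {w : W} (hv : v ∈ wt V a) (hw : w ∈ wt W b) :
    hTens V W (mk v w) = algebraMap ℂ Mer (a + b) • mk v w := by
  have h := mk_rel hv w (algebraMap ℂ Mer b)
  rw [AlgHom.commutes] at h
  rw [hTens_mk, mem_wt.1 hv, mem_wt.1 hw, map_add, add_smul, smul_mk, smul_mk, h]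

theorem span_mk : Submodule.span Mer {x : Tens V W | ∃ a b, ∃ v ∈ wt V a, ∃ w ∈ wt W b,
    x = mk v w} = ⊤ := by
  rw [eq_top_iff]
  rintro x -
  induction x using ind with
  | h0 => exact zero_mem _
  | h1 v w =>
    have hv : v ∈ ⨆ a, wt V a := by rw [iSup_wt]; trivial
    have hw : w ∈ ⨆ a, wt W a := by rw [iSup_wt]; trivial
    induction hv using Submodule.iSup_induction' with
    | mem a v hv =>
      induction hw using Submodule.iSup_induction' with
      | mem b w hw => exact Submodule.subset_span ⟨a, b, v, hv, w, hw, rfl⟩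
      | zero => rw [mk_zero]; exact zero_mem _
      | add w w' _ _ h h' => rw [mk_add]; exact add_mem h h'
    | zero => rw [zero_mk]; exact zero_mem _
    | add v v' _ _ h h' => rw [add_mk]; exact add_mem h h'
  | h2 x y hx hy => exact add_mem hx hy

end Tens

variable [HSpace W]

/-- The grading `V_a ⊗̂ W_b ⊆ (V ⊗̂ W)_{a+b}`. -/
instance : HSpace (Tens V W) where
  h := Tens.hTens V W
  diag := by
    rw [eq_top_iff, ← Tens.span_mk, Submodule.span_le]
    rintro x ⟨a, b, v, hv, w, hw, rfl⟩
    refine Submodule.mem_iSup_of_mem (a + b) ?_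
    rw [Module.End.mem_eigenspace_iff]
    exact Tens.hTens_wt hv hw

variable {V W}
theorem Tens.mk_mem_wt {a b : ℂ} {v : V} {w : W} (hv : v ∈ wt V a) (hw : w ∈ wt W b) :
    Tens.mk v w ∈ wt (Tens V W) (a + b) := by
  rw [mem_wt]
  exact Tens.hTens_wt hv hw

/-- The map `a ⊗ v ↦ a b ⊗ (v ⊗ w)` for given `b` and `w`. -/
def sigmaAux (b : FSL q) (w : W) : ATens q V →+ ATens q (Tens V W) :=
  ATens.lift (fun a v => ATens.mk q (a * b) (Tens.mk v w))
    (fun a a' v => by rw [add_mul, ATens.add_mk])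
    (fun a v v' => by rw [Tens.add_mk, ATens.mk_add])
    (fun f a v => by rw [mul_assoc, ATens.r_mk, Tens.smul_mk])

theorem sigmaAux_mk (b : FSL q) (w : W) (a : FSL q) (v : V) :
    sigmaAux q b w (ATens.mk q a v) = ATens.mk q (a * b) (Tens.mk v w) := rfl

theorem sigmaAux_add_left (b b' : FSL q) (w : W) :
    sigmaAux q (V := V) (b + b') w = sigmaAux q b w + sigmaAux q b' w :=
  ATens.hom_ext fun a v => by
    rw [AddMonoidHom.add_apply, sigmaAux_mk, sigmaAux_mk, sigmaAux_mk, mul_add, ATens.add_mk]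

theorem sigmaAux_add_right (b : FSL q) (w w' : W) :
    sigmaAux q (V := V) b (w + w') = sigmaAux q b w + sigmaAux q b w' :=
  ATens.hom_ext fun a v => by
    rw [AddMonoidHom.add_apply, sigmaAux_mk, sigmaAux_mk, sigmaAux_mk, Tens.mk_add, ATens.mk_add]

theorem sigmaAux_smul (b : FSL q) (w : W) (f : Mer) (x : ATens q V) :
    sigmaAux q b w (f • x) = f • sigmaAux q b w x := by
  induction x using ATens.ind with
  | h0 => rw [smul_zero, map_zero, smul_zero]
  | h1 a v => rw [ATens.smul_mk, sigmaAux_mk, sigmaAux_mk, ATens.smul_mk, mul_assoc]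
  | h2 x y hx hy => rw [smul_add, map_add, hx, hy, map_add, smul_add]

variable (V) in
/-- The space `A ⊗̃ V`, as a subspace of `A ⊗ V`. -/
def matched : Submodule Mer (ATens q V) := ⨆ a, gradedPart q V a

theorem sigmaAux_balanced (x : ATens q V) (hx : x ∈ matched q V) (f : Mer) (b : FSL q) (w : W) :
    sigmaAux q (r q f * b) w x = sigmaAux q b (f • w) x := by
  induction hx using Submodule.iSup_induction' with
  | zero => rw [map_zero, map_zero]
  | add x y _ _ hx hy => rw [map_add, map_add, hx, hy]
  | mem m x hx =>
    induction hx using Submodule.span_induction with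
    | zero => rw [map_zero, map_zero]
    | add x y _ _ hx hy => rw [map_add, map_add, hx, hy]
    | smul g x _ hx => rw [sigmaAux_smul, sigmaAux_smul, hx]
    | mem x hx =>
      obtain ⟨n, a, v, ha, hv, rfl⟩ := hx
      have h := Tens.mk_rel hv w (T (-n) f)
      rw [T_T, add_neg_cancel, T_zero] at h
      rw [sigmaAux_mk, sigmaAux_mk, ← mul_assoc, gr_r_comm ha, mul_assoc, ATens.r_mk,
        Tens.smul_mk, h]

/-- The map `(m ⊗ id) σ₂₃`, that is `(a ⊗ v, b ⊗ w) ↦ a b ⊗ (v ⊗ w)`, for a given first argument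
in `A ⊗̃ V`. -/
def sigma (x : ATens q V) (hx : x ∈ matched q V) : ATens q W →+ ATens q (Tens V W) :=
  ATens.lift (fun b w => sigmaAux q b w x)
    (fun b b' w => by rw [sigmaAux_add_left, AddMonoidHom.add_apply])
    (fun b w w' => by rw [sigmaAux_add_right, AddMonoidHom.add_apply])
    (fun f b w => sigmaAux_balanced q x hx f b w)

theorem sigma_mk (x : ATens q V) (hx : x ∈ matched q V) (b : FSL q) (w : W) :
    sigma q x hx (ATens.mk q b w) = sigmaAux q b w x := rfl

theorem Coaction.mem_matched (π : Coaction q V) (v : V) : π.toMap v ∈ matched q V := by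
  have hv : v ∈ ⨆ a, wt V a := by rw [iSup_wt]; trivial
  induction hv using Submodule.iSup_induction' with
  | mem a v hv => exact Submodule.mem_iSup_of_mem a (π.graded a v hv)
  | zero => rw [map_zero]; exact zero_mem _
  | add v v' _ _ h h' => rw [map_add]; exact add_mem h h'

theorem sigma_add (x y : ATens q V) (hx hy hxy) (z : ATens q W) :
    sigma q (x + y) hxy z = sigma q x hx z + sigma q y hy z := by
  induction z using ATens.ind with
  | h0 => rw [map_zero, map_zero, map_zero, add_zero]
  | h1 b w => rw [sigma_mk, sigma_mk, sigma_mk, map_add]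
  | h2 x y hx hy => rw [map_add, map_add, map_add, hx, hy]; abel

theorem sigma_smul (f : Mer) (x : ATens q V) (hx hfx) (z : ATens q W) :
    sigma q (f • x) hfx z = f • sigma q x hx z := by
  induction z using ATens.ind with
  | h0 => rw [map_zero, map_zero, smul_zero]
  | h1 b w => rw [sigma_mk, sigma_mk, sigmaAux_smul]
  | h2 x y hx hy => rw [map_add, map_add, smul_add, hx, hy]

theorem sigmaAux_l (a : ℂ) (f : Mer) (b : FSL q) (w : W) (x : ATens q V)
    (hx : x ∈ gradedPart q V a) :
    sigmaAux q (l q (T a f) * b) w x = f • sigmaAux q b w x := by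
  induction hx using Submodule.span_induction with
  | zero => rw [map_zero, map_zero, smul_zero]
  | add x y _ _ hx hy => rw [map_add, map_add, smul_add, hx, hy]
  | smul g x _ hx => rw [sigmaAux_smul, sigmaAux_smul, hx, smul_comm]
  | mem x hx =>
    obtain ⟨n, c, v, hc, hv, rfl⟩ := hx
    rw [sigmaAux_mk, sigmaAux_mk, ATens.smul_mk, ← mul_assoc, gr_l_comm hc, T_T, neg_add_cancel,
      T_zero, mul_assoc]

theorem sigma_l (a : ℂ) (f : Mer) (x : ATens q V) (hx) (hxa : x ∈ gradedPart q V a)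
    (z : ATens q W) : sigma q x hx (T a f • z) = f • sigma q x hx z := by
  induction z using ATens.ind with
  | h0 => rw [smul_zero, map_zero, smul_zero]
  | h1 b w => rw [ATens.smul_mk, sigma_mk, sigma_mk, sigmaAux_l q a f b w x hxa]
  | h2 x y hx hy => rw [smul_add, map_add, map_add, smul_add, hx, hy]

theorem sigma_congr {x y : ATens q V} (h : x = y) (hx hy) (z : ATens q W) :
    sigma q x hx z = sigma q y hy z := by
  subst h; rfl

/-- The linear map `V ⊗̂ W → A ⊗ (V ⊗̂ W)`. -/
def coTensMap (πV : Coaction q V) (πW : Coaction q W) :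
    Tens V W →ₗ[Mer] ATens q (Tens V W) :=
  Tens.lift (AddMonoidHom.mk' (fun v => AddMonoidHom.mk'
      (fun w => sigma q (πV.toMap v) (πV.mem_matched q v) (πW.toMap w))
      (fun w w' => by rw [map_add, map_add]))
      (fun v v' => AddMonoidHom.ext fun w => by
        have h := sigma_add q (πV.toMap v) (πV.toMap v') (πV.mem_matched q v)
          (πV.mem_matched q v') (by rw [← map_add]; exact πV.mem_matched q _) (πW.toMap w)
        exact (sigma_congr q (map_add πV.toMap v v') (πV.mem_matched q (v + v')) _ _).trans h))
    (fun f v w => by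
      have h := sigma_smul q f (πV.toMap v) (πV.mem_matched q v)
        (by rw [← map_smul]; exact πV.mem_matched q _) (πW.toMap w)
      exact (sigma_congr q (map_smul πV.toMap f v) (πV.mem_matched q (f • v)) _ _).trans h)
    (fun a v w f hv => by
      have h := sigma_smul q f (πV.toMap v) (πV.mem_matched q v)
        (by rw [← map_smul]; exact πV.mem_matched q _) (πW.toMap w)
      have h' := sigma_l q a f (πV.toMap v) (πV.mem_matched q v) (πV.graded a v hv) (πW.toMap w)
      rw [← map_smul (πW.toMap)] at h'
      exact ((sigma_congr q (map_smul πV.toMap f v) (πV.mem_matched q (f • v)) _ _).trans h).trans h'.symm)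

theorem coTensMap_mk (πV : Coaction q V) (πW : Coaction q W) (v : V) (w : W) :
    coTensMap q πV πW (Tens.mk v w) = sigma q (πV.toMap v) (πV.mem_matched q v) (πW.toMap w) := rfl

theorem sigma_graded (a b : ℂ) (x : ATens q V) (hx) (hxa : x ∈ gradedPart q V a)
    (z : ATens q W) (hz : z ∈ gradedPart q W b) :
    sigma q x hx z ∈ gradedPart q (Tens V W) (a + b) := by
  induction hz using Submodule.span_induction with
  | zero => rw [map_zero]; exact zero_mem _
  | add z z' _ _ h h' => rw [map_add]; exact add_mem h h'
  | smul f z _ h =>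
    have := sigma_l q a (T (-a) f) x hx hxa z
    rw [T_T, add_neg_cancel, T_zero] at this
    rw [this]
    exact Submodule.smul_mem _ _ h
  | mem z hz =>
    obtain ⟨n, d, w, hd, hw, rfl⟩ := hz
    rw [sigma_mk]
    clear hx
    induction hxa using Submodule.span_induction with
    | zero => rw [map_zero]; exact zero_mem _
    | add z z' _ _ h h' => rw [map_add]; exact add_mem h h'
    | smul f z _ h => rw [sigmaAux_smul]; exact Submodule.smul_mem _ _ h
    | mem x hx =>
      obtain ⟨m, c, v, hc, hv, rfl⟩ := hx
      rw [sigmaAux_mk]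
      exact Submodule.subset_span ⟨m + n, c * d, _, gr_mul hc hd, Tens.mk_mem_wt hv hw, rfl⟩

/-- The tensor product coaction `(m ⊗ id) σ₂₃ (π_V ⊗ π_W)`: if `π_V v = ∑ a_i ⊗ v_i` and
`π_W w = ∑ b_j ⊗ w_j`, then `v ⊗ w` is mapped to `∑ a_i b_j ⊗ (v_i ⊗ w_j)`. -/
def coTens (πV : Coaction q V) (πW : Coaction q W) : Coaction q (Tens V W) where
  toMap := coTensMap q πV πW
  graded := graded_of_span q _ _ Tens.span_mk (by
    rintro x ⟨a, b, v, hv, w, hw, rfl⟩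
    refine ⟨a + b, Tens.mk_mem_wt hv hw, ?_⟩
    rw [coTensMap_mk]
    exact sigma_graded q a b _ _ (πV.graded a v hv) _ (πW.graded b w hw))

end tens

/-! ### Direct sums of corepresentations -/

section sum
variable {ι : Type} [DecidableEq ι] (V : ι → Type) [∀ i, AddCommGroup (V i)]
  [∀ i, Module Mer (V i)] [∀ i, HSpace (V i)]

/-- The componentwise action of `h`. -/
def hSum : (⨁ i, V i) →ₗ[Mer] (⨁ i, V i) := DirectSum.lmap (fun i => HSpace.h (V := V i))

theorem hSum_lof (i : ι) (v : V i) :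
    hSum V (DirectSum.lof Mer ι V i v) = DirectSum.lof Mer ι V i (HSpace.h v) :=
  DirectSum.lmap_lof _ _ _

theorem span_lof : Submodule.span Mer {x : ⨁ i, V i | ∃ i a, ∃ v ∈ wt (V i) a,
    x = DirectSum.lof Mer ι V i v} = ⊤ := by
  rw [eq_top_iff]
  rintro x -
  induction x using DirectSum.induction_on with
  | zero => exact zero_mem _
  | add x y hx hy => exact add_mem hx hy
  | of i v =>
    have hv : v ∈ ⨆ a, wt (V i) a := by rw [iSup_wt]; trivial
    induction hv using Submodule.iSup_induction' with
    | mem a v hv => exact Submodule.subset_span ⟨i, a, v, hv, rfl⟩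
    | zero => rw [map_zero]; exact zero_mem _
    | add v v' _ _ h h' => rw [map_add]; exact add_mem h h'

instance : HSpace (⨁ i, V i) where
  h := hSum V
  diag := by
    rw [eq_top_iff, ← span_lof, Submodule.span_le]
    rintro x ⟨i, a, v, hv, rfl⟩
    refine Submodule.mem_iSup_of_mem a ?_
    rw [Module.End.mem_eigenspace_iff, hSum_lof, mem_wt.1 hv, map_smul]

theorem lof_mem_wt {i : ι} {a : ℂ} {v : V i} (hv : v ∈ wt (V i) a) :
    DirectSum.lof Mer ι V i v ∈ wt (⨁ i, V i) a := by
  rw [mem_wt]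
  change hSum V _ = _
  rw [hSum_lof, mem_wt.1 hv, map_smul]

variable {V}
/-- The direct sum of coactions. -/
def coSum (π : ∀ i, Coaction q (V i)) : Coaction q (⨁ i, V i) where
  toMap := DirectSum.toModule Mer ι _ (fun i =>
    (ATens.map q (DirectSum.lof Mer ι V i)).comp (π i).toMap)
  graded := graded_of_span q _ _ (span_lof V) (by
    rintro x ⟨i, a, v, hv, rfl⟩
    refine ⟨a, lof_mem_wt V hv, ?_⟩
    rw [DirectSum.toModule_lof, LinearMap.comp_apply]
    have h := (π i).graded a v hv
    generalize (π i).toMap v = x at h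
    induction h using Submodule.span_induction with
    | zero => rw [map_zero]; exact zero_mem _
    | add z z' _ _ h h' => rw [map_add]; exact add_mem h h'
    | smul f z _ h => rw [map_smul]; exact Submodule.smul_mem _ _ h
    | mem x hx =>
      obtain ⟨m, c, v, hc, hv, rfl⟩ := hx
      rw [ATens.map_mk]
      exact Submodule.subset_span ⟨m, c, _, hc, lof_mem_wt V hv, rfl⟩)
end sum

end DynSU2

namespace DynSU2
variable (q : Set.Ioo (0 : ℝ) 1)
open FSL

/-! ### Matrix elements -/

/-- `t` is the matrix of the corepresentation `V_N` in the basis `v_k = γ^{N-k} α^k`, that is,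
`π(v_k) = ∑_j t_{kj} ⊗ v_j`. -/
def IsMatrix (N : ℕ) (t : ℕ → ℕ → FSL q) : Prop :=
  ∀ k ≤ N, (coVN q N).toMap (VN.v q N k) =
    ∑ j ∈ Finset.range (N + 1), ATens.mk q (t k j) (VN.v q N j)

theorem exists_sum {N : ℕ} {m : ℂ} {x : ATens q (FSL q)} (hx : x ∈ UN q N m) :
    ∃ t : ℕ → FSL q, x = ∑ j ∈ Finset.range (N + 1), ATens.mk q (t j) (vec q N j) := by
  induction hx using Submodule.span_induction with
  | mem x hx =>
    obtain ⟨j, hj, a, -, rfl⟩ := hx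
    refine ⟨fun i => if i = j then a else 0, ?_⟩
    rw [Finset.sum_eq_single j]
    · simp
    · intro i _ hi
      simp [hi, ATens.zero_mk]
    · intro h
      exact absurd (Finset.mem_range.2 (by omega)) h
  | zero => exact ⟨fun _ => 0, by simp [ATens.zero_mk]⟩
  | add x y _ _ hx hy =>
    obtain ⟨t, rfl⟩ := hx
    obtain ⟨t', rfl⟩ := hy
    refine ⟨fun j => t j + t' j, ?_⟩
    simp only [ATens.add_mk, Finset.sum_add_distrib]
  | smul c x _ hx =>
    obtain ⟨t, rfl⟩ := hx
    refine ⟨fun j => l q (algebraMap ℂ Mer c) * t j, ?_⟩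
    rw [ATens.complex_smul_def, Finset.smul_sum]
    rfl

/-- Matrix elements exist. -/
theorem exists_isMatrix (N : ℕ) : ∃ t, IsMatrix q N t := by
  have h : ∀ k, ∃ t : ℕ → FSL q, k ≤ N → (coVN q N).toMap (VN.v q N k) =
      ∑ j ∈ Finset.range (N + 1), ATens.mk q (t j) (VN.v q N j) := by
    intro k
    by_cases hk : k ≤ N
    · obtain ⟨t, ht⟩ := exists_sum q (comul_vec q hk)
      refine ⟨t, fun _ => ?_⟩
      apply inclN_injective q N
      refine (inclN_coVNMap q N _).trans ?_
      rw [VN.v_coe hk, ht, map_sum]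
      refine Finset.sum_congr rfl fun j hj => ?_
      rw [inclN, ATens.map_mk, Submodule.subtype_apply,
        VN.v_coe (Nat.lt_succ_iff.1 (Finset.mem_range.1 hj))]
    · exact ⟨fun _ => 0, fun h => absurd h hk⟩
  choose t ht using h
  exact ⟨t, fun k hk => ht k hk⟩

/-! ### Basic hypergeometric functions -/

section hyper
variable {K : Type} [Field K]

/-- `(a; Q)_n = (1 - a) (1 - a Q) ⋯ (1 - a Q^{n-1})` -/
def qPoch (a Q : K) (n : ℕ) : K := ∏ i ∈ Finset.range n, (1 - a * Q ^ i)

/-- The `Q`-binomial coefficient, for `k ≤ n`. -/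
def qBinom (Q : K) (n k : ℕ) : K := qPoch Q Q n / (qPoch Q Q k * qPoch Q Q (n - k))

/-- The terminating basic hypergeometric series `₄φ₃(Q^{-n}, a, b, c; d, e, f; Q, z)`. (Terms with
a vanishing factor in the numerator are zero, even if the denominator vanishes.) -/
def phi43 (n : ℕ) (a b c d e f Q z : K) : K :=
  ∑ i ∈ Finset.range (n + 1),
    (qPoch (Q ^ (-(n : ℤ))) Q i * qPoch a Q i * qPoch b Q i * qPoch c Q i) /
      (qPoch d Q i * qPoch e Q i * qPoch f Q i * qPoch Q Q i) * z ^ i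

/-- The `q`-Racah polynomial `R_n(μ(x); a, b, c, d; Q)`, where `μ(x) = Q^{-x} + c d Q^{x+1}`. -/
def qRacah (n x : ℕ) (a b c d Q : K) : K :=
  phi43 n (a * b * Q ^ (n + 1)) (Q ^ (-(x : ℤ))) (c * d * Q ^ (x + 1)) (a * Q) (b * d * Q) (c * Q)
    Q Q
end hyper

/-- The factor of the Clebsch-Gordan coefficient in front of the series, for `λ` a variable:
`q^{(j-s)(N-k)+sj} (q^{-2(j+k)}; q²)_s (q^{2(j+k-M-N-λ-1)}; q²)_j /
  ((q^{-2N}; q²)_s (q^{2(j-M-λ-1)}; q²)_j)`. -/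
def cgFactor (M N s j k : ℕ) : Mer :=
  qpow q 0 (((j : ℤ) - s) * ((N : ℤ) - k) + s * j) *
    (qPoch (qpow q 0 (-2 * (j + k))) (qpow q 0 2) s *
      qPoch (qpow q (-2) (2 * (j + k - M - N - 1))) (qpow q 0 2) j) /
    (qPoch (qpow q 0 (-2 * N)) (qpow q 0 2) s *
      qPoch (qpow q (-2) (2 * (j - M - 1))) (qpow q 0 2) j)

/-- The Clebsch-Gordan coefficient `C_{jk,j+k-s}^{MN,M+N-2s}(λ)`: the product of the above factor
with `₄φ₃(q^{-2s}, q^{2(s-M-N-1)}, q^{-2j}, q^{2(j-M-λ-1)};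
  q^{-2M}, q^{-2(j+k)}, q^{2(j+k-M-N-λ-1)}; q², q²)`. -/
def cgCoeff (M N s j k : ℕ) : Mer :=
  cgFactor q M N s j k *
    phi43 s (qpow q 0 (2 * (s - M - N - 1))) (qpow q 0 (-2 * j)) (qpow q (-2) (2 * (j - M - 1)))
      (qpow q 0 (-2 * M)) (qpow q 0 (-2 * (j + k))) (qpow q (-2) (2 * (j + k - M - N - 1)))
      (qpow q 0 2) (qpow q 0 2)

/-- The normalizing functions of `V_N`,
`Γ_k^N(λ) = [N choose k]_{q²} (q^{2(k-N-λ-1)}; q²)_k / (q^{-2λ}; q²)_k`. -/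
def normFun (N k : ℕ) : Mer :=
  qBinom (qpow q 0 2) N k * qPoch (qpow q (-2) (2 * (k - N - 1))) (qpow q 0 2) k /
    qPoch (qpow q (-2) 0) (qpow q 0 2) k

/-- The weight `Γ_j^M(λ) Γ_k^N(λ + M - 2j) / Γ_{j+k-s}^{M+N-2s}(λ)`. -/
def cgWeight (M N s j k : ℕ) : Mer :=
  normFun q M j * T ((M : ℂ) - 2 * j) (normFun q N k) / normFun q (M + N - 2 * s) (j + k - s)

/-- `Z_s = (-1)^s q^{-s(s+1)} (q², q^{2(s-M-N-1)}; q²)_s / (q^{-2M}, q^{-2N}; q²)_s`. -/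
def cgNorm (M N s : ℕ) : Mer :=
  (-1) ^ s * qpow q 0 (-(s * (s + 1))) *
    (qPoch (qpow q 0 2) (qpow q 0 2) s *
      qPoch (qpow q 0 (2 * (s - M - N - 1))) (qpow q 0 2) s) /
    (qPoch (qpow q 0 (-2 * M)) (qpow q 0 2) s * qPoch (qpow q 0 (-2 * N)) (qpow q 0 2) s)

end DynSU2

end

open DynSU2
open scoped DirectSum

noncomputable section
open scoped TensorProduct DirectSum
set_option linter.unusedSimpArgs false
set_option linter.unusedSectionVars false

namespace DynSU2

/-! ### Contiguous relations for basic hypergeometric series -/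

section hyper
variable {K : Type} [Field K]

/-! Write `[n] = q^n - q^{-n}` and `X = q^{2(λ+1)}`. Everything is deduced from an induction on `M`,
carried out by tensoring with `V_1` on the left.

Two families of intertwiners start from `V_1 ⊗ V_P`. Left multiplication by `γ` and `α` gives `m :
V_1 ⊗ V_P → V_{P+1}` (`kPair`), which intertwines because the coproduct is multiplicative, and which
is surjective. The second, `e : V_1 ⊗ V_{P+1} → V_P` (`ePair`), is given by explicit coefficients.
Composed with `m`, it is a multiple of the invariant pairing on `V_1 ⊗ V_1`, whose invariance
expresses that the dynamical determinant is one, plus `m` after the map `e` for `P - 1`. Hence it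
intertwines by induction on `P` (`intertwines_of_rec`, `ePair_intertwines`).

With `P = M + 1 + N - 2s`, the maps `C_s` satisfy `[M+1][P+1] C_s (m ⊗ 1) = [M+1-s][M+N+2-s] m (1 ⊗
C_s) + [s] e (1 ⊗ C_{s-1})`, where `C_s` and `C_{s-1}` on the right belong to `V_M ⊗ V_N`. In
coordinates this consists of two identities between `₄φ₃` series, one for the `γ` component
(`cgRat_succ_left`) and one for the `α` component (`cgRat_succ_succ`). They come from two contiguous
relations: an elementary one that holds term by term, and one for terminating Saalschützian series
that is proved by telescoping. As `m` is surjective and the bracket factors on the left are nonzero,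
the recursion shows by induction on `M` that `C_s` is an intertwiner (`cgMap_intertwines`).

Orthogonality follows from the same recursion. With respect to the weights `Γ`, the maps `m` and `e`
out of `V_1 ⊗ V_P` have orthogonal rows, `m` has norm one and `e` has a known constant norm
(`normRat_succ`, `normRat_reduce`, `normRat_cross`). Inserting the recursion into the sum over `j +
k = L` reduces it to the sums for `M`, and the norms `Z_s` satisfy the resulting recursion
(`zRat_rec`, `orthSum_eq`). For fixed `L` there are as many admissible `s` as pairs `(j, k)`, so a
one-sided inverse of a square matrix is two-sided and the dual relation follows. The two relations
provide an explicit inverse of the sum of the `C_s`, which gives the equivalence without any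
irreducibility argument.

The Clebsch-Gordan formula is the intertwining property of `C_s` read off in coordinates, and the
`q`-Racah form is a comparison of parameters. Coordinates require that the `γ^{N-k} α^k` be linearly
independent in an algebra given by generators and relations. They have distinct degrees, so it is
enough that they are nonzero, and this is seen in a representation by difference operators in which
`α` and `γ` are injective (`vec_ne_zero`).

The computations with coefficients take place in an arbitrary field containing `q` and `X`, where
`q` is not a root of unity and no `q^n X` equals one. A shift of `λ` then becomes multiplication of
`X` by a power of `q²`. -/

theorem qPoch_zero (a Q : K) : qPoch a Q 0 = 1 := Finset.prod_range_zero _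

theorem qPoch_succ (a Q : K) (n : ℕ) : qPoch a Q (n + 1) = qPoch a Q n * (1 - a * Q ^ n) :=
  Finset.prod_range_succ _ n

theorem qPoch_succ' (a Q : K) (n : ℕ) : qPoch a Q (n + 1) = (1 - a) * qPoch (a * Q) Q n := by
  rw [qPoch, Finset.prod_range_succ', mul_comm, pow_zero, mul_one]
  congr 1
  refine Finset.prod_congr rfl fun i _ => ?_
  rw [pow_succ']; ring

theorem qPoch_ne_zero {a Q : K} {n : ℕ} (h : ∀ i < n, a * Q ^ i ≠ 1) : qPoch a Q n ≠ 0 :=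
  Finset.prod_ne_zero_iff.2 fun i hi => sub_ne_zero.2 (h i (Finset.mem_range.1 hi)).symm

theorem qPoch_eq_zero {a Q : K} {n i : ℕ} (hi : i < n) (h : a * Q ^ i = 1) : qPoch a Q n = 0 :=
  Finset.prod_eq_zero (Finset.mem_range.2 hi) (by rw [h, sub_self])

/-- The term of index `i` of a `₄φ₃` series with argument `Q`. -/
def phiTerm (a b c g d e f Q : K) (i : ℕ) : K :=
  qPoch a Q i * qPoch b Q i * qPoch c Q i * qPoch g Q i /
    (qPoch d Q i * qPoch e Q i * qPoch f Q i * qPoch Q Q i) * Q ^ i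

/-- The polynomial identity behind the contiguous relations. -/
theorem contiguous_poly (a b c g d e f Q t : K) (h : d * e * f = a * b * c * g * Q) :
    t * (1 - c) * (1 - g) * (1 - d * t) * (1 - e * t) * (1 - f * t) * (a - b) * a * b
      - t * (1 - b * t) * (1 - c * t) * (1 - g * t) * b * ((a - d) * (a - e) * (a - f))
      + t * (1 - a * t) * (1 - c * t) * (1 - g * t) * a * ((b - d) * (b - e) * (b - f)) =
    a * b * (a - b) * ((1 - c * g * Q * t) * (1 - a * t) * (1 - b * t) * (1 - c * t) * (1 - g * t)
      - (1 - c * g * t) * (1 - t) * (1 - d * t) * (1 - e * t) * (1 - f * t)) := by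
  linear_combination (-t * (a - b) * (1 - a * t) * (1 - b * t) * (1 - c * t) * (1 - g * t)) * h

/-- The coefficients of the contiguous relation. -/
def contigL (a b d e f : K) : K :=
  (1 - b) * ((a - d) * (a - e) * (a - f)) / (a * ((1 - d) * (1 - e) * (1 - f)) * (a - b))

variable {a b c g d e f Q : K}

/-- The inductive step of a telescoping sum. Here `t = Q^{n+1}`, `A = (aQ; Q)_n` and likewise for
the other letters, with `R = (Q; Q)_n`. Then `(1 - a) A` and `A (1 - a t)` are `(a; Q)_{n+1}` and
`(aQ; Q)_{n+1}`, and the last two summands are the boundary terms at `n + 1` and at `n`. After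
clearing denominators, `contiguous_poly` is what is left. -/
theorem contiguous_term (h : d * e * f = a * b * c * g * Q) (ha : a ≠ 0) (hb : b ≠ 0)
    (hab : a ≠ b) {t A B C D E F G R : K} (hd : 1 - d ≠ 0) (he : 1 - e ≠ 0) (hf : 1 - f ≠ 0)
    (hd' : 1 - d * t ≠ 0) (he' : 1 - e * t ≠ 0) (hf' : 1 - f * t ≠ 0)
    (hD : D ≠ 0) (hE : E ≠ 0) (hF : F ≠ 0) (hR : R ≠ 0) (ht : 1 - t ≠ 0) :
    ((1 - a) * A) * ((1 - b) * B) * ((1 - c) * C) * ((1 - g) * G) /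
      (((1 - d) * D) * ((1 - e) * E) * ((1 - f) * F) * (R * (1 - t))) * t =
    contigL a b d e f * (((1 - a) * A) * (B * (1 - b * t)) * (C * (1 - c * t)) * (G * (1 - g * t)) /
      ((D * (1 - d * t)) * (E * (1 - e * t)) * (F * (1 - f * t)) * (R * (1 - t))) * t) +
    contigL b a d e f * ((A * (1 - a * t)) * ((1 - b) * B) * (C * (1 - c * t)) * (G * (1 - g * t)) /
      ((D * (1 - d * t)) * (E * (1 - e * t)) * (F * (1 - f * t)) * (R * (1 - t))) * t) +
    (1 - a) * (1 - b) / ((1 - d) * (1 - e) * (1 - f)) * (1 - c * g * Q * t) *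
      ((A * (1 - a * t)) * (B * (1 - b * t)) * (C * (1 - c * t)) * (G * (1 - g * t))) /
      ((D * (1 - d * t)) * (E * (1 - e * t)) * (F * (1 - f * t)) * (R * (1 - t)))  -
    (1 - a) * (1 - b) / ((1 - d) * (1 - e) * (1 - f)) * (1 - c * g * t) *
      (A * B * C * G) / (D * E * F * R) := by
  have key := contiguous_poly a b c g d e f Q t h
  have h1 : a - b ≠ 0 := sub_ne_zero.2 hab
  have h2 : b - a ≠ 0 := sub_ne_zero.2 hab.symm
  have e2 : contigL b a d e f =
      -((1 - a) * ((b - d) * (b - e) * (b - f)) / (b * ((1 - d) * (1 - e) * (1 - f)) * (a - b))) := by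
    rw [contigL, ← neg_sub a b, mul_neg, div_neg]
  rw [e2, contigL]
  have e3 : ∀ {u v w d e f d' e' f' t' c g : K}, d ≠ 0 → e ≠ 0 → f ≠ 0 → d' ≠ 0 → e' ≠ 0 →
      f' ≠ 0 → t' ≠ 0 → w ≠ 0 → (u * A) * (v * B) * (c * C) * (g * G) /
      ((d * D) * (e * E) * (f * F) * (R * t')) * t =
      u * v * (A * B * C * G) / (w * (d * e * f) *
        ((D * d') * (E * e') * (F * f') * (R * t'))) * (t * c * g * d' * e' * f' * w) := by
    intros; field_simp
  have e4 : ∀ {x w u d' e' f' t' : K}, d' ≠ 0 → e' ≠ 0 → f' ≠ 0 → t' ≠ 0 → w ≠ 0 → u ≠ 0 →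
      (1 - a) * (1 - b) / u * x * (A * B * C * G) / (D * E * F * R) =
      (1 - a) * (1 - b) * (A * B * C * G) / (w * u * ((D * d') * (E * e') * (F * f') * (R * t'))) *
        (w * (x * t' * d' * e' * f')) := by
    intros; field_simp
  have hw : a * b * (a - b) ≠ 0 := mul_ne_zero (mul_ne_zero ha hb) h1
  rw [e3 hd he hf hd' he' hf' ht hw, e4 hd' he' hf' ht hw (mul_ne_zero (mul_ne_zero hd he) hf)]
  have hU' : (1 - d) * (1 - e) * (1 - f) ≠ 0 := mul_ne_zero (mul_ne_zero hd he) hf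
  have hW' : (D * (1 - d * t)) * (E * (1 - e * t)) * (F * (1 - f * t)) * (R * (1 - t)) ≠ 0 :=
    mul_ne_zero (mul_ne_zero (mul_ne_zero (mul_ne_zero hD hd') (mul_ne_zero hE he'))
      (mul_ne_zero hF hf')) (mul_ne_zero hR ht)
  have e5 : t * (1 - c) * (1 - g) * (1 - d * t) * (1 - e * t) * (1 - f * t) * (a * b * (a - b)) =
      t * (1 - b * t) * (1 - c * t) * (1 - g * t) * b * ((a - d) * (a - e) * (a - f))
      - t * (1 - a * t) * (1 - c * t) * (1 - g * t) * a * ((b - d) * (b - e) * (b - f)) +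
      a * b * (a - b) * ((1 - c * g * Q * t) * (1 - a * t) * (1 - b * t) * (1 - c * t) * (1 - g * t)
      - (1 - c * g * t) * (1 - t) * (1 - d * t) * (1 - e * t) * (1 - f * t)) := by
    linear_combination key
  rw [e5]
  -- All factors become atoms, so that clearing denominators does not expand them; the content is
  -- already in `e5`.
  generalize (D * (1 - d * t)) * (E * (1 - e * t)) * (F * (1 - f * t)) * (R * (1 - t)) = W at hW' ⊢
  generalize (1 - d) * (1 - e) * (1 - f) = U at hU' ⊢
  generalize (a - d) * (a - e) * (a - f) = p1
  generalize (b - d) * (b - e) * (b - f) = p2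
  generalize (1 - d * t) = d' 
  generalize (1 - e * t) = e' 
  generalize (1 - f * t) = f' 
  generalize (1 - c * g * t) = s1
  generalize (1 - c * g * Q * t) = s2
  generalize (1 - a * t) = a'
  generalize (1 - b * t) = b'
  generalize (1 - c * t) = c'
  generalize (1 - g * t) = g'
  generalize (1 - t) = t'
  generalize (1 - a) = a1
  generalize (1 - b) = b1
  generalize a - b = r at h1 hw ⊢
  field_simp
  ring

/-- For partial sums the contiguous relation holds up to an explicit boundary term. The increment of
that term from `n` to `n + 1` is given by `contiguous_term`, and induction on `n` sums the
increments. -/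
theorem contiguous_partial (h : d * e * f = a * b * c * g * Q) (ha : a ≠ 0) (hb : b ≠ 0)
    (hab : a ≠ b) (n : ℕ) (hd : ∀ i ≤ n, 1 - d * Q ^ i ≠ 0) (he : ∀ i ≤ n, 1 - e * Q ^ i ≠ 0)
    (hf : ∀ i ≤ n, 1 - f * Q ^ i ≠ 0) (hQ : ∀ i < n, 1 - Q * Q ^ i ≠ 0) :
    ∑ i ∈ Finset.range (n + 1), phiTerm a b c g d e f Q i =
      contigL a b d e f *
        ∑ i ∈ Finset.range (n + 1), phiTerm a (b * Q) (c * Q) (g * Q) (d * Q) (e * Q) (f * Q) Q i +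
      contigL b a d e f *
        ∑ i ∈ Finset.range (n + 1), phiTerm (a * Q) b (c * Q) (g * Q) (d * Q) (e * Q) (f * Q) Q i +
      (1 - a) * (1 - b) / ((1 - d) * (1 - e) * (1 - f)) * (1 - c * g * Q ^ (n + 1)) *
        (qPoch (a * Q) Q n * qPoch (b * Q) Q n * qPoch (c * Q) Q n * qPoch (g * Q) Q n) /
        (qPoch (d * Q) Q n * qPoch (e * Q) Q n * qPoch (f * Q) Q n * qPoch Q Q n) := by
  have hd0 : 1 - d ≠ 0 := by simpa using hd 0 (Nat.zero_le _)
  have he0 : 1 - e ≠ 0 := by simpa using he 0 (Nat.zero_le _)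
  have hf0 : 1 - f ≠ 0 := by simpa using hf 0 (Nat.zero_le _)
  have hp : ∀ {x : K} {m : ℕ}, (∀ i < m, 1 - x * Q ^ (i + 1) ≠ 0) → qPoch (x * Q) Q m ≠ 0 := by
    intro x m hx
    refine qPoch_ne_zero fun i hi => ?_
    have := hx i hi
    rw [pow_succ', ← mul_assoc] at this
    exact fun h => this (by rw [h, sub_self])
  induction n with
  | zero =>
    simp only [zero_add, Finset.sum_range_one, phiTerm, qPoch_zero, pow_zero, pow_one]
    have h1 : a - b ≠ 0 := sub_ne_zero.2 hab
    have e2 : contigL b a d e f =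
      -((1 - a) * ((b - d) * (b - e) * (b - f)) / (b * ((1 - d) * (1 - e) * (1 - f)) * (a - b))) := by
      rw [contigL, ← neg_sub a b, mul_neg, div_neg]
    rw [e2, contigL]
    field_simp
    linear_combination -(a - b) * (1 - a) * (1 - b) * h
  | succ n ih =>
    rw [Finset.sum_range_succ, Finset.sum_range_succ _ (n + 1), Finset.sum_range_succ _ (n + 1),
      ih (fun i hi => hd i (by omega)) (fun i hi => he i (by omega)) (fun i hi => hf i (by omega))
        (fun i hi => hQ i (by omega))]
    have := contiguous_term h ha hb hab (t := Q ^ (n + 1)) (A := qPoch (a * Q) Q n)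
      (B := qPoch (b * Q) Q n) (C := qPoch (c * Q) Q n) (G := qPoch (g * Q) Q n)
      hd0 he0 hf0 (hd _ le_rfl) (he _ le_rfl) (hf _ le_rfl)
      (hp (m := n) fun i hi => hd (i + 1) (by omega)) (hp (m := n) fun i hi => he (i + 1) (by omega))
      (hp (m := n) fun i hi => hf (i + 1) (by omega))
      (qPoch_ne_zero (a := Q) (n := n) fun i hi h => hQ i (by omega) (by rw [h, sub_self]))
      (by rw [pow_succ']; exact hQ n (by omega))
    have hs : ∀ x : K, qPoch (x * Q) Q (n + 1) = qPoch (x * Q) Q n * (1 - x * Q ^ (n + 1)) := by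
      intro x; rw [qPoch_succ, pow_succ', mul_assoc]
    have hs' : qPoch Q Q (n + 1) = qPoch Q Q n * (1 - Q ^ (n + 1)) := by
      rw [qPoch_succ, pow_succ']
    rw [phiTerm, phiTerm, phiTerm, hs, hs, hs, hs, hs, hs, hs, hs', qPoch_succ' a, qPoch_succ' b,
      qPoch_succ' c, qPoch_succ' g, qPoch_succ' d, qPoch_succ' e, qPoch_succ' f, this,
      pow_succ Q (n + 1)]
    ring

/-- A contiguous relation for terminating Saalschützian `₄φ₃` series. -/
theorem contiguous_sum (h : d * e * f = a * b * c * g * Q) (ha : a ≠ 0) (hb : b ≠ 0)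
    (hab : a ≠ b) (n : ℕ) (hc : c * Q ^ (n + 1) = 1) (hd : ∀ i ≤ n, 1 - d * Q ^ i ≠ 0)
    (he : ∀ i ≤ n, 1 - e * Q ^ i ≠ 0)
    (hf : ∀ i ≤ n, 1 - f * Q ^ i ≠ 0) (hQ : ∀ i ≤ n, 1 - Q * Q ^ i ≠ 0) :
    ∑ i ∈ Finset.range (n + 2), phiTerm a b c g d e f Q i =
      contigL a b d e f *
        ∑ i ∈ Finset.range (n + 1), phiTerm a (b * Q) (c * Q) (g * Q) (d * Q) (e * Q) (f * Q) Q i +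
      contigL b a d e f *
        ∑ i ∈ Finset.range (n + 1),
          phiTerm (a * Q) b (c * Q) (g * Q) (d * Q) (e * Q) (f * Q) Q i := by
  rw [Finset.sum_range_succ, contiguous_partial h ha hb hab n hd he hf fun i hi => hQ i hi.le]
  -- The left series has one term more than the right ones. As `c Q^{n+1} = 1`, it is exactly the
  -- negative of the boundary term.
  have e1 : phiTerm a b c g d e f Q (n + 1) = -((1 - a) * (1 - b) / ((1 - d) * (1 - e) * (1 - f)) *
      (1 - c * g * Q ^ (n + 1)) *
        (qPoch (a * Q) Q n * qPoch (b * Q) Q n * qPoch (c * Q) Q n * qPoch (g * Q) Q n) /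
        (qPoch (d * Q) Q n * qPoch (e * Q) Q n * qPoch (f * Q) Q n * qPoch Q Q n)) := by
    have hQn := hQ n le_rfl
    rw [phiTerm, qPoch_succ' a, qPoch_succ' b, qPoch_succ' c, qPoch_succ' g, qPoch_succ' d,
        qPoch_succ' e, qPoch_succ' f, qPoch_succ Q]
    rw [← pow_succ'] at hQn ⊢
    have e2 : 1 - c * g * Q ^ (n + 1) = 1 - g := by linear_combination -g * hc
    have e3 : (1 - c) * Q ^ (n + 1) / (1 - Q ^ (n + 1)) = -1 := by
      rw [div_eq_iff hQn]; linear_combination -hc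
    rw [e2]
    calc _ = ((1 - c) * Q ^ (n + 1) / (1 - Q ^ (n + 1))) * ((1 - a) * (1 - b) / ((1 - d) * (1 - e) * (1 - f)) *
      (1 - g) * (qPoch (a * Q) Q n * qPoch (b * Q) Q n * qPoch (c * Q) Q n * qPoch (g * Q) Q n) /
        (qPoch (d * Q) Q n * qPoch (e * Q) Q n * qPoch (f * Q) Q n * qPoch Q Q n)) := by
          simp only [div_eq_mul_inv, mul_inv]; ring
      _ = _ := by rw [e3]; ring
  rw [e1]; ring

/-- A contiguous relation for the parameters `a`, `b`, `d` of the terms of a series. -/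
theorem contiguous_abd (hab : a ≠ b) (n : ℕ)
    (hd : ∀ i ≤ n, 1 - d * Q ^ i ≠ 0) :
    ∑ i ∈ Finset.range (n + 1), phiTerm a b c g d e f Q i =
      (1 - b) * (a - d) / ((1 - d) * (a - b)) *
        ∑ i ∈ Finset.range (n + 1), phiTerm a (b * Q) c g (d * Q) e f Q i +
      (1 - a) * (d - b) / ((1 - d) * (a - b)) *
        ∑ i ∈ Finset.range (n + 1), phiTerm (a * Q) b c g (d * Q) e f Q i := by
  have hd0 : 1 - d ≠ 0 := by simpa using hd 0 (Nat.zero_le _)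
  have h1 : a - b ≠ 0 := sub_ne_zero.2 hab
  rw [Finset.mul_sum, Finset.mul_sum, ← Finset.sum_add_distrib]
  refine Finset.sum_congr rfl fun i hi => ?_
  rcases i with _ | i
  · simp only [phiTerm, qPoch_zero]
    field_simp
    ring
  · have hi' := hd (i + 1) (by have := Finset.mem_range.1 hi; omega)
    have hs : ∀ x : K, qPoch (x * Q) Q (i + 1) = qPoch (x * Q) Q i * (1 - x * Q ^ (i + 1)) := by
      intro x; rw [qPoch_succ, pow_succ', mul_assoc]
    have hD : qPoch (d * Q) Q i ≠ 0 := by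
      refine qPoch_ne_zero fun j hj h => hd (j + 1) (by have := Finset.mem_range.1 hi; omega) ?_
      rw [pow_succ', ← mul_assoc, h, sub_self]
    rw [phiTerm, phiTerm, phiTerm, hs, hs, hs, qPoch_succ' a, qPoch_succ' b, qPoch_succ' d]
    generalize qPoch c Q (i + 1) = C
    generalize qPoch g Q (i + 1) = G
    have hI : ∀ x : K, x / (qPoch (d * Q) Q i * (1 - d * Q ^ (i + 1)) * qPoch e Q (i + 1) *
        qPoch f Q (i + 1) * qPoch Q Q (i + 1)) = x / (qPoch (d * Q) Q i * (1 - d * Q ^ (i + 1))) *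
        (qPoch e Q (i + 1) * qPoch f Q (i + 1) * qPoch Q Q (i + 1))⁻¹ := by
      intro x; simp only [div_eq_mul_inv, mul_inv]; ring
    have hI' : ∀ x : K, x / ((1 - d) * qPoch (d * Q) Q i * qPoch e Q (i + 1) *
        qPoch f Q (i + 1) * qPoch Q Q (i + 1)) = x / ((1 - d) * qPoch (d * Q) Q i) *
        (qPoch e Q (i + 1) * qPoch f Q (i + 1) * qPoch Q Q (i + 1))⁻¹ := by
      intro x; simp only [div_eq_mul_inv, mul_inv]; ring
    rw [hI, hI, hI']
    generalize (qPoch e Q (i + 1) * qPoch f Q (i + 1) * qPoch Q Q (i + 1))⁻¹ = Y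
    -- What remains is `(a - b)(1 - d t) = (a - d)(1 - b t) + (d - b)(1 - a t)`; the relation holds
    -- term by term.
    generalize Q ^ (i + 1) = t at hi' ⊢
    field_simp
    ring
end hyper

/-! ### Clebsch-Gordan coefficients as rational functions -/

section rational
variable {K : Type} [Field K]

theorem sum_phiTerm_congr {a b c g d e f Q : K} {m n : ℕ} (hmn : m ≤ n)
    (h : ∀ i, m < i → qPoch a Q i = 0 ∨ qPoch c Q i = 0) :
    ∑ i ∈ Finset.range (m + 1), phiTerm a b c g d e f Q i =
      ∑ i ∈ Finset.range (n + 1), phiTerm a b c g d e f Q i := by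
  refine Finset.sum_subset (Finset.range_mono (by omega)) fun i _ hi => ?_
  have := h i (by have := mt Finset.mem_range.2 hi; omega)
  rcases this with h | h <;> simp [phiTerm, h]

/-- The series is terminated both by `Q^{-s}` and by `c = Q^{-j}`, so it may be cut at either index.
Cutting at `j` suits the recursions, which lower `j`, and for `j ≤ M` none of the retained lower
parameters of a Clebsch-Gordan coefficient produces a zero denominator. -/
theorem phi43_eq_sum {s j : ℕ} {b c g d e f Q : K} (hQ : Q ≠ 0) (hc : c * Q ^ j = 1) :
    phi43 s b c g d e f Q Q =
      ∑ i ∈ Finset.range (j + 1), phiTerm (Q ^ (-(s : ℤ))) b c g d e f Q i := by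
  have h1 : ∀ i, s < i → qPoch (Q ^ (-(s : ℤ))) Q i = 0 := fun i hi =>
    qPoch_eq_zero hi (by rw [zpow_neg, zpow_natCast, inv_mul_cancel₀ (pow_ne_zero _ hQ)])
  have h2 : ∀ i, j < i → qPoch c Q i = 0 := fun i hi => qPoch_eq_zero hi hc
  change ∑ i ∈ Finset.range (s + 1), phiTerm (Q ^ (-(s : ℤ))) b c g d e f Q i = _
  rcases le_total s j with h | h
  · exact sum_phiTerm_congr h fun i hi => Or.inl (h1 i hi)
  · exact (sum_phiTerm_congr h fun i hi => Or.inr (h2 i hi)).symm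

variable (q X : K)

/-- `q^n - q^{-n}` -/
def br (n : ℤ) : K := q ^ n - q ^ (-n)

/-- The function `q^{-i} (q^{2i} X - 1) / (X - 1)`, where `X = q^{2(λ+1)}`. -/
def aFun (i : ℤ) : K := q ^ (-i) * (q ^ (2 * i) * X - 1) / (X - 1)

/-- The coefficients of the intertwiner `V_1 ⊗ V_P → V_{P-1}`. -/
def eFun (P p : ℤ) : K := -br q (P - p) * q ^ (p + 1) * (q ^ (-2 * (p + 1)) * X - 1) / (X - 1)

/-- The factor in front of the series in `cgRat`. -/
def cgPre (M N s j k : ℕ) : K :=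
  q ^ (((j : ℤ) - s) * ((N : ℤ) - k) + s * j) *
    (qPoch (q ^ (-2 * ((j : ℤ) + k))) (q ^ 2) s *
      qPoch (q ^ (2 * ((j : ℤ) + k - M - N)) * X⁻¹) (q ^ 2) j) /
    (qPoch (q ^ (-2 * (N : ℤ))) (q ^ 2) s * qPoch (q ^ (2 * ((j : ℤ) - M)) * X⁻¹) (q ^ 2) j)

/-- The series in `cgRat`. -/
def cgSum (M N s j k : ℕ) : K :=
  ∑ i ∈ Finset.range (j + 1), phiTerm (q ^ (-2 * (s : ℤ))) (q ^ (2 * ((s : ℤ) - M - N - 1)))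
    (q ^ (-2 * (j : ℤ))) (q ^ (2 * ((j : ℤ) - M)) * X⁻¹) (q ^ (-2 * (M : ℤ)))
    (q ^ (-2 * ((j : ℤ) + k))) (q ^ (2 * ((j : ℤ) + k - M - N)) * X⁻¹) (q ^ 2) i

/-- The Clebsch-Gordan coefficient as a function of `X = q^{2(λ+1)}`. -/
def cgRat (M N s j k : ℕ) : K := cgPre q X M N s j k * cgSum q X M N s j k

variable {q X}

theorem zpow_two_mul_eq (n : ℤ) : q ^ (2 * n) = (q ^ n) ^ 2 := by
  rw [mul_comm, zpow_mul]; norm_cast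

theorem one_sub_zpow_mul_pow (hq0 : q ≠ 0) (hq : ∀ n : ℤ, n ≠ 0 → q ^ n ≠ 1) {a : ℤ} {i : ℕ}
    (h : a + 2 * i ≠ 0) : 1 - q ^ a * (q ^ 2) ^ i ≠ 0 := by
  have : q ^ a * (q ^ 2) ^ i = q ^ (a + 2 * i) := by
    rw [zpow_add₀ hq0, ← pow_mul]; norm_cast
  rw [this]
  exact sub_ne_zero.2 (hq _ h).symm

theorem one_sub_zpow_mul_inv_mul_pow (hq0 : q ≠ 0) (hX : ∀ n : ℤ, q ^ n * X ≠ 1)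
    (a : ℤ) (i : ℕ) : 1 - q ^ a * X⁻¹ * (q ^ 2) ^ i ≠ 0 := by
  have : q ^ a * X⁻¹ * (q ^ 2) ^ i = (q ^ (-(a + 2 * i)) * X)⁻¹ := by
    rw [mul_inv, ← zpow_neg, neg_neg, zpow_add₀ hq0, ← pow_mul, mul_right_comm]; norm_cast
  rw [this]
  exact sub_ne_zero.2 fun h => hX _ (inv_eq_one.1 h.symm)

theorem cgSum_zero (M N j k : ℕ) : cgSum q X M N 0 j k = 1 := by
  rw [cgSum, Finset.sum_eq_single_of_mem 0 (by simp)]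
  · simp [phiTerm, qPoch_zero]
  · intro i _ hi
    have : qPoch (q ^ (-2 * ((0 : ℕ) : ℤ))) (q ^ 2) i = 0 :=
      qPoch_eq_zero (i := 0) (by omega) (by simp)
    rw [phiTerm, this]
    simp only [zero_mul, zero_div]

/-- This is `contiguous_sum` with `Q = q²`. Multiplying the five parameters `c, g, d, e, f` by `q²`
amounts to lowering `M` and `j` by one and dividing `X` by `q²`. The remaining shift then keeps `s`
if it falls on `b`, and lowers `s` if it falls on `a`. The second series is written out with the
integer `s - 1`, so that `s = 0` is allowed. -/
theorem cgSum_succ_succ (hq0 : q ≠ 0) (hq : ∀ n : ℤ, n ≠ 0 → q ^ n ≠ 1)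
    (hX : ∀ n : ℤ, q ^ n * X ≠ 1) {M N s j : ℕ} (k : ℕ) (hs : s ≤ N) (hsM : s ≤ M + 1) (hj : j ≤ M) :
    cgSum q X (M + 1) N s (j + 1) k =
      contigL (q ^ (-2 * (s : ℤ))) (q ^ (2 * ((s : ℤ) - M - N - 2))) (q ^ (-2 * ((M : ℤ) + 1)))
        (q ^ (-2 * ((j : ℤ) + k + 1))) (q ^ (2 * ((j : ℤ) + k - M - N)) * X⁻¹) *
        cgSum q (X / q ^ 2) M N s j k +
      contigL (q ^ (2 * ((s : ℤ) - M - N - 2))) (q ^ (-2 * (s : ℤ))) (q ^ (-2 * ((M : ℤ) + 1)))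
        (q ^ (-2 * ((j : ℤ) + k + 1))) (q ^ (2 * ((j : ℤ) + k - M - N)) * X⁻¹) *
        (∑ i ∈ Finset.range (j + 1), phiTerm (q ^ (-2 * ((s : ℤ) - 1)))
          (q ^ (2 * ((s : ℤ) - 1 - M - N - 1)))
          (q ^ (-2 * (j : ℤ))) (q ^ (2 * ((j : ℤ) - M)) * (X / q ^ 2)⁻¹) (q ^ (-2 * (M : ℤ)))
          (q ^ (-2 * ((j : ℤ) + k))) (q ^ (2 * ((j : ℤ) + k - M - N)) * (X / q ^ 2)⁻¹) (q ^ 2) i) := by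
  have hz : ∀ a b : ℤ, a + 2 = b → q ^ a * q ^ 2 = q ^ b := by
    rintro a b rfl; rw [zpow_add₀ hq0]; norm_cast
  have hz' : ∀ a : ℤ, q ^ a * (X / q ^ 2)⁻¹ = q ^ a * X⁻¹ * q ^ 2 := by
    intro a; rw [inv_div, div_eq_mul_inv]; ring
  have h2 : ∀ a b : ℤ, a ≠ b → q ^ a ≠ q ^ b := by
    intro a b hab h
    refine hq (a - b) (sub_ne_zero.2 hab) ?_
    rw [zpow_sub₀ hq0, h, div_self (zpow_ne_zero _ hq0)]
  have key := contiguous_sum (a := q ^ (-2 * (s : ℤ))) (b := q ^ (2 * ((s : ℤ) - M - N - 2)))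
    (c := q ^ (-2 * ((j : ℤ) + 1))) (g := q ^ (2 * ((j : ℤ) - M)) * X⁻¹)
    (d := q ^ (-2 * ((M : ℤ) + 1))) (e := q ^ (-2 * ((j : ℤ) + k + 1)))
    (f := q ^ (2 * ((j : ℤ) + k - M - N)) * X⁻¹) (Q := q ^ 2)
    (by
      have : q ^ (-2 * ((M : ℤ) + 1)) * q ^ (-2 * ((j : ℤ) + k + 1)) *
          q ^ (2 * ((j : ℤ) + k - M - N)) = q ^ (-2 * (s : ℤ)) * q ^ (2 * ((s : ℤ) - M - N - 2)) *
          q ^ (-2 * ((j : ℤ) + 1)) * q ^ (2 * ((j : ℤ) - M)) * q ^ (2 : ℤ) := by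
        simp only [← zpow_add₀ hq0]; congr 1; ring
      rw [← mul_assoc, this]; norm_cast; ring)
    (zpow_ne_zero _ hq0) (zpow_ne_zero _ hq0) (h2 _ _ (by omega)) j
    (by
      rw [← pow_mul, ← zpow_natCast, ← zpow_add₀ hq0]
      have : -2 * ((j : ℤ) + 1) + ((2 * (j + 1) : ℕ) : ℤ) = 0 := by push_cast; ring
      rw [this, zpow_zero])
    (fun i hi => one_sub_zpow_mul_pow hq0 hq (by omega))
    (fun i hi => one_sub_zpow_mul_pow hq0 hq (by omega))
    (fun i hi => one_sub_zpow_mul_inv_mul_pow hq0 hX _ _)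
    (fun i hi => by
      have := one_sub_zpow_mul_pow hq0 hq (a := 2) (i := i) (by omega)
      exact_mod_cast this)
  rw [hz (2 * ((s : ℤ) - M - N - 2)) (2 * ((s : ℤ) - M - N - 1)) (by ring),
    hz (-2 * (s : ℤ)) (-2 * ((s : ℤ) - 1)) (by ring),
    hz (-2 * ((j : ℤ) + 1)) (-2 * j) (by ring), hz (-2 * ((M : ℤ) + 1)) (-2 * M) (by ring),
    hz (-2 * ((j : ℤ) + k + 1)) (-2 * (j + k)) (by ring), ← hz', ← hz'] at key
  rw [cgSum, cgSum]
  push_cast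
  rw [show 2 * ((s : ℤ) - (M + 1) - N - 1) = 2 * (s - M - N - 2) by ring,
    show -2 * ((j : ℤ) + 1 + k) = -2 * (j + k + 1) by ring,
    show (j : ℤ) + 1 - (M + 1) = j - M by ring,
    show (j : ℤ) + 1 + k - (M + 1) - N = j + k - M - N by ring,
    show 2 * ((s : ℤ) - 1 - M - N - 1) = 2 * (s - M - N - 2) by ring]
  exact key

/-- Here `j` and `k` stay fixed. The parameters in which `M` occurs together with `X` are unchanged
when `M` drops by one and `X` is multiplied by `q²`, so only `a`, `b`, `d` move and `contiguous_abd`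
applies. -/
theorem cgSum_succ_left (hq0 : q ≠ 0) (hq : ∀ n : ℤ, n ≠ 0 → q ^ n ≠ 1) {M N s j : ℕ} (k : ℕ) (hs : s ≤ N) (hsM : s ≤ M + 1) (hj : j ≤ M) :
    cgSum q X (M + 1) N s j k =
      (1 - q ^ (2 * ((s : ℤ) - M - N - 2))) * (q ^ (-2 * (s : ℤ)) - q ^ (-2 * ((M : ℤ) + 1))) /
        ((1 - q ^ (-2 * ((M : ℤ) + 1))) *
          (q ^ (-2 * (s : ℤ)) - q ^ (2 * ((s : ℤ) - M - N - 2)))) *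
        cgSum q (X * q ^ 2) M N s j k +
      (1 - q ^ (-2 * (s : ℤ))) * (q ^ (-2 * ((M : ℤ) + 1)) - q ^ (2 * ((s : ℤ) - M - N - 2))) /
        ((1 - q ^ (-2 * ((M : ℤ) + 1))) *
          (q ^ (-2 * (s : ℤ)) - q ^ (2 * ((s : ℤ) - M - N - 2)))) *
        (∑ i ∈ Finset.range (j + 1), phiTerm (q ^ (-2 * ((s : ℤ) - 1)))
          (q ^ (2 * ((s : ℤ) - 1 - M - N - 1)))
          (q ^ (-2 * (j : ℤ))) (q ^ (2 * ((j : ℤ) - M)) * (X * q ^ 2)⁻¹) (q ^ (-2 * (M : ℤ)))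
          (q ^ (-2 * ((j : ℤ) + k))) (q ^ (2 * ((j : ℤ) + k - M - N)) * (X * q ^ 2)⁻¹) (q ^ 2) i) := by
  have hz : ∀ a b : ℤ, a + 2 = b → q ^ a * q ^ 2 = q ^ b := by
    rintro a b rfl; rw [zpow_add₀ hq0]; norm_cast
  have hz' : ∀ a : ℤ, q ^ a * (X * q ^ 2)⁻¹ = q ^ (a - 2) * X⁻¹ := by
    intro a
    rw [zpow_sub₀ hq0, mul_inv, div_eq_mul_inv]; norm_cast; ring
  have h2 : ∀ a b : ℤ, a ≠ b → q ^ a ≠ q ^ b := by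
    intro a b hab h
    refine hq (a - b) (sub_ne_zero.2 hab) ?_
    rw [zpow_sub₀ hq0, h, div_self (zpow_ne_zero _ hq0)]
  have key := contiguous_abd (a := q ^ (-2 * (s : ℤ))) (b := q ^ (2 * ((s : ℤ) - M - N - 2)))
    (c := q ^ (-2 * (j : ℤ))) (g := q ^ (2 * ((j : ℤ) - M) - 2) * X⁻¹)
    (d := q ^ (-2 * ((M : ℤ) + 1))) (e := q ^ (-2 * ((j : ℤ) + k)))
    (f := q ^ (2 * ((j : ℤ) + k - M - N) - 2) * X⁻¹) (Q := q ^ 2) (h2 _ _ (by omega)) j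
    (fun i hi => one_sub_zpow_mul_pow hq0 hq (by omega))
  rw [hz (2 * ((s : ℤ) - M - N - 2)) (2 * ((s : ℤ) - M - N - 1)) (by ring),
    hz (-2 * (s : ℤ)) (-2 * ((s : ℤ) - 1)) (by ring),
    hz (-2 * ((M : ℤ) + 1)) (-2 * M) (by ring), ← hz', ← hz'] at key
  rw [cgSum, cgSum]
  push_cast
  rw [show 2 * ((s : ℤ) - (M + 1) - N - 1) = 2 * (s - M - N - 2) by ring,
    show 2 * ((j : ℤ) - (M + 1)) = 2 * (j - M) - 2 by ring,
    show 2 * ((j : ℤ) + k - (M + 1) - N) = 2 * (j + k - M - N) - 2 by ring,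
    show 2 * ((s : ℤ) - 1 - M - N - 1) = 2 * (s - M - N - 2) by ring]
  rw [← hz', ← hz']
  exact key
end rational

/-! ### Recursions for the Clebsch-Gordan coefficients in `M` -/

section rational
variable {K : Type} [Field K] {q X : K}

theorem br_zero : br q 0 = 0 := by simp [br]

theorem cgPre_shift_left (hq0 : q ≠ 0) (M N s j k : ℕ) :
    cgPre q X (M + 1) N s j k = cgPre q (X * q ^ 2) M N s j k := by
  have hz' : ∀ a : ℤ, q ^ a * (X * q ^ 2)⁻¹ = q ^ (a - 2) * X⁻¹ := by
    intro a
    rw [zpow_sub₀ hq0, mul_inv, div_eq_mul_inv]; norm_cast; ring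
  rw [cgPre, cgPre, hz', hz']
  push_cast
  rw [show 2 * ((j : ℤ) - (M + 1)) = 2 * (j - M) - 2 by ring,
    show 2 * ((j : ℤ) + k - (M + 1) - N) = 2 * (j + k - M - N) - 2 by ring]

theorem cgPre_succ (hq0 : q ≠ 0) (M N s j k : ℕ) :
    cgPre q X M N (s + 1) j k = cgPre q X M N s j k * (q ^ ((j : ℤ) + k - N) *
      (1 - q ^ (2 * ((s : ℤ) - j - k))) / (1 - q ^ (2 * ((s : ℤ) - N)))) := by
  have h1 : ∀ a : ℤ, q ^ a * (q ^ 2) ^ s = q ^ (a + 2 * s) := by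
    intro a
    rw [zpow_add₀ hq0, ← pow_mul]; norm_cast
  rw [cgPre, cgPre, qPoch_succ, qPoch_succ, h1, h1,
    show -2 * ((j : ℤ) + k) + 2 * s = 2 * (s - j - k) by ring,
    show -2 * (N : ℤ) + 2 * s = 2 * (s - N) by ring]
  have h2 : ((j : ℤ) - (s + 1 : ℕ)) * ((N : ℤ) - k) + (s + 1 : ℕ) * j =
    (((j : ℤ) - s) * ((N : ℤ) - k) + s * j) + (j + k - N) := by push_cast; ring
  rw [h2, zpow_add₀ hq0]
  simp only [div_eq_mul_inv, mul_inv]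
  ring

theorem cgPre_succ_succ (hq0 : q ≠ 0) (M N s j k : ℕ) :
    cgPre q X (M + 1) N (s + 1) (j + 1) k = cgPre q (X / q ^ 2) M N s j k *
      (q ^ ((j : ℤ) + s + 1) * (1 - q ^ (-2 * ((j : ℤ) + k + 1))) *
        (1 - q ^ (2 * ((j : ℤ) + k - M - N)) * X⁻¹) /
      ((1 - q ^ (2 * ((s : ℤ) - N))) * (1 - q ^ (2 * ((j : ℤ) - M)) * X⁻¹))) := by
  have hz' : ∀ a : ℤ, q ^ a * (X / q ^ 2)⁻¹ = q ^ a * X⁻¹ * q ^ 2 := by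
    intro a; rw [inv_div, div_eq_mul_inv]; ring
  have h1 : ∀ a : ℤ, q ^ a * (q ^ 2) ^ s = q ^ (a + 2 * s) := by
    intro a
    rw [zpow_add₀ hq0, ← pow_mul]; norm_cast
  have h3 : ∀ a : ℤ, q ^ a * q ^ 2 = q ^ (a + 2) := by
    intro a; rw [zpow_add₀ hq0]; norm_cast
  have h2 : ((j + 1 : ℕ) - (s + 1 : ℕ) : ℤ) * ((N : ℤ) - k) + (s + 1 : ℕ) * (j + 1 : ℕ) =
    (((j : ℤ) - s) * ((N : ℤ) - k) + s * j) + (j + s + 1) := by push_cast; ring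
  rw [cgPre, cgPre, h2, hz', hz', qPoch_succ' _ _ s, qPoch_succ' _ _ j, qPoch_succ _ _ s,
    qPoch_succ' _ _ j, h1, h3, zpow_add₀ hq0]
  push_cast
  rw [show -2 * ((j : ℤ) + 1 + k) + 2 = -2 * (j + k) by ring,
    show -2 * ((j : ℤ) + 1 + k) = -2 * (j + k + 1) by ring,
    show (j : ℤ) + 1 - (M + 1) = j - M by ring,
    show (j : ℤ) + 1 + k - (M + 1) - N = j + k - M - N by ring,
    show -2 * (N : ℤ) + 2 * s = 2 * (s - N) by ring]
  simp only [div_eq_mul_inv, mul_inv]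
  ring

/-- The case `s = 0` is separate because `cgPre_succ_succ` lowers `s` together with `M` and `j`. -/
theorem cgPre_zero_succ (hq0 : q ≠ 0) (M N j k : ℕ) :
    cgPre q X (M + 1) N 0 (j + 1) k = cgPre q (X / q ^ 2) M N 0 j k *
      (q ^ ((N : ℤ) - k) * (1 - q ^ (2 * ((j : ℤ) + k - M - N)) * X⁻¹) /
        (1 - q ^ (2 * ((j : ℤ) - M)) * X⁻¹)) := by
  have hz' : ∀ a : ℤ, q ^ a * (X / q ^ 2)⁻¹ = q ^ a * X⁻¹ * q ^ 2 := by
    intro a; rw [inv_div, div_eq_mul_inv]; ring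
  have h2 : ((j + 1 : ℕ) - (0 : ℕ) : ℤ) * ((N : ℤ) - k) + (0 : ℕ) * (j + 1 : ℕ) =
    (((j : ℤ) - (0 : ℕ)) * ((N : ℤ) - k) + (0 : ℕ) * j) + (N - k) := by push_cast; ring
  rw [cgPre, cgPre, h2, hz', hz', qPoch_zero, qPoch_zero, qPoch_zero, qPoch_succ' _ _ j,
    qPoch_succ' _ _ j, zpow_add₀ hq0]
  push_cast
  rw [show (j : ℤ) + 1 - (M + 1) = j - M by ring,
    show (j : ℤ) + 1 + k - (M + 1) - N = j + k - M - N by ring]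
  simp only [div_eq_mul_inv, mul_inv]
  ring

/-- The action of the recursion on `γ ⊗ x ⊗ w`. -/
theorem cgRat_succ_left (hq0 : q ≠ 0) (hq : ∀ n : ℤ, n ≠ 0 → q ^ n ≠ 1) {M N s j : ℕ} (k : ℕ)
    (hs : s ≤ N) (hsM : s ≤ M + 1) (hj : j ≤ M) :
    br q (M + 1) * br q (M + N + 2 - 2 * s) * cgRat q X (M + 1) N s j k =
      br q (M + 1 - s) * br q (M + N + 2 - s) * cgRat q (X * q ^ 2) M N s j k +
      br q s * (br q (j + k - s + 1) * cgRat q (X * q ^ 2) M N (s - 1) j k) := by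
  rw [cgRat, cgRat, cgRat, cgPre_shift_left hq0]
  -- For `s = 0` both series equal one, and the truncated index `s - 1` is harmless because of the
  -- factor `[s] = 0`.
  rcases s with _ | s
  · simp [cgSum_zero, br_zero]
  · have h2 : ∀ a b : ℤ, a ≠ b → q ^ a - q ^ b ≠ 0 := by
      intro a b hab h
      refine hq (a - b) (sub_ne_zero.2 hab) ?_
      rw [zpow_sub₀ hq0, sub_eq_zero.1 h, div_self (zpow_ne_zero _ hq0)]
    have h1 : ∀ a : ℤ, a ≠ 0 → 1 - q ^ a ≠ 0 := fun a ha => sub_ne_zero.2 (hq a ha).symm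
    have hd := h1 (-2 * ((M : ℤ) + 1)) (by omega)
    have hN := h1 (2 * ((s : ℤ) - N)) (by omega)
    have hab := h2 (-2 * ((s + 1 : ℕ) : ℤ)) (2 * (((s + 1 : ℕ) : ℤ) - M - N - 2)) (by omega)
    rw [cgSum_succ_left hq0 hq k hs hsM hj]
    have e : (((s + 1 : ℕ) : ℤ) - 1) = (s : ℤ) := by push_cast; ring
    rw [e, ← cgSum, cgPre_succ hq0, Nat.add_sub_cancel]
    generalize cgSum q (X * q ^ 2) M N (s + 1) j k = S1
    generalize cgSum q (X * q ^ 2) M N s j k = S2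
    generalize cgPre q (X * q ^ 2) M N s j k = C
    -- `i1` and `i2` compare the coefficients of the two series on the right of the contiguous
    -- relation.
    have i1 : br q (M + 1) * br q (M + N + 2 - 2 * (s + 1 : ℕ)) *
        ((1 - q ^ (2 * (((s + 1 : ℕ) : ℤ) - M - N - 2))) *
          (q ^ (-2 * ((s + 1 : ℕ) : ℤ)) - q ^ (-2 * ((M : ℤ) + 1)))) =
        br q (M + 1 - (s + 1 : ℕ)) * br q (M + N + 2 - (s + 1 : ℕ)) *
        ((1 - q ^ (-2 * ((M : ℤ) + 1))) *
          (q ^ (-2 * ((s + 1 : ℕ) : ℤ)) - q ^ (2 * (((s + 1 : ℕ) : ℤ) - M - N - 2)))) := by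
      push_cast
      simp only [br, mul_add, mul_sub, neg_add, neg_sub, neg_mul, zpow_add₀ hq0, zpow_sub₀ hq0,
        zpow_neg, zpow_two_mul_eq, zpow_natCast, zpow_one, mul_one]
      field_simp
    have i2 : br q (M + 1) * br q (M + N + 2 - 2 * (s + 1 : ℕ)) *
        ((1 - q ^ (-2 * ((s + 1 : ℕ) : ℤ))) *
          (q ^ (-2 * ((M : ℤ) + 1)) - q ^ (2 * (((s + 1 : ℕ) : ℤ) - M - N - 2)))) *
        (q ^ ((j : ℤ) + k - N) * (1 - q ^ (2 * ((s : ℤ) - j - k)))) =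
        br q (s + 1 : ℕ) * br q (j + k - (s + 1 : ℕ) + 1) * (1 - q ^ (2 * ((s : ℤ) - N))) *
        ((1 - q ^ (-2 * ((M : ℤ) + 1))) *
          (q ^ (-2 * ((s + 1 : ℕ) : ℤ)) - q ^ (2 * (((s + 1 : ℕ) : ℤ) - M - N - 2)))) := by
      push_cast
      simp only [br, mul_add, mul_sub, neg_add, neg_sub, neg_mul, zpow_add₀ hq0, zpow_sub₀ hq0,
        zpow_neg, zpow_two_mul_eq, zpow_natCast, zpow_one, mul_one]
      field_simp
    field_simp
    linear_combination (C * S1 * q ^ ((j : ℤ) + k - N) * (1 - q ^ (2 * ((s : ℤ) - j - k)))) * i1 + C * S2 * i2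

/-- The bookkeeping of `cgRat_succ_succ` with every factor replaced by a letter: once the
coefficients of `S1` and `S2` agree separately, so do the combinations. This keeps the powers of `q`
out of the division algebra. -/
theorem contiguous_coeff {B A1 r e f n g a b d u v P1 P2 S1 S2 B' A2 t B₂ E C x : K} (hx : x ≠ 0)
    (hn : n ≠ 0) (hg : g ≠ 0) (hd : d ≠ 0) (he : e ≠ 0) (hf : f ≠ 0) (ha : a ≠ 0) (hb : b ≠ 0)
    (hu : u ≠ 0) (hv : v ≠ 0) (i1 : B * A1 * r * P1 = B' * A2 * t * g * (a * d * u))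
    (i2 : B * A1 * r * P2 = B₂ * E * n * g * (b * d * v)) :
    B * (A1 / x * (C * (r * e * f / (n * g)) *
      (P1 / (a * (d * e * f) * u) * S1 + P2 / (b * (d * e * f) * v) * S2))) =
    B' * (A2 / x * (C * (t / n) * S1)) + B₂ * (E / x * (C * S2)) := by
  field_simp
  linear_combination (C * b * v * S1) * i1 + (C * a * u * S2) * i2

/-- The action of the recursion on `α ⊗ x ⊗ w`. -/
theorem cgRat_succ_succ (hq0 : q ≠ 0) (hq : ∀ n : ℤ, n ≠ 0 → q ^ n ≠ 1) (hX0 : X ≠ 0)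
    (hX : ∀ n : ℤ, q ^ n * X ≠ 1) {M N s j : ℕ} (k : ℕ)
    (hs : s ≤ N) (hsM : s ≤ M + 1) (hj : j ≤ M) :
    br q (M + 1) * br q (M + N + 2 - 2 * s) *
        (aFun q X (M - j) * cgRat q X (M + 1) N s (j + 1) k) =
      br q (M + 1 - s) * br q (M + N + 2 - s) *
        (aFun q X (M + N - s - j - k) * cgRat q (X / q ^ 2) M N s j k) +
      br q s * (eFun q X (M + N + 2 - 2 * s) (j + k - s + 1) *
        cgRat q (X / q ^ 2) M N (s - 1) j k) := by
  have hX1 : X - 1 ≠ 0 := sub_ne_zero.2 (by simpa using hX 0)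
  have hg : 1 - q ^ (2 * ((j : ℤ) - M)) * X⁻¹ ≠ 0 := by
    simpa using one_sub_zpow_mul_inv_mul_pow hq0 hX (2 * ((j : ℤ) - M)) 0
  have hf : 1 - q ^ (2 * ((j : ℤ) + k - M - N)) * X⁻¹ ≠ 0 := by
    simpa using one_sub_zpow_mul_inv_mul_pow hq0 hX (2 * ((j : ℤ) + k - M - N)) 0
  rw [cgRat, cgRat, cgRat]
  rcases s with _ | s
  · rw [cgSum_zero, cgSum_zero, cgPre_zero_succ hq0]
    generalize cgPre q (X / q ^ 2) M N 0 j k = C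
    have i1 : (q ^ (-((M : ℤ) - j)) * (q ^ (2 * ((M : ℤ) - j)) * X - 1)) * (q ^ ((N : ℤ) - k) *
        (1 - q ^ (2 * ((j : ℤ) + k - M - N)) * X⁻¹)) =
        (q ^ (-((M : ℤ) + N - j - k)) * (q ^ (2 * ((M : ℤ) + N - j - k)) * X - 1)) *
        (1 - q ^ (2 * ((j : ℤ) - M)) * X⁻¹) := by
      simp only [mul_add, mul_sub, neg_add, neg_sub, neg_mul, zpow_add₀ hq0, zpow_sub₀ hq0,
        zpow_neg, zpow_two_mul_eq, zpow_natCast, zpow_one, mul_one]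
      field_simp
    simp only [Nat.cast_zero, br_zero, mul_zero, zero_mul, add_zero, sub_zero, mul_one, aFun]
    generalize 1 - q ^ (2 * ((j : ℤ) - M)) * X⁻¹ = g at hg i1 ⊢
    generalize 1 - q ^ (2 * ((j : ℤ) + k - M - N)) * X⁻¹ = f at i1 ⊢
    field_simp
    linear_combination (br q (M + 1) * br q (M + N + 2) * C) * i1
  · have h2 : ∀ a b : ℤ, a ≠ b → q ^ a - q ^ b ≠ 0 := by
      intro a b hab h
      refine hq (a - b) (sub_ne_zero.2 hab) ?_
      rw [zpow_sub₀ hq0, sub_eq_zero.1 h, div_self (zpow_ne_zero _ hq0)]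
    have h1 : ∀ a : ℤ, a ≠ 0 → 1 - q ^ a ≠ 0 := fun a ha => sub_ne_zero.2 (hq a ha).symm
    have hd := h1 (-2 * ((M : ℤ) + 1)) (by omega)
    have he := h1 (-2 * ((j : ℤ) + k + 1)) (by omega)
    have hN := h1 (2 * ((s : ℤ) - N)) (by omega)
    have hab := h2 (-2 * ((s + 1 : ℕ) : ℤ)) (2 * (((s + 1 : ℕ) : ℤ) - M - N - 2)) (by omega)
    have hba := h2 (2 * (((s + 1 : ℕ) : ℤ) - M - N - 2)) (-2 * ((s + 1 : ℕ) : ℤ)) (by omega)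
    rw [cgSum_succ_succ hq0 hq hX k hs hsM hj]
    have e : (((s + 1 : ℕ) : ℤ) - 1) = (s : ℤ) := by push_cast; ring
    rw [e, ← cgSum, cgPre_succ_succ hq0, cgPre_succ hq0, Nat.add_sub_cancel]
    generalize cgSum q (X / q ^ 2) M N (s + 1) j k = S1
    generalize cgSum q (X / q ^ 2) M N s j k = S2
    generalize cgPre q (X / q ^ 2) M N s j k = C
    rw [contigL, contigL]
    -- The coefficients of the series with `s + 1` and, in `i2`, of the series with `s`; both are
    -- identities between monomials and factors `1 - q^n`.
    have i1 : br q (M + 1) * br q (M + N + 2 - 2 * (s + 1 : ℕ)) *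
        (q ^ (-((M : ℤ) - j)) * (q ^ (2 * ((M : ℤ) - j)) * X - 1)) * q ^ ((j : ℤ) + s + 1) *
        ((1 - q ^ (2 * (((s + 1 : ℕ) : ℤ) - M - N - 2))) *
          ((q ^ (-2 * ((s + 1 : ℕ) : ℤ)) - q ^ (-2 * ((M : ℤ) + 1))) *
          (q ^ (-2 * ((s + 1 : ℕ) : ℤ)) - q ^ (-2 * ((j : ℤ) + k + 1))) *
          (q ^ (-2 * ((s + 1 : ℕ) : ℤ)) - q ^ (2 * ((j : ℤ) + k - M - N)) * X⁻¹))) =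
        br q (M + 1 - (s + 1 : ℕ)) * br q (M + N + 2 - (s + 1 : ℕ)) *
        (q ^ (-((M : ℤ) + N - (s + 1 : ℕ) - j - k)) *
          (q ^ (2 * ((M : ℤ) + N - (s + 1 : ℕ) - j - k)) * X - 1)) *
        (q ^ ((j : ℤ) + k - N) * (1 - q ^ (2 * ((s : ℤ) - j - k)))) *
        (1 - q ^ (2 * ((j : ℤ) - M)) * X⁻¹) *
        (q ^ (-2 * ((s + 1 : ℕ) : ℤ)) * (1 - q ^ (-2 * ((M : ℤ) + 1))) *
          (q ^ (-2 * ((s + 1 : ℕ) : ℤ)) - q ^ (2 * (((s + 1 : ℕ) : ℤ) - M - N - 2)))) := by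
      push_cast
      simp only [br, mul_add, mul_sub, neg_add, neg_sub, neg_mul, zpow_add₀ hq0, zpow_sub₀ hq0,
        zpow_neg, zpow_two_mul_eq, zpow_natCast, zpow_one, mul_one]
      field_simp
    have i2 : br q (M + 1) * br q (M + N + 2 - 2 * (s + 1 : ℕ)) *
        (q ^ (-((M : ℤ) - j)) * (q ^ (2 * ((M : ℤ) - j)) * X - 1)) * q ^ ((j : ℤ) + s + 1) *
        ((1 - q ^ (-2 * ((s + 1 : ℕ) : ℤ))) *
          ((q ^ (2 * (((s + 1 : ℕ) : ℤ) - M - N - 2)) - q ^ (-2 * ((M : ℤ) + 1))) *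
          (q ^ (2 * (((s + 1 : ℕ) : ℤ) - M - N - 2)) - q ^ (-2 * ((j : ℤ) + k + 1))) *
          (q ^ (2 * (((s + 1 : ℕ) : ℤ) - M - N - 2)) -
            q ^ (2 * ((j : ℤ) + k - M - N)) * X⁻¹))) =
        br q (s + 1 : ℕ) * (-br q (M + N + 2 - 2 * (s + 1 : ℕ) - (j + k - (s + 1 : ℕ) + 1)) *
          q ^ (((j : ℤ) + k - (s + 1 : ℕ) + 1) + 1) *
          (q ^ (-2 * (((j : ℤ) + k - (s + 1 : ℕ) + 1) + 1)) * X - 1)) *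
        (1 - q ^ (2 * ((s : ℤ) - N))) * (1 - q ^ (2 * ((j : ℤ) - M)) * X⁻¹) *
        (q ^ (2 * (((s + 1 : ℕ) : ℤ) - M - N - 2)) * (1 - q ^ (-2 * ((M : ℤ) + 1))) *
          (q ^ (2 * (((s + 1 : ℕ) : ℤ) - M - N - 2)) - q ^ (-2 * ((s + 1 : ℕ) : ℤ)))) := by
      push_cast
      simp only [br, mul_add, mul_sub, neg_add, neg_sub, neg_mul, zpow_add₀ hq0, zpow_sub₀ hq0,
        zpow_neg, zpow_two_mul_eq, zpow_natCast, zpow_one, mul_one]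
      field_simp
      ring
    exact contiguous_coeff hX1 hN hg hd he hf (zpow_ne_zero _ hq0) (zpow_ne_zero _ hq0) hab hba i1 i2
end rational

/-! ### Nonvanishing of the factors, and vanishing of the coefficients outside the range of weights
-/

section rational
variable {K : Type} [Field K] {q X : K}

theorem zpow_mul_div_sq_ne_one (hq0 : q ≠ 0) (hX : ∀ n : ℤ, q ^ n * X ≠ 1) (n : ℤ) :
    q ^ n * (X / q ^ 2) ≠ 1 := by
  have := hX (n - 2)
  rw [zpow_sub₀ hq0] at this
  rwa [← mul_div_assoc, ← div_mul_eq_mul_div, show q ^ 2 = q ^ (2 : ℤ) by norm_cast]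

theorem zpow_mul_mul_sq_ne_one (hq0 : q ≠ 0) (hX : ∀ n : ℤ, q ^ n * X ≠ 1) (n : ℤ) :
    q ^ n * (X * q ^ 2) ≠ 1 := by
  have := hX (n + 2)
  rw [zpow_add₀ hq0] at this
  rwa [mul_comm X, ← mul_assoc, show q ^ 2 = q ^ (2 : ℤ) by norm_cast]

theorem one_sub_zpow_ne_zero (hq : ∀ n : ℤ, n ≠ 0 → q ^ n ≠ 1) {n : ℤ} (hn : n ≠ 0) :
    1 - q ^ n ≠ 0 := sub_ne_zero.2 (hq n hn).symm

theorem br_ne_zero (hq0 : q ≠ 0) (hq : ∀ n : ℤ, n ≠ 0 → q ^ n ≠ 1) {n : ℤ} (hn : n ≠ 0) :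
    br q n ≠ 0 := by
  intro h
  refine hq (n - -n) (by omega) ?_
  rw [zpow_sub₀ hq0, sub_eq_zero.1 h, div_self (zpow_ne_zero _ hq0)]

theorem aFun_ne_zero (hq0 : q ≠ 0) (hX : ∀ n : ℤ, q ^ n * X ≠ 1) (i : ℤ) : aFun q X i ≠ 0 :=
  div_ne_zero (mul_ne_zero (zpow_ne_zero _ hq0) (sub_ne_zero.2 (hX _)))
    (sub_ne_zero.2 (by simpa using hX 0))

/-- The prefactor contains `(q^{-2(j+k)}; q²)_s`, which has a zero factor when `s > j + k`. -/
theorem cgRat_eq_zero_of_lt (hq0 : q ≠ 0) (M N : ℕ) {s j k : ℕ} (h : j + k < s) :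
    cgRat q X M N s j k = 0 := by
  have : qPoch (q ^ (-2 * ((j : ℤ) + k))) (q ^ 2) s = 0 := by
    refine qPoch_eq_zero h ?_
    rw [← pow_mul, ← zpow_natCast, ← zpow_add₀ hq0]
    have : -2 * ((j : ℤ) + k) + ((2 * (j + k) : ℕ) : ℤ) = 0 := by push_cast; ring
    rw [this, zpow_zero]
  rw [cgRat, cgPre, this]; simp

/-- Above the top weight no factor vanishes visibly, and it is the series that is zero. The `α`
recursion proves it by induction on `M`: every term on its right vanishes by induction or through
its coefficient, and the coefficient on the left is nonzero. -/
theorem cgRat_eq_zero_of_gt (hq0 : q ≠ 0) (hq : ∀ n : ℤ, n ≠ 0 → q ^ n ≠ 1) {M N s j k : ℕ}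
    (hX0 : X ≠ 0) (hX : ∀ n : ℤ, q ^ n * X ≠ 1)
    (hsM : s ≤ M) (hsN : s ≤ N) (hj : j ≤ M) (hk : k ≤ N) (h : M + N < j + k + s) :
    cgRat q X M N s j k = 0 := by
  induction M generalizing s j X with
  | zero => omega
  | succ M ih =>
    rcases j with _ | j
    · omega
    have hX' := zpow_mul_div_sq_ne_one hq0 hX
    have hX0' : X / q ^ 2 ≠ 0 := div_ne_zero hX0 (pow_ne_zero _ hq0)
    have key := cgRat_succ_succ hq0 hq hX0 hX (M := M) (N := N) (s := s) (j := j) k hsN hsM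
      (by omega)
    have h1 : br q (M + 1 - s) * br q (M + N + 2 - s) *
        (aFun q X (M + N - s - j - k) * cgRat q (X / q ^ 2) M N s j k) = 0 := by
      -- For `s = M + 1` the induction hypothesis is not available, but then `[M+1-s] = 0`.
      rcases hsM.eq_or_lt with hs | hs
      · subst hs
        push_cast
        rw [sub_self, br_zero, zero_mul, zero_mul]
      · rw [ih hX0' hX' (by omega) hsN (by omega) (by omega), mul_zero, mul_zero]
    have h2 : br q s * (eFun q X (M + N + 2 - 2 * s) (j + k - s + 1) *
        cgRat q (X / q ^ 2) M N (s - 1) j k) = 0 := by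
      rcases Nat.eq_zero_or_pos s with hs | hs
      · subst hs
        simp [br_zero]
      -- Just above the top weight the induction hypothesis does not cover `s - 1`; there `eFun` has
      -- both arguments equal and contains the factor `[0]`.
      · rcases (show M + N + 1 ≤ j + k + s by omega).eq_or_lt with h' | h'
        · have : eFun q X (M + N + 2 - 2 * s) (j + k - s + 1) = 0 := by
            have e : (M : ℤ) + N + 2 - 2 * s - (j + k - s + 1) = 0 := by omega
            rw [eFun, e, br_zero]; simp
          rw [this, zero_mul, mul_zero]
        · rw [ih hX0' hX' (by omega) (by omega) (by omega) (by omega), mul_zero, mul_zero]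
    rw [h1, h2, add_zero] at key
    have hb := mul_ne_zero (br_ne_zero hq0 hq (n := M + 1) (by omega))
      (br_ne_zero hq0 hq (n := (M : ℤ) + N + 2 - 2 * s) (by omega))
    have := (mul_eq_zero.1 key).resolve_left hb
    exact (mul_eq_zero.1 this).resolve_left (aFun_ne_zero hq0 hX _)

theorem cgRat_zero_left (N k : ℕ) : cgRat q X 0 N 0 0 k = 1 := by
  rw [cgRat, cgSum_zero, cgPre]
  simp [qPoch_zero]

/-! ### Orthogonality -/

variable (q X) in
/-- The normalizing functions, extended by zero, as functions of `X = q^{2(λ+1)}`. -/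
def normRat (N : ℕ) (k : ℤ) : K :=
  if 0 ≤ k ∧ k ≤ N then
    qBinom (q ^ 2) N k.toNat * qPoch (q ^ (2 * (k - N)) * X⁻¹) (q ^ 2) k.toNat /
      qPoch (q ^ 2 * X⁻¹) (q ^ 2) k.toNat
  else 0

theorem qPoch_self_ne_zero (hq : ∀ n : ℤ, n ≠ 0 → q ^ n ≠ 1) (n : ℕ) :
    qPoch (q ^ 2) (q ^ 2) n ≠ 0 := by
  refine qPoch_ne_zero fun i _ h => hq (2 * (i + 1)) (by omega) ?_
  rw [← pow_succ', ← pow_mul] at h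
  exact_mod_cast h

theorem qPoch_mul_inv_ne_zero (hq0 : q ≠ 0) (hX : ∀ n : ℤ, q ^ n * X ≠ 1) (a : ℤ) (n : ℕ) :
    qPoch (q ^ a * X⁻¹) (q ^ 2) n ≠ 0 :=
  qPoch_ne_zero fun i _ h => one_sub_zpow_mul_inv_mul_pow hq0 hX a i (by rw [h, sub_self])

/-- A quotient of two products, stated without division so that it remains true at the ends: at `k =
M + 1` the left weight is zero by convention and the right side has the factor `1 - q^0`. In
`normRat_div_sq` the same happens at `k = 0`. These two ratios reduce each relation between weights
to a rational identity. -/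
theorem normRat_mul_sq (hq0 : q ≠ 0) (hq : ∀ n : ℤ, n ≠ 0 → q ^ n ≠ 1)
    (hX : ∀ n : ℤ, q ^ n * X ≠ 1) (M : ℕ) (k : ℤ) :
    normRat q (X * q ^ 2) M k * ((1 - q ^ (2 * ((M : ℤ) + 1))) * (1 - X⁻¹)) =
      normRat q X (M + 1) k * ((1 - q ^ (2 * ((M : ℤ) + 1 - k))) * (1 - q ^ (2 * k) * X⁻¹)) := by
  by_cases h1 : 0 ≤ k ∧ k ≤ (M + 1 : ℕ)
  swap
  · rw [normRat, normRat, if_neg h1, if_neg (by omega), zero_mul, zero_mul]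
  by_cases h2 : k ≤ M
  swap
  · have : (M : ℤ) + 1 - k = 0 := by omega
    rw [normRat, if_neg (by omega), this]; simp
  rw [normRat, normRat, if_pos h1, if_pos (by omega)]
  obtain ⟨k, rfl⟩ := Int.eq_ofNat_of_zero_le h1.1
  simp only [Int.toNat_natCast]
  have hk : k ≤ M := by omega
  have e1 : q ^ (2 * ((k : ℤ) - (M + 1 : ℕ))) * X⁻¹ = q ^ (2 * ((k : ℤ) - M)) * (X * q ^ 2)⁻¹ := by
    have : 2 * ((k : ℤ) - (M + 1 : ℕ)) = 2 * (k - M) - 2 := by push_cast; ring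
    rw [this, zpow_sub₀ hq0, mul_inv, div_eq_mul_inv]; norm_cast; ring
  have e2 : q ^ 2 * (X * q ^ 2)⁻¹ = X⁻¹ := by
    rw [mul_inv]; field_simp
  rw [e1, e2, qBinom, qBinom]
  have hx := qPoch_mul_inv_ne_zero hq0 hX 0 k
  have hx' := qPoch_mul_inv_ne_zero hq0 hX 2 k
  have e3 : qPoch (q ^ 2 * X⁻¹) (q ^ 2) k * (1 - X⁻¹) =
      qPoch X⁻¹ (q ^ 2) k * (1 - q ^ (2 * (k : ℤ)) * X⁻¹) := by
    have h1 := qPoch_succ X⁻¹ (q ^ 2) k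
    rw [qPoch_succ', mul_comm X⁻¹] at h1
    rw [mul_comm, h1, ← pow_mul]; norm_cast; ring
  have e4 : qPoch (q ^ 2) (q ^ 2) (M + 1) =
      qPoch (q ^ 2) (q ^ 2) M * (1 - q ^ (2 * ((M : ℤ) + 1))) := by
    rw [qPoch_succ, ← pow_succ', ← pow_mul]; norm_cast
  have e5 : qPoch (q ^ 2) (q ^ 2) (M + 1 - k) =
      qPoch (q ^ 2) (q ^ 2) (M - k) * (1 - q ^ (2 * ((M : ℤ) + 1 - k))) := by
    rw [Nat.succ_sub hk, qPoch_succ, ← pow_succ', ← pow_mul]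
    have : 2 * ((M : ℤ) + 1 - k) = (2 * (M - k + 1) : ℕ) := by omega
    rw [this, zpow_natCast]
  rw [e4, e5]
  have n1 := qPoch_self_ne_zero hq k
  have n2 := qPoch_self_ne_zero hq (M - k)
  have n3 := one_sub_zpow_ne_zero hq (n := 2 * ((M : ℤ) + 1 - k)) (by omega)
  rw [zpow_zero, one_mul] at hx
  have hx'' : qPoch (q ^ 2 * X⁻¹) (q ^ 2) k ≠ 0 := by exact_mod_cast hx'
  generalize qPoch (q ^ (2 * ((k : ℤ) - M)) * (X * q ^ 2)⁻¹) (q ^ 2) k = A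
  generalize qPoch (q ^ 2) (q ^ 2) k = B at *
  generalize qPoch (q ^ 2) (q ^ 2) (M - k) = C at *
  generalize qPoch (q ^ 2) (q ^ 2) M = D at *
  generalize qPoch (q ^ 2 * X⁻¹) (q ^ 2) k = E at *
  generalize qPoch X⁻¹ (q ^ 2) k = F at *
  generalize 1 - q ^ (2 * ((M : ℤ) + 1 - k)) = u at *
  generalize 1 - q ^ (2 * ((M : ℤ) + 1)) = v at *
  generalize 1 - q ^ (2 * (k : ℤ)) * X⁻¹ = w at *
  generalize 1 - X⁻¹ = x at *
  field_simp
  linear_combination (D * A * v) * e3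

theorem normRat_div_sq (hq0 : q ≠ 0) (hq : ∀ n : ℤ, n ≠ 0 → q ^ n ≠ 1)
    (hX : ∀ n : ℤ, q ^ n * X ≠ 1) (M : ℕ) (k : ℤ) :
    normRat q (X / q ^ 2) M (k - 1) *
        ((1 - q ^ (2 * ((M : ℤ) + 1))) * (1 - q ^ (2 * (k - M - 1)) * X⁻¹)) =
      normRat q X (M + 1) k * ((1 - q ^ (2 * k)) * (1 - q ^ 2 * X⁻¹)) := by
  by_cases h1 : 0 ≤ k ∧ k ≤ (M + 1 : ℕ)
  swap
  · rw [normRat, normRat, if_neg h1, if_neg (by omega), zero_mul, zero_mul]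
  by_cases h2 : 1 ≤ k
  swap
  · have : k = 0 := by omega
    subst this
    rw [normRat, if_neg (by omega)]; simp
  rw [normRat, normRat, if_pos h1, if_pos (by omega)]
  obtain ⟨k, rfl⟩ : ∃ n : ℕ, k = n + 1 := ⟨(k - 1).toNat, by omega⟩
  have hk : k ≤ M := by omega
  have t1 : ((k : ℤ) + 1 - 1).toNat = k := by omega
  have t2 : ((k : ℤ) + 1).toNat = k + 1 := by omega
  rw [t1, t2]
  have e1 : q ^ (2 * ((k : ℤ) + 1 - 1 - M)) * (X / q ^ 2)⁻¹ =
      q ^ (2 * ((k : ℤ) + 1 - (M + 1 : ℕ))) * X⁻¹ * q ^ 2 := by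
    have : 2 * ((k : ℤ) + 1 - (M + 1 : ℕ)) = 2 * (k + 1 - 1 - M) := by push_cast; ring
    rw [this, inv_div, div_eq_mul_inv]; ring
  have e2 : q ^ 2 * (X / q ^ 2)⁻¹ = q ^ 2 * X⁻¹ * q ^ 2 := by
    rw [inv_div, div_eq_mul_inv]; ring
  have e6 : (k : ℤ) + 1 - M - 1 = k + 1 - (M + 1 : ℕ) := by push_cast; ring
  rw [e1, e2, e6, qBinom, qBinom, qPoch_succ' (q ^ (2 * ((k : ℤ) + 1 - (M + 1 : ℕ))) * X⁻¹),
    qPoch_succ' (q ^ 2 * X⁻¹)]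
  have e4 : ∀ n : ℕ, qPoch (q ^ 2) (q ^ 2) (n + 1) =
      qPoch (q ^ 2) (q ^ 2) n * (1 - q ^ (2 * ((n : ℤ) + 1))) := by
    intro n
    rw [qPoch_succ, ← pow_succ', ← pow_mul]; norm_cast
  rw [e4, e4, Nat.add_sub_add_right]
  have n1 := qPoch_self_ne_zero hq k
  have n2 := qPoch_self_ne_zero hq (M - k)
  have n3 := one_sub_zpow_ne_zero hq (n := 2 * ((k : ℤ) + 1)) (by omega)
  have n4 := qPoch_mul_inv_ne_zero hq0 (zpow_mul_div_sq_ne_one hq0 hX) 2 k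
  have n5 := one_sub_zpow_mul_inv_mul_pow hq0 hX 2 0
  have n4' : qPoch (q ^ 2 * X⁻¹ * q ^ 2) (q ^ 2) k ≠ 0 := by
    rw [← e2]; exact_mod_cast n4
  have n5' : 1 - q ^ 2 * X⁻¹ ≠ 0 := by
    rw [pow_zero, mul_one] at n5; exact_mod_cast n5
  generalize qPoch (q ^ (2 * ((k : ℤ) + 1 - (M + 1 : ℕ))) * X⁻¹ * q ^ 2) (q ^ 2) k = A
  generalize qPoch (q ^ 2) (q ^ 2) k = B at *
  generalize qPoch (q ^ 2) (q ^ 2) (M - k) = C at *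
  generalize qPoch (q ^ 2) (q ^ 2) M = D at *
  generalize qPoch (q ^ 2 * X⁻¹ * q ^ 2) (q ^ 2) k = E at *
  generalize 1 - q ^ (2 * ((k : ℤ) + 1)) = u at *
  generalize 1 - q ^ (2 * ((M : ℤ) + 1)) = v at *
  generalize 1 - q ^ (2 * ((k : ℤ) + 1 - (M + 1 : ℕ))) * X⁻¹ = w at *
  generalize 1 - q ^ 2 * X⁻¹ = x at *
  field_simp

end rational

/-! ### Recursions for the weights and for the norms -/

section rational
variable {K : Type} [Field K] {q X : K}

theorem sub_one_ne_zero_of_zpow (hX : ∀ n : ℤ, q ^ n * X ≠ 1) : X - 1 ≠ 0 :=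
  sub_ne_zero.2 (by simpa using hX 0)

theorem sub_sq_ne_zero_of_zpow (hq0 : q ≠ 0) (hX : ∀ n : ℤ, q ^ n * X ≠ 1) : X - q ^ 2 ≠ 0 := by
  have h := hX (-2)
  rw [sub_ne_zero]
  rintro rfl
  apply h
  rw [zpow_neg, zpow_ofNat]
  exact inv_mul_cancel₀ (pow_ne_zero 2 hq0)

theorem sub_zpow_ne_zero (hq0 : q ≠ 0) (hX : ∀ n : ℤ, q ^ n * X ≠ 1) (n : ℤ) : X - q ^ n ≠ 0 := by
  have h := hX (-n)
  rw [sub_ne_zero]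
  rintro rfl
  apply h
  rw [zpow_neg]
  exact inv_mul_cancel₀ (zpow_ne_zero _ hq0)

theorem one_sub_mul_inv_ne_zero (hX0 : X ≠ 0) {a : K} (h : X - a ≠ 0) : 1 - a * X⁻¹ ≠ 0 := by
  have : 1 - a * X⁻¹ = (X - a) * X⁻¹ := by rw [sub_mul, mul_inv_cancel₀ hX0]
  rw [this]
  exact mul_ne_zero h (inv_ne_zero hX0)

/-- This says that `m : V_1 ⊗ V_M → V_{M+1}` has norm one for the weights. Its component at `v_k`
receives `γ v_k` with coefficient one and `α v_{k-1}` with coefficient `aFun (M + 1 - k)`, while `(X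
- 1)/(X - q²)` is the weight `Γ^1_1` of `α` in `V_1` and `γ` has weight one. -/
theorem normRat_succ (hq0 : q ≠ 0) (hq : ∀ n : ℤ, n ≠ 0 → q ^ n ≠ 1) (hX0 : X ≠ 0)
    (hX : ∀ n : ℤ, q ^ n * X ≠ 1) (M : ℕ) (k : ℤ) :
    normRat q X (M + 1) k = normRat q (X * q ^ 2) M k +
      (X - 1) / (X - q ^ 2) * aFun q X (M + 1 - k) ^ 2 * normRat q (X / q ^ 2) M (k - 1) := by
  have h1 := normRat_mul_sq hq0 hq hX M k
  have h2 := normRat_div_sq hq0 hq hX M k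
  have n1 := one_sub_zpow_ne_zero hq (n := 2 * ((M : ℤ) + 1)) (by omega)
  have x1 := sub_one_ne_zero_of_zpow hX
  have x2 := sub_sq_ne_zero_of_zpow hq0 hX
  have x3 := sub_zpow_ne_zero hq0 hX (2 * (k - M - 1))
  have n2 : 1 - X⁻¹ ≠ 0 := by simpa using one_sub_mul_inv_ne_zero hX0 x1
  have n3 := one_sub_mul_inv_ne_zero hX0 x3
  rw [← eq_div_iff (mul_ne_zero n1 n2)] at h1
  rw [← eq_div_iff (mul_ne_zero n1 n3)] at h2
  rw [h1, h2, aFun]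
  generalize normRat q X (M + 1) k = g
  simp only [mul_add (2 : ℤ), mul_sub (2 : ℤ), neg_add, neg_sub, neg_mul, zpow_add₀ hq0, zpow_sub₀ hq0, zpow_neg,
    zpow_two_mul_eq, zpow_natCast, zpow_one, mul_one] at n1 n3 x3 ⊢
  have a0 : q ^ M ≠ 0 := pow_ne_zero _ hq0
  have b0 : q ^ k ≠ 0 := zpow_ne_zero _ hq0
  -- With the exponents split, only `q`, `X`, `q^M` and `q^k` remain, and the claim is an identity
  -- of rational functions in four variables.
  generalize q ^ M = a at *
  generalize q ^ k = b at *
  have e2 : q ^ (2 : ℤ) = q ^ 2 := by norm_cast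
  simp only [e2] at n1 n3 x3 ⊢
  have n1' : 1 - a ^ 2 * q ^ 2 ≠ 0 := n1
  have x3' : X * a ^ 2 * q ^ 2 - b ^ 2 ≠ 0 := by
    intro h
    apply x3
    field_simp
    linear_combination h
  have n2' : 1 - 1 / X ≠ 0 := by simpa using n2
  have n3' : 1 - b ^ 2 / a ^ 2 / q ^ 2 * X⁻¹ = (X * a ^ 2 * q ^ 2 - b ^ 2) / (a ^ 2 * q ^ 2 * X) := by
    field_simp
  have n4' : 1 - X⁻¹ = (X - 1) / X := by field_simp
  have n5' : 1 - q ^ 2 * X⁻¹ = (X - q ^ 2) / X := by field_simp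
  have n6' : 1 - b ^ 2 * X⁻¹ = (X - b ^ 2) / X := by field_simp
  rw [n3', n4', n5', n6']
  field_simp
  ring

/-- The map `e : V_1 ⊗ V_{P+1} → V_P` has the constant norm `q⁻¹ [P+2][P+1]`: its component at `v_p`
receives `γ v_{p+1}` with coefficient `[p+1]` and `α v_p` with coefficient `eFun`. -/
theorem normRat_reduce (hq0 : q ≠ 0) (hq : ∀ n : ℤ, n ≠ 0 → q ^ n ≠ 1) (hX0 : X ≠ 0)
    (hX : ∀ n : ℤ, q ^ n * X ≠ 1) (P : ℕ) (p : ℤ) :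
    q⁻¹ * br q (P + 2) * br q (P + 1) * normRat q X P p =
      br q (p + 1) ^ 2 * normRat q (X * q ^ 2) (P + 1) (p + 1) +
      (X - 1) / (X - q ^ 2) * eFun q X (P + 1) p ^ 2 * normRat q (X / q ^ 2) (P + 1) p := by
  have h1 := normRat_mul_sq hq0 hq hX (P + 1) (p + 1)
  have h2 := normRat_div_sq hq0 hq hX (P + 1) (p + 1)
  have h3 := normRat_mul_sq hq0 hq (zpow_mul_div_sq_ne_one hq0 hX) P p
  rw [add_sub_cancel_right] at h2
  have n1 := one_sub_zpow_ne_zero hq (n := 2 * ((P : ℤ) + 1)) (by omega)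
  have n1' := one_sub_zpow_ne_zero hq (n := 2 * (((P + 1 : ℕ) : ℤ) + 1)) (by omega)
  have x1 := sub_one_ne_zero_of_zpow hX
  have x2 := sub_sq_ne_zero_of_zpow hq0 hX
  have x3 := sub_zpow_ne_zero hq0 hX (2 * (p + 1 - (P + 1 : ℕ) - 1))
  have n2 : 1 - X⁻¹ ≠ 0 := by simpa using one_sub_mul_inv_ne_zero hX0 x1
  have n2' := one_sub_mul_inv_ne_zero hX0 x2
  have n3 := one_sub_mul_inv_ne_zero hX0 x3
  have e : 1 - (X / q ^ 2)⁻¹ = 1 - q ^ 2 * X⁻¹ := by rw [inv_div, div_eq_mul_inv]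
  have e' : X / q ^ 2 * q ^ 2 = X := div_mul_cancel₀ _ (pow_ne_zero _ hq0)
  rw [e, e'] at h3
  rw [← eq_div_iff (mul_ne_zero n1' n2)] at h1
  rw [← eq_div_iff (mul_ne_zero n1' n3)] at h2
  rw [← eq_div_iff (mul_ne_zero n1 n2')] at h3
  rw [h3, h1, h2, eFun]
  generalize normRat q X (P + 1 + 1) (p + 1) = g
  simp only [br, Nat.cast_add, Nat.cast_one, mul_add (2 : ℤ), mul_sub (2 : ℤ), neg_add, neg_sub, neg_mul, zpow_add₀ hq0, zpow_sub₀ hq0, zpow_neg,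
    zpow_two_mul_eq, zpow_natCast, zpow_one, mul_one] at n1 n1' n3 x3 ⊢
  have a0 : q ^ P ≠ 0 := pow_ne_zero _ hq0
  have b0 : q ^ p ≠ 0 := zpow_ne_zero _ hq0
  generalize q ^ P = a at *
  generalize q ^ p = b at *
  have e2 : q ^ (2 : ℤ) = q ^ 2 := by norm_cast
  simp only [e2] at n1 n1' n3 x3 ⊢
  have n1'' : 1 - a ^ 2 * q ^ 4 ≠ 0 := by
    intro h; apply n1'; linear_combination h
  have x3' : X * a ^ 2 * q ^ 2 - b ^ 2 ≠ 0 := by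
    intro h
    apply x3
    field_simp
    linear_combination h
  have n3' : 1 - b ^ 2 * q ^ 2 / (a ^ 2 * q ^ 2) / q ^ 2 * X⁻¹ =
      (X * a ^ 2 * q ^ 2 - b ^ 2) / (a ^ 2 * q ^ 2 * X) := by
    field_simp
  have n4' : 1 - X⁻¹ = (X - 1) / X := by field_simp
  have n5' : 1 - q ^ 2 * X⁻¹ = (X - q ^ 2) / X := by field_simp
  have n7' : 1 - b ^ 2 * (X / q ^ 2)⁻¹ = (X - b ^ 2 * q ^ 2) / X := by
    rw [inv_div]; field_simp
  have n6' : 1 - b ^ 2 * q ^ 2 * X⁻¹ = (X - b ^ 2 * q ^ 2) / X := by field_simp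
  have n8' : 1 - a ^ 2 * q ^ 2 * q ^ 2 = 1 - a ^ 2 * q ^ 4 := by ring
  rw [n3', n4', n5', n6', n7', n8']
  have m1 : 1 - q ^ 4 * a ^ 2 ≠ 0 := by rwa [mul_comm]
  have m2 : 1 - q ^ 2 * a ^ 2 ≠ 0 := by rwa [mul_comm]
  have m3 : q ^ 2 * a ^ 2 * X - b ^ 2 ≠ 0 := by
    rwa [show q ^ 2 * a ^ 2 * X = X * a ^ 2 * q ^ 2 by ring]
  field_simp
  ring

/-- Orthogonality of the two maps out of `V_1 ⊗ V_R`: the component of `m` at `v_{p+1}` and that of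
`e` at `v_p` involve the same two vectors `γ v_{p+1}` and `α v_p`. -/
theorem normRat_cross (hq0 : q ≠ 0) (hq : ∀ n : ℤ, n ≠ 0 → q ^ n ≠ 1) (hX0 : X ≠ 0)
    (hX : ∀ n : ℤ, q ^ n * X ≠ 1) (R : ℕ) (p : ℤ) :
    br q (p + 1) * normRat q (X * q ^ 2) R (p + 1) +
      (X - 1) / (X - q ^ 2) * (aFun q X (R - p) * eFun q X R p) *
        normRat q (X / q ^ 2) R p = 0 := by
  have h1 := normRat_mul_sq hq0 hq hX R (p + 1)
  have h2 := normRat_div_sq hq0 hq hX R (p + 1)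
  rw [add_sub_cancel_right] at h2
  have n1 := one_sub_zpow_ne_zero hq (n := 2 * ((R : ℤ) + 1)) (by omega)
  have x1 := sub_one_ne_zero_of_zpow hX
  have x2 := sub_sq_ne_zero_of_zpow hq0 hX
  have x3 := sub_zpow_ne_zero hq0 hX (2 * (p + 1 - R - 1))
  have n2 : 1 - X⁻¹ ≠ 0 := by simpa using one_sub_mul_inv_ne_zero hX0 x1
  have n2' := one_sub_mul_inv_ne_zero hX0 x2
  have n3 := one_sub_mul_inv_ne_zero hX0 x3
  rw [← eq_div_iff (mul_ne_zero n1 n2)] at h1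
  rw [← eq_div_iff (mul_ne_zero n1 n3)] at h2
  rw [h1, h2, aFun, eFun]
  generalize normRat q X (R + 1) (p + 1) = g
  simp only [br, mul_add (2 : ℤ), mul_sub (2 : ℤ), neg_add, neg_sub, neg_mul, zpow_add₀ hq0, zpow_sub₀ hq0, zpow_neg,
    zpow_two_mul_eq, zpow_natCast, zpow_one, mul_one] at n1 n3 x3 ⊢
  have a0 : q ^ R ≠ 0 := pow_ne_zero _ hq0
  have b0 : q ^ p ≠ 0 := zpow_ne_zero _ hq0
  generalize q ^ R = a at *
  generalize q ^ p = b at *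
  have e2 : q ^ (2 : ℤ) = q ^ 2 := by norm_cast
  simp only [e2] at n1 n3 x3 ⊢
  have x3' : X * a ^ 2 - b ^ 2 ≠ 0 := by
    intro h
    apply x3
    field_simp
    linear_combination h
  have n3' : 1 - b ^ 2 * q ^ 2 / a ^ 2 / q ^ 2 * X⁻¹ =
      (X * a ^ 2 - b ^ 2) / (a ^ 2 * X) := by
    field_simp
  have n4' : 1 - X⁻¹ = (X - 1) / X := by field_simp
  have n5' : 1 - q ^ 2 * X⁻¹ = (X - q ^ 2) / X := by field_simp
  have n6' : 1 - b ^ 2 * q ^ 2 * X⁻¹ = (X - b ^ 2 * q ^ 2) / X := by field_simp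
  rw [n3', n4', n5', n6']
  have m2 : 1 - q ^ 2 * a ^ 2 ≠ 0 := by rwa [mul_comm]
  have m3 : a ^ 2 * X - b ^ 2 ≠ 0 := by rwa [mul_comm]
  field_simp
  ring

variable (q) in
/-- The norms `Z_s`. -/
def zRat (M N s : ℕ) : K :=
  (-1) ^ s * q ^ (-((s : ℤ) * (s + 1))) *
    (qPoch (q ^ 2) (q ^ 2) s * qPoch (q ^ (2 * ((s : ℤ) - M - N - 1))) (q ^ 2) s) /
    (qPoch (q ^ (-2 * (M : ℤ))) (q ^ 2) s * qPoch (q ^ (-2 * (N : ℤ))) (q ^ 2) s)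

theorem zRat_zero (M N : ℕ) : zRat q M N 0 = 1 := by
  simp [zRat, qPoch_zero]

theorem qPoch_zpow_ne_zero (hq0 : q ≠ 0) (hq : ∀ n : ℤ, n ≠ 0 → q ^ n ≠ 1) {a : ℤ} {s : ℕ}
    (h : a + 2 * s < 2) : qPoch (q ^ a) (q ^ 2) s ≠ 0 :=
  qPoch_ne_zero fun i hi h' =>
    one_sub_zpow_mul_pow (a := a) (i := i) hq0 hq (by omega) (by rw [h', sub_self])

theorem zRat_ne_zero (hq0 : q ≠ 0) (hq : ∀ n : ℤ, n ≠ 0 → q ^ n ≠ 1) {M N s : ℕ} (hM : s ≤ M)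
    (hN : s ≤ N) : zRat q M N s ≠ 0 := by
  refine div_ne_zero (mul_ne_zero (mul_ne_zero (pow_ne_zero _ (by simp)) (zpow_ne_zero _ hq0))
    (mul_ne_zero (qPoch_self_ne_zero hq s) ?_)) (mul_ne_zero ?_ ?_)
  all_goals exact qPoch_zpow_ne_zero hq0 hq (by omega)

theorem sq_pow_eq_zpow (hq0 : q ≠ 0) (s : ℕ) (a : ℤ) :
    q ^ a * (q ^ 2) ^ s = q ^ (a + 2 * s) := by
  rw [zpow_add₀ hq0, ← pow_mul]; norm_cast

theorem zRat_succ_succ (hq0 : q ≠ 0) (hq : ∀ n : ℤ, n ≠ 0 → q ^ n ≠ 1) {M N s : ℕ} (hM : s ≤ M)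
    (hN : s + 1 ≤ N) :
    zRat q (M + 1) N (s + 1) = -zRat q M N s *
      (q ^ (-2 * ((s : ℤ) + 1)) * (1 - q ^ (2 * ((s : ℤ) + 1))) *
        (1 - q ^ (2 * (2 * (s : ℤ) - M - N - 1)))) /
      ((1 - q ^ (-2 * ((M : ℤ) + 1))) * (1 - q ^ (2 * ((s : ℤ) - N)))) := by
  have n1 := one_sub_zpow_ne_zero hq (n := -2 * ((M : ℤ) + 1)) (by omega)
  have n2 := one_sub_zpow_ne_zero hq (n := 2 * ((s : ℤ) - N)) (by omega)
  have n3 := qPoch_zpow_ne_zero (s := s) (a := -2 * (M : ℤ)) hq0 hq (by omega)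
  have n4 := qPoch_zpow_ne_zero (s := s) (a := -2 * (N : ℤ)) hq0 hq (by omega)
  rw [zRat, zRat]
  have e1 : 2 * (((s + 1 : ℕ) : ℤ) - (M + 1 : ℕ) - N - 1) = 2 * ((s : ℤ) - M - N - 1) := by
    push_cast; ring
  have e2 : qPoch (q ^ (-2 * ((M + 1 : ℕ) : ℤ))) (q ^ 2) (s + 1) =
      (1 - q ^ (-2 * ((M : ℤ) + 1))) * qPoch (q ^ (-2 * (M : ℤ))) (q ^ 2) s := by
    rw [qPoch_succ', show q ^ (-2 * ((M + 1 : ℕ) : ℤ)) * q ^ 2 = q ^ (-2 * (M : ℤ)) by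
      have := sq_pow_eq_zpow hq0 1 (-2 * ((M + 1 : ℕ) : ℤ))
      rw [pow_one] at this
      rw [this]; congr 1; push_cast; ring]
    push_cast; rfl
  have e3 : -(((s + 1 : ℕ) : ℤ) * (((s + 1 : ℕ) : ℤ) + 1)) = -((s : ℤ) * (s + 1)) + -2 * ((s : ℤ) + 1) := by
    push_cast; ring
  rw [e1, e2, e3, qPoch_succ (q ^ 2), qPoch_succ, qPoch_succ (q ^ (-2 * (N : ℤ))), sq_pow_eq_zpow hq0,
    sq_pow_eq_zpow hq0, ← pow_succ', ← pow_mul, zpow_add₀ hq0,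
    show -2 * (N : ℤ) + 2 * s = 2 * (s - N) by ring,
    show 2 * ((s : ℤ) - M - N - 1) + 2 * s = 2 * (2 * s - M - N - 1) by ring,
    show q ^ (2 * (s + 1)) = q ^ (2 * ((s : ℤ) + 1)) by norm_cast]
  generalize qPoch (q ^ (2 * ((s : ℤ) - M - N - 1))) (q ^ 2) s = A at *
  generalize qPoch (q ^ (-2 * (M : ℤ))) (q ^ 2) s = C at *
  generalize qPoch (q ^ (-2 * (N : ℤ))) (q ^ 2) s = D at *
  generalize 1 - q ^ (-2 * ((M : ℤ) + 1)) = E at *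
  generalize 1 - q ^ (2 * ((s : ℤ) - N)) = F at *
  generalize 1 - q ^ (2 * (2 * (s : ℤ) - M - N - 1)) = G
  generalize 1 - q ^ (2 * ((s : ℤ) + 1)) = I
  generalize q ^ (-2 * ((s : ℤ) + 1)) = J
  generalize q ^ (-((s : ℤ) * (s + 1))) = J'
  field_simp
  ring

theorem zRat_succ (hq0 : q ≠ 0) (hq : ∀ n : ℤ, n ≠ 0 → q ^ n ≠ 1) {M N s : ℕ} (hM : s + 1 ≤ M)
    (hN : s + 1 ≤ N) :
    zRat q M N (s + 1) = -zRat q M N s *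
      (q ^ (-2 * ((s : ℤ) + 1)) * (1 - q ^ (2 * ((s : ℤ) + 1))) *
        (1 - q ^ (2 * (2 * (s : ℤ) - M - N - 1))) * (1 - q ^ (2 * (2 * (s : ℤ) - M - N)))) /
      ((1 - q ^ (2 * ((s : ℤ) - M - N - 1))) * (1 - q ^ (2 * ((s : ℤ) - M))) *
        (1 - q ^ (2 * ((s : ℤ) - N)))) := by
  have n1 := one_sub_zpow_ne_zero hq (n := 2 * ((s : ℤ) - M)) (by omega)
  have n2 := one_sub_zpow_ne_zero hq (n := 2 * ((s : ℤ) - N)) (by omega)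
  have n3 := qPoch_zpow_ne_zero (s := s) (a := -2 * (M : ℤ)) hq0 hq (by omega)
  have n4 := qPoch_zpow_ne_zero (s := s) (a := -2 * (N : ℤ)) hq0 hq (by omega)
  have n5 := one_sub_zpow_ne_zero hq (n := 2 * ((s : ℤ) - M - N - 1)) (by omega)
  rw [zRat, zRat]
  have e2 : qPoch (q ^ (2 * (((s + 1 : ℕ) : ℤ) - M - N - 1))) (q ^ 2) (s + 1) =
      qPoch (q ^ (2 * ((s : ℤ) - M - N - 1))) (q ^ 2) s * (1 - q ^ (2 * (2 * (s : ℤ) - M - N - 1))) *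
        (1 - q ^ (2 * (2 * (s : ℤ) - M - N))) / (1 - q ^ (2 * ((s : ℤ) - M - N - 1))) := by
    rw [eq_div_iff n5]
    have h1 := qPoch_succ' (q ^ (2 * ((s : ℤ) - M - N - 1))) (q ^ 2) (s + 1)
    rw [qPoch_succ, qPoch_succ, sq_pow_eq_zpow hq0, sq_pow_eq_zpow hq0] at h1
    have := sq_pow_eq_zpow hq0 1 (2 * ((s : ℤ) - M - N - 1))
    rw [pow_one] at this
    rw [this] at h1
    rw [show 2 * (((s + 1 : ℕ) : ℤ) - M - N - 1) = 2 * ((s : ℤ) - M - N - 1) + 2 * (1 : ℕ) by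
      push_cast; ring, mul_comm, ← h1,
      show 2 * ((s : ℤ) - M - N - 1) + 2 * s = 2 * (2 * s - M - N - 1) by ring,
      show 2 * ((s : ℤ) - M - N - 1) + 2 * (s + 1 : ℕ) = 2 * (2 * s - M - N) by push_cast; ring]
  have e3 : -(((s + 1 : ℕ) : ℤ) * (((s + 1 : ℕ) : ℤ) + 1)) = -((s : ℤ) * (s + 1)) + -2 * ((s : ℤ) + 1) := by
    push_cast; ring
  rw [e2, e3, qPoch_succ (q ^ 2), qPoch_succ (q ^ (-2 * (M : ℤ))), qPoch_succ (q ^ (-2 * (N : ℤ))),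
    sq_pow_eq_zpow hq0,
    sq_pow_eq_zpow hq0, ← pow_succ', ← pow_mul, zpow_add₀ hq0,
    show -2 * (N : ℤ) + 2 * s = 2 * (s - N) by ring,
    show -2 * (M : ℤ) + 2 * s = 2 * (s - M) by ring,
    show q ^ (2 * (s + 1)) = q ^ (2 * ((s : ℤ) + 1)) by norm_cast]
  generalize qPoch (q ^ (2 * ((s : ℤ) - M - N - 1))) (q ^ 2) s = A at *
  generalize (1 - q ^ (2 * ((s : ℤ) - M - N - 1))) = B at *
  generalize qPoch (q ^ (-2 * (M : ℤ))) (q ^ 2) s = C at *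
  generalize qPoch (q ^ (-2 * (N : ℤ))) (q ^ 2) s = D at *
  generalize 1 - q ^ (2 * ((s : ℤ) - M)) = E at *
  generalize 1 - q ^ (2 * ((s : ℤ) - N)) = F at *
  generalize 1 - q ^ (2 * (2 * (s : ℤ) - M - N - 1)) = G
  generalize 1 - q ^ (2 * (2 * (s : ℤ) - M - N)) = H
  generalize 1 - q ^ (2 * ((s : ℤ) + 1)) = I
  generalize q ^ (-2 * ((s : ℤ) + 1)) = J
  generalize q ^ (-((s : ℤ) * (s + 1))) = J'
  field_simp
  ring

/-- The norm of both sides of the recursion for `C_{s+1}`. The two terms on the right are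
orthogonal, `m` has norm one and `e` contributes the constant of `normRat_reduce`. -/
theorem zRat_rec (hq0 : q ≠ 0) (hq : ∀ n : ℤ, n ≠ 0 → q ^ n ≠ 1) {M N s : ℕ} (hM : s ≤ M)
    (hN : s + 1 ≤ N) :
    (br q (M + 1) * br q (M + N - 2 * s)) ^ 2 * zRat q (M + 1) N (s + 1) =
      (br q (M - s) * br q (M + N + 1 - s)) ^ 2 * zRat q M N (s + 1) +
      br q (s + 1) ^ 2 * (q⁻¹ * br q (M + N + 1 - 2 * s) * br q (M + N - 2 * s)) * zRat q M N s := by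
  rw [zRat_succ_succ hq0 hq hM hN]
  have n1 := one_sub_zpow_ne_zero hq (n := -2 * ((M : ℤ) + 1)) (by omega)
  have n2 := one_sub_zpow_ne_zero hq (n := 2 * ((s : ℤ) - N)) (by omega)
  have n5 := one_sub_zpow_ne_zero hq (n := 2 * ((s : ℤ) - M - N - 1)) (by omega)
  have a0 : q ^ M ≠ 0 := pow_ne_zero _ hq0
  have b0 : q ^ N ≠ 0 := pow_ne_zero _ hq0
  have c0 : q ^ s ≠ 0 := pow_ne_zero _ hq0
  have e2 : q ^ (2 : ℤ) = q ^ 2 := by norm_cast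
  -- For `s = M` the expression `zRat q M N (s + 1)` has a zero denominator; it occurs only with the
  -- factor `[M - s] = 0`.
  rcases hM.eq_or_lt with rfl | hM
  · rw [sub_self, br_zero]
    generalize zRat q s N s = z
    simp only [br, mul_add (2 : ℤ), mul_sub (2 : ℤ), neg_add, neg_sub, neg_mul, zpow_add₀ hq0, zpow_sub₀ hq0, zpow_neg,
      zpow_two_mul_eq, zpow_natCast, zpow_one, mul_one, e2] at n1 n2 ⊢
    generalize q ^ N = b at *
    generalize q ^ s = c at *
    have n1' : c ^ 2 * q ^ 2 - 1 ≠ 0 := by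
      intro h; apply n1; field_simp; linear_combination h
    have n2' : b ^ 2 - c ^ 2 ≠ 0 := by
      intro h; apply n2; field_simp; linear_combination h
    rw [show 1 - (c ^ 2)⁻¹ * (q ^ 2)⁻¹ = (c ^ 2 * q ^ 2 - 1) / (c ^ 2 * q ^ 2) by field_simp,
      show 1 - c ^ 2 / b ^ 2 = (b ^ 2 - c ^ 2) / b ^ 2 by field_simp]
    field_simp
    ring
  · rw [zRat_succ hq0 hq hM hN]
    have n3 := one_sub_zpow_ne_zero hq (n := 2 * ((s : ℤ) - M)) (by omega)
    generalize zRat q M N s = z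
    simp only [br, mul_add (2 : ℤ), mul_sub (2 : ℤ), neg_add, neg_sub, neg_mul, zpow_add₀ hq0, zpow_sub₀ hq0, zpow_neg,
      zpow_two_mul_eq, zpow_natCast, zpow_one, mul_one, e2] at n1 n2 n3 n5 ⊢
    generalize q ^ N = b at *
    generalize q ^ s = c at *
    generalize q ^ M = a at *
    have n1' : a ^ 2 * q ^ 2 - 1 ≠ 0 := by
      intro h; apply n1; field_simp; linear_combination h
    have n2' : b ^ 2 - c ^ 2 ≠ 0 := by
      intro h; apply n2; field_simp; linear_combination h
    have n3' : a ^ 2 - c ^ 2 ≠ 0 := by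
      intro h; apply n3; field_simp; linear_combination h
    have n5' : a ^ 2 * b ^ 2 * q ^ 2 - c ^ 2 ≠ 0 := by
      intro h; apply n5; field_simp; linear_combination h
    rw [show 1 - (a ^ 2)⁻¹ * (q ^ 2)⁻¹ = (a ^ 2 * q ^ 2 - 1) / (a ^ 2 * q ^ 2) by field_simp,
      show 1 - c ^ 2 / b ^ 2 = (b ^ 2 - c ^ 2) / b ^ 2 by field_simp,
      show 1 - c ^ 2 / a ^ 2 = (a ^ 2 - c ^ 2) / a ^ 2 by field_simp,
      show 1 - c ^ 2 / a ^ 2 / b ^ 2 / q ^ 2 =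
        (a ^ 2 * b ^ 2 * q ^ 2 - c ^ 2) / (a ^ 2 * b ^ 2 * q ^ 2) by field_simp]
    field_simp
    ring

end rational

/-! ### The orthogonality sums, by induction on `M` -/

section rational
variable {K : Type} [Field K] {q X : K}

variable (q X) in
/-- The left hand side of the orthogonality relations. -/
def orthSum (M N L s t : ℕ) : K :=
  ∑ x ∈ Finset.HasAntidiagonal.antidiagonal L, normRat q X M x.1 *
    normRat q (X * q ^ (2 * ((M : ℤ) - 2 * x.1))) N x.2 *
    (cgRat q X M N s x.1 x.2 * cgRat q X M N t x.1 x.2)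

variable (q X) in
/-- The right hand side of the orthogonality relations. -/
def orthVal (M N : ℕ) (L : ℤ) (s t : ℕ) : K :=
  if s = t then zRat q M N s * normRat q X (M + N - 2 * s) (L - s) else 0

theorem orthSum_comm (M N L s t : ℕ) : orthSum q X M N L s t = orthSum q X M N L t s := by
  simp only [orthSum, mul_comm (cgRat q X M N s _ _)]

/-- The contribution of the vectors `γ x ⊗ w`: the `γ` recursion is inserted for both coefficients
and the product is multiplied out. -/
theorem orthSum_succ_aux_left (hq0 : q ≠ 0) (hq : ∀ n : ℤ, n ≠ 0 → q ^ n ≠ 1) {M N s t : ℕ}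
    (L : ℕ) (hs : s ≤ N) (hsM : s ≤ M + 1) (ht : t ≤ N) (htM : t ≤ M + 1)
    {us vs ut vt : K}
    (hus : us = br q (M + 1 - s) * br q (M + N + 2 - s)) (hvs : vs = br q s * br q (L - s + 1))
    (hut : ut = br q (M + 1 - t) * br q (M + N + 2 - t)) (hvt : vt = br q t * br q (L - t + 1)) :
    (br q (M + 1) * br q (M + N + 2 - 2 * s)) * (br q (M + 1) * br q (M + N + 2 - 2 * t)) *
      (∑ x ∈ Finset.HasAntidiagonal.antidiagonal L, normRat q (X * q ^ 2) M x.1 *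
        normRat q (X * q ^ (2 * (((M + 1 : ℕ) : ℤ) - 2 * x.1))) N x.2 *
        (cgRat q X (M + 1) N s x.1 x.2 * cgRat q X (M + 1) N t x.1 x.2)) =
    us * ut * orthSum q (X * q ^ 2) M N L s t + us * vt * orthSum q (X * q ^ 2) M N L s (t - 1) +
    vs * ut * orthSum q (X * q ^ 2) M N L (s - 1) t +
    vs * vt * orthSum q (X * q ^ 2) M N L (s - 1) (t - 1) := by
  simp only [orthSum, Finset.mul_sum, ← Finset.sum_add_distrib]
  refine Finset.sum_congr rfl fun x hx => ?_
  by_cases hxM : x.1 ≤ M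
  swap
  · have : normRat q (X * q ^ 2) M x.1 = 0 := by rw [normRat, if_neg (by omega)]
    rw [this]; ring
  have h1 := cgRat_succ_left (X := X) hq0 hq x.2 hs hsM hxM
  have h2 := cgRat_succ_left (X := X) hq0 hq x.2 ht htM hxM
  have hL : (x.1 : ℤ) + x.2 = L := by
    have := Finset.HasAntidiagonal.mem_antidiagonal.1 hx; omega
  have e : X * q ^ (2 * (((M + 1 : ℕ) : ℤ) - 2 * x.1)) =
      X * q ^ 2 * q ^ (2 * ((M : ℤ) - 2 * x.1)) := by
    rw [mul_assoc, ← zpow_ofNat, ← zpow_add₀ hq0]; congr 2; push_cast; ring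
  -- On the antidiagonal the coefficients of the recursion depend only on `L = j + k`, so they leave
  -- the sum.
  rw [hL] at h1 h2
  rw [← mul_assoc, ← hvs, ← hus] at h1
  rw [← mul_assoc, ← hvt, ← hut] at h2
  rw [e]
  generalize normRat q (X * q ^ 2) M x.1 = a
  generalize normRat q (X * q ^ 2 * q ^ (2 * ((M : ℤ) - 2 * x.1))) N x.2 = b
  generalize br q (M + 1) * br q (M + N + 2 - 2 * s) = B at *
  generalize br q (M + 1) * br q (M + N + 2 - 2 * t) = B' at *
  have : B * B' * (a * b * (cgRat q X (M + 1) N s x.1 x.2 * cgRat q X (M + 1) N t x.1 x.2)) =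
    a * b * ((B * cgRat q X (M + 1) N s x.1 x.2) * (B' * cgRat q X (M + 1) N t x.1 x.2)) := by ring
  rw [this, h1, h2]
  ring

/-- The contribution of the vectors `α x ⊗ w`. The square of `aFun` that the weight carries is
shared between the two coefficients, as the `α` recursion requires. -/
theorem orthSum_succ_aux_right (hq0 : q ≠ 0) (hq : ∀ n : ℤ, n ≠ 0 → q ^ n ≠ 1) (hX0 : X ≠ 0)
    (hX : ∀ n : ℤ, q ^ n * X ≠ 1) {M N s t : ℕ}
    (L : ℕ) (hs : s ≤ N) (hsM : s ≤ M + 1) (ht : t ≤ N) (htM : t ≤ M + 1)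
    {us vs ut vt : K}
    (hus : us = br q (M + 1 - s) * br q (M + N + 2 - s) * aFun q X (M + N - s - L))
    (hvs : vs = br q s * eFun q X (M + N + 2 - 2 * s) (L - s + 1))
    (hut : ut = br q (M + 1 - t) * br q (M + N + 2 - t) * aFun q X (M + N - t - L))
    (hvt : vt = br q t * eFun q X (M + N + 2 - 2 * t) (L - t + 1)) :
    (br q (M + 1) * br q (M + N + 2 - 2 * s)) * (br q (M + 1) * br q (M + N + 2 - 2 * t)) *
      (∑ x ∈ Finset.HasAntidiagonal.antidiagonal L, aFun q X (M - x.1) ^ 2 * normRat q (X / q ^ 2) M x.1 *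
        normRat q (X * q ^ (2 * (((M + 1 : ℕ) : ℤ) - 2 * (x.1 + 1 : ℕ)))) N x.2 *
        (cgRat q X (M + 1) N s (x.1 + 1) x.2 * cgRat q X (M + 1) N t (x.1 + 1) x.2)) =
    us * ut * orthSum q (X / q ^ 2) M N L s t + us * vt * orthSum q (X / q ^ 2) M N L s (t - 1) +
    vs * ut * orthSum q (X / q ^ 2) M N L (s - 1) t +
    vs * vt * orthSum q (X / q ^ 2) M N L (s - 1) (t - 1) := by
  simp only [orthSum, Finset.mul_sum, ← Finset.sum_add_distrib]
  refine Finset.sum_congr rfl fun x hx => ?_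
  by_cases hxM : x.1 ≤ M
  swap
  · have : normRat q (X / q ^ 2) M x.1 = 0 := by rw [normRat, if_neg (by omega)]
    rw [this]; ring
  have h1 := cgRat_succ_succ hq0 hq hX0 hX x.2 hs hsM hxM
  have h2 := cgRat_succ_succ hq0 hq hX0 hX x.2 ht htM hxM
  have hL : (x.1 : ℤ) + x.2 = L := by
    have := Finset.HasAntidiagonal.mem_antidiagonal.1 hx; omega
  have e : X * q ^ (2 * (((M + 1 : ℕ) : ℤ) - 2 * (x.1 + 1 : ℕ))) =
      X / q ^ 2 * q ^ (2 * ((M : ℤ) - 2 * x.1)) := by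
    rw [div_mul_eq_mul_div, mul_div_assoc, ← zpow_ofNat, ← zpow_sub₀ hq0]
    congr 2; push_cast; ring
  have e1 : ∀ s : ℕ, (M : ℤ) + N - s - x.1 - x.2 = M + N - s - L := fun s => by omega
  rw [hL, e1, ← mul_assoc (br q (M + 1 - s) * br q (M + N + 2 - s)), ← hus,
    ← mul_assoc (br q s), ← hvs] at h1
  rw [hL, e1, ← mul_assoc (br q (M + 1 - t) * br q (M + N + 2 - t)), ← hut,
    ← mul_assoc (br q t), ← hvt] at h2
  rw [e]
  generalize normRat q (X / q ^ 2) M x.1 = a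
  generalize normRat q (X / q ^ 2 * q ^ (2 * ((M : ℤ) - 2 * x.1))) N x.2 = b
  generalize br q (M + 1) * br q (M + N + 2 - 2 * s) = B at *
  generalize br q (M + 1) * br q (M + N + 2 - 2 * t) = B' at *
  generalize aFun q X (M - x.1) = A at *
  have : B * B' * (A ^ 2 * a * b * (cgRat q X (M + 1) N s (x.1 + 1) x.2 *
      cgRat q X (M + 1) N t (x.1 + 1) x.2)) =
    a * b * ((B * (A * cgRat q X (M + 1) N s (x.1 + 1) x.2)) *
      (B' * (A * cgRat q X (M + 1) N t (x.1 + 1) x.2))) := by ring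
  rw [this, h1, h2]
  ring

/-- The weight `Γ^{M+1}_j` is split by `normRat_succ` into the parts due to `γ` and to `α`. In the
second part the index moves from `j` to `j + 1`, so that it is a sum over `L - 1`; for `L = 0` it is
empty because `Γ_{-1} = 0`. -/
theorem orthSum_eq_add (hq0 : q ≠ 0) (hq : ∀ n : ℤ, n ≠ 0 → q ^ n ≠ 1) (hX0 : X ≠ 0)
    (hX : ∀ n : ℤ, q ^ n * X ≠ 1) (M N L s t : ℕ) :
    orthSum q X (M + 1) N L s t =
      (∑ x ∈ Finset.HasAntidiagonal.antidiagonal L, normRat q (X * q ^ 2) M x.1 *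
        normRat q (X * q ^ (2 * (((M + 1 : ℕ) : ℤ) - 2 * x.1))) N x.2 *
        (cgRat q X (M + 1) N s x.1 x.2 * cgRat q X (M + 1) N t x.1 x.2)) +
      if L = 0 then 0 else (X - 1) / (X - q ^ 2) *
      (∑ x ∈ Finset.HasAntidiagonal.antidiagonal (L - 1), aFun q X (M - x.1) ^ 2 * normRat q (X / q ^ 2) M x.1 *
        normRat q (X * q ^ (2 * (((M + 1 : ℕ) : ℤ) - 2 * (x.1 + 1 : ℕ)))) N x.2 *
        (cgRat q X (M + 1) N s (x.1 + 1) x.2 * cgRat q X (M + 1) N t (x.1 + 1) x.2)) := by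
  have h0 : normRat q (X / q ^ 2) M (-1) = 0 := by rw [normRat, if_neg (by omega)]
  simp only [orthSum, normRat_succ hq0 hq hX0 hX, add_mul, Finset.sum_add_distrib]
  congr 1
  rcases L with _ | L
  · simp [h0]
  · rw [Finset.Nat.sum_antidiagonal_succ]
    simp only [Nat.cast_zero, zero_sub, h0, mul_zero, zero_mul, zero_add, Nat.succ_ne_zero,
      if_false, Nat.add_sub_cancel, Finset.mul_sum, if_neg]
    refine Finset.sum_congr rfl fun x _ => ?_
    push_cast
    rw [add_sub_cancel_right, show (M : ℤ) + 1 - (x.1 + 1) = M - x.1 by ring]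
    ring

/-- Replacing sums by their values in the recursion. -/
theorem orth_subst {M N s t : ℕ} (hs : s ≤ N) (hsM : s ≤ M + 1) (ht : t ≤ N) (htM : t ≤ M + 1)
    {us vs ut vt : K} (hus : s = M + 1 → us = 0) (hut : t = M + 1 → ut = 0) {O V : ℕ → ℕ → K}
    (h : ∀ s t, s ≤ M → s ≤ N → t ≤ M → t ≤ N → O s t = V s t) :
    us * ut * O s t + us * vt * O s (t - 1) + vs * ut * O (s - 1) t + vs * vt * O (s - 1) (t - 1) =
    us * ut * V s t + us * vt * V s (t - 1) + vs * ut * V (s - 1) t +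
      vs * vt * V (s - 1) (t - 1) := by
  congr 1
  · congr 1
    · congr 1
      · by_cases h1 : s = M + 1
        · simp [hus h1]
        by_cases h2 : t = M + 1
        · simp [hut h2]
        rw [h _ _ (by omega) hs (by omega) ht]
      · by_cases h1 : s = M + 1
        · simp [hus h1]
        rw [h _ _ (by omega) hs (by omega) (by omega)]
    · by_cases h2 : t = M + 1
      · simp [hut h2]
      rw [h _ _ (by omega) (by omega) (by omega) ht]
  · rw [h _ _ (by omega) (by omega) (by omega) (by omega)]

theorem normRat_of_neg (N : ℕ) {k : ℤ} (hk : k < 0) : normRat q X N k = 0 := by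
  rw [normRat, if_neg (by omega)]

theorem orthVal_of_neg {M N : ℕ} {L : ℤ} (hL : L < 0) (s t : ℕ) : orthVal q X M N L s t = 0 := by
  rw [orthVal, normRat_of_neg _ (by omega)]; simp

/-- The recursion for the sums, with known values inserted. -/
theorem orthSum_succ (hq0 : q ≠ 0) (hq : ∀ n : ℤ, n ≠ 0 → q ^ n ≠ 1) (hX0 : X ≠ 0)
    (hX : ∀ n : ℤ, q ^ n * X ≠ 1) {M N : ℕ}
    (ih : ∀ Y : K, Y ≠ 0 → (∀ n : ℤ, q ^ n * Y ≠ 1) → ∀ L s t, s ≤ M → s ≤ N → t ≤ M → t ≤ N →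
      orthSum q Y M N L s t = orthVal q Y M N L s t) {s t : ℕ}
    (L : ℕ) (hs : s ≤ N) (hsM : s ≤ M + 1) (ht : t ≤ N) (htM : t ≤ M + 1)
    {us vs ut vt us' vs' ut' vt' : K}
    (hus : us = br q (M + 1 - s) * br q (M + N + 2 - s)) (hvs : vs = br q s * br q (L - s + 1))
    (hut : ut = br q (M + 1 - t) * br q (M + N + 2 - t)) (hvt : vt = br q t * br q (L - t + 1))
    (hus' : us' = br q (M + 1 - s) * br q (M + N + 2 - s) * aFun q X (M + N + 1 - s - L))
    (hvs' : vs' = br q s * eFun q X (M + N + 2 - 2 * s) (L - s))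
    (hut' : ut' = br q (M + 1 - t) * br q (M + N + 2 - t) * aFun q X (M + N + 1 - t - L))
    (hvt' : vt' = br q t * eFun q X (M + N + 2 - 2 * t) (L - t)) :
    (br q (M + 1) * br q (M + N + 2 - 2 * s)) * (br q (M + 1) * br q (M + N + 2 - 2 * t)) *
      orthSum q X (M + 1) N L s t =
    (us * ut * orthVal q (X * q ^ 2) M N L s t + us * vt * orthVal q (X * q ^ 2) M N L s (t - 1) +
    vs * ut * orthVal q (X * q ^ 2) M N L (s - 1) t +
    vs * vt * orthVal q (X * q ^ 2) M N L (s - 1) (t - 1)) + (X - 1) / (X - q ^ 2) *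
    (us' * ut' * orthVal q (X / q ^ 2) M N (L - 1) s t +
    us' * vt' * orthVal q (X / q ^ 2) M N (L - 1) s (t - 1) +
    vs' * ut' * orthVal q (X / q ^ 2) M N (L - 1) (s - 1) t +
    vs' * vt' * orthVal q (X / q ^ 2) M N (L - 1) (s - 1) (t - 1)) := by
  -- No value is known for `V_M` when `s = M + 1`, but the coefficient of that unknown sum vanishes.
  have z1 : ∀ s : ℕ, s = M + 1 → br q (M + 1 - s) = 0 := by
    rintro _ rfl
    rw [show (M : ℤ) + 1 - (M + 1 : ℕ) = 0 by push_cast; ring, br_zero]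
  rw [orthSum_eq_add hq0 hq hX0 hX, mul_add, orthSum_succ_aux_left hq0 hq L hs hsM ht htM hus hvs hut hvt,
    orth_subst hs hsM ht htM (fun h => by rw [hus, z1 _ h, zero_mul])
      (fun h => by rw [hut, z1 _ h, zero_mul])
      (ih (X * q ^ 2) (mul_ne_zero hX0 (pow_ne_zero _ hq0)) (zpow_mul_mul_sq_ne_one hq0 hX) L)]
  congr 1
  rcases L with _ | L
  · simp [orthVal_of_neg]
  · rw [if_neg (Nat.succ_ne_zero L), mul_left_comm, Nat.add_sub_cancel,
      orthSum_succ_aux_right hq0 hq hX0 hX L hs hsM ht htM (us := us') (vs := vs') (ut := ut') (vt := vt'),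
      orth_subst hs hsM ht htM (fun h => by rw [hus', z1 _ h, zero_mul, zero_mul])
      (fun h => by rw [hut', z1 _ h, zero_mul, zero_mul])
      (ih (X / q ^ 2) (div_ne_zero hX0 (pow_ne_zero _ hq0)) (zpow_mul_div_sq_ne_one hq0 hX) L)]
    · push_cast
      rw [add_sub_cancel_right]
    · rw [hus']; congr 2; push_cast; ring
    · rw [hvs']; congr 2; push_cast; ring
    · rw [hut']; congr 2; push_cast; ring
    · rw [hvt']; congr 2; push_cast; ring

/-- Induction on `M` for all `X` at once, since the step uses `X q²` and `X / q²`. After the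
recursion only diagonal values for `M` survive. Equal indices require the norm relations, indices
differing by one require `normRat_cross`, and for larger differences nothing remains. -/
theorem orthSum_eq (hq0 : q ≠ 0) (hq : ∀ n : ℤ, n ≠ 0 → q ^ n ≠ 1) (M N : ℕ) : ∀ X : K, X ≠ 0 →
    (∀ n : ℤ, q ^ n * X ≠ 1) → ∀ L s t, s ≤ M → s ≤ N → t ≤ M → t ≤ N →
      orthSum q X M N L s t = orthVal q X M N L s t := by
  induction M with
  | zero =>
    intro X hX0 hX L s t hs _ ht _
    obtain rfl := Nat.le_zero.1 hs
    obtain rfl := Nat.le_zero.1 ht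
    rw [orthSum, orthVal, if_pos rfl, zRat_zero, Finset.sum_eq_single (0, L)]
    · simp only [cgRat_zero_left]
      have : normRat q X 0 ((0 : ℕ) : ℤ) = 1 := by
        rw [normRat, if_pos (by simp)]
        simp [qBinom, qPoch_zero]
      rw [this]; simp
    · rintro ⟨j, k⟩ _ hne
      have : normRat q X 0 (j : ℤ) = 0 := by
        rw [normRat, if_neg]
        rintro ⟨_, h⟩
        have h' : j = 0 := by simpa using h
        subst h'
        simp_all
      rw [this]; simp
    · simp
  | succ M ih =>
    intro X hX0 hX L
    -- By symmetry `s ≤ t` may be assumed. Then the factors by which the relation is multiplied are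
    -- nonzero.
    suffices key : ∀ s t : ℕ, s ≤ t → t ≤ M + 1 → t ≤ N →
        orthSum q X (M + 1) N L s t = orthVal q X (M + 1) N L s t by
      intro s t hs hsN ht htN
      rcases le_total s t with h | h
      · exact key s t h ht htN
      · rw [orthSum_comm, key t s h hs hsN, orthVal, orthVal]
        by_cases e : s = t
        · subst e; rfl
        · rw [if_neg e, if_neg (Ne.symm e)]
    intro s t hst ht htN
    have hb : ∀ s : ℕ, s ≤ t → br q (M + 1) * br q (M + N + 2 - 2 * s) ≠ 0 := fun s hs =>
      mul_ne_zero (br_ne_zero hq0 hq (by omega)) (br_ne_zero hq0 hq (by omega))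
    refine mul_left_cancel₀ (mul_ne_zero (hb s hst) (hb t le_rfl)) ?_
    rw [orthSum_succ hq0 hq hX0 hX ih L (by omega) (by omega) htN ht rfl rfl rfl rfl rfl rfl rfl rfl]
    simp only [orthVal]
    rcases hst.eq_or_lt with rfl | hlt
    · rcases s with _ | s
      · have h1 := normRat_succ hq0 hq hX0 hX (M + N) L
        simp only [if_true, zRat_zero, Nat.cast_zero, br_zero, zero_mul, mul_zero, add_zero,
          sub_zero, one_mul, Nat.zero_sub, Nat.sub_zero]
        rw [show M + 1 + N = M + N + 1 by omega, h1,
          show ((M + N : ℕ) : ℤ) + 1 - L = M + N + 1 - L by push_cast; ring]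
        ring
      -- Equal positive indices: the mixed products drop out, the square of the first coefficient is
      -- treated by `normRat_succ`, that of the second by `normRat_reduce`, and `zRat_rec` adds them
      -- up.
      · rw [if_pos rfl, if_pos rfl, if_neg (by omega), if_neg (by omega), if_pos rfl, if_pos rfl,
          if_neg (by omega), if_neg (by omega), if_pos rfl, Nat.add_sub_cancel]
        have e1 : M + N - 2 * s = M + 1 + N - 2 * (s + 1) + 1 := by omega
        have h2 := normRat_reduce hq0 hq hX0 hX (M + 1 + N - 2 * (s + 1)) (L - (s + 1))
        rw [← e1, show (L : ℤ) - (s + 1) + 1 = L - s by ring,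
          show ((M + 1 + N - 2 * (s + 1) : ℕ) : ℤ) + 2 = M + N + 1 - 2 * s by omega,
          show ((M + 1 + N - 2 * (s + 1) : ℕ) : ℤ) + 1 = M + N - 2 * s by omega] at h2
        have h3 := zRat_rec (M := M) (N := N) hq0 hq (s := s) (by omega) htN
        have h1 : s < M → normRat q X (M + 1 + N - 2 * (s + 1)) (L - (s + 1)) =
            normRat q (X * q ^ 2) (M + N - 2 * (s + 1)) (L - (s + 1)) +
            (X - 1) / (X - q ^ 2) * aFun q X (M + N - s - L) ^ 2 *
              normRat q (X / q ^ 2) (M + N - 2 * (s + 1)) (L - (s + 1) - 1) := by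
          intro hs
          have := normRat_succ hq0 hq hX0 hX (M + N - 2 * (s + 1)) (L - (s + 1))
          rwa [show M + N - 2 * (s + 1) + 1 = M + 1 + N - 2 * (s + 1) by omega,
            show ((M + N - 2 * (s + 1) : ℕ) : ℤ) + 1 - (L - (s + 1)) = M + N - s - L by omega] at this
        -- For `s = M` the relation `h1` is unavailable, because `M + N - 2 (s + 1)` may be
        -- truncated; with the factor `[M - s]` it becomes trivial.
        have h1' : br q (M - s) * normRat q X (M + 1 + N - 2 * (s + 1)) (L - (s + 1)) =
            br q (M - s) * (normRat q (X * q ^ 2) (M + N - 2 * (s + 1)) (L - (s + 1)) +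
            (X - 1) / (X - q ^ 2) * aFun q X (M + N - s - L) ^ 2 *
              normRat q (X / q ^ 2) (M + N - 2 * (s + 1)) (L - (s + 1) - 1)) := by
          rcases (show s ≤ M by omega).eq_or_lt with rfl | hs
          · rw [sub_self, br_zero, zero_mul, zero_mul]
          · rw [h1 hs]
        simp only [Nat.cast_add, Nat.cast_one] at h1' h2 h3 ⊢
        simp only [show (M : ℤ) + 1 - (s + 1) = M - s by ring,
          show (M : ℤ) + N + 2 - (s + 1) = M + N + 1 - s by ring,
          show (L : ℤ) - (s + 1) + 1 = L - s by ring,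
          show (M : ℤ) + N + 1 - (s + 1) - L = M + N - s - L by ring,
          show (M : ℤ) + N + 2 - 2 * (s + 1) = M + N - 2 * s by ring,
          show (L : ℤ) - 1 - (s + 1) = L - (s + 1) - 1 by ring,
          show (L : ℤ) - 1 - s = L - (s + 1) by ring]
        generalize normRat q X (M + 1 + N - 2 * (s + 1)) (L - (s + 1)) = g0 at *
        generalize normRat q (X * q ^ 2) (M + N - 2 * (s + 1)) (L - (s + 1)) = g1 at *
        generalize normRat q (X / q ^ 2) (M + N - 2 * (s + 1)) (L - (s + 1) - 1) = g2 at *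
        generalize normRat q (X * q ^ 2) (M + N - 2 * s) (L - s) = g3 at *
        generalize normRat q (X / q ^ 2) (M + N - 2 * s) (L - (s + 1)) = g4 at *
        generalize (X - 1) / (X - q ^ 2) = ρ at *
        linear_combination (-g0) * h3 - (br q (M - s) * br q (M + N + 1 - s) ^ 2 *
          zRat q M N (s + 1)) * h1' - br q (s + 1) ^ 2 * zRat q M N s * h2
    · obtain ⟨t, rfl⟩ : ∃ t', t = t' + 1 := ⟨t - 1, by omega⟩
      simp only [Nat.add_sub_cancel, if_neg (show ¬ s = t + 1 by omega),
        if_neg (show ¬ s - 1 = t + 1 by omega)]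
      by_cases e : s = t
      · subst e
        have h3 := normRat_cross hq0 hq hX0 hX (M + N - 2 * s) (L - (s + 1))
        simp only [if_true, if_neg (show ¬ s = s + 1 by omega)]
        -- The truncated subtraction makes `s - 1 = s` true for `s = 0`; the factor `[s]` removes
        -- this spurious term.
        have hz : (if s - 1 = s then zRat q M N (s - 1) * normRat q (X * q ^ 2) (M + N - 2 * (s - 1))
              ((L : ℤ) - (s - 1 : ℕ)) else 0) * br q s = 0 := by
          rcases s with _ | s
          · simp [br_zero]
          · rw [if_neg (by omega), zero_mul]
        have hz' : (if s - 1 = s then zRat q M N (s - 1) * normRat q (X / q ^ 2) (M + N - 2 * (s - 1))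
              ((L : ℤ) - 1 - (s - 1 : ℕ)) else 0) * br q s = 0 := by
          rcases s with _ | s
          · simp [br_zero]
          · rw [if_neg (by omega), zero_mul]
        simp only [Nat.cast_add, Nat.cast_one] at h3 ⊢
        rw [show (L : ℤ) - (s + 1) + 1 = L - s by ring,
          show ((M + N - 2 * s : ℕ) : ℤ) - (L - (s + 1)) = M + N + 1 - s - L by omega,
          show ((M + N - 2 * s : ℕ) : ℤ) = M + N - 2 * s by omega] at h3
        rw [show (L : ℤ) - (s + 1) + 1 = L - s by ring,
          show (M : ℤ) + N + 2 - 2 * (s + 1) = M + N - 2 * s by ring,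
          show (L : ℤ) - 1 - s = L - (s + 1) by ring]
        linear_combination (br q (M + 1 - s) * br q (M + N + 2 - s) * br q (s + 1) * zRat q M N s) * h3
          + br q (L - s + 1) * br q (s + 1) * br q (L - s) * hz
          + (X - 1) / (X - q ^ 2) * eFun q X (M + N + 2 - 2 * s) (L - s) * br q (s + 1) *
            eFun q X (M + N - 2 * s) (L - (s + 1)) * hz'
      -- Here `t + 1` exceeds `s` by at least two, and no diagonal value occurs.
      · simp only [if_neg e, if_neg (show ¬ s - 1 = t by omega)]
        ring

end rational

/-! ### Normalized orthogonality relations and their duals -/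

section rational
variable {K : Type} [Field K] {q X : K}

theorem normRat_ne_zero (hq0 : q ≠ 0) (hq : ∀ n : ℤ, n ≠ 0 → q ^ n ≠ 1)
    (hX : ∀ n : ℤ, q ^ n * X ≠ 1) {N : ℕ} {k : ℤ} (h : 0 ≤ k ∧ k ≤ N) : normRat q X N k ≠ 0 := by
  rw [normRat, if_pos h]
  have := qPoch_mul_inv_ne_zero hq0 hX 2 k.toNat
  refine div_ne_zero (mul_ne_zero (div_ne_zero (qPoch_self_ne_zero hq _)
    (mul_ne_zero (qPoch_self_ne_zero hq _) (qPoch_self_ne_zero hq _)))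
    (qPoch_mul_inv_ne_zero hq0 hX _ _)) (by exact_mod_cast this)

variable (q X) in
/-- The weight in the orthogonality relations. -/
def wRat (M N s j k : ℕ) : K :=
  normRat q X M j * normRat q (X * q ^ (2 * ((M : ℤ) - 2 * j))) N k /
    normRat q X (M + N - 2 * s) (((j + k - s : ℕ) : ℤ))

theorem wRat_eq_zero {M N s j k : ℕ} (h : ¬ (j ≤ M ∧ k ≤ N)) : wRat q X M N s j k = 0 := by
  rw [wRat]
  by_cases h1 : j ≤ M
  · have : normRat q (X * q ^ (2 * ((M : ℤ) - 2 * j))) N k = 0 := by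
      rw [normRat, if_neg (by omega)]
    rw [this, mul_zero, zero_div]
  · rw [normRat, if_neg (by omega), zero_mul, zero_div]

theorem sum_wRat_mul (hq0 : q ≠ 0) (hq : ∀ n : ℤ, n ≠ 0 → q ^ n ≠ 1) (hX0 : X ≠ 0)
    (hX : ∀ n : ℤ, q ^ n * X ≠ 1) {M N L s t : ℕ} (hsM : s ≤ M) (hsN : s ≤ N) (htM : t ≤ M)
    (htN : t ≤ N) (htL : t ≤ L) (htL' : L + t ≤ M + N) :
    ∑ x ∈ Finset.HasAntidiagonal.antidiagonal L,
      wRat q X M N t x.1 x.2 * cgRat q X M N s x.1 x.2 * cgRat q X M N t x.1 x.2 =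
    if s = t then zRat q M N s else 0 := by
  have h := orthSum_eq hq0 hq M N X hX0 hX L s t hsM hsN htM htN
  have h0 : normRat q X (M + N - 2 * t) ((L - t : ℕ) : ℤ) ≠ 0 :=
    normRat_ne_zero hq0 hq hX (by omega)
  have : ∑ x ∈ Finset.HasAntidiagonal.antidiagonal L,
      wRat q X M N t x.1 x.2 * cgRat q X M N s x.1 x.2 * cgRat q X M N t x.1 x.2 =
      orthSum q X M N L s t / normRat q X (M + N - 2 * t) ((L - t : ℕ) : ℤ) := by
    rw [orthSum, Finset.sum_div]
    refine Finset.sum_congr rfl fun x hx => ?_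
    rw [wRat, Finset.HasAntidiagonal.mem_antidiagonal.1 hx]
    ring
  rw [this, h, orthVal, ite_div, zero_div]
  refine if_ctx_congr Iff.rfl (fun e => ?_) fun _ => rfl
  subst e
  rw [show (L : ℤ) - s = ((L - s : ℕ) : ℤ) by omega, mul_div_cancel_right₀ _ h0]

theorem sum_antidiagonal_eq_sum_filter {A : Type} [AddCommMonoid A] (M N L : ℕ) (f : ℕ → ℕ → A)
    (hf : ∀ j k, ¬ (j ≤ M ∧ k ≤ N) → f j k = 0) :
    ∑ x ∈ Finset.range (M + 1) ×ˢ Finset.range (N + 1) with x.1 + x.2 = L, f x.1 x.2 =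
      ∑ x ∈ Finset.HasAntidiagonal.antidiagonal L, f x.1 x.2 := by
  refine Finset.sum_subset ?_ ?_
  · intro x hx
    exact Finset.HasAntidiagonal.mem_antidiagonal.2 (Finset.mem_filter.1 hx).2
  · intro x hx hx'
    refine hf _ _ fun h => hx' ?_
    rw [Finset.mem_filter, Finset.mem_product, Finset.mem_range, Finset.mem_range]
    exact ⟨⟨by omega, by omega⟩, Finset.HasAntidiagonal.mem_antidiagonal.1 hx⟩

/-- The line `j + k = L` meets the rectangle in exactly `min(M, N, L, M+N-L) + 1` points, the number
of admissible `s`; with truncated subtraction `L - N` is the least possible `j`. This is what makes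
the matrix of coefficients square. -/
theorem sum_antidiagonal_eq_sum_fin {A : Type} [AddCommMonoid A] {M N L : ℕ} (hL : L ≤ M + N)
    (f : ℕ → ℕ → A) (hf : ∀ j k, ¬ (j ≤ M ∧ k ≤ N) → f j k = 0) :
    ∑ x ∈ Finset.HasAntidiagonal.antidiagonal L, f x.1 x.2 =
      ∑ i : Fin (min (min M N) (min L (M + N - L)) + 1), f (L - N + i) (L - (L - N + i)) := by
  rw [Finset.Nat.sum_antidiagonal_eq_sum_range_succ f,
    Fin.sum_univ_eq_sum_range fun i => f (L - N + i) (L - (L - N + i))]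
  have := Finset.sum_Ico_eq_sum_range (fun j => f j (L - j)) (L - N)
    (L - N + (min (min M N) (min L (M + N - L)) + 1))
  rw [Nat.add_sub_cancel_left] at this
  rw [← this]
  symm
  refine Finset.sum_subset ?_ ?_
  · intro j hj
    rw [Finset.mem_Ico] at hj
    rw [Finset.mem_range]
    omega
  · intro j hj hj'
    rw [Finset.mem_range] at hj
    rw [Finset.mem_Ico] at hj'
    exact hf _ _ (by omega)

/-- For fixed `L`, orthogonality says that the matrix `P` of coefficients has the right inverse `R`,
its weighted and normalized transpose. The matrices are square, so `R` is also a left inverse. -/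
theorem sum_wRat_mul_dual (hq0 : q ≠ 0) (hq : ∀ n : ℤ, n ≠ 0 → q ^ n ≠ 1) (hX0 : X ≠ 0)
    (hX : ∀ n : ℤ, q ^ n * X ≠ 1) {M N L j k : ℕ} (hL : L ≤ M + N) (hj : j ≤ min L M)
    (hk : k ≤ min L M) (hj' : L - j ≤ N) (hk' : L - k ≤ N) :
    ∑ s ∈ Finset.range (min (min M N) (min L (M + N - L)) + 1),
      1 / zRat q M N s * wRat q X M N s j (L - j) * cgRat q X M N s j (L - j) *
        cgRat q X M N s k (L - k) = if j = k then 1 else 0 := by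
  set n := min (min M N) (min L (M + N - L)) + 1 with hn
  let P : Matrix (Fin n) (Fin n) K := fun s i =>
    cgRat q X M N s (L - N + i) (L - (L - N + i))
  let R : Matrix (Fin n) (Fin n) K := fun i s =>
    1 / zRat q M N s * wRat q X M N s (L - N + i) (L - (L - N + i)) *
      cgRat q X M N s (L - N + i) (L - (L - N + i))
  have h1 : P * R = 1 := by
    ext s t
    have hs := s.2
    have ht := t.2
    have h := sum_wRat_mul hq0 hq hX0 hX (M := M) (N := N) (L := L) (s := s) (t := t) (by omega)
      (by omega) (by omega) (by omega) (by omega) (by omega)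
    rw [sum_antidiagonal_eq_sum_fin hL (fun j k =>
      wRat q X M N t j k * cgRat q X M N s j k * cgRat q X M N t j k)
      fun j k h => by rw [wRat_eq_zero h, zero_mul, zero_mul]] at h
    rw [Matrix.mul_apply, Matrix.one_apply]
    have : ∀ i, P s i * R i t = (1 / zRat q M N t) * (wRat q X M N t (L - N + i) (L - (L - N + i)) *
        cgRat q X M N s (L - N + i) (L - (L - N + i)) *
          cgRat q X M N t (L - N + i) (L - (L - N + i))) := fun i => by
      simp only [P, R]; ring
    simp only [this, ← Finset.mul_sum]
    rw [h, mul_ite, mul_zero]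
    refine if_ctx_congr Fin.ext_iff.symm (fun e => ?_) fun _ => rfl
    rw [e]
    exact one_div_mul_cancel (zRat_ne_zero hq0 hq (by omega) (by omega))
  -- One-sided inverses of square matrices over a field are two-sided.
  have h2 : R * P = 1 := mul_eq_one_comm.1 h1
  have h3 := congrFun (congrFun h2 ⟨j - (L - N), by omega⟩) ⟨k - (L - N), by omega⟩
  rw [Matrix.mul_apply, Matrix.one_apply] at h3
  have e1 : L - N + (j - (L - N)) = j := by omega
  have e2 : L - N + (k - (L - N)) = k := by omega
  rw [← Fin.sum_univ_eq_sum_range fun s =>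
    1 / zRat q M N s * wRat q X M N s j (L - j) * cgRat q X M N s j (L - j) *
        cgRat q X M N s k (L - k)]
  simp only [P, R, e1, e2] at h3
  rw [h3]
  refine if_congr ?_ rfl rfl
  rw [Fin.ext_iff]
  simp only
  omega

end rational

/-! ### From rational functions of `q` and `X` to meromorphic functions of `λ` -/

section transfer

theorem map_qPoch {K L : Type} [Field K] [Field L] (φ : K →+* L) (a Q : K) (n : ℕ) :
    φ (qPoch a Q n) = qPoch (φ a) (φ Q) n := by
  simp [qPoch, map_prod]

/-- Applied to the automorphism `T_a`, which fixes the constant `q`, this turns a shift of `λ` into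
a substitution for `X`. -/
theorem map_cgRat {K L : Type} [Field K] [Field L] (φ : K →+* L) (q X : K) (M N s j k : ℕ) :
    φ (cgRat q X M N s j k) = cgRat (φ q) (φ X) M N s j k := by
  simp [cgRat, cgPre, cgSum, phiTerm, map_qPoch, map_sum]

theorem map_normRat {K L : Type} [Field K] [Field L] (φ : K →+* L) (q X : K) (N : ℕ) (k : ℤ) :
    φ (normRat q X N k) = normRat (φ q) (φ X) N k := by
  rw [normRat, normRat]
  split_ifs
  · simp [qBinom, map_qPoch]
  · simp

theorem map_aFun {K L : Type} [Field K] [Field L] (φ : K →+* L) (q X : K) (i : ℤ) :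
    φ (aFun q X i) = aFun (φ q) (φ X) i := by
  simp [aFun]

theorem map_br {K L : Type} [Field K] [Field L] (φ : K →+* L) (q : K) (i : ℤ) :
    φ (br q i) = br (φ q) i := by
  simp [br]

theorem map_eFun {K L : Type} [Field K] [Field L] (φ : K →+* L) (q X : K) (P i : ℤ) :
    φ (eFun q X P i) = eFun (φ q) (φ X) P i := by
  simp [eFun, map_br]

variable (q : Set.Ioo (0 : ℝ) 1)

theorem qpow_zero_eq_zpow (a : ℤ) : qpow q 0 a = qpow q 0 1 ^ a := by
  rw [qpow_zero_left, qpow_zero_left, ← map_zpow₀, zpow_one]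

theorem qpow_mul_zpow (b a c : ℤ) : qpow q b (a + c) = qpow q b a * qpow q 0 1 ^ c := by
  rw [← qpow_zero_eq_zpow, ← qpow_add, add_zero]

theorem qpow_neg_two (a : ℤ) : qpow q (-2) a = qpow q 0 1 ^ (a + 2) * (qpow q 2 2)⁻¹ := by
  rw [eq_mul_inv_iff_mul_eq₀ (qpow_ne_zero q 2 2), ← qpow_add, ← qpow_zero_eq_zpow]
  norm_num

theorem qpow_zero_one_zpow_ne_one (n : ℤ) (hn : n ≠ 0) : qpow q 0 1 ^ n ≠ 1 := by
  intro h
  rw [← qpow_zero_eq_zpow, qpow_zero_left, ← map_one (algebraMap ℂ Mer)] at h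
  have h4 := (algebraMap ℂ Mer).injective h
  have h5 : (q : ℝ) ^ n = 1 := by exact_mod_cast h4
  exact hn ((zpow_eq_one_iff_right₀ q.2.1.le q.2.2.ne).1 h5)

/-- `q^n X` is not a constant function. This is the genericity assumption of the rational
computations. -/
theorem zpow_mul_qpow_ne_one (n : ℤ) : qpow q 0 1 ^ n * qpow q 2 2 ≠ 1 := by
  rw [mul_comm, ← qpow_mul_zpow, ← map_one (algebraMap ℂ Mer)]
  exact qpow_ne_algebraMap q two_ne_zero _ _

theorem T_qpow_two_two (n : ℤ) : T n (qpow q 2 2) = qpow q 2 2 * qpow q 0 1 ^ (2 * n) := by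
  rw [T_qpow, qpow_mul_zpow]

theorem T_qpow_zero_one (a : ℂ) : T a (qpow q 0 1) = qpow q 0 1 := by
  rw [qpow_zero_left, AlgHom.commutes]

/-- Since `q^{2(a-λ-1)} = q^{2a} X⁻¹`, the parameters agree. The series, cut at `s` in one place and
at `j` in the other, are compared by `phi43_eq_sum`. -/
theorem cgCoeff_eq_cgRat (M N s j k : ℕ) :
    cgCoeff q M N s j k = cgRat (qpow q 0 1) (qpow q 2 2) M N s j k := by
  have e2 : qpow q 0 2 = qpow q 0 1 ^ 2 := by rw [qpow_zero_eq_zpow]; norm_cast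
  have h1 : ∀ a : ℤ, qpow q (-2) (2 * (a - 1)) = qpow q 0 1 ^ (2 * a) * (qpow q 2 2)⁻¹ := by
    intro a
    rw [qpow_neg_two]; congr 2; ring
  rw [cgCoeff, phi43_eq_sum (j := j) (qpow_ne_zero q 0 2) ?_, cgRat]
  · congr 1
    · rw [cgFactor, cgPre, h1, h1, e2, qpow_zero_eq_zpow q (-2 * _), qpow_zero_eq_zpow q (-2 * _),
        qpow_zero_eq_zpow q (_ + _)]
    · rw [cgSum, h1, h1, qpow_zero_eq_zpow q (-2 * j), qpow_zero_eq_zpow q (-2 * M),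
        qpow_zero_eq_zpow q (-2 * (_ + _)), qpow_zero_eq_zpow q (2 * _), e2, ← zpow_natCast,
        ← zpow_mul]
      refine Finset.sum_congr rfl fun i _ => ?_
      congr 2
      push_cast; ring
  · rw [e2, qpow_zero_eq_zpow, ← pow_mul, ← zpow_natCast, ← zpow_add₀ (qpow_ne_zero q 0 1)]
    have : -2 * (j : ℤ) + ((2 * j : ℕ) : ℤ) = 0 := by push_cast; ring
    rw [this, zpow_zero]

theorem normFun_eq_normRat {N k : ℕ} (hk : k ≤ N) :
    normFun q N k = normRat (qpow q 0 1) (qpow q 2 2) N k := by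
  have e2 : qpow q 0 2 = qpow q 0 1 ^ 2 := by rw [qpow_zero_eq_zpow]; norm_cast
  rw [normFun, normRat, if_pos (by omega), qpow_neg_two, qpow_neg_two, e2, Int.toNat_natCast,
    show 2 * ((k : ℤ) - N - 1) + 2 = 2 * (k - N) by ring]
  norm_cast

theorem cgWeight_eq_wRat {M N s j k : ℕ} (hj : j ≤ M) (hk : k ≤ N)
    (hs' : j + k - s ≤ M + N - 2 * s) :
    cgWeight q M N s j k = wRat (qpow q 0 1) (qpow q 2 2) M N s j k := by
  rw [cgWeight, wRat, normFun_eq_normRat q hj, normFun_eq_normRat q hk, normFun_eq_normRat q hs',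
    show (M : ℂ) - 2 * j = (((M : ℤ) - 2 * j : ℤ) : ℂ) by push_cast; ring]
  have := map_normRat (T (((M : ℤ) - 2 * j : ℤ) : ℂ)).toRingHom (qpow q 0 1) (qpow q 2 2) N k
  simp only [AlgHom.toRingHom_eq_coe, RingHom.coe_coe] at this
  rw [this, T_qpow_zero_one, T_qpow_two_two]

theorem cgNorm_eq_zRat (M N s : ℕ) : cgNorm q M N s = zRat (qpow q 0 1) M N s := by
  have e2 : qpow q 0 2 = qpow q 0 1 ^ 2 := by rw [qpow_zero_eq_zpow]; norm_cast
  rw [cgNorm, zRat, e2, qpow_zero_eq_zpow, qpow_zero_eq_zpow q (2 * _),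
    qpow_zero_eq_zpow q (-2 * M), qpow_zero_eq_zpow q (-2 * N)]

theorem T_cgCoeff (n : ℤ) (M N s j k : ℕ) : T n (cgCoeff q M N s j k) =
    cgRat (qpow q 0 1) (qpow q 2 2 * qpow q 0 1 ^ (2 * n)) M N s j k := by
  have := map_cgRat (T (n : ℂ)).toRingHom (qpow q 0 1) (qpow q 2 2) M N s j k
  simp only [AlgHom.toRingHom_eq_coe, RingHom.coe_coe] at this
  rw [cgCoeff_eq_cgRat, this, T_qpow_zero_one, T_qpow_two_two]

/-- The `q`-Racah convention lists the last two lower parameters in the opposite order. -/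
theorem phi43_swap {K : Type} [Field K] (n : ℕ) (a b c d e f Q z : K) :
    phi43 n a b c d e f Q z = phi43 n a b c d f e Q z := by
  simp only [phi43, mul_right_comm (qPoch d Q _) (qPoch e Q _)]

theorem cgCoeff_eq_qRacah (M N s j k : ℕ) :
    cgCoeff q M N s j k = cgFactor q M N s j k *
      qRacah s j (qpow q 0 (-2 * (M + 1))) (qpow q 0 (-2 * (N + 1)))
        (qpow q 0 (-2 * (j + k + 1))) (qpow q (-2) (2 * (j + k - M - 1))) (qpow q 0 2) := by
  rw [cgCoeff, qRacah, phi43_swap]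
  have e : ∀ n : ℕ, qpow q 0 2 ^ n = qpow q 0 (2 * n) := by
    intro n
    rw [qpow_zero_eq_zpow q 2, qpow_zero_eq_zpow q (2 * n), ← zpow_natCast, ← zpow_mul]
  have e' : qpow q 0 2 ^ (-(j : ℤ)) = qpow q 0 (-2 * j) := by
    rw [qpow_zero_eq_zpow q 2, qpow_zero_eq_zpow q (-2 * j), ← zpow_mul]
    congr 1; ring
  rw [e, e, e', ← qpow_add, ← qpow_add, ← qpow_add, ← qpow_add, ← qpow_add, ← qpow_add, ← qpow_add,
    ← qpow_add]
  congr 2 <;> congr 1 <;> push_cast <;> ring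

/-- Orthogonality of the Clebsch-Gordan coefficients. -/
theorem sum_cgWeight_mul {M N L s t : ℕ} (hsM : s ≤ M) (hsN : s ≤ N) (htM : t ≤ M)
    (htN : t ≤ N) (htL : t ≤ L) (htL' : L + t ≤ M + N) :
    ∑ x ∈ Finset.range (M + 1) ×ˢ Finset.range (N + 1) with x.1 + x.2 = L,
        cgWeight q M N t x.1 x.2 * cgCoeff q M N s x.1 x.2 * cgCoeff q M N t x.1 x.2 =
      if s = t then cgNorm q M N s else 0 := by
  have h := sum_wRat_mul (qpow_ne_zero q 0 1) (qpow_zero_one_zpow_ne_one q) (qpow_ne_zero q 2 2)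
    (zpow_mul_qpow_ne_one q) hsM hsN htM htN htL htL'
  rw [← sum_antidiagonal_eq_sum_filter M N L (fun j k =>
    wRat (qpow q 0 1) (qpow q 2 2) M N t j k * cgRat (qpow q 0 1) (qpow q 2 2) M N s j k *
      cgRat (qpow q 0 1) (qpow q 2 2) M N t j k)
    fun j k h => by rw [wRat_eq_zero h, zero_mul, zero_mul]] at h
  rw [cgNorm_eq_zRat, ← h]
  refine Finset.sum_congr rfl fun x hx => ?_
  rw [Finset.mem_filter, Finset.mem_product, Finset.mem_range, Finset.mem_range] at hx
  rw [cgWeight_eq_wRat q (by omega) (by omega) (by omega), cgCoeff_eq_cgRat, cgCoeff_eq_cgRat]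

/-- Dual orthogonality of the Clebsch-Gordan coefficients. -/
theorem sum_cgWeight_mul_dual {M N L j k : ℕ} (hL : L ≤ M + N) (hj : j ≤ min L M)
    (hk : k ≤ min L M) (hj' : L - j ≤ N) (hk' : L - k ≤ N) :
    ∑ s ∈ Finset.range (min (min M N) (min L (M + N - L)) + 1),
      1 / cgNorm q M N s * cgWeight q M N s j (L - j) *
          cgCoeff q M N s j (L - j) * cgCoeff q M N s k (L - k) = if j = k then 1 else 0 := by
  rw [← sum_wRat_mul_dual (qpow_ne_zero q 0 1) (qpow_zero_one_zpow_ne_one q) (qpow_ne_zero q 2 2)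
    (zpow_mul_qpow_ne_one q) hL hj hk hj' hk']
  refine Finset.sum_congr rfl fun s hs => ?_
  rw [Finset.mem_range] at hs
  rw [cgWeight_eq_wRat q (by omega) (by omega) (by omega), cgCoeff_eq_cgRat, cgCoeff_eq_cgRat,
    cgNorm_eq_zRat]

theorem cgCoeff_eq_zero_of_lt {M N s j k : ℕ} (h : j + k < s) : cgCoeff q M N s j k = 0 := by
  rw [cgCoeff_eq_cgRat, cgRat_eq_zero_of_lt (qpow_ne_zero q 0 1) _ _ h]

theorem cgCoeff_eq_zero_of_gt {M N s j k : ℕ} (hsM : s ≤ M) (hsN : s ≤ N) (hj : j ≤ M)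
    (hk : k ≤ N) (h : M + N < j + k + s) : cgCoeff q M N s j k = 0 := by
  rw [cgCoeff_eq_cgRat, cgRat_eq_zero_of_gt (qpow_ne_zero q 0 1) (qpow_zero_one_zpow_ne_one q)
    (qpow_ne_zero q 2 2) (zpow_mul_qpow_ne_one q) hsM hsN hj hk h]

theorem cgNorm_ne_zero {M N s : ℕ} (hsM : s ≤ M) (hsN : s ≤ N) : cgNorm q M N s ≠ 0 := by
  rw [cgNorm_eq_zRat]
  exact zRat_ne_zero (qpow_ne_zero q 0 1) (qpow_zero_one_zpow_ne_one q) hsM hsN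

end transfer

/-! ### A representation by difference operators -/

section representation

/-- The difference operator `φ ↦ (n ↦ w(n) T_s φ(n + t))`. -/
def shiftOp (w : ℤ → Mer) (s t : ℤ) : Module.End ℂ (ℤ → Mer) where
  toFun φ n := w n * T s (φ (n + t))
  map_add' φ ψ := funext fun n => by simp [mul_add]
  map_smul' c φ := funext fun n => by simp

theorem shiftOp_apply (w : ℤ → Mer) (s t : ℤ) (φ : ℤ → Mer) (n : ℤ) :
    shiftOp w s t φ n = w n * T s (φ (n + t)) := rfl

theorem shiftOp_mul (w w' : ℤ → Mer) (s t s' t' : ℤ) :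
    shiftOp w s t * shiftOp w' s' t' =
      shiftOp (fun n => w n * T s (w' (n + t))) (s + s') (t + t') := by
  refine LinearMap.ext fun φ => funext fun n => ?_
  rw [Module.End.mul_apply, shiftOp_apply, shiftOp_apply, shiftOp_apply, map_mul, T_T, mul_assoc,
    add_assoc]
  push_cast
  rfl

theorem shiftOp_sub (w w' : ℤ → Mer) (s t : ℤ) :
    shiftOp w s t - shiftOp w' s t = shiftOp (fun n => w n - w' n) s t :=
  LinearMap.ext fun _ => funext fun _ => (sub_mul _ _ _).symm

theorem shiftOp_add (w w' : ℤ → Mer) (s t : ℤ) :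
    shiftOp w s t + shiftOp w' s t = shiftOp (fun n => w n + w' n) s t :=
  LinearMap.ext fun _ => funext fun _ => (add_mul _ _ _).symm

theorem shiftOp_algebraMap (c : ℂ) :
    shiftOp (fun _ => algebraMap ℂ Mer c) 0 0 = algebraMap ℂ (Module.End ℂ (ℤ → Mer)) c :=
  LinearMap.ext fun φ => funext fun n => by
    rw [shiftOp_apply, Int.cast_zero, T_zero, add_zero, Module.algebraMap_end_apply, Pi.smul_apply,
      Algebra.smul_def]

theorem shiftOp_one : shiftOp (fun _ => 1) 0 0 = 1 := by
  have := shiftOp_algebraMap 1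
  rwa [map_one, map_one] at this

theorem shiftOp_congr {w w' : ℤ → Mer} {s s' t t' : ℤ} (hs : s = s') (ht : t = t')
    (h : ∀ n, w n = w' n) : shiftOp w s t = shiftOp w' s' t' := by
  rw [hs, ht, funext h]

theorem shiftOp_injective {w : ℤ → Mer} (s t : ℤ) (hw : ∀ n, w n ≠ 0) :
    Function.Injective (shiftOp w s t) := by
  intro φ ψ h
  funext n
  have := congrFun h (n - t)
  rw [shiftOp_apply, shiftOp_apply, sub_add_cancel] at this
  exact (T s).toRingHom.injective (mul_left_cancel₀ (hw _) this)

variable (q : Set.Ioo (0 : ℝ) 1)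

/-- `q^{2(λ+2n+1)}` -/
def yFun (n : ℤ) : Mer := qpow q 2 (2 + 4 * n)

theorem T_yFun (s n : ℤ) : T s (yFun q n) = yFun q n * qpow q 0 1 ^ (2 * s) := by
  rw [yFun, T_qpow, qpow_mul_zpow]

theorem yFun_add (n m : ℤ) : yFun q (n + m) = yFun q n * qpow q 0 1 ^ (4 * m) := by
  rw [yFun, yFun, ← qpow_mul_zpow]; congr 1; ring

theorem zpow_mul_yFun_ne_one (k n : ℤ) : qpow q 0 1 ^ k * yFun q n ≠ 1 := by
  rw [yFun, mul_comm, ← qpow_mul_zpow, ← map_one (algebraMap ℂ Mer)]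
  exact qpow_ne_algebraMap q two_ne_zero _ _

/-- The weight of `γ`. -/
def cWt : Mer := qpow q 1 0 / (qpow q 0 1 ^ 2 * qpow q 2 2 - 1)
/-- The weight of `β`. -/
def bWt (n : ℤ) : Mer :=
  (qpow q 1 0)⁻¹ * (qpow q 2 2 + qpow q 0 1 ^ 2 * yFun q n) / (yFun q n - 1)
/-- The weight of `δ`. -/
def dWt (n : ℤ) : Mer :=
  (qpow q 0 1 ^ 2 * qpow q 2 2 * yFun q n + 1) /
    ((yFun q n - 1) * (qpow q 0 1 ^ 2 * qpow q 2 2 - 1))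

theorem T_qpow_one (s : ℤ) : T s (qpow q 1 0) = qpow q 1 0 * qpow q 0 1 ^ s := by
  rw [T_qpow, one_mul, qpow_mul_zpow]

theorem qpow_one_sq : qpow q 1 0 ^ 2 * qpow q 0 1 ^ 2 = qpow q 2 2 := by
  rw [pow_two, pow_two, ← qpow_add, ← qpow_add, ← qpow_add]; norm_num

theorem F_eq_div : F q = (qpow q 0 1 ^ 2 * qpow q 2 2 - 1) / (qpow q 0 1 ^ 2 * (qpow q 2 2 - 1)) := by
  have h := qpow_ne_zero q 0 1
  have h1 := x_sub_one_ne_zero q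
  rw [F, qpow_zero_eq_zpow q (-2), zpow_neg]
  have : qpow q 0 1 ^ (2 : ℤ) = qpow q 0 1 ^ 2 := by norm_cast
  rw [this]
  field_simp

theorem T_F_eq_div (n : ℤ) : T (2 * n) (F q) =
    (qpow q 0 1 ^ 2 * yFun q n - 1) / (qpow q 0 1 ^ 2 * (yFun q n - 1)) := by
  have h : T ((2 * n : ℤ) : ℂ) (qpow q 2 2) = yFun q n := by
    rw [T_qpow_two_two, yFun, qpow_mul_zpow]; congr 2; ring
  push_cast at h
  rw [F_eq_div]
  simp only [map_div₀, map_mul, map_sub, map_pow, map_one, h, T_qpow_zero_one]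

/-- Multiplication by `f(μ)`. -/
def rOp (f : Mer) : Module.End ℂ (ℤ → Mer) := shiftOp (fun n => T (2 * n) f) 0 0
/-- Multiplication by `f(λ)`. -/
def lOp (f : Mer) : Module.End ℂ (ℤ → Mer) := shiftOp (fun _ => f) 0 0

/-- The operators act on sequences of functions, with `μ` interpreted as `λ + 2n` at place `n`.
Bidegree `(a, b)` forces the shift `T_{-a}` in `λ` and the displacement `(a - b)/2` in `n`, which
gives the commutation rules with functions. The weights of `β`, `γ` and `δ` are chosen so that the
remaining relations hold when `α` has weight one; these are rational identities in `q`, `q^λ`, `X =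
q^{2(λ+1)}` and `Y = q^{2(μ+1)}`. -/
theorem rep_rel (x y : Module.End ℂ (ℤ → Mer))
    (h : Relation q (shiftOp (fun _ => 1) (-1) 0) (shiftOp (bWt q) (-1) 1)
      (shiftOp (fun _ => cWt q) 1 (-1)) (shiftOp (dWt q) 1 0) lOp rOp x y) : x = y := by
  have q0 := qpow_ne_zero q 0 1
  have L0 := qpow_ne_zero q 1 0
  have X0 := qpow_ne_zero q 2 2
  have y0 : ∀ n, yFun q n ≠ 0 := fun n => qpow_ne_zero q _ _
  have hX1 := x_sub_one_ne_zero q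
  have hX2 : qpow q 0 1 ^ 2 * qpow q 2 2 - 1 ≠ 0 :=
    sub_ne_zero.2 (by exact_mod_cast zpow_mul_qpow_ne_one q 2)
  have hX4 : qpow q 0 1 ^ 4 * qpow q 2 2 - 1 ≠ 0 :=
    sub_ne_zero.2 (by exact_mod_cast zpow_mul_qpow_ne_one q 4)
  have hY1 : ∀ n, yFun q n - 1 ≠ 0 := fun n =>
    sub_ne_zero.2 (by simpa using zpow_mul_yFun_ne_one q 0 n)
  have hY2 : ∀ n, yFun q n - qpow q 0 1 ^ 2 ≠ 0 := fun n h => by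
    refine zpow_mul_yFun_ne_one q (-2) n ?_
    rw [sub_eq_zero.1 h, zpow_neg]
    exact inv_mul_cancel₀ (by exact_mod_cast pow_ne_zero 2 q0)
  have hY2' : ∀ n, qpow q 0 1 ^ 2 * yFun q n - 1 ≠ 0 := fun n =>
    sub_ne_zero.2 (by exact_mod_cast zpow_mul_yFun_ne_one q 2 n)
  have hL := qpow_one_sq q
  have tX1 : T 1 (qpow q 2 2) = qpow q 2 2 * qpow q 0 1 ^ 2 := by
    have := T_qpow_two_two q 1
    push_cast at this; rw [this]; norm_cast
  have tX1' : T (-1) (qpow q 2 2) = qpow q 2 2 / qpow q 0 1 ^ 2 := by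
    have := T_qpow_two_two q (-1)
    push_cast at this; rw [this, div_eq_mul_inv, ← zpow_ofNat, ← zpow_neg]
  have tL1 : T 1 (qpow q 1 0) = qpow q 1 0 * qpow q 0 1 := by
    have := T_qpow_one q 1
    push_cast at this; rw [this, zpow_one]
  have tL1' : T (-1) (qpow q 1 0) = qpow q 1 0 / qpow q 0 1 := by
    have := T_qpow_one q (-1)
    push_cast at this; rw [this, zpow_neg, zpow_one, div_eq_mul_inv]
  have tY1 : ∀ n, T 1 (yFun q n) = yFun q n * qpow q 0 1 ^ 2 := fun n => by
    have := T_yFun q 1 n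
    push_cast at this; rw [this]; norm_cast
  have tY1' : ∀ n, T (-1) (yFun q n) = yFun q n / qpow q 0 1 ^ 2 := fun n => by
    have := T_yFun q (-1) n
    push_cast at this; rw [this, div_eq_mul_inv, ← zpow_ofNat, ← zpow_neg]
  have sY1 : ∀ n, yFun q (n + 1) = yFun q n * qpow q 0 1 ^ 4 := fun n => by
    have := yFun_add q n 1
    rw [this]; norm_cast
  have sY1' : ∀ n, yFun q (n + -1) = yFun q n / qpow q 0 1 ^ 4 := fun n => by
    have := yFun_add q n (-1)
    rw [this, mul_neg, zpow_neg, div_eq_mul_inv]; norm_cast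
  -- The function `F(μ - 1)` at place `n`.
  have tF : ∀ n : ℤ, T (2 * n) (T (-1) (F q)) =
      (yFun q n - 1) / (yFun q n - qpow q 0 1 ^ 2) := fun n => by
    have := hY2 n
    rw [T_T, add_comm, ← T_T, T_F_eq_div]
    simp only [map_div₀, map_mul, map_sub, map_pow, map_one, T_qpow_zero_one, tY1']
    field_simp
  have tX : ∀ n : ℤ, T (2 * n) (qpow q 2 2) = yFun q n := fun n => by
    have := T_qpow_two_two q (2 * n)
    push_cast at this
    rw [this, yFun, qpow_mul_zpow]; congr 2; ring
  have hQ2 : qpow q 0 2 = qpow q 0 1 ^ 2 := by rw [qpow_zero_eq_zpow]; norm_cast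
  have hQ1' : qpow q 0 (-1) = (qpow q 0 1)⁻¹ := by rw [qpow_zero_eq_zpow, zpow_neg, zpow_one]
  have hQ2' : qpow q 0 (-2) = (qpow q 0 1 ^ 2)⁻¹ := by
    rw [qpow_zero_eq_zpow, zpow_neg]; norm_cast
  have c1 : ∀ f g : Mer, f * T ((1 : ℤ) : ℂ) g = f * T 1 g := fun f g => by norm_cast
  have c2 : ∀ f g : Mer, f * T ((-1 : ℤ) : ℂ) g = f * T (-1) g := fun f g => by norm_cast
  have c0 : ∀ f g : Mer, f * T ((0 : ℤ) : ℂ) g = f * g := fun f g => by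
    rw [Int.cast_zero, T_zero]
  have c0' : ∀ n : ℤ, n + 0 = n := fun n => add_zero n
  cases h
  case l_add f g => exact (shiftOp_add _ _ _ _).symm
  case l_mul f g =>
    rw [lOp, lOp, lOp, shiftOp_mul]
    exact shiftOp_congr rfl rfl fun n => (c0 _ _).symm
  case l_const c => exact shiftOp_algebraMap c
  case r_add f g =>
    rw [rOp, rOp, rOp, shiftOp_add]
    exact shiftOp_congr rfl rfl fun n => map_add _ _ _
  case r_mul f g =>
    rw [rOp, rOp, rOp, shiftOp_mul]
    exact shiftOp_congr rfl rfl fun n => by rw [c0, c0', map_mul]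
  case r_const c =>
    rw [← shiftOp_algebraMap, rOp]
    exact shiftOp_congr rfl rfl fun n => AlgHom.commutes _ _
  case l_r f g =>
    rw [rOp, lOp, shiftOp_mul, shiftOp_mul]
    exact shiftOp_congr rfl rfl fun n => by rw [c0, c0', c0, mul_comm]
  case l_α f =>
    rw [lOp, lOp, shiftOp_mul, shiftOp_mul]
    exact shiftOp_congr rfl rfl fun n => by rw [c0, c2, T_T, neg_add_cancel, T_zero, mul_comm]
  case r_α f =>
    rw [rOp, rOp, shiftOp_mul, shiftOp_mul]
    exact shiftOp_congr rfl rfl fun n => by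
      rw [c0, c2, T_T, T_T, mul_comm]; congr 2; push_cast; ring_nf
  case l_β f =>
    rw [lOp, lOp, shiftOp_mul, shiftOp_mul]
    exact shiftOp_congr rfl rfl fun n => by
      rw [c0, c2, T_T, neg_add_cancel, T_zero, mul_comm, add_zero]
  case r_β f =>
    rw [rOp, rOp, shiftOp_mul, shiftOp_mul]
    exact shiftOp_congr rfl rfl fun n => by
      rw [c0, c2, T_T, T_T, mul_comm, add_zero]; congr 2; push_cast; ring_nf
  case l_γ f =>
    rw [lOp, lOp, shiftOp_mul, shiftOp_mul]
    exact shiftOp_congr rfl rfl fun n => by rw [c0, c1, T_T, add_neg_cancel, T_zero, mul_comm]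
  case r_γ f =>
    rw [rOp, rOp, shiftOp_mul, shiftOp_mul]
    exact shiftOp_congr rfl rfl fun n => by
      rw [c0, c1, T_T, T_T, mul_comm]; congr 2; push_cast; ring_nf
  case l_δ f =>
    rw [lOp, lOp, shiftOp_mul, shiftOp_mul]
    exact shiftOp_congr rfl rfl fun n => by
      rw [c0, c1, T_T, add_neg_cancel, T_zero, mul_comm, add_zero]
  case r_δ f =>
    rw [rOp, rOp, shiftOp_mul, shiftOp_mul]
    exact shiftOp_congr rfl rfl fun n => by
      rw [c0, c1, T_T, T_T, mul_comm, add_zero]; congr 2; ring_nf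
  case αβ =>
    rw [rOp, shiftOp_mul, shiftOp_mul, shiftOp_mul]
    refine shiftOp_congr rfl rfl fun n => ?_
    have h1 := hY1 n; have h2 := hY2 n
    rw [c0, c2, c2, map_mul, tF]
    simp only [bWt, add_zero, map_div₀, map_mul, map_sub, map_add, map_pow, map_inv₀, map_one, T_qpow_zero_one, tX1',
      tY1', tL1']
    field_simp
  case αγ =>
    rw [lOp, shiftOp_mul, shiftOp_mul, shiftOp_mul]
    refine shiftOp_congr rfl rfl fun n => ?_
    rw [c0, c1, c2, F_eq_div]
    simp only [cWt, map_div₀, map_mul, map_sub, map_add, map_pow, map_inv₀, map_one, T_qpow_zero_one, tX1',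
      tY1', tL1']
    field_simp
  case βδ =>
    rw [lOp, shiftOp_mul, shiftOp_mul, shiftOp_mul]
    refine shiftOp_congr rfl rfl fun n => ?_
    have h1 := hY1 n; have h2 := hY2' n
    rw [c0, c1, c2, F_eq_div]
    simp only [bWt, dWt, add_zero, map_div₀, map_mul, map_sub, map_add, map_pow, map_inv₀, map_one, T_qpow_zero_one, tX1',
      tY1', tL1', sY1, tX1, tY1, tL1]
    generalize yFun q n = Y at *
    generalize qpow q 2 2 = X at *
    generalize qpow q 1 0 = L at *
    generalize qpow q 0 1 = p at *
    have h3 : Y * p ^ 2 - 1 ≠ 0 := by rwa [mul_comm]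
    have h4 : Y / p ^ 2 * p ^ 4 - 1 = Y * p ^ 2 - 1 := by field_simp
    have h5 : p ^ 2 * (X / p ^ 2) - 1 = X - 1 := by field_simp
    have h6 : X * p ^ 2 - 1 ≠ 0 := by rwa [mul_comm]
    rw [h4, h5]
    field_simp
  case γδ =>
    rw [rOp, shiftOp_mul, shiftOp_mul, shiftOp_mul]
    refine shiftOp_congr rfl rfl fun n => ?_
    have h1 := hY1 n; have h2 := hY2 n
    rw [c0, c1, c1, map_mul, tF]
    simp only [cWt, dWt, add_zero, map_div₀, map_mul, map_sub, map_add, map_pow, map_inv₀, map_one, T_qpow_zero_one, tX1',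
      tY1', tL1', sY1', tX1, tY1, tL1]
    generalize yFun q n = Y at *
    generalize qpow q 2 2 = X at *
    generalize qpow q 1 0 = L at *
    generalize qpow q 0 1 = p at *
    have h4 : Y * p ^ 2 / p ^ 4 - 1 = (Y - p ^ 2) / p ^ 2 := by field_simp
    have h5 : p ^ 2 * (X * p ^ 2) - 1 = p ^ 4 * X - 1 := by ring
    rw [h4, h5]
    field_simp
  case αδ =>
    simp only [lOp, rOp]
    simp only [shiftOp_mul, ← shiftOp_one, shiftOp_sub, add_zero, zero_add, add_neg_cancel,
      neg_add_cancel]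
    refine shiftOp_congr rfl rfl fun n => ?_
    have h1 := hY1 n; have h2 := hY2 n
    simp only [Int.cast_zero, Int.cast_one, Int.cast_neg, T_zero, hQ1', tX, cWt, bWt, dWt, add_zero, map_div₀, map_mul, map_sub, map_add, map_pow, map_inv₀, map_one, T_qpow_zero_one, tX1',
      tY1', tL1', sY1', tX1, tY1, tL1]
    generalize yFun q n = Y at *
    generalize qpow q 2 2 = X at *
    generalize qpow q 1 0 = L at *
    generalize qpow q 0 1 = p at *
    have h4 : Y * p ^ 2 / p ^ 4 - 1 = (Y - p ^ 2) / p ^ 2 := by field_simp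
    have h4' : Y / p ^ 2 - 1 = (Y - p ^ 2) / p ^ 2 := by field_simp
    have h5 : p ^ 2 * (X / p ^ 2) - 1 = X - 1 := by field_simp
    rw [h4, h4', h5]
    generalize hD : p ^ 2 * X - 1 = D at *
    field_simp
    rw [← hD]
    ring
  case βγ =>
    simp only [lOp, rOp]
    simp only [shiftOp_mul, ← shiftOp_one, shiftOp_sub, add_zero, zero_add, add_neg_cancel,
      neg_add_cancel]
    refine shiftOp_congr rfl rfl fun n => ?_
    have h1 := hY1 n; have h2 := hY2 n
    simp only [G, Int.cast_zero, Int.cast_one, Int.cast_neg, T_zero, hQ1', hQ2, hQ2', tX, cWt, bWt, dWt, add_zero, map_div₀, map_mul, map_sub, map_add, map_pow, map_inv₀, map_one, T_qpow_zero_one, tX1',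
      tY1', tL1', sY1', tX1, tY1, tL1]
    generalize yFun q n = Y at *
    generalize qpow q 2 2 = X at *
    generalize qpow q 1 0 = L at *
    generalize qpow q 0 1 = p at *
    have h4 : Y * p ^ 2 / p ^ 4 - 1 = (Y - p ^ 2) / p ^ 2 := by field_simp
    have h5 : p ^ 2 * (X / p ^ 2) - 1 = X - 1 := by field_simp
    rw [h4, h5]
    generalize hD : p ^ 2 * X - 1 = D at *
    field_simp
    rw [← hD]
    ring
  case det =>
    simp only [lOp, rOp]
    simp only [shiftOp_mul, ← shiftOp_one, shiftOp_sub, add_zero, zero_add, add_neg_cancel,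
      neg_add_cancel]
    refine shiftOp_congr rfl rfl fun n => ?_
    have h1 := hY1 n; have h2 := hY2 n
    simp only [F_eq_div, Int.cast_zero, Int.cast_one, Int.cast_neg, T_zero, hQ1', tX, cWt, bWt, dWt, add_zero, map_div₀, map_mul, map_sub, map_add, map_pow, map_inv₀, map_one, T_qpow_zero_one, tX1',
      tY1', tL1', sY1', tX1, tY1, tL1]
    generalize yFun q n = Y at *
    generalize qpow q 2 2 = X at *
    generalize qpow q 1 0 = L at *
    generalize qpow q 0 1 = p at *
    have h4 : Y * p ^ 2 / p ^ 4 - 1 = (Y - p ^ 2) / p ^ 2 := by field_simp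
    have h4' : Y / p ^ 2 - 1 = (Y - p ^ 2) / p ^ 2 := by field_simp
    have h5 : p ^ 2 * (X / p ^ 2) - 1 = X - 1 := by field_simp
    rw [h4, h4', h5]
    field_simp
    ring

/-- A representation of `A` by difference operators. -/
def rep : FSL q →ₐ[ℂ] Module.End ℂ (ℤ → Mer) :=
  FSL.lift q (shiftOp (fun _ => 1) (-1) 0) (shiftOp (bWt q) (-1) 1)
      (shiftOp (fun _ => cWt q) 1 (-1)) (shiftOp (dWt q) 1 0) lOp rOp (rep_rel q)

/-- In the representation `α` and `γ` act by shifts with nowhere vanishing weights, hence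
injectively, and so does every monomial in them. An injective operator on a nonzero space is not
zero. -/
theorem vec_ne_zero (N k : ℕ) : vec q N k ≠ 0 := by
  have hα : Function.Injective (rep q (FSL.α q)) := by
    rw [rep, FSL.lift_α]
    exact shiftOp_injective _ _ fun _ => one_ne_zero
  have hγ : Function.Injective (rep q (FSL.γ q)) := by
    rw [rep, FSL.lift_γ]
    exact shiftOp_injective _ _ fun _ => div_ne_zero (qpow_ne_zero q _ _)
      (sub_ne_zero.2 (by exact_mod_cast zpow_mul_qpow_ne_one q 2))
  have hv : Function.Injective (rep q (vec q N k)) := by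
    intro a b hab
    rw [vec, map_mul, map_pow, map_pow, Module.End.mul_apply, Module.End.mul_apply,
      Module.End.pow_apply, Module.End.pow_apply, Module.End.pow_apply, Module.End.pow_apply] at hab
    exact hα.iterate _ (hγ.iterate _ hab)
  intro h
  rw [h, map_zero] at hv
  have := hv (a₁ := fun _ => 1) (a₂ := fun _ => 0) rfl
  exact one_ne_zero (congrFun this 0)

end representation

section basis
variable (q : Set.Ioo (0 : ℝ) 1)
open FSL

/-! ### The basis of `V_N` -/

/-- Nonzero vectors of distinct degrees `2k - N` are eigenvectors of `h` for distinct eigenvalues.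
-/
theorem linearIndependent_v (N : ℕ) :
    LinearIndependent Mer (fun i : Fin (N + 1) => VN.v q N i) := by
  refine Module.End.eigenvectors_linearIndependent' (HSpace.h (V := VN q N))
    (fun i : Fin (N + 1) => algebraMap ℂ Mer (2 * (i : ℕ) - N)) ?_ _ fun i => ⟨?_, ?_⟩
  · intro i j h
    have h1 := (algebraMap ℂ Mer).injective h
    have h2 : ((i : ℕ) : ℂ) = (j : ℕ) := by linear_combination h1 / 2
    exact Fin.ext (by exact_mod_cast h2)
  · exact VN.v_mem_wt q (Nat.lt_succ_iff.1 i.2)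
  · intro h
    refine vec_ne_zero q N i ?_
    rw [← VN.v_coe (Nat.lt_succ_iff.1 i.2), h, ZeroMemClass.coe_zero]

theorem VN.span_range_v (N : ℕ) :
    ⊤ ≤ Submodule.span Mer (Set.range fun i : Fin (N + 1) => VN.v q N i) := by
  rw [← VN.span_v, Submodule.span_le]
  rintro x ⟨k, hk, rfl⟩
  exact Submodule.subset_span ⟨⟨k, Nat.lt_succ_iff.2 hk⟩, rfl⟩

/-- The basis `γ^{N-k} α^k` of `V_N`. -/
def vBasis (N : ℕ) : Module.Basis (Fin (N + 1)) Mer (VN q N) :=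
  Module.Basis.mk (linearIndependent_v q N) (VN.span_range_v q N)

theorem vBasis_apply (N : ℕ) (i : Fin (N + 1)) : vBasis q N i = VN.v q N i := by
  rw [vBasis, Module.Basis.mk_apply]

/-- The coordinate functions of the basis. -/
def crd (N k : ℕ) : VN q N →ₗ[Mer] Mer :=
  if h : k < N + 1 then (vBasis q N).coord ⟨k, h⟩ else 0

theorem crd_v (N k j : ℕ) (hj : j ≤ N) : crd q N k (VN.v q N j) = if j = k then 1 else 0 := by
  rw [crd]
  split_ifs with h h' h'
  · subst h'
    rw [show VN.v q N j = vBasis q N ⟨j, h⟩ from (vBasis_apply q N ⟨j, h⟩).symm]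
    simp
  · rw [show VN.v q N j = vBasis q N ⟨j, by omega⟩ from (vBasis_apply q N ⟨j, by omega⟩).symm,
      Module.Basis.coord_apply, Module.Basis.repr_self, Finsupp.single_apply, if_neg]
    simpa using h'
  · omega
  · rfl

theorem sum_crd (N : ℕ) (x : VN q N) :
    ∑ k ∈ Finset.range (N + 1), crd q N k x • VN.v q N k = x := by
  conv_rhs => rw [← (vBasis q N).sum_repr x]
  rw [Finset.sum_range]
  refine Finset.sum_congr rfl fun i _ => ?_
  rw [vBasis_apply, crd, dif_pos i.2]
  rfl

theorem VN.v_eq_zero {N k : ℕ} (h : N < k) : VN.v q N k = 0 := dif_neg (by omega)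

variable {q} in
theorem VN.ind {N : ℕ} {p : VN q N → Prop} (h1 : ∀ k ≤ N, p (VN.v q N k))
    (h2 : ∀ x y, p x → p y → p (x + y)) (h3 : ∀ (f : Mer) x, p x → p (f • x)) (x : VN q N) :
    p x := by
  have h0 : p 0 := by simpa using h3 0 _ (h1 0 (Nat.zero_le _))
  rw [← sum_crd q N x]
  refine Finset.sum_induction _ p h2 h0 fun k hk => ?_
  exact h3 _ _ (h1 k (Nat.lt_succ_iff.1 (Finset.mem_range.1 hk)))

variable {q} in
theorem VN.linearMap_ext {N : ℕ} {P : Type} [AddCommGroup P] [Module Mer P]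
    {φ ψ : VN q N →ₗ[Mer] P} (h : ∀ k ≤ N, φ (VN.v q N k) = ψ (VN.v q N k)) : φ = ψ :=
  LinearMap.ext fun x => VN.ind (p := fun x => φ x = ψ x) h
    (fun x y hx hy => by rw [map_add, map_add, hx, hy])
    (fun f x hx => by rw [map_smul, map_smul, hx]) x

/-- The coordinate at `v_k` sees only the component of degree `2k - N`. This is needed because the
relations of `V ⊗̂ W` are given for homogeneous vectors. -/
theorem crd_eq_zero {N k : ℕ} {a : ℂ} {x : VN q N} (hx : x ∈ wt (VN q N) a)
    (h : (2 * k - N : ℂ) ≠ a) : crd q N k x = 0 := by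
  by_cases hk : k < N + 1
  swap
  · rw [crd, dif_neg hk]; rfl
  have h1 : (crd q N k).comp (HSpace.h (V := VN q N)) =
      algebraMap ℂ Mer (2 * k - N) • crd q N k := by
    refine VN.linearMap_ext fun j hj => ?_
    rw [LinearMap.comp_apply, mem_wt.1 (VN.v_mem_wt q hj), map_smul, LinearMap.smul_apply,
      crd_v q _ _ _ hj]
    split_ifs with hjk
    · rw [hjk]
    · rw [smul_zero, smul_zero]
  have h2 := LinearMap.congr_fun h1 x
  rw [LinearMap.comp_apply, mem_wt.1 hx, map_smul, LinearMap.smul_apply, smul_eq_mul, smul_eq_mul,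
    ← sub_eq_zero, ← sub_mul, ← map_sub, mul_eq_zero] at h2
  refine h2.resolve_left fun h3 => h ?_
  exact (sub_eq_zero.1 ((map_eq_zero_iff _ (algebraMap ℂ Mer).injective).1 h3)).symm

/-- The coefficient of `v_k` of an element of `A ⊗ V_N`. -/
def coef (N k : ℕ) : ATens q (VN q N) →+ FSL q :=
  ATens.lift (fun a v => r q (crd q N k v) * a) (fun a b v => mul_add _ _ _)
    (fun a v w => by rw [map_add, map_add, add_mul])
    (fun f a v => by rw [map_smul, smul_eq_mul, mul_comm f, map_mul, mul_assoc])

theorem coef_mk (N k : ℕ) (a : FSL q) (v : VN q N) :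
    coef q N k (ATens.mk q a v) = r q (crd q N k v) * a := rfl

theorem coef_mk_v {N k j : ℕ} (hj : j ≤ N) (a : FSL q) :
    coef q N k (ATens.mk q a (VN.v q N j)) = if j = k then a else 0 := by
  rw [coef_mk, crd_v q N k j hj]
  split_ifs
  · rw [map_one, one_mul]
  · rw [map_zero, zero_mul]

theorem ATens.mk_smul_eq {V : Type} [AddCommGroup V] [Module Mer V] (f : Mer) (a : FSL q) (v : V) :
    ATens.mk q a (f • v) = ATens.mk q (r q f * a) v := (ATens.r_mk f a v).symm

theorem ATens.mk_sum {V ι : Type} [AddCommGroup V] [Module Mer V] (s : Finset ι) (a : FSL q)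
    (v : ι → V) : ATens.mk q a (∑ i ∈ s, v i) = ∑ i ∈ s, ATens.mk q a (v i) :=
  map_sum (AddMonoidHom.mk' (fun v => ATens.mk q a v) (ATens.mk_add a)) v s

/-- How a scalar on the right factor is moved to the front; it explains the shifts of `λ` attached
to the second factor. -/
theorem Tens.mk_smul {V W : Type} [AddCommGroup V] [Module Mer V] [HSpace V] [AddCommGroup W]
    [Module Mer W] {a : ℂ} {v : V} (hv : v ∈ wt V a) (w : W) (f : Mer) :
    Tens.mk v (f • w) = T (-a) f • Tens.mk v w := by
  rw [Tens.smul_mk, Tens.mk_rel hv, T_T, add_neg_cancel, T_zero]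

/-! ### Linear maps from `V_M ⊗ V_N` -/

section
variable {P : Type} [AddCommGroup P] [Module Mer P] (M N : ℕ) (c : ℕ → ℕ → P)

/-- The linear map `V_M ⊗ V_N → P` with given values on the basis. -/
def tensLift : Tens (VN q M) (VN q N) →ₗ[Mer] P :=
  Tens.lift (AddMonoidHom.mk' (fun v => AddMonoidHom.mk' (fun w =>
      ∑ j ∈ Finset.range (M + 1), ∑ k ∈ Finset.range (N + 1),
        -- The scalar `f` in `v_j ⊗ f w` comes out as `T_{-(2j-M)} f`, because `v_j` has degree `2j
        -- - M`.
        (crd q M j v * T (-(2 * j - M)) (crd q N k w)) • c j k)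
      (fun w w' => by
        simp only [map_add, mul_add, add_smul, Finset.sum_add_distrib]))
      (fun v v' => AddMonoidHom.ext fun w => by
        simp only [map_add, add_mul, add_smul, Finset.sum_add_distrib, AddMonoidHom.add_apply,
          AddMonoidHom.mk'_apply]))
    (fun f v w => by
      simp only [AddMonoidHom.mk'_apply, map_smul, Finset.smul_sum, smul_smul, smul_eq_mul,
        mul_assoc])
    (fun a v w f hv => by
      simp only [AddMonoidHom.mk'_apply]
      refine Finset.sum_congr rfl fun j _ => Finset.sum_congr rfl fun k _ => ?_
      -- In the degree of `v` the two shifts cancel; in any other degree the coordinate of `v` is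
      -- zero.
      by_cases h : (2 * j - M : ℂ) = a
      · rw [map_smul, map_smul, smul_eq_mul, smul_eq_mul, map_mul, T_T, h, neg_add_cancel, T_zero,
          mul_left_comm, mul_assoc]
      · rw [map_smul, crd_eq_zero q hv h, smul_zero, zero_mul, zero_mul])

theorem tensLift_mk {j k : ℕ} (hj : j ≤ M) (hk : k ≤ N) :
    tensLift q M N c (Tens.mk (VN.v q M j) (VN.v q N k)) = c j k := by
  change ∑ j' ∈ Finset.range (M + 1), ∑ k' ∈ Finset.range (N + 1), _ = _
  rw [Finset.sum_eq_single j, Finset.sum_eq_single k]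
  · rw [crd_v q _ _ _ hj, crd_v q _ _ _ hk, if_pos rfl, if_pos rfl, map_one, mul_one, one_smul]
  · intro k' _ h
    rw [crd_v q _ _ _ hk, if_neg h.symm, map_zero, mul_zero, zero_smul]
  · intro h
    exact absurd (Finset.mem_range.2 (by omega)) h
  · intro j' _ h
    refine Finset.sum_eq_zero fun k' _ => ?_
    rw [crd_v q _ _ _ hj, if_neg h.symm, zero_mul, zero_smul]
  · intro h
    exact absurd (Finset.mem_range.2 (by omega)) h

end

variable {q} in
theorem Tens.indV {M N : ℕ} {p : Tens (VN q M) (VN q N) → Prop}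
    (h1 : ∀ j ≤ M, ∀ k ≤ N, p (Tens.mk (VN.v q M j) (VN.v q N k)))
    (h2 : ∀ x y, p x → p y → p (x + y)) (h3 : ∀ (f : Mer) x, p x → p (f • x))
    (x : Tens (VN q M) (VN q N)) : p x := by
  have h0 : p 0 := by simpa using h3 0 _ (h1 0 (Nat.zero_le _) 0 (Nat.zero_le _))
  induction x using Tens.ind with
  | h0 => exact h0
  | h2 x y hx hy => exact h2 x y hx hy
  | h1 v w =>
    induction v using VN.ind with
    | h2 v v' h h' => rw [Tens.add_mk]; exact h2 _ _ h h'
    | h3 f v h => rw [← Tens.smul_mk]; exact h3 f _ h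
    | h1 j hj =>
      induction w using VN.ind with
      | h1 k hk => exact h1 j hj k hk
      | h2 w w' h h' => rw [Tens.mk_add]; exact h2 _ _ h h'
      | h3 f w h => rw [Tens.mk_smul (VN.v_mem_wt q hj)]; exact h3 _ _ h

end basis

section corep
variable (q : Set.Ioo (0 : ℝ) 1)
open FSL

/-! ### Pairs of operators that transform like `γ` and `α` -/

/-- A pair of semilinear maps, a map out of `V_1 ⊗ V`. -/
structure Pair (V W : Type) [AddCommGroup V] [Module Mer V] [AddCommGroup W] [Module Mer W] where
  /-- The operator for `γ`. -/
  g : V →+ W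
  /-- The operator for `α`. -/
  a : V →+ W
  g_smul : ∀ (f : Mer) v, g (f • v) = T 1 f • g v
  a_smul : ∀ (f : Mer) v, a (f • v) = T (-1) f • a v

section pair
variable {V W : Type} [AddCommGroup V] [Module Mer V] [AddCommGroup W] [Module Mer W]

/-- `x ⊗ v ↦ γ x ⊗ α v + δ x ⊗ γ v` -/
def Pair.opG (U : Pair V W) : ATens q V →+ ATens q W :=
  ATens.lift (fun c v => ATens.mk q (γ q * c) (U.a v) + ATens.mk q (δ q * c) (U.g v))
    (fun c d v => by rw [mul_add, mul_add, ATens.add_mk, ATens.add_mk]; abel)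
    (fun c v w => by rw [map_add, map_add, ATens.mk_add, ATens.mk_add]; abel)
    (fun f c v => by rw [γ_r_mul, δ_r_mul, ATens.r_mk, ATens.r_mk, U.a_smul, U.g_smul])

/-- `x ⊗ v ↦ α x ⊗ α v + β x ⊗ γ v` -/
def Pair.opA (U : Pair V W) : ATens q V →+ ATens q W :=
  ATens.lift (fun c v => ATens.mk q (α q * c) (U.a v) + ATens.mk q (β q * c) (U.g v))
    (fun c d v => by rw [mul_add, mul_add, ATens.add_mk, ATens.add_mk]; abel)
    (fun c v w => by rw [map_add, map_add, ATens.mk_add, ATens.mk_add]; abel)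
    (fun f c v => by rw [α_r_mul, β_r_mul, ATens.r_mk, ATens.r_mk, U.a_smul, U.g_smul])

variable {q}
theorem Pair.opG_mk (U : Pair V W) (c : FSL q) (v : V) : U.opG q (ATens.mk q c v) =
    ATens.mk q (γ q * c) (U.a v) + ATens.mk q (δ q * c) (U.g v) := rfl
theorem Pair.opA_mk (U : Pair V W) (c : FSL q) (v : V) : U.opA q (ATens.mk q c v) =
    ATens.mk q (α q * c) (U.a v) + ATens.mk q (β q * c) (U.g v) := rfl

theorem Pair.opG_smul (U : Pair V W) (f : Mer) (x : ATens q V) :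
    U.opG q (f • x) = T 1 f • U.opG q x := by
  induction x using ATens.ind with
  | h0 => simp
  | h1 c v => rw [ATens.smul_mk, U.opG_mk, U.opG_mk, γ_l_mul, δ_l_mul, smul_add]; rfl
  | h2 x y hx hy => rw [smul_add, map_add, map_add, hx, hy, smul_add]

theorem Pair.opA_smul (U : Pair V W) (f : Mer) (x : ATens q V) :
    U.opA q (f • x) = T (-1) f • U.opA q x := by
  induction x using ATens.ind with
  | h0 => simp
  | h1 c v => rw [ATens.smul_mk, U.opA_mk, U.opA_mk, α_l_mul, β_l_mul, smul_add]; rfl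
  | h2 x y hx hy => rw [smul_add, map_add, map_add, hx, hy, smul_add]
end pair

/-! ### Coassociativity -/

/-- Left multiplication by `γ` and `α`. -/
def leftPair : Pair (FSL q) (FSL q) where
  g := AddMonoidHom.mulLeft (γ q)
  a := AddMonoidHom.mulLeft (α q)
  g_smul f v := γ_l_mul f v
  a_smul f v := α_l_mul f v

theorem leftPair_op (x : ATens q (FSL q)) :
    (leftPair q).opA q x = opα q x ∧ (leftPair q).opG q x = opγ q x := by
  induction x using ATens.ind with
  | h0 => simp
  | h1 c v => exact ⟨rfl, rfl⟩
  | h2 x y hx hy => simp only [map_add, hx.1, hx.2, hy.1, hy.2, and_self]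

/-- Left multiplication by the coproducts of `γ` and `α`. -/
def opPair : Pair (ATens q (FSL q)) (ATens q (FSL q)) where
  g := (opγ q).toAddMonoidHom
  a := (opα q).toAddMonoidHom
  g_smul f x := by
    change opγ q (f • x) = T 1 f • opγ q x
    rw [← (leftPair_op q _).2, ← (leftPair_op q _).2, Pair.opG_smul]
  a_smul f x := by
    change opα q (f • x) = T (-1) f • opα q x
    rw [← (leftPair_op q _).1, ← (leftPair_op q _).1, Pair.opA_smul]

theorem comulMap_mk {V : Type} [AddCommGroup V] [Module Mer V] (a : FSL q) (v : V) :
    comulMap q V (ATens.mk q a v) = ATens.map q (insertMap q v) (comul q a) := rfl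

theorem counitMap_mk {V : Type} [AddCommGroup V] [Module Mer V] (a : FSL q) (v : V) :
    counitMap q V (ATens.mk q a v) = (counit q a 1) • v := rfl

theorem comulMap_smul {V : Type} [AddCommGroup V] [Module Mer V] (f : Mer) (x : ATens q V) :
    comulMap q V (f • x) = f • comulMap q V x := by
  induction x using ATens.ind with
  | h0 => rw [smul_zero, map_zero, smul_zero]
  | h1 c v => rw [ATens.smul_mk, comulMap_mk, comulMap_mk, ← smul_def, map_smul, map_smul]
  | h2 x y hx hy => rw [smul_add, map_add, map_add, hx, hy, smul_add]

theorem counitMap_smul {V : Type} [AddCommGroup V] [Module Mer V] (f : Mer) (x : ATens q V) :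
    counitMap q V (f • x) = f • counitMap q V x := by
  induction x using ATens.ind with
  | h0 => rw [smul_zero, map_zero, smul_zero]
  | h1 c v =>
    rw [ATens.smul_mk, counitMap_mk, counitMap_mk, map_mul, Module.End.mul_apply, smul_smul]
    congr 1
    rw [counit, FSL.lift_l]; rfl
  | h2 x y hx hy => rw [smul_add, map_add, map_add, hx, hy, smul_add]

theorem comulMap_map {V W : Type} [AddCommGroup V] [Module Mer V] [AddCommGroup W] [Module Mer W]
    (φ : V →ₗ[Mer] W) (x : ATens q V) :
    comulMap q W (ATens.map q φ x) = ATens.map q (ATens.map q φ) (comulMap q V x) := by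
  induction x using ATens.ind with
  | h0 => simp
  | h1 c v =>
    rw [ATens.map_mk, comulMap_mk, comulMap_mk]
    generalize comul q c = y
    induction y using ATens.ind with
    | h0 => simp
    | h1 a b => rfl
    | h2 x y hx hy => rw [map_add, map_add, map_add, hx, hy]
  | h2 x y hx hy => rw [map_add, map_add, map_add, map_add, hx, hy]

theorem counitMap_map {V W : Type} [AddCommGroup V] [Module Mer V] [AddCommGroup W] [Module Mer W]
    (φ : V →ₗ[Mer] W) (x : ATens q V) :
    counitMap q W (ATens.map q φ x) = φ (counitMap q V x) := by
  induction x using ATens.ind with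
  | h0 => simp
  | h1 c v => rw [ATens.map_mk, counitMap_mk, counitMap_mk, map_smul]
  | h2 x y hx hy => rw [map_add, map_add, map_add, map_add, hx, hy]

theorem ATens.map_comp {U V W : Type} [AddCommGroup U] [Module Mer U] [AddCommGroup V]
    [Module Mer V] [AddCommGroup W] [Module Mer W]
    (φ : V →ₗ[Mer] W) (ψ : U →ₗ[Mer] V) (x : ATens q U) :
    ATens.map q φ (ATens.map q ψ x) = ATens.map q (φ.comp ψ) x := by
  induction x using ATens.ind with
  | h0 => simp
  | h1 c v => rfl
  | h2 x y hx hy => rw [map_add, map_add, map_add, hx, hy]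

/-- Together with `map_comul_op` this is coassociativity on the generators `α` and `γ`: under `Δ ⊗
id` and under `id ⊗ Δ`, left multiplication by `Δα` or `Δγ` becomes the same operator on the triple
tensor product. -/
theorem comulMap_op (x : ATens q (FSL q)) :
    comulMap q _ (opα q x) = (opPair q).opA q (comulMap q _ x) ∧
    comulMap q _ (opγ q x) = (opPair q).opG q (comulMap q _ x) := by
  induction x using ATens.ind with
  | h0 => simp
  | h1 c v =>
    rw [opα_mk, opγ_mk, map_add, map_add, comulMap_mk, comulMap_mk, comulMap_mk, comulMap_mk,
      comulMap_mk, comul_mul, comul_mul, comul_mul, comul_mul, comulEnd_α, comulEnd_β, comulEnd_γ,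
      comulEnd_δ]
    generalize comul q c = y
    induction y using ATens.ind with
    | h0 => simp
    | h1 a b =>
      rw [opα_mk, opβ_mk, opγ_mk, opδ_mk, map_add, map_add, map_add, map_add]
      change _ = ATens.mk q _ (opα q (ATens.mk q b v)) + ATens.mk q _ (opγ q (ATens.mk q b v)) ∧
        _ = ATens.mk q _ (opα q (ATens.mk q b v)) + ATens.mk q _ (opγ q (ATens.mk q b v))
      rw [opα_mk, opγ_mk, ATens.mk_add, ATens.mk_add, ATens.mk_add, ATens.mk_add]
      exact ⟨add_add_add_comm _ _ _ _, add_add_add_comm _ _ _ _⟩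
    | h2 x y hx hy =>
      simp only [map_add]
      rw [← hx.1, ← hx.2, ← hy.1, ← hy.2]
      constructor <;> abel
  | h2 x y hx hy => simp only [map_add, hx.1, hx.2, hy.1, hy.2, and_self]

theorem map_comul_op (x : ATens q (FSL q)) :
    ATens.map q (comul q) (opα q x) = (opPair q).opA q (ATens.map q (comul q) x) ∧
    ATens.map q (comul q) (opγ q x) = (opPair q).opG q (ATens.map q (comul q) x) := by
  induction x using ATens.ind with
  | h0 => simp
  | h1 c v =>
    rw [opα_mk, opγ_mk, map_add, map_add, ATens.map_mk, ATens.map_mk, ATens.map_mk, ATens.map_mk,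
      ATens.map_mk, comul_mul, comul_mul, comulEnd_α, comulEnd_γ]
    exact ⟨rfl, rfl⟩
  | h2 x y hx hy => simp only [map_add, hx.1, hx.2, hy.1, hy.2, and_self]

theorem counitMap_op (x : ATens q (FSL q)) :
    counitMap q _ (opα q x) = α q * counitMap q _ x ∧
    counitMap q _ (opγ q x) = γ q * counitMap q _ x := by
  induction x using ATens.ind with
  | h0 => simp
  | h1 c v =>
    have e1 : counit q (α q) = (T (-1)).toLinearMap := FSL.lift_α _ _ _ _ _ _ _ _
    have e2 : counit q (β q) = 0 := FSL.lift_β _ _ _ _ _ _ _ _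
    have e3 : counit q (γ q) = 0 := FSL.lift_γ _ _ _ _ _ _ _ _
    have e4 : counit q (δ q) = (T 1).toLinearMap := FSL.lift_δ _ _ _ _ _ _ _ _
    rw [opα_mk, opγ_mk, map_add, map_add, counitMap_mk, counitMap_mk, counitMap_mk, counitMap_mk,
      counitMap_mk, map_mul, map_mul, map_mul, map_mul, e1, e2, e3, e4, smul_def, smul_def, smul_def,
      smul_def, smul_def, α_l_mul, γ_l_mul]
    simp
  | h2 x y hx hy => simp only [map_add, hx.1, hx.2, hy.1, hy.2, mul_add, and_self]

/-- Starting from `Δ1 = 1 ⊗ 1`, the letters `α` and then `γ` are multiplied on one at a time, each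
step commuting with both sides of the coassociativity and counit axioms. -/
theorem coassoc_vec (N k : ℕ) :
    comulMap q _ (comul q (vec q N k)) = ATens.map q (comul q) (comul q (vec q N k)) ∧
      counitMap q _ (comul q (vec q N k)) = vec q N k := by
  have hα : ∀ k : ℕ, comulMap q _ (comul q (α q ^ k)) = ATens.map q (comul q) (comul q (α q ^ k)) ∧
      counitMap q _ (comul q (α q ^ k)) = α q ^ k := by
    intro k
    induction k with
    | zero =>
      rw [pow_zero, comul_one, comulMap_mk, counitMap_mk, ATens.map_mk, comul_one, ATens.map_mk,
        map_one (counit q), Module.End.one_apply, one_smul]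
      exact ⟨rfl, rfl⟩
    | succ k ih =>
      rw [pow_succ', comul_mul, comulEnd_α, (comulMap_op q _).1, (map_comul_op q _).1,
        (counitMap_op q _).1, ih.1, ih.2]
      exact ⟨rfl, rfl⟩
  rw [vec]
  induction N - k with
  | zero => simpa using hα k
  | succ i ih =>
    rw [pow_succ', mul_assoc, comul_mul, comulEnd_γ, (comulMap_op q _).2, (map_comul_op q _).2,
        (counitMap_op q _).2, ih.1, ih.2]
    exact ⟨rfl, rfl⟩

/-- The axioms hold for the coproduct on the vectors `γ^{N-k} α^k` and are pulled back along the
inclusion of `V_N` in `A`. -/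
theorem coVN_isCorepresentation (N : ℕ) : (coVN q N).IsCorepresentation := by
  have h : ∀ v : VN q N, comulMap q _ (comul q (v : FSL q)) =
      ATens.map q (comul q) (comul q (v : FSL q)) ∧ counitMap q _ (comul q (v : FSL q)) = v := by
    intro v
    induction v using VN.ind with
    | h1 k hk => rw [VN.v_coe hk]; exact coassoc_vec q N k
    | h2 x y hx hy =>
      rw [Submodule.coe_add, map_add, map_add, map_add, map_add, hx.1, hx.2, hy.1, hy.2]
      exact ⟨rfl, rfl⟩
    | h3 f x hx =>
      rw [Submodule.coe_smul, map_smul (comul q), map_smul (ATens.map q (comul q)), comulMap_smul,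
        counitMap_smul, hx.1, hx.2]
      exact ⟨rfl, rfl⟩
  have e : ∀ v, inclN q N ((coVN q N).toMap v) = comul q (v : FSL q) := inclN_coVNMap q N
  refine ⟨fun v => ?_, fun v => ?_⟩
  -- Since `V_N` is included twice, injectivity is used for the map induced by an already induced
  -- inclusion.
  · apply ATens.map_injective (inclN q N) (inclN_injective q N)
    rw [inclN, ← comulMap_map, ATens.map_comp, ← inclN, e, (h v).1, ← e, inclN, ATens.map_comp]
    congr 2
    exact (LinearMap.ext e).symm
  · apply (VN q N).injective_subtype
    rw [← counitMap_map, ← inclN, e, (h v).2]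
    rfl

/-! ### Direct sums -/

theorem coSum_isCorepresentation {ι : Type} [DecidableEq ι] {V : ι → Type}
    [∀ i, AddCommGroup (V i)] [∀ i, Module Mer (V i)] [∀ i, HSpace (V i)]
    (π : ∀ i, Coaction q (V i)) (h : ∀ i, (π i).IsCorepresentation) :
    (coSum q π).IsCorepresentation := by
  have e : ∀ i v, (coSum q π).toMap (DirectSum.lof Mer ι V i v) =
      ATens.map q (DirectSum.lof Mer ι V i) ((π i).toMap v) := fun i v =>
    DirectSum.toModule_lof _ _ _
  refine ⟨fun x => ?_, fun x => ?_⟩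
  · induction x using DirectSum.induction_on with
    | zero => simp
    | add x y hx hy => rw [map_add, map_add, map_add, hx, hy]
    | of i v =>
      change comulMap q _ ((coSum q π).toMap (DirectSum.lof Mer ι V i v)) =
        ATens.map q (coSum q π).toMap ((coSum q π).toMap (DirectSum.lof Mer ι V i v))
      rw [e, comulMap_map, (h i).1, ATens.map_comp, ATens.map_comp]
      congr 2
      exact LinearMap.ext fun v => (e i v).symm
  · induction x using DirectSum.induction_on with
    | zero => simp
    | add x y hx hy => rw [map_add, map_add, hx, hy]
    | of i v =>
      change counitMap q _ ((coSum q π).toMap (DirectSum.lof Mer ι V i v)) =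
        DirectSum.lof Mer ι V i v
      rw [e, counitMap_map, (h i).2]

end corep

section tensor
variable (q : Set.Ioo (0 : ℝ) 1)
open FSL

/-! ### The coproduct of the matrix elements -/

/-- `coef` as a linear map. -/
def coefL (N k : ℕ) : ATens q (VN q N) →ₗ[Mer] FSL q :=
  ATens.toLinear (coef q N k) fun f a v => by
    rw [coef_mk, coef_mk, smul_def, ← mul_assoc, ← mul_assoc, l_comm_r]

theorem coefL_apply (N k : ℕ) (x : ATens q (VN q N)) : coefL q N k x = coef q N k x := rfl

variable {q} in
-- The coefficients of `v_k` on both sides of `(Δ ⊗ id) π = (id ⊗ π) π`.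
theorem IsMatrix.comul {N : ℕ} {t : ℕ → ℕ → FSL q} (ht : IsMatrix q N t) {m k : ℕ} (hm : m ≤ N)
    (hk : k ≤ N) : comul q (t m k) =
      ∑ i ∈ Finset.range (N + 1), ATens.mk q (t m i) (t i k) := by
  have h := congrArg (ATens.map q (coefL q N k)) ((coVN_isCorepresentation q N).1 (VN.v q N m))
  rw [ht m hm, map_sum, map_sum, map_sum, map_sum] at h
  have h1 : ∀ j ∈ Finset.range (N + 1), ATens.map q (coefL q N k)
      (comulMap q _ (ATens.mk q (t m j) (VN.v q N j))) =
      if j = k then DynSU2.comul q (t m j) else 0 := by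
    intro j hj
    have hj' : j ≤ N := Nat.lt_succ_iff.1 (Finset.mem_range.1 hj)
    rw [comulMap_mk]
    generalize DynSU2.comul q (t m j) = y
    induction y using ATens.ind with
    | h0 => simp
    | h1 a b =>
      rw [ATens.map_mk, ATens.map_mk]
      change ATens.mk q a (coef q N k (ATens.mk q b (VN.v q N j))) = _
      rw [coef_mk_v q hj']
      split_ifs
      · rfl
      · rw [ATens.mk_zero]
    | h2 x y hx hy =>
      rw [map_add, map_add, hx, hy]
      split_ifs
      · rfl
      · rw [add_zero]
  have h2 : ∀ j ∈ Finset.range (N + 1), ATens.map q (coefL q N k) (ATens.map q (coVN q N).toMap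
      (ATens.mk q (t m j) (VN.v q N j))) = ATens.mk q (t m j) (t j k) := by
    intro j hj
    have hj' : j ≤ N := Nat.lt_succ_iff.1 (Finset.mem_range.1 hj)
    rw [ATens.map_mk, ATens.map_mk, ht j hj', coefL_apply, map_sum]
    congr 1
    rw [Finset.sum_eq_single k]
    · rw [coef_mk_v q hk, if_pos rfl]
    · intro i hi hik
      rw [coef_mk_v q (Nat.lt_succ_iff.1 (Finset.mem_range.1 hi)), if_neg hik]
    · intro h
      exact absurd (Finset.mem_range.2 (by omega)) h
  rw [Finset.sum_congr rfl h1, Finset.sum_congr rfl h2, Finset.sum_ite_eq',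
    if_pos (Finset.mem_range.2 (by omega))] at h
  exact h

variable {q} in
theorem IsMatrix.counit {N : ℕ} {t : ℕ → ℕ → FSL q} (ht : IsMatrix q N t) {m k : ℕ} (hm : m ≤ N)
    (hk : k ≤ N) : counit q (t m k) 1 = if m = k then 1 else 0 := by
  have h := congrArg (crd q N k) ((coVN_isCorepresentation q N).2 (VN.v q N m))
  rw [ht m hm, map_sum, map_sum, crd_v q _ _ _ hm] at h
  rw [← h, Finset.sum_eq_single k]
  · rw [counitMap_mk, map_smul, crd_v q _ _ _ hk, if_pos rfl, smul_eq_mul, mul_one]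
  · intro j hj hjk
    rw [counitMap_mk, map_smul, crd_v q _ _ _ (Nat.lt_succ_iff.1 (Finset.mem_range.1 hj)),
      if_neg hjk, smul_zero]
  · intro h
    exact absurd (Finset.mem_range.2 (by omega)) h

/-- Right multiplication by `x ⊗ y` -/
def rightMul (x y : FSL q) : ATens q (FSL q) →+ ATens q (FSL q) :=
  ATens.lift (fun c d => ATens.mk q (c * x) (d * y))
    (fun a b v => by rw [add_mul, ATens.add_mk])
    (fun a v w => by rw [add_mul, ATens.mk_add])
    (fun f a v => by rw [mul_assoc, ATens.r_mk, smul_def, smul_def, mul_assoc])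

theorem rightMul_mk (x y c d : FSL q) :
    rightMul q x y (ATens.mk q c d) = ATens.mk q (c * x) (d * y) := rfl

/-- Left and right multiplications commute by associativity; no degree condition is needed for right
multiplication by `x ⊗ y`, as the tensor product is balanced through left multiplications. It
suffices to check the generators. The consequence `comulEnd_mk` determines the left action of `Δa`
on any `x ⊗ y` from its action on `1 ⊗ 1`. -/
theorem comulEnd_rightMul (a x y : FSL q) (z : ATens q (FSL q)) :
    comulEnd q a (rightMul q x y z) = rightMul q x y (comulEnd q a z) := by
  have hpair : ∀ (b : FSL q), (∀ c d, comulEnd q b (rightMul q x y (ATens.mk q c d)) =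
      rightMul q x y (comulEnd q b (ATens.mk q c d))) →
      ∀ z, comulEnd q b (rightMul q x y z) = rightMul q x y (comulEnd q b z) := by
    intro b hb z
    induction z using ATens.ind with
    | h0 => simp
    | h1 c d => exact hb c d
    | h2 z w hz hw => rw [map_add, map_add, map_add, map_add, hz, hw]
  obtain ⟨a, rfl⟩ := FSL.proj_surjective q a
  induction a using FreeAlgebra.induction generalizing z with
  | grade0 c =>
    refine hpair _ (fun d e => ?_) z
    rw [AlgHom.commutes, AlgHom.commutes, Module.algebraMap_end_apply, Module.algebraMap_end_apply,
      ATens.complex_smul_def, ATens.complex_smul_def, rightMul_mk, ATens.smul_mk, ATens.smul_mk,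
      rightMul_mk, mul_assoc]
  | grade1 g =>
    refine hpair _ (fun c d => ?_) z
    rw [proj_ι, rightMul_mk]
    cases g with
    | α =>
      change comulEnd q (α q) _ = rightMul q x y (comulEnd q (α q) _)
      rw [comulEnd_α, opα_mk, opα_mk, map_add, rightMul_mk, rightMul_mk]
      simp only [mul_assoc]
    | β =>
      change comulEnd q (β q) _ = rightMul q x y (comulEnd q (β q) _)
      rw [comulEnd_β, opβ_mk, opβ_mk, map_add, rightMul_mk, rightMul_mk]
      simp only [mul_assoc]
    | γ =>
      change comulEnd q (γ q) _ = rightMul q x y (comulEnd q (γ q) _)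
      rw [comulEnd_γ, opγ_mk, opγ_mk, map_add, rightMul_mk, rightMul_mk]
      simp only [mul_assoc]
    | δ =>
      change comulEnd q (δ q) _ = rightMul q x y (comulEnd q (δ q) _)
      rw [comulEnd_δ, opδ_mk, opδ_mk, map_add, rightMul_mk, rightMul_mk]
      simp only [mul_assoc]
    | l f =>
      change comulEnd q (l q f) _ = rightMul q x y (comulEnd q (l q f) _)
      rw [comulEnd_l, opL_mk, opL_mk, rightMul_mk, mul_assoc]
    | r f =>
      change comulEnd q (r q f) _ = rightMul q x y (comulEnd q (r q f) _)
      rw [comulEnd_r, opM_mk, opM_mk, rightMul_mk, mul_assoc]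
  | mul a b ha hb => rw [map_mul, map_mul, Module.End.mul_apply, Module.End.mul_apply, hb, ha]
  | add a b ha hb => rw [map_add, map_add, LinearMap.add_apply, LinearMap.add_apply, hb, ha, map_add]

theorem comulEnd_mk (a x y : FSL q) :
    comulEnd q a (ATens.mk q x y) = rightMul q x y (comul q a) := by
  have h := comulEnd_rightMul q a x y (ATens.mk q 1 1)
  rw [rightMul_mk, one_mul, one_mul] at h
  exact h

/-! ### Tensor products -/

section
variable {q} {M N : ℕ} {t u : ℕ → ℕ → FSL q}

theorem coTens_mk (ht : IsMatrix q M t) (hu : IsMatrix q N u) {m n : ℕ} (hm : m ≤ M)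
    (hn : n ≤ N) : (coTens q (coVN q M) (coVN q N)).toMap (Tens.mk (VN.v q M m) (VN.v q N n)) =
      ∑ k ∈ Finset.range (M + 1), ∑ l ∈ Finset.range (N + 1),
        ATens.mk q (t m k * u n l) (Tens.mk (VN.v q M k) (VN.v q N l)) := by
  refine (coTensMap_mk q (coVN q M) (coVN q N) _ _).trans ?_
  rw [hu n hn, map_sum, Finset.sum_comm]
  refine Finset.sum_congr rfl fun l _ => ?_
  rw [sigma_mk, ht m hm, map_sum]
  rfl

/-- Multiplicativity of the coproduct makes the products `t u` the matrix elements of the tensor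
product. -/
theorem IsMatrix.comul_mul (ht : IsMatrix q M t) (hu : IsMatrix q N u) {m n k l : ℕ} (hm : m ≤ M)
    (hn : n ≤ N) (hk : k ≤ M) (hl : l ≤ N) : DynSU2.comul q (t m k * u n l) =
      ∑ i ∈ Finset.range (M + 1), ∑ j ∈ Finset.range (N + 1),
        ATens.mk q (t m i * u n j) (t i k * u j l) := by
  rw [DynSU2.comul_mul, hu.comul hn hl, map_sum, Finset.sum_comm]
  refine Finset.sum_congr rfl fun j _ => ?_
  rw [comulEnd_mk, ht.comul hm hk, map_sum]
  rfl

theorem sum_comm_pairs {P : Type} [AddCommMonoid P] (s s' : Finset ℕ) (f : ℕ → ℕ → ℕ → ℕ → P) :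
    ∑ k ∈ s, ∑ l ∈ s', ∑ i ∈ s, ∑ j ∈ s', f k l i j =
      ∑ i ∈ s, ∑ j ∈ s', ∑ k ∈ s, ∑ l ∈ s', f k l i j := by
  have h := Finset.sum_comm (s := s ×ˢ s') (t := s ×ˢ s') (f := fun x y => f x.1 x.2 y.1 y.2)
  simpa only [Finset.sum_product] using h

variable (q M N)
-- On the basis `v_m ⊗ v_n` the axioms become the coproduct and counit formulas for the products of
-- matrix elements, up to exchanging the order of summation.
theorem coTens_isCorepresentation :
    (coTens q (coVN q M) (coVN q N)).IsCorepresentation := by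
  obtain ⟨t, ht⟩ := exists_isMatrix q M
  obtain ⟨u, hu⟩ := exists_isMatrix q N
  have hr : ∀ {K k : ℕ}, k ∈ Finset.range (K + 1) → k ≤ K := fun h =>
    Nat.lt_succ_iff.1 (Finset.mem_range.1 h)
  refine ⟨fun x => ?_, fun x => ?_⟩
  · induction x using Tens.indV with
    | h2 x y hx hy => rw [map_add, map_add, map_add, hx, hy]
    | h3 f x hx =>
      rw [map_smul (coTens q (coVN q M) (coVN q N)).toMap, comulMap_smul, map_smul, hx]
    | h1 m hm n hn =>
      rw [coTens_mk ht hu hm hn]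
      simp only [map_sum]
      have h1 : ∀ k ∈ Finset.range (M + 1), ∀ l ∈ Finset.range (N + 1),
          comulMap q _ (ATens.mk q (t m k * u n l) (Tens.mk (VN.v q M k) (VN.v q N l))) =
          ∑ i ∈ Finset.range (M + 1), ∑ j ∈ Finset.range (N + 1), ATens.mk q (t m i * u n j)
            (ATens.mk q (t i k * u j l) (Tens.mk (VN.v q M k) (VN.v q N l))) := by
        intro k hk l hl
        rw [comulMap_mk, ht.comul_mul hu hm hn (hr hk) (hr hl), map_sum]
        refine Finset.sum_congr rfl fun i _ => ?_
        rw [map_sum]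
        rfl
      have h2 : ∀ i ∈ Finset.range (M + 1), ∀ j ∈ Finset.range (N + 1),
          ATens.map q (coTens q (coVN q M) (coVN q N)).toMap
            (ATens.mk q (t m i * u n j) (Tens.mk (VN.v q M i) (VN.v q N j))) =
          ∑ k ∈ Finset.range (M + 1), ∑ l ∈ Finset.range (N + 1), ATens.mk q (t m i * u n j)
            (ATens.mk q (t i k * u j l) (Tens.mk (VN.v q M k) (VN.v q N l))) := by
        intro i hi j hj
        rw [ATens.map_mk, coTens_mk ht hu (hr hi) (hr hj), ATens.mk_sum]
        exact Finset.sum_congr rfl fun k _ => ATens.mk_sum q _ _ _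
      rw [Finset.sum_congr rfl fun k hk => Finset.sum_congr rfl fun l hl => h1 k hk l hl,
        Finset.sum_congr rfl fun i hi => Finset.sum_congr rfl fun j hj => h2 i hi j hj]
      exact sum_comm_pairs _ _ _
  · induction x using Tens.indV with
    | h2 x y hx hy => rw [map_add, map_add, hx, hy]
    | h3 f x hx =>
      rw [map_smul (coTens q (coVN q M) (coVN q N)).toMap, counitMap_smul, hx]
    | h1 m hm n hn =>
      rw [coTens_mk ht hu hm hn]
      simp only [map_sum]
      have h1 : ∀ k ∈ Finset.range (M + 1), ∀ l ∈ Finset.range (N + 1),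
          counitMap q _ (ATens.mk q (t m k * u n l) (Tens.mk (VN.v q M k) (VN.v q N l))) =
          if n = l then (if m = k then Tens.mk (VN.v q M m) (VN.v q N n) else 0) else 0 := by
        intro k hk l hl
        rw [counitMap_mk, map_mul, Module.End.mul_apply, hu.counit hn (hr hl)]
        split_ifs with h h'
        · rw [ht.counit hm (hr hk), if_pos h', one_smul, h, h']
        · rw [ht.counit hm (hr hk), if_neg h', zero_smul]
        · rw [map_zero, zero_smul]
      rw [Finset.sum_congr rfl fun k hk => Finset.sum_congr rfl fun l hl => h1 k hk l hl]
      simp only [Finset.sum_ite_eq, Finset.mem_range, Nat.lt_succ_iff, hm, hn, if_true]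
end

end tensor

/-! ### Identities for the coefficients of the two intertwiners out of `V_1 ⊗ V_P` -/

section rational
variable {K : Type} [Field K] {q X : K}

/-- The ratio is `q F(λ + i)`, so `aFun` is the product of the factors that `α` picks up on passing
powers of `γ`. -/
theorem aFun_succ (hq0 : q ≠ 0) (hX : ∀ n : ℤ, q ^ n * X ≠ 1) (i : ℤ) :
    aFun q X (i + 1) = aFun q X i * (q ^ (2 * (i + 1)) * X - 1) / (q * (q ^ (2 * i) * X - 1)) := by
  have h0 : X - 1 ≠ 0 := sub_ne_zero.2 (by simpa using hX 0)
  have h1 : q ^ (2 * i) * X - 1 ≠ 0 := sub_ne_zero.2 (hX _)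
  rw [aFun, aFun, neg_add, zpow_add₀ hq0, zpow_neg_one]
  generalize q ^ (2 * (i + 1)) = A
  generalize q ^ (2 * i) * X - 1 = B at *
  field_simp

/-- This identity and the next two are the cases `(γ, α)`, `(α, γ)` and `(α, α)` of the recursion
that determines `e`. The case `(γ, γ)` needs no identity. The shift of `X` comes from the outer
letter. -/
theorem eFun_rec_gα (hq0 : q ≠ 0) (hX : ∀ n : ℤ, q ^ n * X ≠ 1) (P j : ℤ) :
    aFun q (X * q ^ 2) (P - j) * br q (j + 1) = br q (P + 1) + eFun q (X * q ^ 2) P j := by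
  have h0 : X * q ^ 2 - 1 ≠ 0 := by
    rw [mul_comm]; exact sub_ne_zero.2 (by simpa using hX 2)
  simp only [aFun, eFun, br, mul_add (2 : ℤ), mul_sub (2 : ℤ), neg_add, neg_sub, neg_mul,
    zpow_add₀ hq0, zpow_sub₀ hq0, zpow_neg, zpow_two_mul_eq, zpow_one, mul_one]
  have hP := zpow_ne_zero P hq0
  have hj := zpow_ne_zero j hq0
  generalize q ^ P = A at *
  generalize q ^ j = B at *
  generalize X * q ^ 2 = Y at *
  have h2 : q ^ (2 : ℤ) = q ^ 2 := by norm_cast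
  simp only [h2]
  field_simp
  ring

theorem eFun_rec_αg (hq0 : q ≠ 0) (hX : ∀ n : ℤ, q ^ n * X ≠ 1) (P j : ℤ) :
    eFun q X (P + 1) j = br q (P + 1) * -(q⁻¹ * ((X - q ^ 2) / (X - 1))) +
      br q j * aFun q X (P - j) := by
  have h0 : X - 1 ≠ 0 := sub_ne_zero.2 (by simpa using hX 0)
  simp only [aFun, eFun, br, mul_add (2 : ℤ), mul_sub (2 : ℤ), neg_add, neg_sub, neg_mul,
    zpow_add₀ hq0, zpow_sub₀ hq0, zpow_neg, zpow_two_mul_eq, zpow_one, mul_one]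
  have hP := zpow_ne_zero P hq0
  have hj := zpow_ne_zero j hq0
  generalize q ^ P = A at *
  generalize q ^ j = B at *
  have h2 : q ^ (2 : ℤ) = q ^ 2 := by norm_cast
  simp only [h2]
  field_simp
  ring

theorem eFun_rec_αα (hq0 : q ≠ 0) (hX : ∀ n : ℤ, q ^ n * X ≠ 1) (P j : ℤ) :
    aFun q (X / q ^ 2) (P - j) * eFun q X (P + 1) (j + 1) =
      eFun q (X / q ^ 2) P j * aFun q X (P - 1 - j) := by
  have h0 : X - 1 ≠ 0 := sub_ne_zero.2 (by simpa using hX 0)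
  have h1 : X - q ^ 2 ≠ 0 := by
    intro h
    refine hX (-2) ?_
    rw [sub_eq_zero.1 h, zpow_neg, zpow_ofNat]
    exact inv_mul_cancel₀ (pow_ne_zero 2 hq0)
  have h3 : X / q ^ 2 - 1 = (X - q ^ 2) / q ^ 2 := by field_simp
  simp only [aFun, eFun, br, h3, mul_add (2 : ℤ), mul_sub (2 : ℤ), neg_add, neg_sub, neg_mul,
    zpow_add₀ hq0, zpow_sub₀ hq0, zpow_neg, zpow_two_mul_eq, zpow_one, mul_one]
  have hP := zpow_ne_zero P hq0
  have hj := zpow_ne_zero j hq0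
  generalize q ^ P = A at *
  generalize q ^ j = B at *
  have h2 : q ^ (2 : ℤ) = q ^ 2 := by norm_cast
  simp only [h2]
  field_simp

end rational

/-! ### Left multiplication by `α` on `V_N`, and operators with given values on a basis -/

section pairs
variable (q : Set.Ioo (0 : ℝ) 1)
open FSL

theorem T_one_x : T 1 (qpow q 2 2) = qpow q 2 2 * qpow q 0 1 ^ 2 := by
  have := T_qpow_two_two q 1
  push_cast at this; rw [this]; norm_cast

theorem T_neg_one_x : T (-1) (qpow q 2 2) = qpow q 2 2 / qpow q 0 1 ^ 2 := by
  have := T_qpow_two_two q (-1)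
  push_cast at this; rw [this, div_eq_mul_inv, ← zpow_ofNat, ← zpow_neg]

/-- `[n] = q^n - q^{-n}` as a constant function. -/
def brF (n : ℤ) : Mer := br (qpow q 0 1) n
/-- `aFun` as a function of `λ`. -/
def aF (i : ℤ) : Mer := aFun (qpow q 0 1) (qpow q 2 2) i
/-- `eFun` as a function of `λ`. -/
def eF (P p : ℤ) : Mer := eFun (qpow q 0 1) (qpow q 2 2) P p

theorem brF_eq (n : ℤ) : brF q n = algebraMap ℂ Mer (br ((q : ℝ) : ℂ) n) := by
  rw [brF, qpow_zero_left, ← RingHom.coe_coe (algebraMap ℂ Mer), ← map_br, zpow_one]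

theorem T_brF (a : ℂ) (n : ℤ) : T a (brF q n) = brF q n := by
  rw [brF_eq, AlgHom.commutes]

theorem brF_ne_zero {n : ℤ} (hn : n ≠ 0) : brF q n ≠ 0 :=
  br_ne_zero (qpow_ne_zero q 0 1) (qpow_zero_one_zpow_ne_one q) hn

theorem brF_zero : brF q 0 = 0 := br_zero

theorem T_aF (a : ℂ) (i : ℤ) : T a (aF q i) = aFun (qpow q 0 1) (T a (qpow q 2 2)) i := by
  have := map_aFun (T a).toRingHom (qpow q 0 1) (qpow q 2 2) i
  simp only [AlgHom.toRingHom_eq_coe, RingHom.coe_coe] at this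
  rw [aF, this, T_qpow_zero_one]

theorem T_eF (a : ℂ) (P i : ℤ) : T a (eF q P i) = eFun (qpow q 0 1) (T a (qpow q 2 2)) P i := by
  have := map_eFun (T a).toRingHom (qpow q 0 1) (qpow q 2 2) P i
  simp only [AlgHom.toRingHom_eq_coe, RingHom.coe_coe] at this
  rw [eF, this, T_qpow_zero_one]

theorem T_F_nat (i : ℕ) : T i (F q) = (qpow q 0 1 ^ (2 * ((i : ℤ) + 1)) * qpow q 2 2 - 1) /
    (qpow q 0 1 ^ 2 * (qpow q 0 1 ^ (2 * (i : ℤ)) * qpow q 2 2 - 1)) := by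
  have h := T_qpow_two_two q i
  push_cast at h
  rw [F_eq_div]
  simp only [map_div₀, map_mul, map_sub, map_pow, map_one, h, T_qpow_zero_one]
  rw [mul_add, zpow_add₀ (qpow_ne_zero q 0 1), mul_comm (qpow q 2 2)]
  norm_cast
  ring_nf

/-- Each exchange of `α` with `γ` produces `q F(λ)`; moved to the left through `γ^i` it becomes `q
F(λ + i)`. -/
theorem α_mul_γ_pow (i : ℕ) : α q * γ q ^ i = l q (aF q i) * (γ q ^ i * α q) := by
  induction i with
  | zero =>
    have : aF q (0 : ℕ) = 1 := by
      have := x_sub_one_ne_zero q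
      simp [aF, aFun, div_self this]
    rw [this, map_one]; simp
  | succ i ih =>
    have h := gr_l_comm (pow_mem_gr q (γ_mem_gr q) i) (qpow q 0 1 * F q)
    have h2 : (-((i : ℂ) * -1)) = i := by ring
    rw [h2] at h
    have h3 : aF q i * T i (qpow q 0 1 * F q) = aF q (i + 1 : ℕ) := by
      have q0 := qpow_ne_zero q 0 1
      rw [map_mul, T_qpow_zero_one, T_F_nat, aF, aF, Nat.cast_succ,
        aFun_succ q0 (zpow_mul_qpow_ne_one q)]
      have h1 : qpow q 0 1 ^ (2 * (i : ℤ)) * qpow q 2 2 - 1 ≠ 0 :=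
        sub_ne_zero.2 (zpow_mul_qpow_ne_one q _)
      generalize qpow q 0 1 ^ (2 * (i : ℤ)) * qpow q 2 2 - 1 = A at *
      generalize qpow q 0 1 ^ (2 * ((i : ℤ) + 1)) * qpow q 2 2 - 1 = B at *
      field_simp
    calc α q * γ q ^ (i + 1) = α q * γ q ^ i * γ q := by rw [pow_succ, mul_assoc]
      _ = l q (aF q i) * γ q ^ i * (α q * γ q) := by rw [ih]; simp only [mul_assoc]
      _ = l q (aF q i) * (γ q ^ i * l q (qpow q 0 1 * F q)) * (γ q * α q) := by
        rw [rel q Relation.αγ]; simp only [mul_assoc]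
      _ = _ := by rw [h, ← h3, map_mul (l q) (aF q i), pow_succ]; simp only [mul_assoc]

theorem α_mul_vec {N k : ℕ} (hk : k ≤ N) :
    α q * vec q N k = aF q (N - k) • vec q (N + 1) (k + 1) := by
  rw [smul_def, vec, vec, ← mul_assoc, α_mul_γ_pow, Nat.add_sub_add_right, pow_succ',
    Nat.cast_sub hk]
  simp only [mul_assoc]

/-- The pair of operators on `V_N` with given values on the basis. -/
def basisPair (N : ℕ) {W : Type} [AddCommGroup W] [Module Mer W] (ug ua : ℕ → W) :
    Pair (VN q N) W where
  g := AddMonoidHom.mk' (fun v => ∑ k ∈ Finset.range (N + 1), T 1 (crd q N k v) • ug k)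
    (fun v w => by simp only [map_add, add_smul, Finset.sum_add_distrib])
  a := AddMonoidHom.mk' (fun v => ∑ k ∈ Finset.range (N + 1), T (-1) (crd q N k v) • ua k)
    (fun v w => by simp only [map_add, add_smul, Finset.sum_add_distrib])
  g_smul f v := by
    simp only [AddMonoidHom.mk'_apply, map_smul, smul_eq_mul, map_mul, mul_smul, Finset.smul_sum]
  a_smul f v := by
    simp only [AddMonoidHom.mk'_apply, map_smul, smul_eq_mul, map_mul, mul_smul, Finset.smul_sum]

section
variable {N : ℕ} {W : Type} [AddCommGroup W] [Module Mer W] (ug ua : ℕ → W) {k : ℕ}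

theorem basisPair_g (hk : k ≤ N) : (basisPair q N ug ua).g (VN.v q N k) = ug k := by
  change ∑ k' ∈ Finset.range (N + 1), _ = _
  rw [Finset.sum_eq_single k]
  · rw [crd_v q _ _ _ hk, if_pos rfl, map_one, one_smul]
  · intro j _ h
    rw [crd_v q _ _ _ hk, if_neg h.symm, map_zero, zero_smul]
  · intro h
    exact absurd (Finset.mem_range.2 (by omega)) h

theorem basisPair_a (hk : k ≤ N) : (basisPair q N ug ua).a (VN.v q N k) = ua k := by
  change ∑ k' ∈ Finset.range (N + 1), _ = _
  rw [Finset.sum_eq_single k]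
  · rw [crd_v q _ _ _ hk, if_pos rfl, map_one, one_smul]
  · intro j _ h
    rw [crd_v q _ _ _ hk, if_neg h.symm, map_zero, zero_smul]
  · intro h
    exact absurd (Finset.mem_range.2 (by omega)) h

end

end pairs

/-! ### Intertwiners from `V_1 ⊗ V` to `W` -/

section intertwining
variable (q : Set.Ioo (0 : ℝ) 1)
open FSL

/-- The pair is an intertwiner `V_1 ⊗ V → W`. -/
def Pair.Intertwines {V W : Type} [AddCommGroup V] [Module Mer V] [HSpace V] [AddCommGroup W]
    [Module Mer W] [HSpace W] (U : Pair V W) (π : Coaction q V) (π' : Coaction q W) : Prop :=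
  ∀ v, π'.toMap (U.g v) = U.opG q (π.toMap v) ∧ π'.toMap (U.a v) = U.opA q (π.toMap v)

/-- Left multiplication by `γ` and `α` (for `P = N + 1`). -/
def kPair (N P : ℕ) : Pair (VN q N) (VN q P) :=
  basisPair q N (fun k => VN.v q P k) (fun k => aF q (N - k) • VN.v q P (k + 1))

/-- The intertwiner `V_1 ⊗ V_{P+1} → V_P`. -/
def ePair (P : ℕ) : Pair (VN q (P + 1)) (VN q P) :=
  basisPair q (P + 1) (fun k => brF q k • VN.v q P (k - 1)) (fun k => eF q (P + 1) k • VN.v q P k)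

theorem kPair_coe (N : ℕ) (x : VN q N) : ((kPair q N (N + 1)).g x : FSL q) = γ q * x ∧
    ((kPair q N (N + 1)).a x : FSL q) = α q * x := by
  induction x using VN.ind with
  | h1 k hk =>
    rw [kPair, basisPair_g q _ _ hk, basisPair_a q _ _ hk, VN.v_coe hk, VN.v_coe (by omega),
      Submodule.coe_smul, VN.v_coe (by omega), γ_vec q hk, α_mul_vec q hk]
    exact ⟨rfl, rfl⟩
  | h2 x y hx hy =>
    rw [map_add, map_add, Submodule.coe_add, Submodule.coe_add, Submodule.coe_add, hx.1, hx.2,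
      hy.1, hy.2, mul_add, mul_add]
    exact ⟨rfl, rfl⟩
  | h3 f x hx =>
    rw [Pair.g_smul, Pair.a_smul, Submodule.coe_smul, Submodule.coe_smul, Submodule.coe_smul, hx.1,
      hx.2]
    exact ⟨(γ_l_mul f _).symm, (α_l_mul f _).symm⟩

/-- Inside `A` the pair is left multiplication by `γ` and `α`, and `Δ(γ x) = Δγ Δx`, `Δ(α x) = Δα
Δx`. -/
theorem kPair_intertwines (N : ℕ) : (kPair q N (N + 1)).Intertwines q (coVN q N) (coVN q (N + 1)) := by
  have h : ∀ x, inclN q (N + 1) ((kPair q N (N + 1)).opG q x) = opγ q (inclN q N x) ∧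
      inclN q (N + 1) ((kPair q N (N + 1)).opA q x) = opα q (inclN q N x) := by
    intro x
    induction x using ATens.ind with
    | h0 => simp
    | h1 c v =>
      rw [Pair.opG_mk, Pair.opA_mk, inclN, inclN, map_add, map_add, ATens.map_mk, ATens.map_mk,
        ATens.map_mk, ATens.map_mk, ATens.map_mk, Submodule.subtype_apply, Submodule.subtype_apply,
        (kPair_coe q N v).1, (kPair_coe q N v).2]
      exact ⟨rfl, rfl⟩
    | h2 x y hx hy => simp only [map_add, hx.1, hx.2, hy.1, hy.2, and_self]
  have e : ∀ N v, inclN q N ((coVN q N).toMap v) = comul q (v : FSL q) := inclN_coVNMap q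
  refine fun v => ⟨inclN_injective q _ ?_, inclN_injective q _ ?_⟩
  · rw [(h _).1, e, e, (kPair_coe q N v).1, comul_mul, comulEnd_γ]
  · rw [(h _).2, e, e, (kPair_coe q N v).2, comul_mul, comulEnd_α]

/-- The constant `-q⁻¹ F(λ-1)⁻¹`. -/
def epsF : Mer := -(qpow q 0 (-1) * vF q)

section det
variable {q} (k : FSL q)

theorem q_mul_inv : qpow q 0 1 * qpow q 0 (-1) = 1 := by
  rw [qpow_const_mul, add_neg_cancel, qpow_zero_zero]

theorem epsF_mul : epsF q * qpow q 0 1 * vI q = -1 := by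
  have h1 := vF_mul_vI q
  have h2 := q_mul_inv (q := q)
  rw [epsF]
  linear_combination -(qpow q 0 1 * qpow q 0 (-1)) * h1 - h2

/-- The four lemmas `det_γγ`, `det_αα`, `det_γα`, `det_αγ` say that the pairing on `V_1 ⊗ V_1` with
`⟨γ, α⟩ = 1`, `⟨α, γ⟩ = ε` (`epsF`) and `⟨γ, γ⟩ = ⟨α, α⟩ = 0` is invariant. This is the dynamical
determinant relation together with the exchange relations. -/
theorem det_γγ : r q (epsF q) * (γ q * (δ q * k)) = -(δ q * (γ q * k)) := by
  rw [γδ_mul, ← mul_assoc, ← mul_assoc, ← map_mul, ← map_mul, epsF_mul, map_neg, map_one,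
    neg_one_mul]

theorem det_αα : r q (epsF q) * (α q * (β q * k)) = -(β q * (α q * k)) := by
  rw [αβ_mul, ← mul_assoc, ← mul_assoc, ← map_mul, ← map_mul, epsF_mul, map_neg, map_one,
    neg_one_mul]

theorem det_γα : r q (epsF q) * (γ q * (β q * k)) + δ q * (α q * k) = k := by
  rw [δα_mul, epsF, map_neg, map_mul (r q), neg_mul, mul_assoc, ← sub_eq_neg_add, add_sub_cancel_right]

/-- `q F(λ) + q⁻¹ F(λ-1)⁻¹` is constant, hence the same in `λ` and in `μ`. This turns `ε(μ)` into
`ε(λ)` in `det_αγ`. -/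
theorem uF_add_vF : qpow q 0 (-1) * vF q + qpow q 0 1 * uF q = qpow q 0 1 + qpow q 0 (-1) := by
  have h2 := q_mul_inv (q := q)
  have h3 : qpow q 0 2 = qpow q 0 1 * qpow q 0 1 := by rw [qpow_const_mul]; norm_num
  have h4 : qpow q 0 (-2) = qpow q 0 (-1) * qpow q 0 (-1) := by rw [qpow_const_mul]; norm_num
  rw [uF, vF, h3, h4]
  linear_combination (-wInv q * (qpow q 0 1 + qpow q 0 (-1))) * h2

theorem l_qpow_eq_r (a : ℤ) : l q (qpow q 0 a) = r q (qpow q 0 a) := by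
  rw [qpow_zero_left, AlgHom.commutes, AlgHom.commutes]

theorem det_αγ : r q (epsF q) * (α q * (δ q * k)) + β q * (γ q * k) = l q (epsF q) * k := by
  have h1 : r q (epsF q) - r q (qpow q 0 1 * uF q) = l q (epsF q) - l q (qpow q 0 1 * uF q) := by
    rw [← map_sub, ← map_sub, epsF, show -(qpow q 0 (-1) * vF q) - qpow q 0 1 * uF q =
      -(qpow q 0 (-1) * vF q + qpow q 0 1 * uF q) by ring, uF_add_vF, map_neg, map_neg, map_add,
      map_add, l_qpow_eq_r, l_qpow_eq_r]
  have h2 : r q (epsF q) * l q (qpow q 0 1 * uF q) = -(l q (uF q) * r q (vF q)) := by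
    rw [← l_comm_r, epsF, map_neg, map_mul (r q), ← l_qpow_eq_r, mul_neg, ← mul_assoc, ← map_mul,
      mul_comm _ (qpow q 0 (-1)), ← mul_assoc (qpow q 0 (-1)), mul_comm (qpow q 0 (-1)), q_mul_inv,
      one_mul]
  rw [← mul_assoc (α q), αδ_eq, ← mul_assoc (β q), βγ_eq, ← mul_assoc (r q _), ← add_mul, mul_add,
    mul_one, ← mul_assoc, h2]
  congr 1
  rw [neg_mul, show ∀ a b c d : FSL q, a + -b + (c - d + b) = (a - d) + c by intros; abel, h1,
    sub_add_cancel]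

end det

theorem ATens.neg_mk' {V : Type} [AddCommGroup V] [Module Mer V] (c : FSL q) (v : V) :
    ATens.mk q (-c) v = -ATens.mk q c v := by
  rw [eq_neg_iff_add_eq_zero, ← ATens.add_mk, neg_add_cancel, ATens.zero_mk]

section recursion
variable {V V₀ X : Type} [AddCommGroup V] [Module Mer V] [HSpace V] [AddCommGroup V₀]
  [Module Mer V₀] [HSpace V₀] [AddCommGroup X] [Module Mer X] [HSpace X]
  {π : Coaction q V} {π₀ : Coaction q V₀} {πX : Coaction q X}

/-- As maps on `V_1 ⊗ V_1 ⊗ V₀`, the hypotheses say that `E (1 ⊗ m)` is `c` times the invariant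
pairing on the first two factors plus `mX (1 ⊗ E')`. Both summands intertwine, and so does `1 ⊗ m`,
which is surjective by `hV`; hence `E` intertwines. -/
theorem intertwines_of_rec (m : Pair V₀ V) (E : Pair V V₀) (E' : Pair V₀ X) (mX : Pair X V₀)
    (hm : m.Intertwines q π₀ π) (hE' : E'.Intertwines q π₀ πX) (hX : mX.Intertwines q πX π₀)
    (c : ℂ) (hgg : ∀ z, E.g (m.g z) = mX.g (E'.g z))
    (hga : ∀ z, E.g (m.a z) = algebraMap ℂ Mer c • z + mX.g (E'.a z))
    (hag : ∀ z, E.a (m.g z) = (algebraMap ℂ Mer c * epsF q) • z + mX.a (E'.g z))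
    (haa : ∀ z, E.a (m.a z) = mX.a (E'.a z))
    (hV : ∀ v, ∃ z z', v = m.g z + m.a z') : E.Intertwines q π π₀ := by
  have hop : ∀ y, E.opG q (m.opG q y) = mX.opG q (E'.opG q y) ∧
      E.opG q (m.opA q y) = algebraMap ℂ Mer c • y + mX.opG q (E'.opA q y) ∧
      E.opA q (m.opG q y) = (algebraMap ℂ Mer c * epsF q) • y + mX.opA q (E'.opG q y) ∧
      E.opA q (m.opA q y) = mX.opA q (E'.opA q y) := by
    intro y
    induction y using ATens.ind with
    | h0 => simp
    | h2 x y hx hy =>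
      obtain ⟨a1, a2, a3, a4⟩ := hx
      obtain ⟨b1, b2, b3, b4⟩ := hy
      simp only [map_add, smul_add, a1, a2, a3, a4, b1, b2, b3, b4, true_and, and_true]
      constructor <;> abel
    | h1 k z =>
      -- The constant `c` is the same in `λ` and in `μ`, so it comes out of the tensor product,
      -- while `f` turns into `f(μ)` on the left factor.
      have hc : ∀ (x : FSL q) (f : Mer) (v : V₀), ATens.mk q x ((algebraMap ℂ Mer c * f) • v) =
          algebraMap ℂ Mer c • ATens.mk q (r q f * x) v := by
        intro x f v
        rw [ATens.mk_smul_eq, ATens.smul_mk, map_mul, mul_assoc, AlgHom.commutes, AlgHom.commutes]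
      have hc' : ∀ (x : FSL q) (v : V₀), ATens.mk q x (algebraMap ℂ Mer c • v) =
          algebraMap ℂ Mer c • ATens.mk q x v := by
        intro x v
        have := hc x 1 v
        rwa [mul_one, map_one, one_mul] at this
      simp only [Pair.opG_mk, Pair.opA_mk, map_add, hgg, hga, hag, haa, ATens.mk_add, hc, hc']
      refine ⟨?_, ?_, ?_, ?_⟩
      · rw [det_γγ, ATens.neg_mk', smul_neg]; abel
      · have h : ATens.mk q k z = ATens.mk q (r q (epsF q) * (γ q * (β q * k))) z +
            ATens.mk q (δ q * (α q * k)) z := by rw [← ATens.add_mk, det_γα]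
        rw [h, smul_add]; abel
      · have h : epsF q • ATens.mk q k z = ATens.mk q (r q (epsF q) * (α q * (δ q * k))) z +
            ATens.mk q (β q * (γ q * k)) z := by rw [← ATens.add_mk, det_αγ, ATens.smul_mk]
        rw [mul_smul, h, smul_add]; abel
      · rw [det_αα, ATens.neg_mk', smul_neg]; abel
  intro v
  obtain ⟨z, z', rfl⟩ := hV v
  obtain ⟨a1, a2, a3, a4⟩ := hop (π₀.toMap z)
  obtain ⟨b1, b2, b3, b4⟩ := hop (π₀.toMap z')
  simp only [map_add, hgg, hga, hag, haa, map_smul, (hm z).1, (hm z').2, (hX _).1, (hX _).2,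
    (hE' _).1, (hE' _).2, a1, a3, b2, b4, and_self]

theorem zero_intertwines (π₀ : Coaction q V₀) (πX : Coaction q X) :
    (⟨0, 0, fun f v => by simp, fun f v => by simp⟩ : Pair V₀ X).Intertwines q π₀ πX := by
  intro v
  generalize π₀.toMap v = x
  refine ⟨?_, ?_⟩
  all_goals
    change πX.toMap 0 = _
    rw [map_zero]
    symm
    induction x using ATens.ind with
    | h0 => rw [map_zero]
    | h1 c v =>
      simp only [Pair.opG_mk, Pair.opA_mk, AddMonoidHom.zero_apply, ATens.mk_zero, add_zero]
    | h2 x y hx hy => rw [map_add, hx, hy, add_zero]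

end recursion

theorem aF_zero : aF q 0 = 1 := by
  have := x_sub_one_ne_zero q
  simp [aF, aFun, div_self this]

/-- Every `v_k` with `k ≤ N` is `γ` times `v_k` of `V_N`, and `v_{N+1}` is `α` times `v_N` because
`a_0 = 1`. -/
theorem kPair_span (N : ℕ) (v : VN q (N + 1)) :
    ∃ z z', v = (kPair q N (N + 1)).g z + (kPair q N (N + 1)).a z' := by
  induction v using VN.ind with
  | h1 k hk =>
    rcases Nat.lt_or_ge N k with h | h
    · obtain rfl : k = N + 1 := by omega
      refine ⟨0, VN.v q N N, ?_⟩
      rw [kPair, basisPair_a q _ _ le_rfl, map_zero, zero_add, sub_self, aF_zero, one_smul]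
    · exact ⟨VN.v q N k, 0, by rw [kPair, basisPair_g q _ _ h, map_zero, add_zero]⟩
  | h2 x y hx hy =>
    obtain ⟨a, b, rfl⟩ := hx
    obtain ⟨c, d, rfl⟩ := hy
    exact ⟨a + c, b + d, by rw [map_add, map_add]; abel⟩
  | h3 f x hx =>
    obtain ⟨a, b, rfl⟩ := hx
    refine ⟨T (-1) f • a, T 1 f • b, ?_⟩
    rw [Pair.g_smul, Pair.a_smul, T_T, T_T, add_neg_cancel, neg_add_cancel, T_zero, smul_add]

theorem T_one_aF_mul (P j : ℤ) :
    T 1 (aF q (P - j)) * brF q (j + 1) = brF q (P + 1) + T 1 (eF q P j) := by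
  rw [T_aF, T_eF, T_one_x]
  exact eFun_rec_gα (qpow_ne_zero q 0 1) (zpow_mul_qpow_ne_one q) P j

theorem eF_eq (P j : ℤ) :
    eF q (P + 1) j = brF q (P + 1) * epsF q + brF q j * aF q (P - j) := by
  have h := eFun_rec_αg (qpow_ne_zero q 0 1) (zpow_mul_qpow_ne_one q) P j
  have h2 : vF q = (qpow q 2 2 - qpow q 0 1 ^ 2) / (qpow q 2 2 - 1) := by
    have := x_sub_one_ne_zero q
    have h3 : qpow q 0 2 = qpow q 0 1 ^ 2 := by rw [qpow_zero_eq_zpow]; norm_cast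
    rw [vF, wInv, h3]
    field_simp
    ring
  rw [epsF, h2, qpow_zero_eq_zpow, zpow_neg_one]
  exact h

theorem T_neg_one_aF_mul (P j : ℤ) : T (-1) (aF q (P - j)) * eF q (P + 1) (j + 1) =
    T (-1) (eF q P j) * aF q (P - 1 - j) := by
  rw [T_aF, T_eF, T_neg_one_x]
  exact eFun_rec_αα (qpow_ne_zero q 0 1) (zpow_mul_qpow_ne_one q) P j

theorem eF_self (P : ℤ) : eF q P P = 0 := by
  rw [eF, eFun, sub_self, br_zero, neg_zero, zero_mul, zero_mul, zero_div]

/-- Induction on `P` through `intertwines_of_rec`, with the constant `c = [P+1]`; the four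
conditions are checked on basis vectors. -/
theorem ePair_intertwines (P : ℕ) : (ePair q P).Intertwines q (coVN q (P + 1)) (coVN q P) := by
  have c0 := brF_zero q
  have kg : ∀ P, ∀ j ≤ P, (kPair q P (P + 1)).g (VN.v q P j) = VN.v q (P + 1) j :=
    fun P j hj => basisPair_g q _ _ hj
  have ka : ∀ P, ∀ j ≤ P, (kPair q P (P + 1)).a (VN.v q P j) =
      aF q (P - j) • VN.v q (P + 1) (j + 1) := fun P j hj => basisPair_a q _ _ hj
  have eg : ∀ P, ∀ j ≤ P + 1, (ePair q P).g (VN.v q (P + 1) j) = brF q j • VN.v q P (j - 1) :=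
    fun P j hj => basisPair_g q _ _ hj
  have ea : ∀ P, ∀ j ≤ P + 1, (ePair q P).a (VN.v q (P + 1) j) = eF q (P + 1) j • VN.v q P j :=
    fun P j hj => basisPair_a q _ _ hj
  have cst : ∀ n : ℤ, algebraMap ℂ Mer (br ((q : ℝ) : ℂ) n) = brF q n := fun n => (brF_eq q n).symm
  induction P with
  | zero =>
    -- For `P = 0` there is no smaller `e`, and the zero pair takes its place: the composite is a
    -- multiple of the invariant pairing alone.
    refine intertwines_of_rec q (kPair q 0 1) _ (⟨0, 0, fun f v => by simp, fun f v => by simp⟩ :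
      Pair (VN q 0) (VN q 0)) ⟨0, 0, fun f v => by simp, fun f v => by simp⟩
      (kPair_intertwines q 0) (zero_intertwines q (coVN q 0) (coVN q 0))
      (zero_intertwines q (coVN q 0) (coVN q 0)) (br ((q : ℝ) : ℂ) 1) ?_ ?_ ?_ ?_ (kPair_span q 0)
    all_goals
      intro z
      induction z using VN.ind with
      | h2 x y hx hy => simp only [map_add, smul_add, hx, hy]; try abel
      | h3 f x hx =>
        simp only [Pair.g_smul, Pair.a_smul, hx, T_T, AddMonoidHom.zero_apply, add_zero, smul_zero,
          smul_smul, neg_add_cancel, add_neg_cancel, T_zero, mul_comm f]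
      | h1 j hj => ?_
    all_goals
      obtain rfl : j = 0 := by omega
      simp only [AddMonoidHom.zero_apply, add_zero]
    · rw [kg 0 0 hj, eg 0 0 (by omega), Nat.cast_zero, c0, zero_smul]
    · rw [ka 0 0 hj, Pair.g_smul, eg 0 1 le_rfl, sub_self, aF_zero, map_one, one_smul, cst]
      rfl
    · rw [kg 0 0 hj, ea 0 0 (by omega), cst]
      have := eF_eq q 0 0
      rw [c0, zero_mul, add_zero, zero_add] at this
      simp only [Nat.cast_zero, zero_add, this]
    · rw [ka 0 0 hj, Pair.a_smul, ea 0 1 le_rfl, VN.v_eq_zero q (by omega), smul_zero, smul_zero]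
  | succ P ih =>
    refine intertwines_of_rec q (kPair q (P + 1) (P + 2)) _ (ePair q P) (kPair q P (P + 1))
      (kPair_intertwines q (P + 1)) ih (kPair_intertwines q P)
      (br ((q : ℝ) : ℂ) (P + 2)) ?_ ?_ ?_ ?_ (kPair_span q (P + 1))
    all_goals
      intro z
      induction z using VN.ind with
      | h2 x y hx hy => simp only [map_add, smul_add, hx, hy]; try abel
      | h3 f x hx =>
        simp only [Pair.g_smul, Pair.a_smul, hx, T_T, smul_add,
          smul_smul, neg_add_cancel, add_neg_cancel, T_zero, mul_comm f]
      | h1 j hj => ?_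
    · rw [kg _ _ hj, eg (P + 1) j (by omega), eg P j hj, Pair.g_smul, T_brF, kg P _ (by omega)]
    · have h := T_one_aF_mul q (P + 1) j
      rw [ka _ _ hj, Pair.g_smul, eg (P + 1) (j + 1) (by omega), ea P j hj, Pair.g_smul, cst, smul_smul]
      push_cast
      rw [h, add_smul, show (P : ℤ) + 1 + 1 = P + 2 by ring]
      congr 1
      -- At `j = P + 1` the vector `v_j` of `V_P` is zero by convention, and the coefficient `eF` of
      -- the other term vanishes too.
      rcases Nat.lt_or_ge P j with h1 | h1
      · obtain rfl : j = P + 1 := by omega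
        push_cast
        rw [eF_self, map_zero, zero_smul, zero_smul]
      · rw [kg P j h1]
    · have h := eF_eq q (P + 1) j
      rw [kg _ _ hj, ea (P + 1) j (by omega), eg P j hj, Pair.a_smul, cst, T_brF]
      push_cast
      rw [h, add_smul, show (P : ℤ) + 1 + 1 = P + 2 by ring]
      congr 1
      -- For `j = 0` the index `j - 1` is truncated, but `[j] = 0`.
      rcases j with _ | j
      · rw [Nat.cast_zero, c0, zero_mul, zero_smul, zero_smul]
      · rw [Nat.add_sub_cancel, ka P j (by omega), mul_smul]
        congr 3
        push_cast; ring
    · have h := T_neg_one_aF_mul q (P + 1) j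
      rw [ka _ _ hj, Pair.a_smul, ea (P + 1) (j + 1) (by omega), ea P j hj, Pair.a_smul]
      rcases Nat.lt_or_ge P j with h1 | h1
      · rw [VN.v_eq_zero q (N := P) h1, VN.v_eq_zero q (N := P + 1) (by omega), map_zero]
        simp only [smul_zero]
      · rw [ka P j h1, smul_smul, smul_smul]
        push_cast
        rw [h]
        congr 3
        ring

end intertwining

section clebschGordan
variable (q : Set.Ioo (0 : ℝ) 1)
open FSL

/-! ### The Clebsch-Gordan intertwiners -/

/-- The map `V_M ⊗ V_N → V_P` with the Clebsch-Gordan coefficients, for `P = M + N - 2s`. -/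
def cgMap (M N s P : ℕ) : Tens (VN q M) (VN q N) →ₗ[Mer] VN q P :=
  tensLift q M N fun j k => cgCoeff q M N s j k • VN.v q P (j + k - s)

theorem cgMap_mk {M N s P j k : ℕ} (hj : j ≤ M) (hk : k ≤ N) :
    cgMap q M N s P (Tens.mk (VN.v q M j) (VN.v q N k)) =
      cgCoeff q M N s j k • VN.v q P (j + k - s) := tensLift_mk q M N _ hj hk

section values
variable {M N s P P₀ j k : ℕ}

/-- This lemma and the three after it evaluate the right side of the recursion on basis vectors.
Where the target index is truncated or out of range, the vanishing of the Clebsch-Gordan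
coefficients keeps the formulas true. -/
theorem kPair_g_cgMap (hj : j ≤ M) (hk : k ≤ N) (hs : s ≤ N) (hsM : s ≤ M)
    (h : M + N = P₀ + 2 * s) :
    (kPair q P₀ P).g (cgMap q M N s P₀ (Tens.mk (VN.v q M j) (VN.v q N k))) =
      T 1 (cgCoeff q M N s j k) • VN.v q P (j + k - s) := by
  rw [cgMap_mk q hj hk, Pair.g_smul]
  rcases Nat.lt_or_ge P₀ (j + k - s) with h1 | h1
  · rw [cgCoeff_eq_zero_of_gt q hsM hs hj hk (by omega), map_zero, zero_smul, zero_smul]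
  · rw [kPair, basisPair_g q _ _ h1]

theorem kPair_a_cgMap (hj : j ≤ M) (hk : k ≤ N) (hs : s ≤ N) (hsM : s ≤ M)
    (h : M + N = P₀ + 2 * s) :
    (kPair q P₀ P).a (cgMap q M N s P₀ (Tens.mk (VN.v q M j) (VN.v q N k))) =
      (T (-1) (cgCoeff q M N s j k) * aF q (M + N - s - j - k)) • VN.v q P (j + 1 + k - s) := by
  rw [cgMap_mk q hj hk, Pair.a_smul]
  rcases Nat.lt_or_ge P₀ (j + k - s) with h1 | h1
  · rw [cgCoeff_eq_zero_of_gt q hsM hs hj hk (by omega), map_zero, zero_smul, zero_mul, zero_smul]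
  rcases Nat.lt_or_ge (j + k) s with h2 | h2
  · rw [cgCoeff_eq_zero_of_lt q h2, map_zero, zero_smul, zero_mul, zero_smul]
  · rw [kPair, basisPair_a q _ _ h1, mul_smul]
    congr 3
    · omega
    · omega

theorem ePair_g_cgMap (hj : j ≤ M) (hk : k ≤ N) (hs : s ≤ N) (hsM : s ≤ M + 1) (h1s : 1 ≤ s)
    (h : M + 1 + N = P + 2 * s) :
    (ePair q P).g (cgMap q M N (s - 1) (P + 1) (Tens.mk (VN.v q M j) (VN.v q N k))) =
      (T 1 (cgCoeff q M N (s - 1) j k) * brF q (j + k - s + 1)) • VN.v q P (j + k - s) := by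
  rw [cgMap_mk q hj hk, Pair.g_smul]
  rcases Nat.lt_or_ge (P + 1) (j + k - (s - 1)) with h1 | h1
  · rw [cgCoeff_eq_zero_of_gt q (by omega) (by omega) hj hk (by omega), map_zero, zero_smul,
      zero_mul, zero_smul]
  rcases Nat.lt_or_ge (j + k) (s - 1) with h2 | h2
  · rw [cgCoeff_eq_zero_of_lt q h2, map_zero, zero_smul, zero_mul, zero_smul]
  · rw [ePair, basisPair_g q _ _ h1, mul_smul]
    congr 3
    · omega
    · omega

theorem ePair_a_cgMap (hj : j ≤ M) (hk : k ≤ N) (hs : s ≤ N) (hsM : s ≤ M + 1) (h1s : 1 ≤ s)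
    (h : M + 1 + N = P + 2 * s) :
    (ePair q P).a (cgMap q M N (s - 1) (P + 1) (Tens.mk (VN.v q M j) (VN.v q N k))) =
      (T (-1) (cgCoeff q M N (s - 1) j k) * eF q (P + 1) (j + k - s + 1)) •
        VN.v q P (j + 1 + k - s) := by
  rw [cgMap_mk q hj hk, Pair.a_smul]
  rcases Nat.lt_or_ge (P + 1) (j + k - (s - 1)) with h1 | h1
  · rw [cgCoeff_eq_zero_of_gt q (by omega) (by omega) hj hk (by omega), map_zero, zero_smul,
      zero_mul, zero_smul]
  rcases Nat.lt_or_ge (j + k) (s - 1) with h2 | h2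
  · rw [cgCoeff_eq_zero_of_lt q h2, map_zero, zero_smul, zero_mul, zero_smul]
  · rw [ePair, basisPair_a q _ _ h1, mul_smul]
    congr 3
    · omega
    · omega

theorem T_one_cgCoeff (M N s j k : ℕ) : T 1 (cgCoeff q M N s j k) =
    cgRat (qpow q 0 1) (qpow q 2 2 * qpow q 0 1 ^ 2) M N s j k := by
  have := T_cgCoeff q 1 M N s j k
  push_cast at this
  rw [this]
  norm_cast

theorem T_neg_one_cgCoeff (M N s j k : ℕ) : T (-1) (cgCoeff q M N s j k) =
    cgRat (qpow q 0 1) (qpow q 2 2 / qpow q 0 1 ^ 2) M N s j k := by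
  have := T_cgCoeff q (-1) M N s j k
  push_cast at this
  rw [this, div_eq_mul_inv, zpow_neg]
  norm_cast

/-- The coefficient recursions `cgRat_succ_left` and `cgRat_succ_succ` read as identities between
vectors of `V_P`. The space `V_{P₀}`, with `P₀ = P - 1`, matters only for `s ≤ M`, which is why `hP`
is conditional. -/
theorem cgMap_rec_basis (hj : j ≤ M) (hk : k ≤ N) (hs : s ≤ N) (hsM : s ≤ M + 1)
    (h : M + 1 + N = P + 2 * s) (hP : s ≤ M → P = P₀ + 1) :
    (brF q (M + 1) * brF q (P + 1)) • cgMap q (M + 1) N s P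
        (Tens.mk ((kPair q M (M + 1)).g (VN.v q M j)) (VN.v q N k)) =
      (brF q (M + 1 - s) * brF q (M + N + 2 - s)) •
        (kPair q P₀ P).g (cgMap q M N s P₀ (Tens.mk (VN.v q M j) (VN.v q N k))) +
      brF q s • (ePair q P).g (cgMap q M N (s - 1) (P + 1) (Tens.mk (VN.v q M j) (VN.v q N k))) ∧
    (brF q (M + 1) * brF q (P + 1)) • cgMap q (M + 1) N s P
        (Tens.mk ((kPair q M (M + 1)).a (VN.v q M j)) (VN.v q N k)) =
      (brF q (M + 1 - s) * brF q (M + N + 2 - s)) •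
        (kPair q P₀ P).a (cgMap q M N s P₀ (Tens.mk (VN.v q M j) (VN.v q N k))) +
      brF q s • (ePair q P).a (cgMap q M N (s - 1) (P + 1) (Tens.mk (VN.v q M j) (VN.v q N k))) := by
  have q0 := qpow_ne_zero q 0 1
  have hP1 : (P : ℤ) + 1 = M + N + 2 - 2 * s := by omega
  have kg : (kPair q M (M + 1)).g (VN.v q M j) = VN.v q (M + 1) j := basisPair_g q _ _ hj
  have ka : (kPair q M (M + 1)).a (VN.v q M j) = aF q (M - j) • VN.v q (M + 1) (j + 1) :=
    basisPair_a q _ _ hj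
  -- For `s = M + 1` the first term has the factor `[M+1-s] = 0`, so its value is immaterial.
  have t1 : ∀ (c : Mer), (s ≤ M → (kPair q P₀ P).g
      (cgMap q M N s P₀ (Tens.mk (VN.v q M j) (VN.v q N k))) = c • VN.v q P (j + k - s)) →
      (brF q (M + 1 - s) * brF q (M + N + 2 - s)) •
        (kPair q P₀ P).g (cgMap q M N s P₀ (Tens.mk (VN.v q M j) (VN.v q N k))) =
      (brF q (M + 1 - s) * brF q (M + N + 2 - s) * c) • VN.v q P (j + k - s) := by
    intro c hc
    rcases Nat.lt_or_ge M s with h1 | h1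
    · rw [show (M : ℤ) + 1 - s = 0 by omega, brF_zero, zero_mul, zero_smul, zero_mul, zero_smul]
    · rw [hc h1, smul_smul]
  have t2 : ∀ (c : Mer), (s ≤ M → (kPair q P₀ P).a
      (cgMap q M N s P₀ (Tens.mk (VN.v q M j) (VN.v q N k))) = c • VN.v q P (j + 1 + k - s)) →
      (brF q (M + 1 - s) * brF q (M + N + 2 - s)) •
        (kPair q P₀ P).a (cgMap q M N s P₀ (Tens.mk (VN.v q M j) (VN.v q N k))) =
      (brF q (M + 1 - s) * brF q (M + N + 2 - s) * c) • VN.v q P (j + 1 + k - s) := by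
    intro c hc
    rcases Nat.lt_or_ge M s with h1 | h1
    · rw [show (M : ℤ) + 1 - s = 0 by omega, brF_zero, zero_mul, zero_smul, zero_mul, zero_smul]
    · rw [hc h1, smul_smul]
  -- Likewise the factor `[s]` removes the second term for `s = 0`.
  have t3 : ∀ (c : Mer) (x y : VN q P), (1 ≤ s → x = c • y) → brF q s • x = (brF q s * c) • y := by
    intro c x y hc
    rcases Nat.eq_zero_or_pos s with h1 | h1
    · rw [h1, Nat.cast_zero, brF_zero, zero_smul, zero_mul, zero_smul]
    · rw [hc h1, smul_smul]
  constructor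
  · rw [kg, cgMap_mk q (by omega) hk,
      t1 _ fun h1 => kPair_g_cgMap q hj hk hs h1 (by have := hP h1; omega),
      t3 _ _ _ fun h1 => ePair_g_cgMap q hj hk hs hsM h1 h, smul_smul, ← add_smul]
    congr 1
    rw [T_one_cgCoeff, T_one_cgCoeff, cgCoeff_eq_cgRat, hP1]
    have := cgRat_succ_left (X := qpow q 2 2) q0 (qpow_zero_one_zpow_ne_one q) k hs hsM hj
    refine this.trans ?_
    rw [mul_comm (br _ _) (cgRat _ _ _ _ (s - 1) _ _)]
    rfl
  · rw [ka, ← Tens.smul_mk, map_smul, cgMap_mk q (by omega) hk,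
      t2 _ fun h1 => kPair_a_cgMap q hj hk hs h1 (by have := hP h1; omega),
      t3 _ _ _ fun h1 => ePair_a_cgMap q hj hk hs hsM h1 h, smul_smul, smul_smul, ← add_smul]
    congr 1
    rw [T_neg_one_cgCoeff, T_neg_one_cgCoeff, cgCoeff_eq_cgRat, hP1]
    have := cgRat_succ_succ (X := qpow q 2 2) q0 (qpow_zero_one_zpow_ne_one q)
      (qpow_ne_zero q 2 2) (zpow_mul_qpow_ne_one q) k hs hsM hj
    refine Eq.trans ?_ (this.trans ?_)
    · rw [aF, brF, brF]; ring
    · rw [aF, brF, brF, brF, eF]; ring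

/-- Both sides are semilinear in `v` and in `w` with the same shifts, so the basis case is enough.
-/
theorem cgMap_rec (hs : s ≤ N) (hsM : s ≤ M + 1)
    (h : M + 1 + N = P + 2 * s) (hP : s ≤ M → P = P₀ + 1) (v : VN q M) (w : VN q N) :
    (brF q (M + 1) * brF q (P + 1)) • cgMap q (M + 1) N s P
        (Tens.mk ((kPair q M (M + 1)).g v) w) =
      (brF q (M + 1 - s) * brF q (M + N + 2 - s)) •
        (kPair q P₀ P).g (cgMap q M N s P₀ (Tens.mk v w)) +
      brF q s • (ePair q P).g (cgMap q M N (s - 1) (P + 1) (Tens.mk v w)) ∧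
    (brF q (M + 1) * brF q (P + 1)) • cgMap q (M + 1) N s P
        (Tens.mk ((kPair q M (M + 1)).a v) w) =
      (brF q (M + 1 - s) * brF q (M + N + 2 - s)) •
        (kPair q P₀ P).a (cgMap q M N s P₀ (Tens.mk v w)) +
      brF q s • (ePair q P).a (cgMap q M N (s - 1) (P + 1) (Tens.mk v w)) := by
  induction v using VN.ind with
  | h2 v v' hv hv' =>
    simp only [map_add, Tens.add_mk, smul_add, hv.1, hv.2, hv'.1, hv'.2]
    constructor <;> abel
  | h3 f v hv =>
    simp only [Pair.g_smul, Pair.a_smul, ← Tens.smul_mk, LinearMap.map_smul]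
    rw [smul_comm, hv.1, smul_comm _ (T (-1) f), hv.2, smul_add, smul_add]
    constructor
    · congr 1 <;> exact smul_comm _ _ _
    · congr 1 <;> exact smul_comm _ _ _
  | h1 j hj =>
    induction w using VN.ind with
    | h1 k hk => exact cgMap_rec_basis q hj hk hs hsM h hP
    | h2 w w' hw hw' =>
      simp only [map_add, Tens.mk_add, smul_add, hw.1, hw.2, hw'.1, hw'.2]
      constructor <;> abel
    | h3 f w hw =>
      have kg : (kPair q M (M + 1)).g (VN.v q M j) ∈ wt _ (2 * j - (M + 1 : ℕ) : ℂ) := by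
        rw [kPair, basisPair_g q _ _ hj]; exact VN.v_mem_wt q (by omega)
      have ka : (kPair q M (M + 1)).a (VN.v q M j) ∈ wt _ (2 * (j + 1 : ℕ) - (M + 1 : ℕ) : ℂ) := by
        rw [kPair, basisPair_a q _ _ hj]
        exact Submodule.smul_mem _ _ (VN.v_mem_wt q (by omega))
      -- A scalar on `w` crosses either `v_j` and then `γ` or `α`, or their product; the degrees
      -- add, so the shifts agree.
      have e1 : T 1 (T (-(2 * j - M)) f) = T (-(2 * j - (M + 1 : ℕ))) f := by
        rw [T_T]; congr 1; push_cast; ring_nf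
      have e2 : T (-1) (T (-(2 * j - M)) f) = T (-(2 * (j + 1 : ℕ) - (M + 1 : ℕ))) f := by
        rw [T_T]; congr 1; push_cast; ring_nf
      simp only [Tens.mk_smul kg, Tens.mk_smul ka, Tens.mk_smul (VN.v_mem_wt q hj),
        LinearMap.map_smul, Pair.g_smul, Pair.a_smul, e1, e2]
      rw [smul_comm, hw.1, smul_comm _ (T (-(2 * (j + 1 : ℕ) - (M + 1 : ℕ))) f), hw.2, smul_add, smul_add]
      constructor
      · congr 1 <;> exact smul_comm _ _ _
      · congr 1 <;> exact smul_comm _ _ _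

end values

end clebschGordan

/-! ### The Clebsch-Gordan maps are intertwiners -/

section clebschGordan
variable (q : Set.Ioo (0 : ℝ) 1)
open FSL

theorem brF_smul_mk {V : Type} [AddCommGroup V] [Module Mer V] (n n' : ℤ) (a : FSL q) (v : V) :
    ATens.mk q a ((brF q n * brF q n') • v) = (brF q n * brF q n') • ATens.mk q a v := by
  rw [brF_eq, brF_eq, ← map_mul, ATens.mk_smul_eq, ATens.smul_mk, AlgHom.commutes, AlgHom.commutes]

theorem brF_smul_mk' {V : Type} [AddCommGroup V] [Module Mer V] (n : ℤ) (a : FSL q) (v : V) :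
    ATens.mk q a (brF q n • v) = brF q n • ATens.mk q a v := by
  rw [brF_eq, ATens.mk_smul_eq, ATens.smul_mk, AlgHom.commutes, AlgHom.commutes]

section step
variable {M N s P P₀ : ℕ}

/-- The recursion carried over to `A ⊗ V_P`. It applies on each `c ⊗ v`, because the bracket factors
are constants and pass through the tensor product. -/
theorem map_cgMap_sigmaAux (hs : s ≤ N) (hsM : s ≤ M + 1) (h : M + 1 + N = P + 2 * s)
    (hP : s ≤ M → P = P₀ + 1) (b : FSL q) (w : VN q N) (z : ATens q (VN q M)) :
    (brF q (M + 1) * brF q (P + 1)) • ATens.map q (cgMap q (M + 1) N s P)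
        (sigmaAux q b w ((kPair q M (M + 1)).opG q z)) =
      (brF q (M + 1 - s) * brF q (M + N + 2 - s)) •
        (kPair q P₀ P).opG q (ATens.map q (cgMap q M N s P₀) (sigmaAux q b w z)) +
      brF q s • (ePair q P).opG q
        (ATens.map q (cgMap q M N (s - 1) (P + 1)) (sigmaAux q b w z)) ∧
    (brF q (M + 1) * brF q (P + 1)) • ATens.map q (cgMap q (M + 1) N s P)
        (sigmaAux q b w ((kPair q M (M + 1)).opA q z)) =
      (brF q (M + 1 - s) * brF q (M + N + 2 - s)) •
        (kPair q P₀ P).opA q (ATens.map q (cgMap q M N s P₀) (sigmaAux q b w z)) +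
      brF q s • (ePair q P).opA q
        (ATens.map q (cgMap q M N (s - 1) (P + 1)) (sigmaAux q b w z)) := by
  induction z using ATens.ind with
  | h0 => simp
  | h2 x y hx hy =>
    simp only [map_add, smul_add, hx.1, hx.2, hy.1, hy.2]
    constructor <;> abel
  | h1 c v =>
    obtain ⟨h1, h2⟩ := cgMap_rec q hs hsM h hP v w
    simp only [Pair.opG_mk, Pair.opA_mk, map_add, sigmaAux_mk, ATens.map_mk, smul_add,
      ← brF_smul_mk, ← brF_smul_mk', h1, h2, ATens.mk_add, mul_assoc]
    constructor <;> abel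

theorem map_cgMap_sigma (hs : s ≤ N) (hsM : s ≤ M + 1) (h : M + 1 + N = P + 2 * s)
    (hP : s ≤ M → P = P₀ + 1) (v : VN q M) (w : VN q N) :
    (brF q (M + 1) * brF q (P + 1)) • ATens.map q (cgMap q (M + 1) N s P)
        ((coTens q (coVN q (M + 1)) (coVN q N)).toMap (Tens.mk ((kPair q M (M + 1)).g v) w)) =
      (brF q (M + 1 - s) * brF q (M + N + 2 - s)) •
        (kPair q P₀ P).opG q (ATens.map q (cgMap q M N s P₀)
          ((coTens q (coVN q M) (coVN q N)).toMap (Tens.mk v w))) +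
      brF q s • (ePair q P).opG q (ATens.map q (cgMap q M N (s - 1) (P + 1))
          ((coTens q (coVN q M) (coVN q N)).toMap (Tens.mk v w))) ∧
    (brF q (M + 1) * brF q (P + 1)) • ATens.map q (cgMap q (M + 1) N s P)
        ((coTens q (coVN q (M + 1)) (coVN q N)).toMap (Tens.mk ((kPair q M (M + 1)).a v) w)) =
      (brF q (M + 1 - s) * brF q (M + N + 2 - s)) •
        (kPair q P₀ P).opA q (ATens.map q (cgMap q M N s P₀)
          ((coTens q (coVN q M) (coVN q N)).toMap (Tens.mk v w))) +
      brF q s • (ePair q P).opA q (ATens.map q (cgMap q M N (s - 1) (P + 1))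
          ((coTens q (coVN q M) (coVN q N)).toMap (Tens.mk v w))) := by
  have e : ∀ K (x : VN q K), (coTens q (coVN q K) (coVN q N)).toMap (Tens.mk x w) =
      sigma q ((coVN q K).toMap x) ((coVN q K).mem_matched q x) ((coVN q N).toMap w) :=
    fun K x => coTensMap_mk q (coVN q K) (coVN q N) x w
  rw [e, e, e]
  generalize (coVN q N).toMap w = z
  induction z using ATens.ind with
  | h0 => simp
  | h2 x y hx hy =>
    simp only [map_add, smul_add, hx.1, hx.2, hy.1, hy.2]
    constructor <;> abel
  | h1 b w =>
    rw [sigma_mk, sigma_mk, sigma_mk, (kPair_intertwines q M v).1, (kPair_intertwines q M v).2]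
    exact map_cgMap_sigmaAux q hs hsM h hP b w _

end step

/-- Induction on `M`. Every vector of `V_{M+1}` is a sum of products with `γ` and `α`. On these the
recursion expresses both the map and its composite with the coaction through intertwiners already
known: `m`, `e` and the Clebsch-Gordan maps for `M`. -/
theorem cgMap_intertwines {M N s P : ℕ} (hsM : s ≤ M) (hsN : s ≤ N) (h : M + N = P + 2 * s)
    (x : Tens (VN q M) (VN q N)) : (coVN q P).toMap (cgMap q M N s P x) =
      ATens.map q (cgMap q M N s P) ((coTens q (coVN q M) (coVN q N)).toMap x) := by
  induction M generalizing s P with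
  | zero =>
    obtain rfl : s = 0 := by omega
    obtain rfl : P = N := by omega
    induction x using Tens.indV with
    | h2 x y hx hy => simp only [map_add, hx, hy]
    | h3 f x hx => simp only [LinearMap.map_smul, hx]
    | h1 j hj k hk =>
      obtain rfl : j = 0 := by omega
      obtain ⟨u, hu⟩ := exists_isMatrix q P
      -- `V_0` is the trivial corepresentation, and for `M = 0` all coefficients are one.
      have ht : IsMatrix q 0 fun _ _ => 1 := by
        intro k hk
        apply inclN_injective q 0
        refine (inclN_coVNMap q 0 _).trans ?_
        have h1 : vec q 0 k = 1 := by
          obtain rfl : k = 0 := by omega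
          simp [vec]
        rw [VN.v_coe hk, h1, comul_one]
        simp [inclN, ATens.map_mk, VN.v_coe, vec]
      have h1 : ∀ k, cgCoeff q 0 P 0 0 k = 1 := fun k => by
        rw [cgCoeff_eq_cgRat, cgRat_zero_left]
      rw [cgMap_mk q hj hk, h1, one_smul, Nat.sub_zero, zero_add, hu k hk, coTens_mk ht hu hj hk,
        Finset.sum_range_one, map_sum]
      refine Finset.sum_congr rfl fun l hl => ?_
      rw [ATens.map_mk, cgMap_mk q le_rfl (Nat.lt_succ_iff.1 (Finset.mem_range.1 hl)), h1, one_smul,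
        one_mul, zero_add, Nat.sub_zero]
  | succ M ih =>
    induction x using Tens.ind with
    | h0 => simp
    | h2 x y hx hy => simp only [map_add, hx, hy]
    | h1 v w =>
      -- The recursion gives the claim multiplied by this factor, which has to be cancelled.
      have hc : brF q (M + 1) * brF q (P + 1) ≠ 0 :=
        mul_ne_zero (brF_ne_zero q (by omega)) (brF_ne_zero q (by omega))
      have hP : s ≤ M → P = P - 1 + 1 := fun h1 => by omega
      have hK : ∀ v, (brF q (M + 1 - s) * brF q (M + N + 2 - s)) • (coVN q P).toMap
            ((kPair q (P - 1) P).g (cgMap q M N s (P - 1) (Tens.mk v w))) =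
          (brF q (M + 1 - s) * brF q (M + N + 2 - s)) • (kPair q (P - 1) P).opG q
            (ATens.map q (cgMap q M N s (P - 1))
              ((coTens q (coVN q M) (coVN q N)).toMap (Tens.mk v w))) ∧
          (brF q (M + 1 - s) * brF q (M + N + 2 - s)) • (coVN q P).toMap
            ((kPair q (P - 1) P).a (cgMap q M N s (P - 1) (Tens.mk v w))) =
          (brF q (M + 1 - s) * brF q (M + N + 2 - s)) • (kPair q (P - 1) P).opA q
            (ATens.map q (cgMap q M N s (P - 1))
              ((coTens q (coVN q M) (coVN q N)).toMap (Tens.mk v w))) := by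
        intro v
        -- When `s = M + 1` there is no `C_s` on `V_M ⊗ V_N`, and its coefficient is zero.
        rcases Nat.lt_or_ge M s with h1 | h1
        · rw [show (M : ℤ) + 1 - s = 0 by omega, brF_zero]
          simp only [zero_mul, zero_smul, and_self]
        · obtain ⟨P, rfl⟩ : ∃ P', P = P' + 1 := ⟨P - 1, hP h1⟩
          rw [Nat.add_sub_cancel, ← ih h1 (by omega) (by omega), (kPair_intertwines q P _).1,
            (kPair_intertwines q P _).2]
          exact ⟨rfl, rfl⟩
      have hE : ∀ v, brF q s • (coVN q P).toMap
            ((ePair q P).g (cgMap q M N (s - 1) (P + 1) (Tens.mk v w))) =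
          brF q s • (ePair q P).opG q (ATens.map q (cgMap q M N (s - 1) (P + 1))
              ((coTens q (coVN q M) (coVN q N)).toMap (Tens.mk v w))) ∧
          brF q s • (coVN q P).toMap
            ((ePair q P).a (cgMap q M N (s - 1) (P + 1) (Tens.mk v w))) =
          brF q s • (ePair q P).opA q (ATens.map q (cgMap q M N (s - 1) (P + 1))
              ((coTens q (coVN q M) (coVN q N)).toMap (Tens.mk v w))) := by
        intro v
        rcases Nat.eq_zero_or_pos s with h1 | h1
        · rw [h1, Nat.cast_zero, brF_zero]
          simp only [zero_smul, and_self]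
        · rw [← ih (by omega) (by omega) (by omega), (ePair_intertwines q P _).1,
            (ePair_intertwines q P _).2]
          exact ⟨rfl, rfl⟩
      obtain ⟨z, z', rfl⟩ := kPair_span q M v
      rw [Tens.add_mk, map_add, map_add, map_add, map_add]
      congr 1
      · apply smul_right_injective _ hc
        change (brF q (M + 1) * brF q (P + 1)) • _ = (brF q (M + 1) * brF q (P + 1)) • _
        rw [← LinearMap.map_smul, (cgMap_rec q hsN hsM h hP z w).1,
          (map_cgMap_sigma q hsN hsM h hP z w).1, map_add, LinearMap.map_smul, LinearMap.map_smul,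
          (hK z).1, (hE z).1]
      · apply smul_right_injective _ hc
        change (brF q (M + 1) * brF q (P + 1)) • _ = (brF q (M + 1) * brF q (P + 1)) • _
        rw [← LinearMap.map_smul, (cgMap_rec q hsN hsM h hP z' w).2,
          (map_cgMap_sigma q hsN hsM h hP z' w).2, map_add, LinearMap.map_smul, LinearMap.map_smul,
          (hK z').2, (hE z').2]

end clebschGordan

/-! ### The Clebsch-Gordan formula and the decomposition of the tensor product -/

section equivalence
variable (q : Set.Ioo (0 : ℝ) 1)
open FSL

theorem cgMap_mem_wt {M N s P j k : ℕ} (hj : j ≤ M) (hk : k ≤ N) (h : M + N = P + 2 * s) :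
    cgMap q M N s P (Tens.mk (VN.v q M j) (VN.v q N k)) ∈
      wt (VN q P) ((2 * j - M : ℂ) + (2 * k - N)) := by
  rw [cgMap_mk q hj hk]
  rcases Nat.lt_or_ge (j + k) s with h1 | h1
  · rw [cgCoeff_eq_zero_of_lt q h1, zero_smul]
    exact zero_mem _
  rcases Nat.lt_or_ge P (j + k - s) with h2 | h2
  · rw [VN.v_eq_zero q h2, smul_zero]
    exact zero_mem _
  · refine Submodule.smul_mem _ _ ?_
    have h3 := VN.v_mem_wt q h2
    have h4 : (M : ℂ) + N = P + 2 * s := by exact_mod_cast h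
    rw [Nat.cast_sub h1] at h3
    push_cast at h3
    rwa [show (2 * j - M : ℂ) + (2 * k - N) = 2 * (j + k - s) - P by linear_combination -h4]

theorem cgMap_isIntertwiner {M N s P : ℕ} (hsM : s ≤ M) (hsN : s ≤ N) (h : M + N = P + 2 * s) :
    IsIntertwiner q (coTens q (coVN q M) (coVN q N)) (coVN q P) (cgMap q M N s P) := by
  refine ⟨fun x => ?_, cgMap_intertwines q hsM hsN h⟩
  induction x using Tens.indV with
  | h2 x y hx hy => simp only [map_add, hx, hy]
  | h3 f x hx => simp only [LinearMap.map_smul, hx]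
  | h1 j hj k hk =>
    rw [mem_wt.1 (Tens.mk_mem_wt (VN.v_mem_wt q hj) (VN.v_mem_wt q hk)), LinearMap.map_smul,
      mem_wt.1 (cgMap_mem_wt q hj hk h)]

/-- The Clebsch-Gordan formula. -/
theorem sum_cgCoeff_mul {M N s P : ℕ} (hsM : s ≤ M) (hsN : s ≤ N) (h : M + N = P + 2 * s)
    {t u w : ℕ → ℕ → FSL q} (ht : IsMatrix q M t) (hu : IsMatrix q N u) (hw : IsMatrix q P w)
    {m n p : ℕ} (hm : m ≤ M) (hn : n ≤ N) (hp : p ≤ P) :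
    ∑ x ∈ Finset.range (M + 1) ×ˢ Finset.range (N + 1) with x.1 + x.2 = p + s,
        r q (cgCoeff q M N s x.1 x.2) * (t m x.1 * u n x.2) =
      if s ≤ m + n ∧ m + n ≤ M + N - s then
        l q (cgCoeff q M N s m n) * w (m + n - s) p else 0 := by
  have e := congrArg (coefL q P p)
    (cgMap_intertwines q hsM hsN h (Tens.mk (VN.v q M m) (VN.v q N n)))
  rw [coTens_mk ht hu hm hn, cgMap_mk q hm hn, LinearMap.map_smul, LinearMap.map_smul] at e
  simp only [map_sum] at e
  rw [Finset.sum_filter, Finset.sum_product]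
  -- Both sides are the coefficient of `v_p` in the intertwining relation applied to `v_m ⊗ v_n`. On
  -- the coaction side only `k + l = p + s` contributes, and there the scalar `C(λ)` sits on `V_P`
  -- and becomes `C(μ)` in `A`.
  refine Eq.trans (Finset.sum_congr rfl fun k hk => Finset.sum_congr rfl fun l hl => ?_)
    (e.symm.trans ?_)
  · rw [Finset.mem_range] at hk hl
    dsimp only
    rw [ATens.map_mk, cgMap_mk q (by omega) (by omega)]
    rw [coefL_apply, coef_mk, LinearMap.map_smul]
    rcases Nat.lt_or_ge (k + l) s with h1 | h1
    · rw [cgCoeff_eq_zero_of_lt q h1, zero_smul, map_zero, zero_mul, ite_self]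
    rcases Nat.lt_or_ge P (k + l - s) with h2 | h2
    · rw [VN.v_eq_zero q h2, map_zero, smul_zero, map_zero, zero_mul, if_neg]
      omega
    · rw [crd_v q _ _ _ h2]
      by_cases h3 : k + l = p + s
      · rw [if_pos h3, if_pos (by omega), smul_eq_mul, mul_one]
      · rw [if_neg h3, if_neg (by omega), smul_zero, map_zero, zero_mul]
  · split_ifs with h1
    · rw [hw _ (by omega), map_sum, smul_def, Finset.sum_eq_single p]
      · rw [coefL_apply, coef_mk_v q hp, if_pos rfl]
      · intro j hj hjp
        rw [Finset.mem_range] at hj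
        rw [coefL_apply, coef_mk_v q (by omega), if_neg hjp]
      · intro h
        exact absurd (Finset.mem_range.2 (by omega)) h
    · rcases Nat.lt_or_ge (m + n) s with h2 | h2
      · rw [cgCoeff_eq_zero_of_lt q h2, zero_smul]
      · rw [VN.v_eq_zero q (by omega), map_zero, map_zero, smul_zero]

section
variable (M N : ℕ)

/-- The map `V_M ⊗ V_N → ⨁_s V_{M+N-2s}`. -/
def cgSumMap : Tens (VN q M) (VN q N) →ₗ[Mer]
    ⨁ s : Fin (min M N + 1), VN q (M + N - 2 * s) :=
  (DirectSum.linearEquivFunOnFintype Mer (Fin (min M N + 1))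
    (fun s => VN q (M + N - 2 * s))).symm.toLinearMap.comp
    (LinearMap.pi fun s => cgMap q M N s (M + N - 2 * s))

theorem cgSumMap_apply (x : Tens (VN q M) (VN q N)) (s : Fin (min M N + 1)) :
    cgSumMap q M N x s = cgMap q M N s (M + N - 2 * s) x :=
  congrFun ((DirectSum.linearEquivFunOnFintype Mer (Fin (min M N + 1))
    (fun s => VN q (M + N - 2 * s))).apply_symm_apply
      (LinearMap.pi (fun s : Fin (min M N + 1) => cgMap q M N s (M + N - 2 * s)) x)) s

theorem cgSumMap_eq_sum (x : Tens (VN q M) (VN q N)) : cgSumMap q M N x =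
    ∑ s : Fin (min M N + 1), DirectSum.lof Mer _ (fun s : Fin (min M N + 1) =>
      VN q (M + N - 2 * s)) s (cgMap q M N s (M + N - 2 * s) x) := by
  rw [← DirectSum.sum_univ_of (cgSumMap q M N x)]
  refine Finset.sum_congr rfl fun s _ => ?_
  rw [cgSumMap_apply]
  rfl

/-- The images of the basis vectors under the inverse map. -/
def cgInvVec (s p : ℕ) : Tens (VN q M) (VN q N) :=
  ∑ x ∈ Finset.range (M + 1) ×ˢ Finset.range (N + 1) with x.1 + x.2 = p + s,
    (1 / cgNorm q M N s * cgWeight q M N s x.1 x.2 * cgCoeff q M N s x.1 x.2) •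
      Tens.mk (VN.v q M x.1) (VN.v q N x.2)

/-- The inverse map. -/
def cgInvMap : (⨁ s : Fin (min M N + 1), VN q (M + N - 2 * s)) →ₗ[Mer]
    Tens (VN q M) (VN q N) :=
  DirectSum.toModule Mer _ _ fun s =>
    (vBasis q (M + N - 2 * s)).constr Mer fun p => cgInvVec q M N s p

theorem cgInvMap_lof (s : Fin (min M N + 1)) {p : ℕ} (hp : p ≤ M + N - 2 * s) :
    cgInvMap q M N (DirectSum.lof Mer _ (fun s : Fin (min M N + 1) =>
      VN q (M + N - 2 * s)) s (VN.v q _ p)) = cgInvVec q M N s p := by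
  rw [cgInvMap, DirectSum.toModule_lof,
    show VN.v q (M + N - 2 * s) p = vBasis q _ ⟨p, Nat.lt_succ_iff.2 hp⟩ from
      (vBasis_apply q _ ⟨p, Nat.lt_succ_iff.2 hp⟩).symm, Module.Basis.constr_basis]

/-- The orthogonality relation for `L = p + s`. -/
theorem cgMap_cgInvVec {s t p : ℕ} (hs : s ≤ min M N) (ht : t ≤ min M N)
    (hp : p ≤ M + N - 2 * s) (P : ℕ) :
    cgMap q M N t P (cgInvVec q M N s p) = if t = s then VN.v q P p else 0 := by
  have h := sum_cgWeight_mul q (M := M) (N := N) (s := t) (t := s) (L := p + s) (by omega)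
    (by omega) (by omega) (by omega) (by omega) (by omega)
  rw [cgInvVec, map_sum]
  have h1 : ∀ x ∈ (Finset.range (M + 1) ×ˢ Finset.range (N + 1)).filter
      (fun x => x.1 + x.2 = p + s), cgMap q M N t P
        ((1 / cgNorm q M N s * cgWeight q M N s x.1 x.2 * cgCoeff q M N s x.1 x.2) •
          Tens.mk (VN.v q M x.1) (VN.v q N x.2)) =
      (cgWeight q M N s x.1 x.2 * cgCoeff q M N t x.1 x.2 * cgCoeff q M N s x.1 x.2) •
        ((1 / cgNorm q M N s) • VN.v q P (p + s - t)) := by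
    intro x hx
    rw [Finset.mem_filter, Finset.mem_product, Finset.mem_range, Finset.mem_range] at hx
    rw [LinearMap.map_smul, cgMap_mk q (by omega) (by omega), hx.2, smul_smul, smul_smul]
    congr 1
    ring
  rw [Finset.sum_congr rfl h1, ← Finset.sum_smul, h]
  split_ifs with hst
  · rw [hst, smul_smul, mul_one_div_cancel (cgNorm_ne_zero q (by omega) (by omega)), one_smul,
      Nat.add_sub_cancel]
  · rw [zero_smul]

theorem cgSumMap_cgInvMap (y : ⨁ s : Fin (min M N + 1), VN q (M + N - 2 * s)) :
    cgSumMap q M N (cgInvMap q M N y) = y := by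
  induction y using DirectSum.induction_on with
  | zero => rw [map_zero, map_zero]
  | add x y hx hy => rw [map_add, map_add, hx, hy]
  | of s v =>
    change cgSumMap q M N (cgInvMap q M N (DirectSum.lof Mer _ (fun s : Fin (min M N + 1) =>
      VN q (M + N - 2 * s)) s v)) = DirectSum.lof Mer _ (fun s : Fin (min M N + 1) =>
      VN q (M + N - 2 * s)) s v
    induction v using VN.ind with
    | h2 x y hx hy => simp only [map_add, hx, hy]
    | h3 f x hx => simp only [LinearMap.map_smul, hx]
    | h1 p hp =>
      rw [cgInvMap_lof q M N s hp, cgSumMap_eq_sum, Finset.sum_eq_single s]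
      · rw [cgMap_cgInvVec q M N (by omega) (by omega) hp, if_pos rfl]
      · intro t _ hts
        rw [cgMap_cgInvVec q M N (by omega) (by omega) hp, if_neg fun h => hts (Fin.ext h),
          map_zero]
      · intro h
        exact absurd (Finset.mem_univ _) h

/-- On `v_j ⊗ v_k` this is the dual orthogonality relation for `L = j + k`. Summands whose `s` is
inadmissible for this `L` vanish, either through the coefficient or because the target vector is
zero. -/
theorem cgInvMap_cgSumMap (x : Tens (VN q M) (VN q N)) :
    cgInvMap q M N (cgSumMap q M N x) = x := by
  induction x using Tens.indV with
  | h2 x y hx hy => simp only [map_add, hx, hy]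
  | h3 f x hx => simp only [LinearMap.map_smul, hx]
  | h1 j hj k hk =>
    have h1 : ∀ s : Fin (min M N + 1), cgInvMap q M N (DirectSum.lof Mer _
        (fun s : Fin (min M N + 1) => VN q (M + N - 2 * s)) s
          (cgMap q M N s (M + N - 2 * s) (Tens.mk (VN.v q M j) (VN.v q N k)))) =
        if (s : ℕ) ≤ min (j + k) (M + N - (j + k)) then
          ∑ x ∈ Finset.range (M + 1) ×ˢ Finset.range (N + 1) with x.1 + x.2 = j + k,
            (1 / cgNorm q M N s * cgWeight q M N s x.1 x.2 * cgCoeff q M N s x.1 x.2 *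
              cgCoeff q M N s j k) • Tens.mk (VN.v q M x.1) (VN.v q N x.2) else 0 := by
      intro s
      rw [cgMap_mk q hj hk, LinearMap.map_smul, LinearMap.map_smul]
      split_ifs with h
      · rw [cgInvMap_lof q M N s (by omega), cgInvVec, Nat.sub_add_cancel (by omega),
          Finset.smul_sum]
        refine Finset.sum_congr rfl fun x _ => ?_
        rw [smul_smul]
        congr 1
        ring
      · rcases Nat.lt_or_ge (j + k) s with h2 | h2
        · rw [cgCoeff_eq_zero_of_lt q h2, zero_smul]
        · rw [VN.v_eq_zero q (by omega), map_zero, map_zero, smul_zero]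
    rw [cgSumMap_eq_sum, map_sum, Finset.sum_congr rfl fun s _ => h1 s,
      ← Finset.sum_range (fun s => if s ≤ min (j + k) (M + N - (j + k)) then
          ∑ x ∈ Finset.range (M + 1) ×ˢ Finset.range (N + 1) with x.1 + x.2 = j + k,
            (1 / cgNorm q M N s * cgWeight q M N s x.1 x.2 * cgCoeff q M N s x.1 x.2 *
              cgCoeff q M N s j k) • Tens.mk (VN.v q M x.1) (VN.v q N x.2) else 0),
      ← Finset.sum_filter]
    have h2 : (Finset.range (min M N + 1)).filter
        (fun s => s ≤ min (j + k) (M + N - (j + k))) =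
        Finset.range (min (min M N) (min (j + k) (M + N - (j + k))) + 1) := by
      ext s
      simp only [Finset.mem_filter, Finset.mem_range]
      omega
    -- With the sum over `s` inside, the coefficient of each `v_a ⊗ v_b` is a dual orthogonality
    -- sum.
    rw [h2, Finset.sum_comm]
    have h3 : ∀ x ∈ (Finset.range (M + 1) ×ˢ Finset.range (N + 1)).filter
        (fun x => x.1 + x.2 = j + k),
        ∑ s ∈ Finset.range (min (min M N) (min (j + k) (M + N - (j + k))) + 1),
          (1 / cgNorm q M N s * cgWeight q M N s x.1 x.2 * cgCoeff q M N s x.1 x.2 *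
              cgCoeff q M N s j k) • Tens.mk (VN.v q M x.1) (VN.v q N x.2) =
        if x = (j, k) then Tens.mk (VN.v q M j) (VN.v q N k) else 0 := by
      rintro ⟨a, b⟩ hx
      rw [Finset.mem_filter, Finset.mem_product, Finset.mem_range, Finset.mem_range] at hx
      dsimp only at hx ⊢
      have h := sum_cgWeight_mul_dual q (M := M) (N := N) (L := j + k) (j := a) (k := j)
        (by omega) (by omega) (by omega) (by omega) (by omega)
      rw [show j + k - a = b by omega, Nat.add_sub_cancel_left] at h
      rw [← Finset.sum_smul, h]
      by_cases haj : a = j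
      · obtain rfl : b = k := by omega
        rw [if_pos haj, haj, if_pos rfl, one_smul]
      · rw [if_neg haj, zero_smul, if_neg fun h => haj (congrArg Prod.fst h)]
    rw [Finset.sum_congr rfl h3, Finset.sum_ite_eq', if_pos]
    rw [Finset.mem_filter, Finset.mem_product, Finset.mem_range, Finset.mem_range]
    exact ⟨⟨Nat.lt_succ_iff.2 hj, Nat.lt_succ_iff.2 hk⟩, rfl⟩

/-- The equivalence `V_M ⊗ V_N ≃ ⨁_s V_{M+N-2s}`. -/
def cgEquiv : Tens (VN q M) (VN q N) ≃ₗ[Mer] ⨁ s : Fin (min M N + 1), VN q (M + N - 2 * s) :=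
  LinearEquiv.ofLinearMap (cgSumMap q M N) (cgInvMap q M N)
    (LinearMap.ext (cgSumMap_cgInvMap q M N)) (LinearMap.ext (cgInvMap_cgSumMap q M N))

theorem cgSumMap_isIntertwiner : IsIntertwiner q (coTens q (coVN q M) (coVN q N))
    (coSum q fun s : Fin (min M N + 1) => coVN q (M + N - 2 * s)) (cgSumMap q M N) := by
  have hs : ∀ s : Fin (min M N + 1), IsIntertwiner q (coTens q (coVN q M) (coVN q N))
      (coVN q (M + N - 2 * s)) (cgMap q M N s (M + N - 2 * s)) := fun s =>
    cgMap_isIntertwiner q (by omega) (by omega) (by omega)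
  refine ⟨fun x => ?_, fun x => ?_⟩
  · rw [cgSumMap_eq_sum, cgSumMap_eq_sum, map_sum]
    refine Finset.sum_congr rfl fun s _ => ?_
    rw [(hs s).1]
    exact (hSum_lof _ s _).symm
  · rw [cgSumMap_eq_sum, map_sum]
    have h1 : cgSumMap q M N = ∑ s : Fin (min M N + 1), (DirectSum.lof Mer _
        (fun s : Fin (min M N + 1) => VN q (M + N - 2 * s)) s).comp
          (cgMap q M N s (M + N - 2 * s)) := by
      refine LinearMap.ext fun x => ?_
      rw [cgSumMap_eq_sum, LinearMap.sum_apply]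
      rfl
    have h2 : ∀ y, ATens.map q (cgSumMap q M N) y = ∑ s : Fin (min M N + 1),
        ATens.map q (W := ⨁ s : Fin (min M N + 1), VN q (M + N - 2 * s))
          (DirectSum.lof Mer _ (fun s : Fin (min M N + 1) => VN q (M + N - 2 * s)) s)
          (ATens.map q (cgMap q M N s (M + N - 2 * s)) y) := by
      intro y
      induction y using ATens.ind with
      | h0 => simp
      | h1 a v =>
        rw [ATens.map_mk, cgSumMap_eq_sum, ATens.mk_sum]
        rfl
      | h2 x y hx hy => simp only [map_add, hx, hy, Finset.sum_add_distrib]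
    rw [h2]
    refine Finset.sum_congr rfl fun s _ => ?_
    rw [← (hs s).2]
    exact DirectSum.toModule_lof _ _ _

end
end equivalence

end DynSU2
end

theorem mainTheorem6 (q : Set.Ioo (0 : ℝ) 1) (M N : ℕ) :
    -- the corepresentations
    (∀ n, (coVN q n).IsCorepresentation) ∧
    (coTens q (coVN q M) (coVN q N)).IsCorepresentation ∧
    (coSum q fun s : Fin (min M N + 1) => coVN q (M + N - 2 * s)).IsCorepresentation ∧
    -- the intertwiners `C_s` and the equivalence of corepresentations
    (∃ C : ∀ s : Fin (min M N + 1),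
        Tens (VN q M) (VN q N) →ₗ[Mer] VN q (M + N - 2 * s),
      (∀ s : Fin (min M N + 1), IsIntertwiner q (coTens q (coVN q M) (coVN q N)) (coVN q (M + N - 2 * s)) (C s)) ∧
      (∀ s : Fin (min M N + 1), ∀ j ≤ M, ∀ k ≤ N, C s (Tens.mk (VN.v q M j) (VN.v q N k)) =
        if (s : ℕ) ≤ j + k ∧ j + k ≤ M + N - s then
          cgCoeff q M N s j k • VN.v q (M + N - 2 * s) (j + k - s) else 0) ∧
      ∃ e : Tens (VN q M) (VN q N) ≃ₗ[Mer] ⨁ s : Fin (min M N + 1), VN q (M + N - 2 * s),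
        IsIntertwiner q (coTens q (coVN q M) (coVN q N))
          (coSum q fun s : Fin (min M N + 1) => coVN q (M + N - 2 * s)) e.toLinearMap ∧
        ∀ x (s : Fin (min M N + 1)), e x s = C s x) ∧
    -- the Clebsch-Gordan formula
    (∀ s ≤ min M N, ∀ tM tN tP, IsMatrix q M tM → IsMatrix q N tN →
      IsMatrix q (M + N - 2 * s) tP → ∀ m ≤ M, ∀ n ≤ N, ∀ p ≤ M + N - 2 * s,
        ∑ x ∈ Finset.range (M + 1) ×ˢ Finset.range (N + 1) with x.1 + x.2 = p + s,
          FSL.r q (cgCoeff q M N s x.1 x.2) * (tM m x.1 * tN n x.2) =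
        if s ≤ m + n ∧ m + n ≤ M + N - s then
          FSL.l q (cgCoeff q M N s m n) * tP (m + n - s) p else 0) ∧
    -- the coefficients are `q`-Racah polynomials
    (∀ s ≤ min M N, ∀ j ≤ M, ∀ k ≤ N, cgCoeff q M N s j k = cgFactor q M N s j k *
      qRacah s j (qpow q 0 (-2 * (M + 1))) (qpow q 0 (-2 * (N + 1)))
        (qpow q 0 (-2 * (j + k + 1))) (qpow q (-2) (2 * (j + k - M - 1))) (qpow q 0 2)) ∧
    -- orthogonality
    (∀ L ≤ M + N, ∀ s ≤ min (min M N) (min L (M + N - L)), ∀ t ≤ min (min M N) (min L (M + N - L)),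
      ∑ x ∈ Finset.range (M + 1) ×ˢ Finset.range (N + 1) with x.1 + x.2 = L,
        cgWeight q M N t x.1 x.2 * cgCoeff q M N s x.1 x.2 * cgCoeff q M N t x.1 x.2 =
      if s = t then cgNorm q M N s else 0) ∧
    -- dual orthogonality
    (∀ L ≤ M + N, ∀ j ≤ min L M, ∀ k ≤ min L M, L - j ≤ N → L - k ≤ N →
      ∑ s ∈ Finset.range (min (min M N) (min L (M + N - L)) + 1),
        1 / cgNorm q M N s * cgWeight q M N s j (L - j) *
          cgCoeff q M N s j (L - j) * cgCoeff q M N s k (L - k) =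
      if j = k then 1 else 0) := by
  refine ⟨coVN_isCorepresentation q, coTens_isCorepresentation q M N,
    coSum_isCorepresentation q _ fun s => coVN_isCorepresentation q _,
    ⟨fun s => cgMap q M N s (M + N - 2 * s),
      fun s => cgMap_isIntertwiner q (by omega) (by omega) (by omega), fun s j hj k hk => ?_,
      cgEquiv q M N, cgSumMap_isIntertwiner q M N, fun x s => cgSumMap_apply q M N x s⟩,
    fun s hs tM tN tP hM hN hP m hm n hn p hp =>
      sum_cgCoeff_mul q (by omega) (by omega) (by omega) hM hN hP hm hn hp,
    fun s _ j _ k _ => cgCoeff_eq_qRacah q M N s j k,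
    fun L hL s hs t ht => sum_cgWeight_mul q (by omega) (by omega) (by omega) (by omega)
      (by omega) (by omega),
    fun L hL j hj k hk hj' hk' => sum_cgWeight_mul_dual q hL hj hk hj' hk'⟩
  rw [cgMap_mk q hj hk]
  split_ifs with h
  · rfl
  -- Outside the range, `cgMap` gives zero for two reasons: below it the coefficient vanishes, above
  -- it the vector is zero by convention.
  · rcases Nat.lt_or_ge (j + k) s with h1 | h1
    · rw [cgCoeff_eq_zero_of_lt q h1, zero_smul]
    · rw [VN.v_eq_zero q (by omega), smul_zero]
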